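/- **Setting.** Let $\Bbbk$ be an algebraically closed field of characteristic zero, $V$ a vector space with basis $x_1,x_2,x_3$, and $t\in\Bbbk$, $t\neq 0$. To a $9\times 9$ matrix $\mathfrak R$ whose rows are indexed by $mn=11,12,13,21,22,23,31,32,33$ and whose columns are indexed by $ij=11,21,31,12,22,32,13,23,33$ (in these orders), with entries $r^{ij}_{mn}$, associate $c\in\mathrm{End}(V\otimes V)$, $c(x_i\otimes x_j)=\sum_{m,n}r^{ij}_{mn}\,x_m\otimes x_n$. Consider the following ten families (a dot stands for $0$; the parameters are arbitrary elements of $\Bbbk$). $$\mathfrak R_{1,1}=t\begin{pmatrix}1&\cdot&a&\cdot&\cdot&\cdot&-a&\cdot&-ab\\ \cdot&1&\cdot&\cdot&\cdot&a-b&\cdot&-a&p\\ \cdot&\cdot&1&\cdot&\cdot&\cdot&\cdot&\cdot&-b\\ \cdot&\cdot&\cdot&1&\cdot&a&\cdot&b-a&-p\\ \cdot&\cdot&\cdot&\cdot&1&\cdot&\cdot&\cdot&\cdot\\ \cdot&\cdot&\cdot&\cdot&\cdot&1&\cdot&\cdot&\cdot\\ \cdot&\cdot&\cdot&\cdot&\cdot&\cdot&1&\cdot&b\\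 \cdot&\cdot&\cdot&\cdot&\cdot&\cdot&\cdot&1&\cdot\\ \cdot&\cdot&\cdot&\cdot&\cdot&\cdot&\cdot&\cdot&1\end{pmatrix}\qquad(a,b,p\in\Bbbk)$$ $$\mathfrak R_{1,2}=t\begin{pmatrix}1&\cdot&b&\cdot&\cdot&\cdot&p&\cdot&a\\ \cdot&1&\cdot&\cdot&\cdot&p-q&\cdot&q&k\\ \cdot&\cdot&1&\cdot&\cdot&\cdot&\cdot&\cdot&p\\ \cdot&\cdot&\cdot&1&\cdot&b&\cdot&\cdot&-k\\ \cdot&\cdot&\cdot&\cdot&1&\cdot&\cdot&\cdot&\cdot\\ \cdot&\cdot&\cdot&\cdot&\cdot&1&\cdot&\cdot&\cdot\\ \cdot&\cdot&\cdot&\cdot&\cdot&\cdot&1&\cdot&b\\ \cdot&\cdot&\cdot&\cdot&\cdot&\cdot&\cdot&1&\cdot\\ \cdot&\cdot&\cdot&\cdot&\cdot&\cdot&\cdot&\cdot&1\end{pmatrix}\qquad(a,b,p,q,k\in\Bbbk)$$ $$\mathfrak R_{1,3}=t\begin{pmatrix}1&\cdot&a&\cdot&\cdot&\cdot&-a&\cdot&-ab\\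 \cdot&1&\cdot&\cdot&\cdot&\cdot&\cdot&-b&-p\\ \cdot&\cdot&1&\cdot&\cdot&\cdot&\cdot&\cdot&-b\\ \cdot&\cdot&\cdot&1&\cdot&b&\cdot&\cdot&p\\ \cdot&\cdot&\cdot&\cdot&1&\cdot&\cdot&\cdot&q\\ \cdot&\cdot&\cdot&\cdot&\cdot&1&\cdot&\cdot&\cdot\\ \cdot&\cdot&\cdot&\cdot&\cdot&\cdot&1&\cdot&b\\ \cdot&\cdot&\cdot&\cdot&\cdot&\cdot&\cdot&1&\cdot\\ \cdot&\cdot&\cdot&\cdot&\cdot&\cdot&\cdot&\cdot&1\end{pmatrix}\qquad(a,b,p,q\in\Bbbk)$$ $$\mathfrak R_{1,4}=t\begin{pmatrix}1&\cdot&a&\cdot&\cdot&\cdot&-a&\cdot&-ab\\ \cdot&1&\cdot&\cdot&\cdot&\cdot&\cdot&a-2b&p\\ \cdot&\cdot&1&\cdot&\cdot&\cdot&\cdot&\cdot&-b\\ \cdot&\cdot&\cdot&1&\cdot&2b-a&\cdot&\cdot&\cdot\\ \cdot&\cdot&\cdot&\cdot&1&\cdot&\cdot&\cdot&\cdot\\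 \cdot&\cdot&\cdot&\cdot&\cdot&1&\cdot&\cdot&\cdot\\ \cdot&\cdot&\cdot&\cdot&\cdot&\cdot&1&\cdot&b\\ \cdot&\cdot&\cdot&\cdot&\cdot&\cdot&\cdot&1&\cdot\\ \cdot&\cdot&\cdot&\cdot&\cdot&\cdot&\cdot&\cdot&1\end{pmatrix}\qquad(a,b,p\in\Bbbk)$$ $$\mathfrak R_{1,5}=t\begin{pmatrix}1&\ell &\cdot&-\ell &-\ell ^2&\ell q-k&p&k&a\\ \cdot&1&\cdot&\cdot&-\ell &\cdot&\cdot&q&b\\ \cdot&\cdot&1&\cdot&\cdot&-\ell &\cdot&\cdot&p\\ \cdot&\cdot&\cdot&1&\ell &\cdot&\cdot&p-q&-b\\ \cdot&\cdot&\cdot&\cdot&1&\cdot&\cdot&\cdot&\cdot\\ \cdot&\cdot&\cdot&\cdot&\cdot&1&\cdot&\cdot&\cdot\\ \cdot&\cdot&\cdot&\cdot&\cdot&\cdot&1&\ell &\cdot\\ \cdot&\cdot&\cdot&\cdot&\cdot&\cdot&\cdot&1&\cdot\\ \cdot&\cdot&\cdot&\cdot&\cdot&\cdot&\cdot&\cdot&1\end{pmatrix}\qquad(a,b,p,q,k,\ell\in\Bbbk)$$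 $$\mathfrak R_{1,6}=t\begin{pmatrix}1&a&p&-a&-ab&-(2pa+k)&-p&k&-pq\\ \cdot&1&\cdot&\cdot&-b&\cdot&\cdot&-p&\cdot\\ \cdot&\cdot&1&\cdot&\cdot&-a&\cdot&\cdot&-q\\ \cdot&\cdot&\cdot&1&b&p&\cdot&\cdot&\cdot\\ \cdot&\cdot&\cdot&\cdot&1&\cdot&\cdot&\cdot&\cdot\\ \cdot&\cdot&\cdot&\cdot&\cdot&1&\cdot&\cdot&\cdot\\ \cdot&\cdot&\cdot&\cdot&\cdot&\cdot&1&a&q\\ \cdot&\cdot&\cdot&\cdot&\cdot&\cdot&\cdot&1&\cdot\\ \cdot&\cdot&\cdot&\cdot&\cdot&\cdot&\cdot&\cdot&1\end{pmatrix}\qquad(a,b,p,q,k\in\Bbbk)$$ $$\mathfrak R_{1,7}=t\begin{pmatrix}1&k&p&-k&-k\ell &d&a&(k(a-q)-d)&b\\ \cdot&1&\cdot&\cdot&-\ell &p-q&\cdot&a&\cdot\\ \cdot&\cdot&1&\cdot&\cdot&-k&\cdot&\cdot&a\\ \cdot&\cdot&\cdot&1&\ell &q&\cdot&\cdot&\cdot\\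 \cdot&\cdot&\cdot&\cdot&1&\cdot&\cdot&\cdot&\cdot\\ \cdot&\cdot&\cdot&\cdot&\cdot&1&\cdot&\cdot&\cdot\\ \cdot&\cdot&\cdot&\cdot&\cdot&\cdot&1&k&p\\ \cdot&\cdot&\cdot&\cdot&\cdot&\cdot&\cdot&1&\cdot\\ \cdot&\cdot&\cdot&\cdot&\cdot&\cdot&\cdot&\cdot&1\end{pmatrix}\qquad(a,b,p,q,k,\ell,d\in\Bbbk)$$ $$\mathfrak R_{1,8}=t\begin{pmatrix}1&a&q&-a&-a^2&-b&-q&b&ap\\ \cdot&1&\cdot&\cdot&-a&q&\cdot&\cdot&p\\ \cdot&\cdot&1&\cdot&\cdot&-a&\cdot&\cdot&\cdot\\ \cdot&\cdot&\cdot&1&a&\cdot&\cdot&-q&-p\\ \cdot&\cdot&\cdot&\cdot&1&\cdot&\cdot&\cdot&\cdot\\ \cdot&\cdot&\cdot&\cdot&\cdot&1&\cdot&\cdot&\cdot\\ \cdot&\cdot&\cdot&\cdot&\cdot&\cdot&1&a&\cdot\\ \cdot&\cdot&\cdot&\cdot&\cdot&\cdot&\cdot&1&\cdot\\ \cdot&\cdot&\cdot&\cdot&\cdot&\cdot&\cdot&\cdot&1\end{pmatrix}\qquad(a,b,p,q\in\Bbbk)$$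 $$\mathfrak R_{1,9}=t\begin{pmatrix}1&1&\cdot&-1&-1&a&b&b-a&p\\ \cdot&1&1&\cdot&-1&-1&\cdot&b&b-q\\ \cdot&\cdot&1&\cdot&\cdot&-1&\cdot&\cdot&b\\ \cdot&\cdot&\cdot&1&1&\cdot&-1&-1&q\\ \cdot&\cdot&\cdot&\cdot&1&1&\cdot&-1&-1\\ \cdot&\cdot&\cdot&\cdot&\cdot&1&\cdot&\cdot&-1\\ \cdot&\cdot&\cdot&\cdot&\cdot&\cdot&1&1&\cdot\\ \cdot&\cdot&\cdot&\cdot&\cdot&\cdot&\cdot&1&1\\ \cdot&\cdot&\cdot&\cdot&\cdot&\cdot&\cdot&\cdot&1\end{pmatrix}\qquad(a,b,p,q\in\Bbbk)$$ $$\mathfrak R_{1,10}=t\begin{pmatrix}1&2&\cdot&-2&-4a&8a&4&\cdot&-4a^2(a+7)\\ \cdot&1&2&\cdot&-2a&4-6a-2a^2&\cdot&2a(a+1)&6a(a+2)(a-1)\\ \cdot&\cdot&1&\cdot&\cdot&2-4a&\cdot&\cdot&-4a(1-2a)\\ \cdot&\cdot&\cdot&1&2a&-2a(1-a)&-2&-2a(a+1)&-2a(1+3a)(a-2)\\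 \cdot&\cdot&\cdot&\cdot&1&2a&\cdot&-2a&4a(1-2a)\\ \cdot&\cdot&\cdot&\cdot&\cdot&1&\cdot&\cdot&2-4a\\ \cdot&\cdot&\cdot&\cdot&\cdot&\cdot&1&4a-2&4(1-2a)(1-a)\\ \cdot&\cdot&\cdot&\cdot&\cdot&\cdot&\cdot&1&4a-2\\ \cdot&\cdot&\cdot&\cdot&\cdot&\cdot&\cdot&\cdot&1\end{pmatrix}\qquad(a\in\Bbbk)$$ A braided vector space is a pair $(V,c)$ with $c\in GL(V\otimes V)$ and $(c\otimes\mathrm{id})(\mathrm{id}\otimes c)(c\otimes\mathrm{id})=(\mathrm{id}\otimes c)(c\otimes\mathrm{id})(\mathrm{id}\otimes c)$; it is rigid if $c^\flat:V^*\otimes V\to V\otimes V^*$, $f\otimes v\mapsto\sum_i(f\otimes\mathrm{id})(c(v\otimes x_i))\otimes x^i$, is bijective, where $(x^i)$ is the dual basis. Its Nichols algebra is $\mathfrak B(V)=T(V)/\mathcal J(V)$, where $T(V)$ is the tensor algebra with the braided Hopf algebra structure in which the elements of $V$ are primitive, and $\mathcal J(V)$ is the largest homogeneous Hopf ideal generated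 by homogeneous elements of degree $\ge 2$. It has quadratic relations if $\mathcal J(V)$ contains a nonzero element of degree $2$. A PBW-basis with (ordered) generators $g_i$ and heights $h_i\in\mathbb N\cup\{\infty\}$ is a linear basis consisting of the ordered monomials in the $g_i$ in which the exponent of $g_i$ is smaller than $h_i$. Put $$B_0=\{x_1^{a_1}x_2^{a_2}x_3^{a_3}: 0\le a_i<2\},\quad B_1=\{x_1^{a_1}x_2^{a_2}x_3^{a_3}: a_i\ge 0;\ a_1,a_2<2\},\quad B_3=\{x_1^{a_1}x_2^{a_2}x_3^{a_3}: a_i\ge 0\}.$$ Below, "type $B_0$ with relations $\dots$" means that $\mathcal J(V)$ is the ideal generated by the given relations, $B_0$ is a PBW-basis of $\mathfrak B(V)$, $\mathrm{GKdim}\,\mathfrak B(V)=0$ and $\dim\mathfrak B(V)=8$; "type $B_1$" (resp. "type $B_3$") means the same with the basis $B_1$ (resp. $B_3$) and $\mathrm{GKdim}\,\mathfrak B(V)=1$ (resp. $3$). **Theorem.** For every $\mathfrak R$ in one of the ten families, $(V,c)$ is a rigid braided vector space, and $\mathfrak B(V)$ has quadratic relations if and only if $t^2=1$. Moreover: 1.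 $\mathfrak R_{1,1}$. If $t=-1$: type $B_0$ with relations $x_2x_1+x_1x_2,\ x_3x_1+x_1x_3,\ x_3x_2+x_2x_3-b\,x_1x_2,\ x_1^2,\ x_2^2,\ x_3^2-b\,x_1x_3+p\,x_1x_2$. If $t=1$: type $B_3$ with relations $x_2x_1-x_1x_2,\ x_3x_1-x_1x_3-a\,x_1^2,\ x_3x_2-x_2x_3+(b-2a)\,x_1x_2$. 2. $\mathfrak R_{1,2}$. (i) Let $t=1$ and $b\ne p-2q$. Put $z_0=x_2$, $z_n=(x_3-nb\,x_1)z_{n-1}-z_{n-1}x_3+(n-1)!\,(q-p)\left(\frac{-b-p}2\right)^{n-1}x_1^nx_2$ and $\beta_n=-n\left(\frac{n+1}2b+\frac{n-1}2p+q\right)$ for $n\ge 1$, and let $\mathcal R$ be the set of the relations $x_2x_1-x_1x_2$, $x_3x_1-x_1x_3+\frac{p-b}2x_1^2$ and $z_{n+1}z_n-z_nz_{n+1}$ $(n\ge 0)$. If $\beta_n\ne 0$ for all $n\ge 1$, then $\mathcal J(V)=\langle\mathcal R\rangle$, $\{x_1^{a_1}x_2^{a_2}z_1^{b_1}\cdots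 z_n^{b_n}x_3^{a_3}: n\ge 1;\ a_i,b_j\ge 0\}$ is a PBW-basis of $\mathfrak B(V)$ and $\mathrm{GKdim}\,\mathfrak B(V)=\infty$. Otherwise there is a unique $N\ge 1$ with $\beta_N=0$, and $\mathcal J(V)=\langle\mathcal R,\ z_{N+1}+(N+1)\frac{b+p}2\,x_1z_N\rangle$, $\{x_1^{a_1}x_2^{a_2}z_1^{b_1}\cdots z_N^{b_N}x_3^{a_3}: a_i,b_j\ge 0\}$ is a PBW-basis of $\mathfrak B(V)$ and $\mathrm{GKdim}\,\mathfrak B(V)=N+3$. (ii) Let $t=-1$ and $b\ne -p$. Put $x_{31}=x_3x_1+x_1x_3$, $z_0=x_2$ and, for $n\ge 1$, $z_n=(x_3-nb\,x_1)z_{n-1}+z_{n-1}x_3+\left(\frac{n-1}2\right)!\,(p-q)(-p-b)^{\frac{n-1}2}x_1x_2x_{31}^{\frac{n-1}2}$ if $n$ is odd, $z_n=(x_3-nb\,x_1)z_{n-1}-z_{n-1}x_3-\left(\frac{n-2}2\right)!\,(p-q)(-p-b)^{\frac{n-2}2}x_2x_{31}^{\frac n2}$ if $n$ is even; and $\widetilde\beta_n=-\left(\frac{n+1}2b+\frac{n-1}2p+q\right)$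 if $n$ is odd, $\widetilde\beta_n=-\frac n2(b+p)$ if $n$ is even. Let $\widetilde{\mathcal R}$ be the set of the relations $x_2x_1+x_1x_2$, $x_1^2$, $x_2^2$, $x_{31}x_2-x_2x_{31}$, $x_3x_{31}-x_{31}x_3+(p-b)\,x_1x_{31}$ and $z_{2n}z_{2n-1}-z_{2n-1}z_{2n}$, $z_{2n}^2$ $(n\ge 1)$. If $\widetilde\beta_n\ne 0$ for all $n\ge 1$, then $\mathcal J(V)=\langle\widetilde{\mathcal R}\rangle$, $\{x_1^{a_1}x_2^{a_2}x_{31}^{a_3}z_1^{b_1}\cdots z_n^{b_n}x_3^{a_4}: n\ge 1;\ a_i,b_j\ge 0;\ a_1,a_2,b_{2j}<2\}$ is a PBW-basis of $\mathfrak B(V)$ and $\mathrm{GKdim}\,\mathfrak B(V)=\infty$. Otherwise there is a unique $N\ge 1$ with $\widetilde\beta_N=0$; it is odd, and $\mathcal J(V)=\langle\widetilde{\mathcal R},\ z_{N+1}+(N+1)\frac{b+p}2\,x_1z_N\rangle$, $\{x_1^{a_1}x_2^{a_2}x_{31}^{a_3}z_1^{b_1}\cdots z_N^{b_N}x_3^{a_4}: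 a_i,b_j\ge 0;\ a_1,a_2,b_{2j}<2\}$ is a PBW-basis of $\mathfrak B(V)$ and $\mathrm{GKdim}\,\mathfrak B(V)=\frac{N+5}2$. (iii) If $t=1$ and $b=p-2q$: type $B_3$ with relations $x_2x_1-x_1x_2,\ x_3x_1-x_1x_3+q\,x_1^2,\ x_3x_2-x_2x_3+(2q-p)\,x_1x_2$. If $t=-1$, $b=-p$ and $a\ne -p^2$: type $B_1$ with relations $x_2x_1+x_1x_2,\ x_3x_1+x_1x_3,\ x_3x_2+x_2x_3+p\,x_1x_2,\ x_1^2,\ x_2^2$. If $t=-1$, $b=-p$ and $a=-p^2$: type $B_0$ with these relations and $x_3^2+k\,x_1x_2+p\,x_1x_3$. 3. $\mathfrak R_{1,3}$. If $t=1$: type $B_3$ with relations $x_2x_1-x_1x_2,\ x_3x_1-x_1x_3-a\,x_1^2,\ x_3x_2-x_2x_3-b\,x_1x_2$. If $t=-1$ and $q\ne 0$: type $B_1$ with relations $x_2x_1+x_1x_2,\ x_3x_1+x_1x_3,\ x_3x_2+x_2x_3-b\,x_1x_2,\ x_1^2,\ x_2^2$. If $t=-1$ and $q=0$: type $B_0$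 with these relations and $x_3^2-b\,x_1x_3-p\,x_1x_2$. 4. $\mathfrak R_{1,4}$. If $t=1$: type $B_3$ with relations $x_2x_1-x_1x_2,\ x_3x_1-x_1x_3-a\,x_1^2,\ x_3x_2-x_2x_3+(a-2b)\,x_1x_2$. If $t=-1$ and $p\ne 0$: type $B_1$ with relations $x_2x_1+x_1x_2,\ x_3x_1+x_1x_3,\ x_3x_2+x_2x_3+(a-2b)\,x_1x_2,\ x_1^2,\ x_2^2$. If $t=-1$ and $p=0$: type $B_0$ with these relations and $x_3^2-b\,x_1x_3$. 5. $\mathfrak R_{1,5}$. If $t=1$ and $p=2q$: type $B_3$ with relations $x_2x_1-x_1x_2-\ell\,x_1^2,\ x_3x_1-x_1x_3+q\,x_1^2,\ x_3x_2-x_2x_3+\ell\,x_1x_3+q\,x_1x_2+(k-q\ell)\,x_1^2$. If $t=-1$, $p=0$ and $a\ne b\ell$: type $B_1$ with relations $x_2x_1+x_1x_2,\ x_3x_1+x_1x_3,\ x_3x_2+x_2x_3-\ell\,x_1x_3+q\,x_1x_2,\ x_1^2,\ x_2^2-\ell\,x_1x_2$. If $t=-1$, $p=0$ and $a=b\ell$: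 type $B_0$ with these relations and $x_3^2+b\,x_1x_2$. 6. $\mathfrak R_{1,6}$. If $t=-1$: type $B_0$ with relations $x_2x_1+x_1x_2,\ x_3x_1+x_1x_3,\ x_3x_2+x_2x_3-a\,x_1x_3-p\,x_1x_2,\ x_1^2,\ x_2^2-b\,x_1x_2,\ x_3^2-q\,x_1x_3$. If $t=1$: type $B_3$ with relations $x_2x_1-x_1x_2-a\,x_1^2,\ x_3x_1-x_1x_3-p\,x_1^2,\ x_3x_2-x_2x_3+a\,x_1x_3-p\,x_1x_2+(k+pa)\,x_1^2$. 7. $\mathfrak R_{1,7}$. If $t=1$ and $a=p-2q$: type $B_3$ with relations $x_2x_1-x_1x_2-k\,x_1^2,\ x_3x_1-x_1x_3-q\,x_1^2,\ x_3x_2-x_2x_3+k\,x_1x_3-q\,x_1x_2-(d+qk)\,x_1^2$. If $t=-1$, $a=-p$ and $b\ne -p^2$: type $B_1$ with relations $x_2x_1+x_1x_2,\ x_3x_1+x_1x_3,\ x_3x_2+x_2x_3-k\,x_1x_3-q\,x_1x_2,\ x_1^2,\ x_2^2-\ell\,x_1x_2$. If $t=-1$, $a=-p$ and $b=-p^2$: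 type $B_0$ with these relations and $x_3^2-p\,x_1x_3$. 8. $\mathfrak R_{1,8}$. If $t=-1$: type $B_0$ with relations $x_2x_1+x_1x_2,\ x_3x_1+x_1x_3,\ x_3x_2+x_2x_3-a\,x_1x_3+q\,x_1x_2,\ x_1^2,\ x_2^2-a\,x_1x_2,\ x_3^2+p\,x_1x_2$. If $t=1$: type $B_3$ with relations $x_2x_1-x_1x_2-a\,x_1^2,\ x_3x_1-x_1x_3-q\,x_1^2,\ x_3x_2-x_2x_3+a\,x_1x_3-q\,x_1x_2+b\,x_1^2$. 9. $\mathfrak R_{1,9}$ with $b=1$. If $t=1$: type $B_3$ with relations $x_2x_1-x_1x_2-x_1^2,\ x_3x_1-x_1x_3-x_1x_2,\ x_3x_2-x_2x_3-x_2^2+x_1x_3+x_1x_2-a\,x_1^2$. If $t=-1$ and $p\ne -a-q$: type $B_1$ with relations $x_2x_1+x_1x_2,\ x_3x_1+x_1x_3+x_1x_2,\ x_3x_2+x_2x_3-x_1x_3,\ x_1^2,\ x_2^2-x_1x_2$. If $t=-1$ and $p=-a-q$: type $B_0$ with these relations and $x_3^2-x_2x_3+x_1x_3-q\,x_1x_2$.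 10. $\mathfrak R_{1,10}$. If $t=1$: type $B_3$ with relations $x_2x_1-x_1x_2-2x_1^2,\ x_3x_1-x_1x_3-2x_1x_2,\ x_3x_2-x_2x_3-2a\,x_2^2+(4a-2)\,x_1x_3+(8a-4)\,x_1x_2-4a(a+1)\,x_1^2$. If $t=-1$: type $B_0$ with relations $x_2x_1+x_1x_2,\ x_3x_1+x_1x_3+2x_1x_2,\ x_3x_2+x_2x_3+2(1-2a)\,x_1x_3+4(1-a)\,x_1x_2,\ x_1^2,\ x_2^2-2a\,x_1x_2,\ x_3^2-2(2a-1)\,x_2x_3+4a(2a-1)\,x_1x_3-2a(a^2-a+4)\,x_1x_2$. -/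

import Mathlib

open scoped TensorProduct

noncomputable section

namespace Hietarinta

universe u

/-! ### Braided vector spaces given by `9 × 9` matrices -/

section Braiding

variable {K : Type u} [Field K]

/-- The coefficient `r^{ij}_{ml}` of a `9 × 9` matrix whose rows are ordered as
`11, 12, 13, 21, 22, 23, 31, 32, 33` (indices `m l`) and whose columns are ordered as
`11, 21, 31, 12, 22, 32, 13, 23, 33` (indices `i j`). -/
def coeff (R : Matrix (Fin 9) (Fin 9) K) (i j m l : Fin 3) : K :=
  R ⟨3 * m.val + l.val, by omega⟩ ⟨3 * j.val + i.val, by omega⟩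

/-- The standard basis `x₁, x₂, x₃` of `V = K³`. -/
abbrev e (K : Type u) [Field K] : Module.Basis (Fin 3) K (Fin 3 → K) := Pi.basisFun K (Fin 3)

/-- `c(x_i ⊗ x_j) = ∑ r^{ij}_{ml} x_m ⊗ x_l`. -/
def braiding (R : Matrix (Fin 9) (Fin 9) K) :
    (Fin 3 → K) ⊗[K] (Fin 3 → K) →ₗ[K] (Fin 3 → K) ⊗[K] (Fin 3 → K) :=
  ((e K).tensorProduct (e K)).constr K
    fun ij => ∑ m, ∑ l, coeff R ij.1 ij.2 m l • (e K m ⊗ₜ[K] e K l)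

/-- The braid equation `(c ⊗ id)(id ⊗ c)(c ⊗ id) = (id ⊗ c)(c ⊗ id)(id ⊗ c)` on `V ⊗ (V ⊗ V)`. -/
def BraidEquation {V : Type u} [AddCommGroup V] [Module K V] (c : V ⊗[K] V →ₗ[K] V ⊗[K] V) : Prop :=
  let c₂₃ : V ⊗[K] (V ⊗[K] V) →ₗ[K] V ⊗[K] (V ⊗[K] V) := c.lTensor V
  let c₁₂ : V ⊗[K] (V ⊗[K] V) →ₗ[K] V ⊗[K] (V ⊗[K] V) :=
    (TensorProduct.assoc K V V V).toLinearMap ∘ₗ c.rTensor V ∘ₗ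
      (TensorProduct.assoc K V V V).symm.toLinearMap
  c₁₂ ∘ₗ c₂₃ ∘ₗ c₁₂ = c₂₃ ∘ₗ c₁₂ ∘ₗ c₂₃

/-- `c^♭ : V* ⊗ V → V ⊗ V*`, `f ⊗ v ↦ ∑ i, (f ⊗ id)(c(v ⊗ v_i)) ⊗ v^i`, for the dual bases
`(v_i)`, `(v^i)`. -/
def flatMap {V : Type u} [AddCommGroup V] [Module K V] (v : Module.Basis (Fin 3) K V)
    (c : V ⊗[K] V →ₗ[K] V ⊗[K] V) :
    Module.Dual K V ⊗[K] V →ₗ[K] V ⊗[K] Module.Dual K V :=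
  TensorProduct.lift (LinearMap.mk₂ K
    (fun f w => ∑ i, (TensorProduct.lid K V (f.rTensor V (c (w ⊗ₜ[K] v i)))) ⊗ₜ[K] v.coord i)
    (by intro f g w; simp [LinearMap.rTensor_add, TensorProduct.add_tmul, Finset.sum_add_distrib])
    (by intro s f w; simp [LinearMap.rTensor_smul, TensorProduct.smul_tmul', Finset.smul_sum])
    (by intro f w w'; simp [TensorProduct.add_tmul, Finset.sum_add_distrib])
    (by intro s f w; simp [← TensorProduct.smul_tmul', Finset.smul_sum]))

/-- `(K³, c)` is a rigid braided vector space: `c` is bijective, satisfies the braid equation, and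
`c^♭` is bijective. -/
def IsRigidBraided (R : Matrix (Fin 9) (Fin 9) K) : Prop :=
  Function.Bijective (braiding R) ∧ BraidEquation (braiding R) ∧
    Function.Bijective (flatMap (e K) (braiding R))

end Braiding

/-! ### The Nichols algebra -/

section Nichols

/-- The tensor algebra of `V = K³`, as the free algebra on the basis `x₁, x₂, x₃`. -/
abbrev T (K : Type u) [Field K] : Type u := FreeAlgebra K (Fin 3)

variable {K : Type u} [Field K]

/-- The first basis vector. -/
abbrev x₁ : T K := FreeAlgebra.ι K 0

/-- The second basis vector. -/
abbrev x₂ : T K := FreeAlgebra.ι K 1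

/-- The third basis vector. -/
abbrev x₃ : T K := FreeAlgebra.ι K 2

/-- The homogeneous component `T^n(V)` of degree `n`. -/
def degreePart (K : Type u) [Field K] (n : ℕ) : Submodule K (T K) :=
  Submodule.span K (Set.range (FreeAlgebra.ι K)) ^ n

/-- The extension of the braiding to `V ⊗ T(V) → T(V) ⊗ V`, written as
`c(x_i ⊗ w) = ∑ l, (braidPast R w) i l ⊗ x_l`. That this is compatible with products,
`c(x_i ⊗ w w') = (w ⊗ c)(c(x_i ⊗ w) ⊗ w')` in the usual sense, is multiplicativity of matrices. -/
def braidPast (R : Matrix (Fin 9) (Fin 9) K) : T K →ₐ[K] Matrix (Fin 3) (Fin 3) (T K) :=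
  FreeAlgebra.lift K fun j => Matrix.of fun i l => ∑ m, coeff R i j m l • FreeAlgebra.ι K m

/-- Left multiplication by `x_i ⊗ 1 + 1 ⊗ x_i` in the braided tensor product algebra `T(V) ⊗ T(V)`,
whose product is `(a ⊗ b)(w ⊗ w') = a c(b ⊗ w) w'`. -/
def mulPrimitive (R : Matrix (Fin 9) (Fin 9) K) (i : Fin 3) : Module.End K (T K ⊗[K] T K) :=
  TensorProduct.map (LinearMap.mulLeft K (FreeAlgebra.ι K i)) LinearMap.id +
    ∑ l, TensorProduct.map
      (Matrix.entryLinearMap K (T K) i l ∘ₗ (braidPast R).toLinearMap)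
      (LinearMap.mulLeft K (FreeAlgebra.ι K l))

/-- The braided comultiplication of `T(V)`: the algebra map to the braided tensor product algebra
with `Δ(x_i) = x_i ⊗ 1 + 1 ⊗ x_i`. -/
def comul (R : Matrix (Fin 9) (Fin 9) K) : T K →ₗ[K] T K ⊗[K] T K :=
  LinearMap.applyₗ (1 ⊗ₜ[K] 1) ∘ₗ (FreeAlgebra.lift K (mulPrimitive R)).toLinearMap

/-- A homogeneous Hopf ideal of `T(V)` generated by homogeneous elements of degree `≥ 2`. (Such
an ideal is killed by the counit, and since `T(V)` is graded and connected, a coideal of this form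
is stable under the antipode.) -/
def IsHopfIdeal (R : Matrix (Fin 9) (Fin 9) K) (I : TwoSidedIdeal (T K)) : Prop :=
  (∃ S : Set (T K), (∀ x ∈ S, ∃ n, 2 ≤ n ∧ x ∈ degreePart K n) ∧ I = TwoSidedIdeal.span S) ∧
    ∀ x ∈ I, comul R x ∈
      Submodule.span K {z : T K ⊗[K] T K | ∃ a b : T K, (a ∈ I ∨ b ∈ I) ∧ z = a ⊗ₜ[K] b}

/-- The defining ideal `𝒥(V)` of the Nichols algebra: the largest homogeneous Hopf ideal generated
by homogeneous elements of degree `≥ 2`, that is, the sum of all of them. -/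
def nicholsIdeal (R : Matrix (Fin 9) (Fin 9) K) : TwoSidedIdeal (T K) :=
  sSup {I | IsHopfIdeal R I}

/-- The Nichols algebra `𝔅(V) = T(V)/𝒥(V)`. -/
abbrev NicholsAlgebra (R : Matrix (Fin 9) (Fin 9) K) : Type u := (nicholsIdeal R).ringCon.Quotient

/-- The canonical projection `T(V) → 𝔅(V)`. -/
def proj (R : Matrix (Fin 9) (Fin 9) K) : T K →ₐ[K] NicholsAlgebra R :=
  (nicholsIdeal R).ringCon.mkₐ K

/-- `𝔅(V)` has a quadratic relation: `𝒥(V)` has a nonzero element of degree two. -/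
def HasQuadraticRelation (R : Matrix (Fin 9) (Fin 9) K) : Prop :=
  ∃ x ∈ nicholsIdeal R, x ∈ degreePart K 2 ∧ x ≠ 0

end Nichols

/-! ### PBW bases and Gelfand–Kirillov dimension -/

section Algebra

variable (K : Type u) [Field K] {A : Type u} [Ring A] [Algebra K A]

/-- The ordered monomial `∏ g_i ^ (n i)`, the factors taken in increasing order of `i`. -/
def orderedMonomial {ι : Type*} [LinearOrder ι] (g : ι → A) (n : ι →₀ ℕ) : A :=
  ((n.support.sort (· ≤ ·)).map fun i => g i ^ n i).prod

/-- The ordered monomials in the generators `g i`, with exponents smaller than the heights `h i`,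
are a `K`-basis of `A`. -/
def IsPBWBasis {ι : Type*} [LinearOrder ι] (g : ι → A) (h : ι → ℕ∞) : Prop :=
  let mon : {n : ι →₀ ℕ // ∀ i, (n i : ℕ∞) < h i} → A := fun n => orderedMonomial g n.1
  LinearIndependent K mon ∧ Submodule.span K (Set.range mon) = ⊤

/-- The Gelfand–Kirillov dimension: the supremum over the finite-dimensional subspaces `W` of `A`
of `limsup log (dim (K + W + ⋯ + W ^ n)) / log n`. -/
def GKdim (A : Type u) [Ring A] [Algebra K A] : EReal :=
  ⨆ (W : Submodule K A) (_ : W.FG),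
    Filter.limsup (fun n : ℕ =>
      ((Real.log (Module.finrank K ↥((1 ⊔ W) ^ n)) / Real.log n : ℝ) : EReal)) Filter.atTop

end Algebra

/-! ### Descriptions of Nichols algebras -/

section Descriptions

variable {K : Type u} [Field K]

/-- `𝒥(V)` is generated by `rels`, the generators `g` (increasing in the index) with heights `h`
give a PBW basis of `𝔅(V)`, and the Gelfand–Kirillov dimension of `𝔅(V)` is `gk`. -/
def Describes (R : Matrix (Fin 9) (Fin 9) K) (rels : Set (T K)) {ι : Type} [LinearOrder ι]
    (g : ι → T K) (h : ι → ℕ∞) (gk : EReal) : Prop :=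
  nicholsIdeal R = TwoSidedIdeal.span rels ∧
    IsPBWBasis K (fun i => proj R (g i)) h ∧
    GKdim K (NicholsAlgebra R) = gk

/-- Basis `{x₁^{a₁} x₂^{a₂} x₃^{a₃} : a_i < 2}`; dimension `8`. -/
def DescribedB0 (R : Matrix (Fin 9) (Fin 9) K) (rels : Set (T K)) : Prop :=
  Describes R rels ![x₁, x₂, x₃] ![2, 2, 2] 0 ∧ Module.finrank K (NicholsAlgebra R) = 8

/-- Basis `{x₁^{a₁} x₂^{a₂} x₃^{a₃} : a₁, a₂ < 2}`. -/
def DescribedB1 (R : Matrix (Fin 9) (Fin 9) K) (rels : Set (T K)) : Prop :=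
  Describes R rels ![x₁, x₂, x₃] ![2, 2, ⊤] 1

/-- Basis `{x₁^{a₁} x₂^{a₂} x₃^{a₃}}`. -/
def DescribedB3 (R : Matrix (Fin 9) (Fin 9) K) (rels : Set (T K)) : Prop :=
  Describes R rels ![x₁, x₂, x₃] ![⊤, ⊤, ⊤] 3

end Descriptions

/-! ### The R-matrices -/

section Matrices

variable {K : Type u} [Field K]

def R1 (t a b p : K) : Matrix (Fin 9) (Fin 9) K :=
  !![t, 0, t*a, 0, 0, 0, -t*a, 0, -t*a*b;
     0, t, 0, 0, 0, t*(a-b), 0, -t*a, t*p;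
     0, 0, t, 0, 0, 0, 0, 0, -t*b;
     0, 0, 0, t, 0, t*a, 0, t*(b-a), -t*p;
     0, 0, 0, 0, t, 0, 0, 0, 0;
     0, 0, 0, 0, 0, t, 0, 0, 0;
     0, 0, 0, 0, 0, 0, t, 0, t*b;
     0, 0, 0, 0, 0, 0, 0, t, 0;
     0, 0, 0, 0, 0, 0, 0, 0, t]

def R2 (t a b p q k : K) : Matrix (Fin 9) (Fin 9) K :=
  !![t, 0, t*b, 0, 0, 0, t*p, 0, t*a;
     0, t, 0, 0, 0, t*(p-q), 0, t*q, t*k;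
     0, 0, t, 0, 0, 0, 0, 0, t*p;
     0, 0, 0, t, 0, t*b, 0, 0, -t*k;
     0, 0, 0, 0, t, 0, 0, 0, 0;
     0, 0, 0, 0, 0, t, 0, 0, 0;
     0, 0, 0, 0, 0, 0, t, 0, t*b;
     0, 0, 0, 0, 0, 0, 0, t, 0;
     0, 0, 0, 0, 0, 0, 0, 0, t]

def R3 (t a b p q : K) : Matrix (Fin 9) (Fin 9) K :=
  !![t, 0, t*a, 0, 0, 0, -t*a, 0, -t*a*b;
     0, t, 0, 0, 0, 0, 0, -t*b, -t*p;
     0, 0, t, 0, 0, 0, 0, 0, -t*b;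
     0, 0, 0, t, 0, t*b, 0, 0, t*p;
     0, 0, 0, 0, t, 0, 0, 0, t*q;
     0, 0, 0, 0, 0, t, 0, 0, 0;
     0, 0, 0, 0, 0, 0, t, 0, t*b;
     0, 0, 0, 0, 0, 0, 0, t, 0;
     0, 0, 0, 0, 0, 0, 0, 0, t]

def R4 (t a b p : K) : Matrix (Fin 9) (Fin 9) K :=
  !![t, 0, t*a, 0, 0, 0, -t*a, 0, -t*a*b;
     0, t, 0, 0, 0, 0, 0, t*(a-2*b), t*p;
     0, 0, t, 0, 0, 0, 0, 0, -t*b;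
     0, 0, 0, t, 0, t*(2*b-a), 0, 0, 0;
     0, 0, 0, 0, t, 0, 0, 0, 0;
     0, 0, 0, 0, 0, t, 0, 0, 0;
     0, 0, 0, 0, 0, 0, t, 0, t*b;
     0, 0, 0, 0, 0, 0, 0, t, 0;
     0, 0, 0, 0, 0, 0, 0, 0, t]

def R5 (t a b p q k ℓ : K) : Matrix (Fin 9) (Fin 9) K :=
  !![t, t*ℓ, 0, -t*ℓ, -t*ℓ^2, t*(ℓ*q-k), t*p, t*k, t*a;
     0, t, 0, 0, -t*ℓ, 0, 0, t*q, t*b;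
     0, 0, t, 0, 0, -t*ℓ, 0, 0, t*p;
     0, 0, 0, t, t*ℓ, 0, 0, t*(p-q), -t*b;
     0, 0, 0, 0, t, 0, 0, 0, 0;
     0, 0, 0, 0, 0, t, 0, 0, 0;
     0, 0, 0, 0, 0, 0, t, t*ℓ, 0;
     0, 0, 0, 0, 0, 0, 0, t, 0;
     0, 0, 0, 0, 0, 0, 0, 0, t]

def R6 (t a b p q k : K) : Matrix (Fin 9) (Fin 9) K :=
  !![t, t*a, t*p, -t*a, -t*a*b, -t*(2*p*a+k), -t*p, t*k, -t*p*q;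
     0, t, 0, 0, -t*b, 0, 0, -t*p, 0;
     0, 0, t, 0, 0, -t*a, 0, 0, -t*q;
     0, 0, 0, t, t*b, t*p, 0, 0, 0;
     0, 0, 0, 0, t, 0, 0, 0, 0;
     0, 0, 0, 0, 0, t, 0, 0, 0;
     0, 0, 0, 0, 0, 0, t, t*a, t*q;
     0, 0, 0, 0, 0, 0, 0, t, 0;
     0, 0, 0, 0, 0, 0, 0, 0, t]

def R7 (t a b p q k ℓ d : K) : Matrix (Fin 9) (Fin 9) K :=
  !![t, t*k, t*p, -t*k, -t*k*ℓ, t*d, t*a, t*(k*(a-q)-d), t*b;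
     0, t, 0, 0, -t*ℓ, t*(p-q), 0, t*a, 0;
     0, 0, t, 0, 0, -t*k, 0, 0, t*a;
     0, 0, 0, t, t*ℓ, t*q, 0, 0, 0;
     0, 0, 0, 0, t, 0, 0, 0, 0;
     0, 0, 0, 0, 0, t, 0, 0, 0;
     0, 0, 0, 0, 0, 0, t, t*k, t*p;
     0, 0, 0, 0, 0, 0, 0, t, 0;
     0, 0, 0, 0, 0, 0, 0, 0, t]

def R8 (t a b p q : K) : Matrix (Fin 9) (Fin 9) K :=
  !![t, t*a, t*q, -t*a, -t*a^2, -t*b, -t*q, t*b, t*a*p;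
     0, t, 0, 0, -t*a, t*q, 0, 0, t*p;
     0, 0, t, 0, 0, -t*a, 0, 0, 0;
     0, 0, 0, t, t*a, 0, 0, -t*q, -t*p;
     0, 0, 0, 0, t, 0, 0, 0, 0;
     0, 0, 0, 0, 0, t, 0, 0, 0;
     0, 0, 0, 0, 0, 0, t, t*a, 0;
     0, 0, 0, 0, 0, 0, 0, t, 0;
     0, 0, 0, 0, 0, 0, 0, 0, t]

def R9 (t a b p q : K) : Matrix (Fin 9) (Fin 9) K :=
  !![t, t, 0, -t, -t, t*a, t*b, t*(b-a), t*p;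
     0, t, t, 0, -t, -t, 0, t*b, t*(b-q);
     0, 0, t, 0, 0, -t, 0, 0, t*b;
     0, 0, 0, t, t, 0, -t, -t, t*q;
     0, 0, 0, 0, t, t, 0, -t, -t;
     0, 0, 0, 0, 0, t, 0, 0, -t;
     0, 0, 0, 0, 0, 0, t, t, 0;
     0, 0, 0, 0, 0, 0, 0, t, t;
     0, 0, 0, 0, 0, 0, 0, 0, t]

/-- The upper right entry is `-4 a² (a + 7)` (times `t`); for `a ≠ 1` it is forced by the other
entries and the Yang–Baxter equation. -/
def R10 (t a : K) : Matrix (Fin 9) (Fin 9) K :=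
  t • !![1, 2, 0, -2, -4*a, 8*a, 4, 0, -4*a^2*(a+7);
     0, 1, 2, 0, -2*a, 4-6*a-2*a^2, 0, 2*a*(a+1), 6*a*(a+2)*(a-1);
     0, 0, 1, 0, 0, 2-4*a, 0, 0, -4*a*(1-2*a);
     0, 0, 0, 1, 2*a, -2*a*(1-a), -2, -2*a*(a+1), -2*a*(1+3*a)*(a-2);
     0, 0, 0, 0, 1, 2*a, 0, -2*a, 4*a*(1-2*a);
     0, 0, 0, 0, 0, 1, 0, 0, 2-4*a;
     0, 0, 0, 0, 0, 0, 1, 4*a-2, 4*(1-2*a)*(1-a);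
     0, 0, 0, 0, 0, 0, 0, 1, 4*a-2;
     0, 0, 0, 0, 0, 0, 0, 0, 1]

/-- `R` is one of the matrices of the ten families, with homogenizing parameter `t`. -/
inductive IsFamilyMember (t : K) : Matrix (Fin 9) (Fin 9) K → Prop
  | r1 (a b p : K) : IsFamilyMember t (R1 t a b p)
  | r2 (a b p q k : K) : IsFamilyMember t (R2 t a b p q k)
  | r3 (a b p q : K) : IsFamilyMember t (R3 t a b p q)
  | r4 (a b p : K) : IsFamilyMember t (R4 t a b p)
  | r5 (a b p q k ℓ : K) : IsFamilyMember t (R5 t a b p q k ℓ)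
  | r6 (a b p q k : K) : IsFamilyMember t (R6 t a b p q k)
  | r7 (a b p q k ℓ d : K) : IsFamilyMember t (R7 t a b p q k ℓ d)
  | r8 (a b p q : K) : IsFamilyMember t (R8 t a b p q)
  | r9 (a b p q : K) : IsFamilyMember t (R9 t a b p q)
  | r10 (a : K) : IsFamilyMember t (R10 t a)

end Matrices

/-! ### Relations and generators for the second family -/

section SecondFamily

variable {K : Type u} [Field K]

/-- The elements `z_n` for `t = 1`. -/
def z (b p q : K) : ℕ → T K
  | 0 => x₂
  | n + 1 =>
    (x₃ - (((n + 1 : ℕ) : K) * b) • x₁) * z b p q n - z b p q n * x₃ +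
      ((n.factorial : K) * (q - p) * ((-b - p) / 2) ^ n) • (x₁ ^ (n + 1) * x₂)

/-- The scalars `β_n` for `t = 1`. -/
def β (b p q : K) (n : ℕ) : K :=
  -(n : K) * (((n : K) + 1) / 2 * b + ((n : K) - 1) / 2 * p + q)

/-- The relations common to all `t = 1`, `b ≠ p - 2q`. -/
def relsPlus (b p q : K) : Set (T K) :=
  {x₂ * x₁ - x₁ * x₂, x₃ * x₁ - x₁ * x₃ + ((p - b) / 2) • x₁ ^ 2} ∪
    {r | ∃ n : ℕ, r = z b p q (n + 1) * z b p q n - z b p q n * z b p q (n + 1)}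

/-- The sequence `x₁, x₂ = z_0, z_1, z_2, …`. -/
def genPlus (b p q : K) : ℕ → T K
  | 0 => x₁
  | n + 1 => z b p q n

/-- `x₃₁ = x₃ x₁ + x₁ x₃`. -/
def x₃₁ : T K := x₃ * x₁ + x₁ * x₃

/-- The elements `z_n` for `t = -1`. In the recursion for `z_{n+1}`, the case of odd `n + 1` is the
case of even `n`. -/
def z' (b p q : K) : ℕ → T K
  | 0 => x₂
  | n + 1 =>
    (x₃ - (((n + 1 : ℕ) : K) * b) • x₁) * z' b p q n +
      if Even n then
        z' b p q n * x₃ +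
          (((n / 2).factorial : K) * (p - q) * (-p - b) ^ (n / 2)) • (x₁ * x₂ * x₃₁ ^ (n / 2))
      else
        -(z' b p q n * x₃) -
          ((((n - 1) / 2).factorial : K) * (p - q) * (-p - b) ^ ((n - 1) / 2)) •
            (x₂ * x₃₁ ^ ((n + 1) / 2))

/-- The scalars `β̃_n` for `t = -1`. -/
def β' (b p q : K) (n : ℕ) : K :=
  if Even n then -((n : K) / 2 * (b + p))
  else -(((n : K) + 1) / 2 * b + ((n : K) - 1) / 2 * p + q)

/-- The relations common to all `t = -1`, `b ≠ -p`. -/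
def relsMinus (b p q : K) : Set (T K) :=
  {x₂ * x₁ + x₁ * x₂, x₁ ^ 2, x₂ ^ 2,
    x₃₁ * x₂ - x₂ * x₃₁, x₃ * x₃₁ - x₃₁ * x₃ + (p - b) • (x₁ * x₃₁)} ∪
    {r | ∃ n : ℕ, 1 ≤ n ∧
      (r = z' b p q (2 * n) * z' b p q (2 * n - 1) - z' b p q (2 * n - 1) * z' b p q (2 * n) ∨
        r = z' b p q (2 * n) ^ 2)}

/-- The sequence `x₁, x₂, x₃₁, z_1, z_2, …`. -/
def genMinus (b p q : K) : ℕ → T K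
  | 0 => x₁
  | 1 => x₂
  | 2 => x₃₁
  | n + 3 => z' b p q (n + 1)

/-- The heights of `x₁, x₂, x₃₁, z_1, z_2, …`: two for `x₁`, `x₂` and the `z_{2j}`, else infinite. -/
def heightMinus : ℕ → ℕ∞
  | 0 => 2
  | 1 => 2
  | 2 => ⊤
  | n + 3 => if Even (n + 1) then 2 else ⊤

/-- A generating sequence, followed by a last element (for us `x₃`). -/
def withLast {ι α : Type*} (last : α) (f : ι → α) : WithTop ι → α :=
  WithTop.recTopCoe last f

end SecondFamily

/-! ### Relations of the remaining cases

`relsjBm` is for the family `R_{1,j}`, in the case where the basis consists of the monomials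
`x₁^{a₁} x₂^{a₂} x₃^{a₃}` as in `DescribedBm`. -/

section Relations

variable {K : Type u} [Field K]

def rels1B0 (b p : K) : Set (T K) :=
  {x₂ * x₁ + x₁ * x₂, x₃ * x₁ + x₁ * x₃, x₃ * x₂ + x₂ * x₃ - b • (x₁ * x₂),
    x₁ ^ 2, x₂ ^ 2, x₃ ^ 2 - b • (x₁ * x₃) + p • (x₁ * x₂)}

def rels1B3 (a b : K) : Set (T K) :=
  {x₂ * x₁ - x₁ * x₂, x₃ * x₁ - x₁ * x₃ - a • x₁ ^ 2,
    x₃ * x₂ - x₂ * x₃ + (b - 2 * a) • (x₁ * x₂)}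

def rels2B3 (p q : K) : Set (T K) :=
  {x₂ * x₁ - x₁ * x₂, x₃ * x₁ - x₁ * x₃ + q • x₁ ^ 2,
    x₃ * x₂ - x₂ * x₃ + (2 * q - p) • (x₁ * x₂)}

def rels2B1 (p : K) : Set (T K) :=
  {x₂ * x₁ + x₁ * x₂, x₃ * x₁ + x₁ * x₃, x₃ * x₂ + x₂ * x₃ + p • (x₁ * x₂),
    x₁ ^ 2, x₂ ^ 2}

def rels2B0 (p k : K) : Set (T K) :=
  {x₂ * x₁ + x₁ * x₂, x₃ * x₁ + x₁ * x₃, x₃ * x₂ + x₂ * x₃ + p • (x₁ * x₂),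
    x₁ ^ 2, x₂ ^ 2, x₃ ^ 2 + k • (x₁ * x₂) + p • (x₁ * x₃)}

def rels3B3 (a b : K) : Set (T K) :=
  {x₂ * x₁ - x₁ * x₂, x₃ * x₁ - x₁ * x₃ - a • x₁ ^ 2,
    x₃ * x₂ - x₂ * x₃ - b • (x₁ * x₂)}

def rels3B1 (b : K) : Set (T K) :=
  {x₂ * x₁ + x₁ * x₂, x₃ * x₁ + x₁ * x₃, x₃ * x₂ + x₂ * x₃ - b • (x₁ * x₂),
    x₁ ^ 2, x₂ ^ 2}

def rels3B0 (b p : K) : Set (T K) :=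
  {x₂ * x₁ + x₁ * x₂, x₃ * x₁ + x₁ * x₃, x₃ * x₂ + x₂ * x₃ - b • (x₁ * x₂),
    x₁ ^ 2, x₂ ^ 2, x₃ ^ 2 - b • (x₁ * x₃) - p • (x₁ * x₂)}

def rels4B3 (a b : K) : Set (T K) :=
  {x₂ * x₁ - x₁ * x₂, x₃ * x₁ - x₁ * x₃ - a • x₁ ^ 2,
    x₃ * x₂ - x₂ * x₃ + (a - 2 * b) • (x₁ * x₂)}

def rels4B1 (a b : K) : Set (T K) :=
  {x₂ * x₁ + x₁ * x₂, x₃ * x₁ + x₁ * x₃, x₃ * x₂ + x₂ * x₃ + (a - 2 * b) • (x₁ * x₂),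
    x₁ ^ 2, x₂ ^ 2}

def rels4B0 (a b : K) : Set (T K) :=
  {x₂ * x₁ + x₁ * x₂, x₃ * x₁ + x₁ * x₃, x₃ * x₂ + x₂ * x₃ + (a - 2 * b) • (x₁ * x₂),
    x₁ ^ 2, x₂ ^ 2, x₃ ^ 2 - b • (x₁ * x₃)}

def rels5B3 (q k ℓ : K) : Set (T K) :=
  {x₂ * x₁ - x₁ * x₂ - ℓ • x₁ ^ 2, x₃ * x₁ - x₁ * x₃ + q • x₁ ^ 2,
    x₃ * x₂ - x₂ * x₃ + ℓ • (x₁ * x₃) + q • (x₁ * x₂) + (k - q * ℓ) • x₁ ^ 2}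

def rels5B1 (q ℓ : K) : Set (T K) :=
  {x₂ * x₁ + x₁ * x₂, x₃ * x₁ + x₁ * x₃,
    x₃ * x₂ + x₂ * x₃ - ℓ • (x₁ * x₃) + q • (x₁ * x₂),
    x₁ ^ 2, x₂ ^ 2 - ℓ • (x₁ * x₂)}

def rels5B0 (b q ℓ : K) : Set (T K) :=
  {x₂ * x₁ + x₁ * x₂, x₃ * x₁ + x₁ * x₃,
    x₃ * x₂ + x₂ * x₃ - ℓ • (x₁ * x₃) + q • (x₁ * x₂),
    x₁ ^ 2, x₂ ^ 2 - ℓ • (x₁ * x₂), x₃ ^ 2 + b • (x₁ * x₂)}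

def rels6B0 (a b p q : K) : Set (T K) :=
  {x₂ * x₁ + x₁ * x₂, x₃ * x₁ + x₁ * x₃,
    x₃ * x₂ + x₂ * x₃ - a • (x₁ * x₃) - p • (x₁ * x₂),
    x₁ ^ 2, x₂ ^ 2 - b • (x₁ * x₂), x₃ ^ 2 - q • (x₁ * x₃)}

def rels6B3 (a p k : K) : Set (T K) :=
  {x₂ * x₁ - x₁ * x₂ - a • x₁ ^ 2, x₃ * x₁ - x₁ * x₃ - p • x₁ ^ 2,
    x₃ * x₂ - x₂ * x₃ + a • (x₁ * x₃) - p • (x₁ * x₂) + (k + p * a) • x₁ ^ 2}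

def rels7B3 (q k d : K) : Set (T K) :=
  {x₂ * x₁ - x₁ * x₂ - k • x₁ ^ 2, x₃ * x₁ - x₁ * x₃ - q • x₁ ^ 2,
    x₃ * x₂ - x₂ * x₃ + k • (x₁ * x₃) - q • (x₁ * x₂) - (d + q * k) • x₁ ^ 2}

def rels7B1 (q k ℓ : K) : Set (T K) :=
  {x₂ * x₁ + x₁ * x₂, x₃ * x₁ + x₁ * x₃,
    x₃ * x₂ + x₂ * x₃ - k • (x₁ * x₃) - q • (x₁ * x₂),
    x₁ ^ 2, x₂ ^ 2 - ℓ • (x₁ * x₂)}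

def rels7B0 (p q k ℓ : K) : Set (T K) :=
  {x₂ * x₁ + x₁ * x₂, x₃ * x₁ + x₁ * x₃,
    x₃ * x₂ + x₂ * x₃ - k • (x₁ * x₃) - q • (x₁ * x₂),
    x₁ ^ 2, x₂ ^ 2 - ℓ • (x₁ * x₂), x₃ ^ 2 - p • (x₁ * x₃)}

def rels8B0 (a p q : K) : Set (T K) :=
  {x₂ * x₁ + x₁ * x₂, x₃ * x₁ + x₁ * x₃,
    x₃ * x₂ + x₂ * x₃ - a • (x₁ * x₃) + q • (x₁ * x₂),
    x₁ ^ 2, x₂ ^ 2 - a • (x₁ * x₂), x₃ ^ 2 + p • (x₁ * x₂)}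

def rels8B3 (a b q : K) : Set (T K) :=
  {x₂ * x₁ - x₁ * x₂ - a • x₁ ^ 2, x₃ * x₁ - x₁ * x₃ - q • x₁ ^ 2,
    x₃ * x₂ - x₂ * x₃ + a • (x₁ * x₃) - q • (x₁ * x₂) + b • x₁ ^ 2}

def rels9B3 (a : K) : Set (T K) :=
  {x₂ * x₁ - x₁ * x₂ - x₁ ^ 2, x₃ * x₁ - x₁ * x₃ - x₁ * x₂,
    x₃ * x₂ - x₂ * x₃ - x₂ ^ 2 + x₁ * x₃ + x₁ * x₂ - a • x₁ ^ 2}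

def rels9B1 : Set (T K) :=
  {x₂ * x₁ + x₁ * x₂, x₃ * x₁ + x₁ * x₃ + x₁ * x₂, x₃ * x₂ + x₂ * x₃ - x₁ * x₃,
    x₁ ^ 2, x₂ ^ 2 - x₁ * x₂}

def rels9B0 (q : K) : Set (T K) :=
  {x₂ * x₁ + x₁ * x₂, x₃ * x₁ + x₁ * x₃ + x₁ * x₂, x₃ * x₂ + x₂ * x₃ - x₁ * x₃,
    x₁ ^ 2, x₂ ^ 2 - x₁ * x₂, x₃ ^ 2 - x₂ * x₃ + x₁ * x₃ - q • (x₁ * x₂)}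

def rels10B3 (a : K) : Set (T K) :=
  {x₂ * x₁ - x₁ * x₂ - (2 : K) • x₁ ^ 2, x₃ * x₁ - x₁ * x₃ - (2 : K) • (x₁ * x₂),
    x₃ * x₂ - x₂ * x₃ - (2 * a) • x₂ ^ 2 + (4 * a - 2) • (x₁ * x₃) +
    (8 * a - 4) • (x₁ * x₂) - (4 * a * (a + 1)) • x₁ ^ 2}

def rels10B0 (a : K) : Set (T K) :=
  {x₂ * x₁ + x₁ * x₂, x₃ * x₁ + x₁ * x₃ + (2 : K) • (x₁ * x₂),
    x₃ * x₂ + x₂ * x₃ + (2 * (1 - 2 * a)) • (x₁ * x₃) + (4 * (1 - a)) • (x₁ * x₂),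
    x₁ ^ 2, x₂ ^ 2 - (2 * a) • (x₁ * x₂),
    x₃ ^ 2 - (2 * (2 * a - 1)) • (x₂ * x₃) + (4 * a * (2 * a - 1)) • (x₁ * x₃) -
    (2 * a * (a ^ 2 - a + 4)) • (x₁ * x₂)}

end Relations

end Hietarinta

end

open Hietarinta

open scoped TensorProduct

noncomputable section

namespace Hietarinta

universe u

/-! ### Skew derivations of the tensor algebra -/

section SkewDerivations

variable {K : Type u} [Field K]

/-- Induction on the tensor algebra by left multiplication with generators. -/
theorem left_induction {p : T K → Prop} (one : p 1) (smul : ∀ (c : K) w, p w → p (c • w))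
    (add : ∀ v w, p v → p w → p (v + w)) (mul : ∀ i w, p w → p (FreeAlgebra.ι K i * w)) (w : T K) :
    p w := by
  have key : ∀ v : T K, ∀ w, p w → p (v * w) := by
    intro v
    induction v using FreeAlgebra.induction with
    | grade0 r => intro w hw; rw [← Algebra.smul_def]; exact smul _ _ hw
    | grade1 i => exact mul i
    | mul a b ha hb => intro w hw; rw [mul_assoc]; exact ha _ (hb _ hw)
    | add a b ha hb => intro w hw; rw [add_mul]; exact add _ _ (ha _ hw) (hb _ hw)
  simpa using key w 1 one

/-- Two linear maps on the tensor algebra satisfying the same recursion agree. -/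
theorem linearMap_ext_left {M : Type*} [AddCommGroup M] [Module K M] {f g : T K →ₗ[K] M}
    (one : f 1 = g 1)
    (mul : ∀ i w, f w = g w → f (FreeAlgebra.ι K i * w) = g (FreeAlgebra.ι K i * w)) (w : T K) :
    f w = g w := by
  induction w using left_induction with
  | one => exact one
  | smul c w h => simp [h]
  | add v w hv hw => simp [hv, hw]
  | mul i w h => exact mul i w h

/-- The counit. -/
abbrev counit : T K →ₐ[K] K := FreeAlgebra.algebraMapInv

@[simp] theorem counit_ι (i : Fin 3) : counit (FreeAlgebra.ι K i) = 0 := by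
  simp [counit, FreeAlgebra.algebraMapInv]

variable (R : Matrix (Fin 9) (Fin 9) K)

theorem braidPast_ι (i j l : Fin 3) :
    braidPast R (FreeAlgebra.ι K j) i l = ∑ m, coeff R i j m l • FreeAlgebra.ι K m := by
  simp [braidPast]

/-- The `(i, l)` entry of `braidPast`, as a linear map. -/
def past (i l : Fin 3) : T K →ₗ[K] T K :=
  Matrix.entryLinearMap K (T K) i l ∘ₗ (braidPast R).toLinearMap

theorem past_apply (i l : Fin 3) (w : T K) : past R i l w = braidPast R w i l := rfl

theorem past_mul (i l : Fin 3) (v w : T K) :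
    past R i l (v * w) = ∑ m, past R i m v * past R m l w := by
  simp [past_apply, Matrix.mul_apply]

theorem past_one (i l : Fin 3) : past R i l 1 = if i = l then 1 else 0 := by
  simp [past_apply, Matrix.one_apply]

theorem past_ι (i j l : Fin 3) :
    past R i l (FreeAlgebra.ι K j) = ∑ m, coeff R i j m l • FreeAlgebra.ι K m :=
  braidPast_ι R i j l

theorem past_ι_mul (i j l : Fin 3) (w : T K) :
    past R i l (FreeAlgebra.ι K j * w) =
      ∑ s, ∑ m, coeff R i j m s • (FreeAlgebra.ι K m * past R s l w) := by
  rw [past_mul]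
  simp only [past_ι, Finset.sum_mul, smul_mul_assoc]

/-- The matrix representation `w ↦ (w, ∂ w; 0, c(- ⊗ w))`. -/
def diffMatrix : T K →ₐ[K] Matrix (Option (Fin 3)) (Option (Fin 3)) (T K) :=
  FreeAlgebra.lift K fun j => Matrix.of fun r s =>
    match r, s with
    | none, none => FreeAlgebra.ι K j
    | none, some l => if j = l then 1 else 0
    | some _, none => 0
    | some i, some l => past R i l (FreeAlgebra.ι K j)

theorem diffMatrix_ι (j : Fin 3) (r s : Option (Fin 3)) :
    diffMatrix R (FreeAlgebra.ι K j) r s =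
      match r, s with
      | none, none => FreeAlgebra.ι K j
      | none, some l => if j = l then 1 else 0
      | some _, none => 0
      | some i, some l => past R i l (FreeAlgebra.ι K j) := by
  rw [diffMatrix, FreeAlgebra.lift_ι_apply]
  rfl

theorem diffMatrix_some_none (i : Fin 3) (w : T K) : diffMatrix R w (some i) none = 0 := by
  have := linearMap_ext_left (K := K)
    (f := LinearMap.pi fun l : Fin 3 =>
      Matrix.entryLinearMap K (T K) (some l) none ∘ₗ (diffMatrix R).toLinearMap)
    (g := 0) (by ext; simp) (by
      intro i w h
      have h'' : ∀ l : Fin 3, diffMatrix R w (some l) none = 0 := fun l => congrFun h l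
      ext l
      simp [Matrix.mul_apply, Fintype.sum_option, h'', diffMatrix_ι]) w
  exact congrFun this i

theorem diffMatrix_none_none (w : T K) : diffMatrix R w none none = w :=
  linearMap_ext_left (K := K)
    (f := Matrix.entryLinearMap K (T K) none none ∘ₗ (diffMatrix R).toLinearMap)
    (g := LinearMap.id) (by simp) (by
      intro i w h
      have h' : diffMatrix R w none none = w := h
      simp [Matrix.mul_apply, Fintype.sum_option, h', diffMatrix_some_none, diffMatrix_ι]) w

theorem diffMatrix_some_some (i l : Fin 3) (w : T K) :
    diffMatrix R w (some i) (some l) = past R i l w := by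
  have := linearMap_ext_left (K := K)
    (f := LinearMap.pi fun i : Fin 3 => LinearMap.pi fun l : Fin 3 =>
      Matrix.entryLinearMap K (T K) (some i) (some l) ∘ₗ (diffMatrix R).toLinearMap)
    (g := LinearMap.pi fun i : Fin 3 => LinearMap.pi fun l : Fin 3 => past R i l)
    (by ext; simp [past_one, Matrix.one_apply]) (by
      intro i w h
      have h'' : ∀ i l : Fin 3, diffMatrix R w (some i) (some l) = past R i l w :=
        fun i l => congrFun (congrFun h i) l
      ext l m
      simp [Matrix.mul_apply, Fintype.sum_option, h'', past_mul, diffMatrix_ι]) w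
  exact congrFun (congrFun this i) l

/-- The skew derivation `∂_l`: the component of the comultiplication in `T(V) ⊗ x_l`. -/
def der (l : Fin 3) : T K →ₗ[K] T K :=
  Matrix.entryLinearMap K (T K) none (some l) ∘ₗ (diffMatrix R).toLinearMap

theorem der_apply (l : Fin 3) (w : T K) : der R l w = diffMatrix R w none (some l) := rfl

@[simp] theorem der_one (l : Fin 3) : der R l 1 = 0 := by simp [der_apply]

theorem der_ι (l j : Fin 3) : der R l (FreeAlgebra.ι K j) = if j = l then 1 else 0 := by
  simp [der_apply, diffMatrix_ι]

theorem der_mul (l : Fin 3) (v w : T K) :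
    der R l (v * w) = v * der R l w + ∑ m, der R m v * past R m l w := by
  simp [der_apply, Matrix.mul_apply, Fintype.sum_option, diffMatrix_none_none, diffMatrix_some_some]

theorem der_ι_mul (l i : Fin 3) (w : T K) :
    der R l (FreeAlgebra.ι K i * w) = FreeAlgebra.ι K i * der R l w + past R i l w := by
  simp [der_mul, der_ι]

theorem counit_past (i l : Fin 3) (w : T K) :
    counit (past R i l w) = if i = l then counit w else 0 := by
  have := linearMap_ext_left (K := K)
    (f := LinearMap.pi fun i : Fin 3 => LinearMap.pi fun l : Fin 3 =>
      (counit (K := K)).toLinearMap ∘ₗ past R i l)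
    (g := LinearMap.pi fun i : Fin 3 => LinearMap.pi fun l : Fin 3 =>
      if i = l then (counit (K := K)).toLinearMap else 0)
    (by ext i l; by_cases h : i = l <;> simp [past_one, h]) (by
      intro j w h
      have h'' : ∀ i l : Fin 3, counit (past R i l w) = if i = l then counit w else 0 := by
        intro i l
        have := congrFun (congrFun h i) l
        by_cases hil : i = l <;> simpa [hil] using this
      ext i l
      by_cases hil : i = l <;> simp [hil, past_ι_mul]) w
  have := congrFun (congrFun this i) l
  by_cases hil : i = l <;> simpa [hil] using this

/-- The braid equation, in coordinates. -/
def BraidCoeff : Prop :=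
  ∀ i j k a b q : Fin 3,
    ∑ m, ∑ n, ∑ r, coeff R i j m n * coeff R n k r q * coeff R m r a b =
      ∑ m, ∑ n, ∑ r, coeff R j k m n * coeff R i m a r * coeff R r n b q

/-- The extension of the braiding to `(V ⊗ V) ⊗ T(V)`. -/
def pastTwo : T K →ₐ[K] Matrix (Fin 3 × Fin 3) (Fin 3 × Fin 3) (T K) :=
  ((Matrix.compAlgEquiv (Fin 3) (Fin 3) (T K) K).toAlgHom.comp
    (AlgHom.mapMatrix (braidPast R))).comp (braidPast R)

theorem pastTwo_apply (w : T K) (i j l m : Fin 3) :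
    pastTwo R w (j, i) (l, m) = past R i m (past R j l w) := rfl

def braidMatrix : Matrix (Fin 3 × Fin 3) (Fin 3 × Fin 3) (T K) :=
  Matrix.of fun x y => algebraMap K (T K) (coeff R x.2 x.1 y.2 y.1)

variable {R}

theorem pastTwo_comm (hR : BraidCoeff R) (w : T K) :
    pastTwo R w * braidMatrix R = braidMatrix R * pastTwo R w := by
  induction w using FreeAlgebra.induction with
  | grade0 r => rw [AlgHom.commutes]; exact Algebra.commutes _ _
  | mul a b ha hb => rw [map_mul, mul_assoc, hb, ← mul_assoc, ha, mul_assoc]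
  | add a b ha hb => rw [map_add, add_mul, mul_add, ha, hb]
  | grade1 r =>
    ext ⟨j, i⟩ ⟨s, m⟩
    simp only [Matrix.mul_apply, Fintype.sum_prod_type, pastTwo_apply, braidMatrix,
      Matrix.of_apply, past_ι, map_sum, map_smul, Finset.smul_sum,
      smul_smul, ← Algebra.smul_def, ← Algebra.commutes]
    have e1 : ∀ f : Fin 3 → Fin 3 → Fin 3 → Fin 3 → T K,
        ∑ a, ∑ b, ∑ c, ∑ d, f a b c d = ∑ d, ∑ a, ∑ b, ∑ c, f a b c d := by
      intro f
      calc _ = ∑ a, ∑ b, ∑ d, ∑ c, f a b c d := by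
            refine Finset.sum_congr rfl fun a _ => Finset.sum_congr rfl fun b _ => ?_
            exact Finset.sum_comm
        _ = ∑ a, ∑ d, ∑ b, ∑ c, f a b c d := by
            refine Finset.sum_congr rfl fun a _ => ?_
            exact Finset.sum_comm
        _ = _ := Finset.sum_comm
    refine (e1 _).trans (Eq.trans ?_ (e1 _).symm)
    refine Finset.sum_congr rfl fun a _ => ?_
    simp only [← Finset.sum_smul]
    refine congrArg (fun c : K => c • FreeAlgebra.ι K a) ?_
    have := hR i j r a m s
    simp only [Fin.sum_univ_three] at this ⊢
    linear_combination -this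

end SkewDerivations

/-! ### Compatibility of the braiding with the comultiplication -/

section Comultiplication

variable {K : Type u} [Field K] {R : Matrix (Fin 9) (Fin 9) K}

theorem past_past (hR : BraidCoeff R) (i j m s : Fin 3) (w : T K) :
    ∑ k, ∑ n, coeff R n k m s • past R i n (past R j k w) =
      ∑ k, ∑ n, coeff R i j n k • past R n m (past R k s w) := by
  have h := congrFun (congrFun (pastTwo_comm hR w) (j, i)) (s, m)
  simpa only [Matrix.mul_apply, Fintype.sum_prod_type, pastTwo_apply, braidMatrix,
    Matrix.of_apply, ← Algebra.smul_def, ← Algebra.commutes] using h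

theorem der_past (hR : BraidCoeff R) (s i l : Fin 3) (w : T K) :
    der R s (past R i l w) = ∑ m, ∑ n, coeff R n m s l • past R i n (der R m w) := by
  have := linearMap_ext_left (K := K)
    (f := LinearMap.pi fun i : Fin 3 => LinearMap.pi fun l : Fin 3 => der R s ∘ₗ past R i l)
    (g := LinearMap.pi fun i : Fin 3 => LinearMap.pi fun l : Fin 3 =>
      ∑ m, ∑ n, coeff R n m s l • past R i n ∘ₗ der R m)
    (by ext i l; by_cases h : i = l <;> simp [past_one, h]) (by
      intro j w h
      have h' : ∀ i l : Fin 3, der R s (past R i l w) =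
          ∑ m, ∑ n, coeff R n m s l • past R i n (der R m w) := by
        intro i l
        simpa [LinearMap.sum_apply] using congrFun (congrFun h i) l
      funext i l
      simp only [LinearMap.pi_apply, LinearMap.comp_apply, LinearMap.sum_apply,
        LinearMap.smul_apply]
      simp only [past_ι_mul, der_ι_mul, map_sum, map_smul, map_add, smul_add, Finset.sum_add_distrib,
        past_past hR, h', Finset.mul_sum, Finset.smul_sum, mul_smul_comm]
      congr 1
      simp only [Fin.sum_univ_three]
      module) w
  simpa [LinearMap.sum_apply] using congrFun (congrFun this i) l

theorem comul_one : comul R 1 = 1 ⊗ₜ[K] 1 := by simp [comul]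

theorem comul_ι_mul (i : Fin 3) (w : T K) :
    comul R (FreeAlgebra.ι K i * w) = mulPrimitive R i (comul R w) := by
  simp [comul]

theorem mulPrimitive_tmul (i : Fin 3) (v w : T K) :
    mulPrimitive R i (v ⊗ₜ[K] w) = (FreeAlgebra.ι K i * v) ⊗ₜ[K] w +
      ∑ l, past R i l v ⊗ₜ[K] (FreeAlgebra.ι K l * w) := by
  simp only [mulPrimitive, LinearMap.add_apply, LinearMap.sum_apply, TensorProduct.map_tmul]
  rfl

/-- The braiding of `x_i` with `T(V) ⊗ T(V)`. -/
def pastTensor (R : Matrix (Fin 9) (Fin 9) K) (i l : Fin 3) : Module.End K (T K ⊗[K] T K) :=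
  ∑ n, TensorProduct.map (past R i n) (past R n l)

theorem pastTensor_tmul (i l : Fin 3) (v w : T K) :
    pastTensor R i l (v ⊗ₜ[K] w) = ∑ n, past R i n v ⊗ₜ[K] past R n l w := by
  simp [pastTensor]

theorem pastTensor_mulPrimitive (hR : BraidCoeff R) (i j l : Fin 3) (y : T K ⊗[K] T K) :
    pastTensor R i l (mulPrimitive R j y) =
      ∑ s, ∑ m, coeff R i j m s • mulPrimitive R m (pastTensor R s l y) := by
  induction y using TensorProduct.induction_on with
  | zero => simp
  | add x y hx hy => simp only [map_add, hx, hy, smul_add, Finset.sum_add_distrib]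
  | tmul v w =>
    simp only [mulPrimitive_tmul, pastTensor_tmul, map_add, map_sum, smul_add,
      Finset.sum_add_distrib]
    congr 1
    · simp only [past_ι_mul, TensorProduct.sum_tmul, ← TensorProduct.smul_tmul', Finset.smul_sum]
      rw [Finset.sum_comm]
      refine Finset.sum_congr rfl fun s _ => Finset.sum_comm
    · calc ∑ k, ∑ n, past R i n (past R j k v) ⊗ₜ[K] past R n l (FreeAlgebra.ι K k * w)
          = ∑ s, ∑ m, (∑ k, ∑ n, coeff R n k m s • past R i n (past R j k v)) ⊗ₜ[K]
              (FreeAlgebra.ι K m * past R s l w) := by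
            simp only [past_ι_mul, TensorProduct.sum_tmul, TensorProduct.tmul_sum,
              TensorProduct.tmul_smul, ← TensorProduct.smul_tmul']
            simp only [Fin.sum_univ_three]
            abel
        _ = _ := by
            simp only [past_past hR, TensorProduct.sum_tmul, ← TensorProduct.smul_tmul',
              Finset.smul_sum]
            simp only [Fin.sum_univ_three]
            abel

theorem comul_past (hR : BraidCoeff R) (i l : Fin 3) (w : T K) :
    comul R (past R i l w) = pastTensor R i l (comul R w) := by
  have := linearMap_ext_left (K := K)
    (f := LinearMap.pi fun i : Fin 3 => LinearMap.pi fun l : Fin 3 => comul R ∘ₗ past R i l)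
    (g := LinearMap.pi fun i : Fin 3 => LinearMap.pi fun l : Fin 3 => pastTensor R i l ∘ₗ comul R)
    (by
      funext i l
      simp only [LinearMap.pi_apply, LinearMap.comp_apply, comul_one, pastTensor_tmul, past_one]
      by_cases h : i = l
      · subst h
        simp [comul_one, TensorProduct.ite_tmul]
      · simp [h, TensorProduct.ite_tmul]) (by
      intro j w h
      have h' : ∀ i l : Fin 3, comul R (past R i l w) = pastTensor R i l (comul R w) :=
        fun i l => congrFun (congrFun h i) l
      funext i l
      simp only [LinearMap.pi_apply, LinearMap.comp_apply, comul_ι_mul, past_ι_mul, map_sum,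
        map_smul, h', pastTensor_mulPrimitive hR]) w
  exact congrFun (congrFun this i) l

theorem map_der_mulPrimitive (l i : Fin 3) (y : T K ⊗[K] T K) :
    TensorProduct.map LinearMap.id (der R l) (mulPrimitive R i y) =
      mulPrimitive R i (TensorProduct.map LinearMap.id (der R l) y) + pastTensor R i l y := by
  induction y using TensorProduct.induction_on with
  | zero => simp
  | add x y hx hy => simp only [map_add, hx, hy]; abel
  | tmul v w =>
    simp only [mulPrimitive_tmul, pastTensor_tmul, map_add, map_sum, TensorProduct.map_tmul,
      LinearMap.id_apply, der_ι_mul, TensorProduct.tmul_add, Finset.sum_add_distrib]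
    abel

theorem map_der_comul (hR : BraidCoeff R) (l : Fin 3) (w : T K) :
    TensorProduct.map LinearMap.id (der R l) (comul R w) = comul R (der R l w) :=
  linearMap_ext_left (K := K) (f := TensorProduct.map LinearMap.id (der R l) ∘ₗ comul R)
    (g := comul R ∘ₗ der R l) (by simp [comul_one]) (by
      intro i w h
      simp only [LinearMap.comp_apply] at h
      simp only [LinearMap.comp_apply, comul_ι_mul, map_der_mulPrimitive, h, der_ι_mul, map_add,
        comul_past hR]) w

theorem rid_map_counit_comul (w : T K) :
    TensorProduct.rid K (T K)
      (TensorProduct.map LinearMap.id (counit (K := K)).toLinearMap (comul R w)) = w := by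
  refine linearMap_ext_left (K := K) (f := (TensorProduct.rid K (T K)).toLinearMap ∘ₗ
    TensorProduct.map LinearMap.id (counit (K := K)).toLinearMap ∘ₗ comul R)
    (g := LinearMap.id) (by simp [comul_one]) ?_ w
  intro i w h
  have aux : ∀ y : T K ⊗[K] T K, TensorProduct.rid K (T K)
      (TensorProduct.map LinearMap.id (counit (K := K)).toLinearMap (mulPrimitive R i y)) =
      FreeAlgebra.ι K i * TensorProduct.rid K (T K)
        (TensorProduct.map LinearMap.id (counit (K := K)).toLinearMap y) := by
    intro y
    induction y using TensorProduct.induction_on with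
    | zero => simp
    | add x y hx hy => simp only [map_add, hx, hy, mul_add]
    | tmul v w => simp [mulPrimitive_tmul]
  simp only [LinearMap.comp_apply, LinearEquiv.coe_coe, LinearMap.id_apply] at h
  simp only [LinearMap.comp_apply, LinearEquiv.coe_coe, LinearMap.id_apply, comul_ι_mul, aux, h]

/-- The component of the comultiplication in `T(V) ⊗ x_l` is `∂_l`. -/
theorem map_coord_comul (φ : Fin 3 → T K →ₗ[K] K) (h1 : ∀ l, φ l 1 = 0)
    (hφ : ∀ l i w, φ l (FreeAlgebra.ι K i * w) = if i = l then counit w else 0)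
    (l : Fin 3) (w : T K) :
    TensorProduct.rid K (T K) (TensorProduct.map LinearMap.id (φ l) (comul R w)) = der R l w := by
  refine linearMap_ext_left (K := K) (f := (TensorProduct.rid K (T K)).toLinearMap ∘ₗ
    TensorProduct.map LinearMap.id (φ l) ∘ₗ comul R) (g := der R l) (by simp [comul_one, h1]) ?_ w
  intro i w h
  have aux : ∀ y : T K ⊗[K] T K, TensorProduct.rid K (T K)
      (TensorProduct.map LinearMap.id (φ l) (mulPrimitive R i y)) =
      FreeAlgebra.ι K i * TensorProduct.rid K (T K) (TensorProduct.map LinearMap.id (φ l) y) +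
      past R i l (TensorProduct.rid K (T K)
        (TensorProduct.map LinearMap.id (counit (K := K)).toLinearMap y)) := by
    intro y
    induction y using TensorProduct.induction_on with
    | zero => simp
    | add x y hx hy => simp only [map_add, hx, hy, mul_add]; abel
    | tmul v w => simp [mulPrimitive_tmul, hφ]
  simp only [LinearMap.comp_apply, LinearEquiv.coe_coe] at h
  simp only [LinearMap.comp_apply, LinearEquiv.coe_coe, comul_ι_mul, aux, h,
    rid_map_counit_comul, der_ι_mul]

end Comultiplication

/-! ### The grading of the tensor algebra -/

section Grading

variable {K : Type u} [Field K]

/-- The grading of `T(V)` as a homomorphism to polynomials. -/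
def gradeHom (K : Type u) [Field K] : T K →ₐ[K] Polynomial (T K) :=
  FreeAlgebra.lift K fun i => Polynomial.C (FreeAlgebra.ι K i) * Polynomial.X

/-- The homogeneous component of degree `n`. -/
def component (n : ℕ) : T K →ₗ[K] T K :=
  (Polynomial.lcoeff (T K) n).restrictScalars K ∘ₗ (gradeHom K).toLinearMap

theorem component_apply (n : ℕ) (w : T K) : component n w = (gradeHom K w).coeff n := rfl

theorem component_one (n : ℕ) : component n (1 : T K) = if n = 0 then 1 else 0 := by
  simp [component_apply, Polynomial.coeff_one]

theorem component_zero_ι_mul (i : Fin 3) (w : T K) :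
    component 0 (FreeAlgebra.ι K i * w) = 0 := by
  simp [component_apply, gradeHom, Polynomial.mul_coeff_zero]

theorem component_succ_ι_mul (n : ℕ) (i : Fin 3) (w : T K) :
    component (n + 1) (FreeAlgebra.ι K i * w) = FreeAlgebra.ι K i * component n w := by
  simp only [component_apply, gradeHom, map_mul, FreeAlgebra.lift_ι_apply, mul_assoc]
  rw [Polynomial.coeff_C_mul, Polynomial.coeff_X_mul]

theorem component_zero (w : T K) : component 0 w = algebraMap K (T K) (counit w) :=
  linearMap_ext_left (K := K) (f := component 0)
    (g := Algebra.linearMap K (T K) ∘ₗ (counit (K := K)).toLinearMap)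
    (by simp [component_one]) (by intro i w _; simp [component_zero_ι_mul]) w

theorem sum_component (w : T K) :
    ∑ n ∈ (gradeHom K w).support, component n w = w := by
  have h : ∀ w : T K, Polynomial.eval 1 (gradeHom K w) = w := by
    intro w
    induction w using left_induction with
    | one => simp
    | smul c w h =>
      rw [map_smul, Polynomial.eval_smul, h]
    | add v w hv hw =>
      rw [map_add, Polynomial.eval_add, hv, hw]
    | mul i w h =>
      rw [map_mul, gradeHom, FreeAlgebra.lift_ι_apply, mul_assoc, Polynomial.eval_C_mul,
        (Polynomial.commute_X _).eq, Polynomial.eval_mul_X, mul_one, ← gradeHom, h]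
  conv_rhs => rw [← h w, Polynomial.eval_eq_sum, Polynomial.sum]
  simp [component_apply]

theorem component_mem (n : ℕ) (w : T K) : component n w ∈ degreePart K n := by
  induction w using left_induction generalizing n with
  | one =>
    rw [component_one]
    split_ifs with h
    · subst h; rw [degreePart, pow_zero]; exact Submodule.one_le.mp le_rfl
    · exact zero_mem _
  | smul c w h => rw [map_smul]; exact Submodule.smul_mem _ _ (h n)
  | add v w hv hw => rw [map_add]; exact add_mem (hv n) (hw n)
  | mul i w h =>
    cases n with
    | zero => rw [component_zero_ι_mul]; exact zero_mem _
    | succ n =>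
      rw [component_succ_ι_mul, degreePart, pow_succ']
      exact Submodule.mul_mem_mul (Submodule.subset_span ⟨i, rfl⟩) (h n)

theorem component_of_mem {n : ℕ} {w : T K} (h : w ∈ degreePart K n) (m : ℕ) :
    component m w = if m = n then w else 0 := by
  induction n generalizing w m with
  | zero =>
    rw [degreePart, pow_zero] at h
    obtain ⟨c, rfl⟩ := Submodule.mem_one.mp h
    rw [Algebra.algebraMap_eq_smul_one, map_smul, component_one]
    split_ifs <;> simp
  | succ n ih =>
    rw [degreePart, pow_succ'] at h
    induction h using Submodule.mul_induction_on' with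
    | mem_mul_mem a ha b hb =>
      induction ha using Submodule.span_induction with
      | mem a ha =>
        obtain ⟨i, rfl⟩ := ha
        cases m with
        | zero => simp [component_zero_ι_mul]
        | succ m =>
          rw [component_succ_ι_mul, ih hb]
          by_cases hm : m = n <;> simp [hm]
      | zero => simp
      | add a a' _ _ h h' => rw [add_mul, map_add, h, h']; split_ifs <;> simp
      | smul c a _ h => rw [smul_mul_assoc, map_smul, h]; split_ifs <;> simp
    | add a _ b _ h h' => rw [map_add, h, h']; split_ifs <;> simp

theorem counit_component (n : ℕ) (w : T K) :
    counit (component n w) = if n = 0 then counit w else 0 := by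
  cases n with
  | zero => simp [component_zero]
  | succ n =>
    refine linearMap_ext_left (K := K) (f := (counit (K := K)).toLinearMap ∘ₗ component (n + 1))
      (g := 0) (by simp [component_one]) ?_ w
    intro i w _
    simp [component_succ_ι_mul]

variable {R : Matrix (Fin 9) (Fin 9) K}

theorem past_component (n : ℕ) (i l : Fin 3) (w : T K) :
    past R i l (component n w) = component n (past R i l w) := by
  induction w using left_induction generalizing n i l with
  | one =>
    rw [component_one, past_one]
    by_cases h : i = l <;> by_cases h' : n = 0 <;> simp [h, h', past_one, component_one]
  | smul c w h => simp [h]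
  | add v w hv hw => simp [hv, hw]
  | mul j w h =>
    cases n with
    | zero => simp [component_zero_ι_mul, past_ι_mul]
    | succ n => simp [component_succ_ι_mul, past_ι_mul, h]

theorem der_component_succ (n : ℕ) (l : Fin 3) (w : T K) :
    der R l (component (n + 1) w) = component n (der R l w) := by
  induction w using left_induction generalizing n with
  | one => simp [component_one]
  | smul c w h => simp [h]
  | add v w hv hw => simp [hv, hw]
  | mul j w h =>
    rw [component_succ_ι_mul, der_ι_mul, der_ι_mul, map_add, past_component]
    cases n with
    | zero => simp [component_zero, Algebra.algebraMap_eq_smul_one]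
    | succ n => rw [h, component_succ_ι_mul]

theorem der_component_zero (l : Fin 3) (w : T K) : der R l (component 0 w) = 0 := by
  simp [component_zero, Algebra.algebraMap_eq_smul_one]

theorem component_one_eq (w : T K) :
    component 1 w = ∑ l, counit (der R l w) • FreeAlgebra.ι K l := by
  refine linearMap_ext_left (K := K) (f := component 1)
    (g := ∑ l, ((counit (K := K)).toLinearMap ∘ₗ der R l).smulRight (FreeAlgebra.ι K l))
    (by simp [component_one]) ?_ w |>.trans (by simp)
  intro i w _
  simp [component_succ_ι_mul, component_zero, der_ι_mul, counit_past, Algebra.algebraMap_eq_smul_one]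

end Grading

/-! ### The Nichols ideal as the common kernel of the iterated skew derivations -/

section Kernel

variable {K : Type u} [Field K] (R : Matrix (Fin 9) (Fin 9) K)

/-- Iterated skew derivations. -/
def iterDer : List (Fin 3) → T K →ₗ[K] T K
  | [] => LinearMap.id
  | l :: u => iterDer u ∘ₗ der R l

/-- The matrix coefficients of the total symmetrizer. -/
def symm (u : List (Fin 3)) : T K →ₗ[K] K := (counit (K := K)).toLinearMap ∘ₗ iterDer R u

theorem symm_nil (x : T K) : symm R [] x = counit x := rfl

theorem symm_cons (l : Fin 3) (u : List (Fin 3)) (x : T K) :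
    symm R (l :: u) x = symm R u (der R l x) := rfl

theorem symm_append (v u : List (Fin 3)) (x : T K) :
    symm R (v ++ u) x = symm R u (iterDer R v x) := by
  induction v generalizing x with
  | nil => rfl
  | cons l v ih => exact ih _

variable {R}

theorem map_iterDer_comul (hR : BraidCoeff R) (v : List (Fin 3)) (w : T K) :
    TensorProduct.map LinearMap.id (iterDer R v) (comul R w) = comul R (iterDer R v w) := by
  induction v generalizing w with
  | nil => simp [iterDer, TensorProduct.map_id]
  | cons l v ih =>
    simp only [iterDer, LinearMap.comp_apply]
    rw [← ih, ← map_der_comul hR, ← LinearMap.comp_apply (TensorProduct.map _ (iterDer R v)),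
      ← TensorProduct.map_comp, LinearMap.id_comp]

theorem map_symm_comul (hR : BraidCoeff R) (v : List (Fin 3)) (w : T K) :
    TensorProduct.rid K (T K) (TensorProduct.map LinearMap.id (symm R v) (comul R w)) =
      iterDer R v w := by
  rw [← rid_map_counit_comul (R := R) (iterDer R v w), ← map_iterDer_comul hR,
    ← LinearMap.comp_apply (TensorProduct.map _ (AlgHom.toLinearMap _)), ← TensorProduct.map_comp,
    LinearMap.id_comp]
  rfl

variable (R) in
/-- The common kernel of the iterated skew derivations, as a subspace. -/
def kernelSubmodule : Submodule K (T K) := ⨅ u, LinearMap.ker (symm R u)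

theorem mem_kernelSubmodule {x : T K} : x ∈ kernelSubmodule R ↔ ∀ u, symm R u x = 0 := by
  simp [kernelSubmodule, Submodule.mem_iInf]

theorem der_mem_kernel {x : T K} (hx : x ∈ kernelSubmodule R) (l : Fin 3) :
    der R l x ∈ kernelSubmodule R := by
  rw [mem_kernelSubmodule] at hx ⊢
  exact fun u => hx (l :: u)

theorem counit_eq_zero_of_mem {x : T K} (hx : x ∈ kernelSubmodule R) : counit x = 0 :=
  mem_kernelSubmodule.mp hx []

theorem mem_kernel_of_der {x : T K} (h0 : counit x = 0)
    (h : ∀ l, der R l x ∈ kernelSubmodule R) : x ∈ kernelSubmodule R := by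
  rw [mem_kernelSubmodule]
  intro u
  cases u with
  | nil => exact h0
  | cons l u => exact mem_kernelSubmodule.mp (h l) u

theorem past_mem_kernel (hR : BraidCoeff R) {x : T K} (hx : x ∈ kernelSubmodule R) (i l : Fin 3) :
    past R i l x ∈ kernelSubmodule R := by
  rw [mem_kernelSubmodule]
  intro u
  induction u generalizing x i l with
  | nil => rw [symm_nil, counit_past, counit_eq_zero_of_mem hx, ite_self]
  | cons s u ih =>
    rw [symm_cons, der_past hR]
    simp only [map_sum, map_smul]
    simp [ih (der_mem_kernel hx _)]

theorem mul_mem_kernel_right {x : T K} (hx : x ∈ kernelSubmodule R) (y : T K) :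
    x * y ∈ kernelSubmodule R := by
  rw [mem_kernelSubmodule]
  intro u
  induction u generalizing x y with
  | nil => rw [symm_nil, map_mul, counit_eq_zero_of_mem hx, zero_mul]
  | cons s u ih =>
    rw [symm_cons, der_mul]
    simp [ih hx, ih (der_mem_kernel hx _)]

theorem mul_mem_kernel_left (hR : BraidCoeff R) {x : T K} (hx : x ∈ kernelSubmodule R) (y : T K) :
    y * x ∈ kernelSubmodule R := by
  rw [mem_kernelSubmodule]
  intro u
  induction u generalizing x y with
  | nil => rw [symm_nil, map_mul, counit_eq_zero_of_mem hx, mul_zero]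
  | cons s u ih =>
    rw [symm_cons, der_mul]
    simp [ih (past_mem_kernel hR hx _ _), ih (der_mem_kernel hx _)]

theorem component_mem_kernel {x : T K} (hx : x ∈ kernelSubmodule R) (n : ℕ) :
    component n x ∈ kernelSubmodule R := by
  rw [mem_kernelSubmodule]
  intro u
  induction u generalizing x n with
  | nil => rw [symm_nil, counit_component, counit_eq_zero_of_mem hx, ite_self]
  | cons s u ih =>
    rw [symm_cons]
    cases n with
    | zero => rw [der_component_zero, map_zero]
    | succ n => rw [der_component_succ]; exact ih (der_mem_kernel hx s) n

/-- The common kernel of the iterated skew derivations, as an ideal. -/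
def kernelIdeal (hR : BraidCoeff R) : TwoSidedIdeal (T K) :=
  TwoSidedIdeal.mk' (kernelSubmodule R) (zero_mem _) (fun h h' => add_mem h h')
    (fun h => neg_mem h) (fun h => mul_mem_kernel_left hR h _) (fun h => mul_mem_kernel_right h _)

theorem mem_kernelIdeal (hR : BraidCoeff R) {x : T K} :
    x ∈ kernelIdeal hR ↔ x ∈ kernelSubmodule R := by
  rw [kernelIdeal, TwoSidedIdeal.mem_mk']; rfl

theorem mem_span_of_symm_eq_zero (y : T K ⊗[K] T K)
    (hy : ∀ v, TensorProduct.rid K (T K) (TensorProduct.map LinearMap.id (symm R v) y) ∈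
      kernelSubmodule R) :
    y ∈ Submodule.span K {z : T K ⊗[K] T K |
      ∃ a b : T K, (a ∈ kernelSubmodule R ∨ b ∈ kernelSubmodule R) ∧ z = a ⊗ₜ[K] b} := by
  classical
  set J := kernelSubmodule R with hJ
  set S := Submodule.span K {z : T K ⊗[K] T K | ∃ a b : T K, (a ∈ J ∨ b ∈ J) ∧ z = a ⊗ₜ[K] b}
  obtain ⟨s, hs⟩ := J.mkQ.exists_rightInverse_of_surjective J.range_mkQ
  have hP : ∀ x, x - s (J.mkQ x) ∈ J := by
    intro x
    have h : J.mkQ (s (J.mkQ x)) = J.mkQ x := LinearMap.congr_fun hs _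
    rw [← Submodule.Quotient.mk_eq_zero, ← Submodule.mkQ_apply, map_sub, h, sub_self]
  have h1 : ∀ y : T K ⊗[K] T K,
      y - TensorProduct.map (s ∘ₗ J.mkQ) (s ∘ₗ J.mkQ) y ∈ S := by
    intro y
    induction y using TensorProduct.induction_on with
    | zero => simp
    | add x y hx hy => rw [map_add, add_sub_add_comm]; exact add_mem hx hy
    | tmul a b =>
      have : a ⊗ₜ[K] b - TensorProduct.map (s ∘ₗ J.mkQ) (s ∘ₗ J.mkQ) (a ⊗ₜ[K] b) =
          (a - s (J.mkQ a)) ⊗ₜ[K] b + s (J.mkQ a) ⊗ₜ[K] (b - s (J.mkQ b)) := by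
        simp [TensorProduct.sub_tmul, TensorProduct.tmul_sub]
      rw [this]
      exact add_mem (Submodule.subset_span ⟨_, _, Or.inl (hP a), rfl⟩)
        (Submodule.subset_span ⟨_, _, Or.inr (hP b), rfl⟩)
  have h2 : TensorProduct.map J.mkQ J.mkQ y = 0 := by
    let φ : List (Fin 3) → (T K ⧸ J) →ₗ[K] K := fun u => J.liftQ (symm R u) (by
      intro x hx; exact mem_kernelSubmodule.mp hx u)
    let bas := Module.Basis.ofVectorSpace K (T K ⧸ J)
    apply (TensorProduct.equivFinsuppOfBasisLeft (N := T K ⧸ J) bas).injective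
    rw [map_zero]
    ext i
    simp only [Finsupp.coe_zero, Pi.zero_apply]
    have key : ∀ v, φ v (TensorProduct.equivFinsuppOfBasisLeft bas
        (TensorProduct.map J.mkQ J.mkQ y) i) = bas.repr (J.mkQ (TensorProduct.rid K (T K)
          (TensorProduct.map LinearMap.id (symm R v) y))) i := by
      intro v
      clear hy
      induction y using TensorProduct.induction_on with
      | zero => simp
      | add x y hx hy => simp only [map_add, Finsupp.add_apply, hx, hy]
      | tmul a b =>
        simp only [TensorProduct.map_tmul, TensorProduct.equivFinsuppOfBasisLeft_apply_tmul_apply,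
          map_smul, LinearMap.id_apply, TensorProduct.rid_tmul, Finsupp.smul_apply]
        exact mul_comm _ _
    have key' : ∀ v, φ v (TensorProduct.equivFinsuppOfBasisLeft bas
        (TensorProduct.map J.mkQ J.mkQ y) i) = 0 := by
      intro v
      have h0 : J.mkQ (TensorProduct.rid K (T K)
          (TensorProduct.map LinearMap.id (symm R v) y)) = 0 :=
        (Submodule.Quotient.mk_eq_zero J).mpr (hy v)
      rw [key v, h0, map_zero, Finsupp.coe_zero, Pi.zero_apply]
    obtain ⟨x, hx⟩ := J.mkQ_surjective (TensorProduct.equivFinsuppOfBasisLeft bas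
        (TensorProduct.map J.mkQ J.mkQ y) i)
    rw [← hx] at key' ⊢
    exact (Submodule.Quotient.mk_eq_zero J).mpr (mem_kernelSubmodule.mpr key')
  have h3 : TensorProduct.map (s ∘ₗ J.mkQ) (s ∘ₗ J.mkQ) y = 0 := by
    rw [TensorProduct.map_comp, LinearMap.comp_apply, h2, map_zero]
  simpa [h3] using h1 y

theorem kernelIdeal_eq_span (hR : BraidCoeff R) : kernelIdeal hR =
    TwoSidedIdeal.span {x | x ∈ kernelSubmodule R ∧ ∃ n, 2 ≤ n ∧ x ∈ degreePart K n} := by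
  apply le_antisymm
  · intro x hx
    rw [mem_kernelIdeal] at hx
    rw [← sum_component x]
    refine sum_mem fun n _ => ?_
    match n with
    | 0 =>
      rw [component_zero, counit_eq_zero_of_mem hx, map_zero]; exact zero_mem _
    | 1 =>
      rw [component_one_eq (R := R)]
      simp only [counit_eq_zero_of_mem (der_mem_kernel hx _), zero_smul, Finset.sum_const_zero]
      exact zero_mem _
    | n + 2 =>
      exact TwoSidedIdeal.subset_span
        ⟨component_mem_kernel hx _, n + 2, Nat.le_add_left _ _, component_mem _ _⟩
  · rw [TwoSidedIdeal.span_le]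
    intro x hx
    exact (mem_kernelIdeal hR).mpr hx.1

theorem isHopfIdeal_kernelIdeal (hR : BraidCoeff R) : IsHopfIdeal R (kernelIdeal hR) := by
  refine ⟨⟨_, fun x hx => hx.2, kernelIdeal_eq_span hR⟩, fun x hx => ?_⟩
  simp only [mem_kernelIdeal] at hx ⊢
  apply mem_span_of_symm_eq_zero
  intro v
  rw [map_symm_comul hR, mem_kernelSubmodule]
  intro u
  rw [← symm_append]
  exact mem_kernelSubmodule.mp hx _

/-- The coordinate functional of `x_l`. -/
def coordOne (l : Fin 3) : T K →ₗ[K] K := symm (0 : Matrix (Fin 9) (Fin 9) K) [l]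

theorem coordOne_ι_mul (l i : Fin 3) (w : T K) :
    coordOne l (FreeAlgebra.ι K i * w) = if i = l then counit w else 0 := by
  rw [coordOne, symm_cons, symm_nil, der_ι_mul, map_add, map_mul, counit_ι, zero_mul, zero_add,
    counit_past]

theorem coordOne_of_mem {n : ℕ} (hn : 2 ≤ n) {x : T K} (hx : x ∈ degreePart K n) (l : Fin 3) :
    coordOne l x = 0 := by
  have h := component_of_mem hx n
  rw [if_pos rfl] at h
  obtain ⟨m, rfl⟩ : ∃ m, n = m + 2 := ⟨n - 2, by omega⟩
  rw [← h, coordOne, symm_cons, symm_nil, der_component_succ, counit_component]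
  simp

theorem le_kernelIdeal (hR : BraidCoeff R) {I : TwoSidedIdeal (T K)} (hI : IsHopfIdeal R I) :
    I ≤ kernelIdeal hR := by
  obtain ⟨⟨S, hS, hIS⟩, hc⟩ := hI
  have hsub : ∀ x ∈ I, counit x = 0 ∧ ∀ l, coordOne l x = 0 := by
    let I2 : TwoSidedIdeal (T K) := TwoSidedIdeal.mk'
      {x | counit x = 0 ∧ ∀ l, coordOne l x = 0} ⟨map_zero _, fun l => map_zero _⟩
      (fun h h' => ⟨by rw [map_add, h.1, h'.1, add_zero],
        fun l => by rw [map_add, h.2, h'.2, add_zero]⟩)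
      (fun h => ⟨by rw [map_neg, h.1, neg_zero], fun l => by rw [map_neg, h.2, neg_zero]⟩)
      (fun {x y} h => ⟨by rw [map_mul, h.1, mul_zero], fun l => by
        rw [coordOne, symm_cons, symm_nil, der_mul, map_add, map_mul, map_sum]
        simp only [map_mul, counit_past, h.1, ite_self, mul_zero, Finset.sum_const_zero, add_zero]
        have := h.2 l
        rw [coordOne, symm_cons, symm_nil] at this
        rw [this, mul_zero]⟩)
      (fun {x y} h => ⟨by rw [map_mul, h.1, zero_mul], fun l => by
        rw [coordOne, symm_cons, symm_nil, der_mul, map_add, map_mul, map_sum]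
        have := fun l => h.2 l
        simp only [coordOne, symm_cons, symm_nil] at this
        simp [h.1, this]⟩)
    have : I ≤ I2 := by
      rw [hIS, TwoSidedIdeal.span_le]
      intro x hx
      obtain ⟨n, hn, hxn⟩ := hS x hx
      rw [SetLike.mem_coe, TwoSidedIdeal.mem_mk']
      refine ⟨?_, coordOne_of_mem hn hxn⟩
      have h := component_of_mem hxn n
      rw [if_pos rfl] at h
      rw [← h, counit_component, if_neg (by omega)]
    intro x hx
    have := this hx
    rwa [TwoSidedIdeal.mem_mk'] at this
  have hder : ∀ x ∈ I, ∀ l, der R l x ∈ I := by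
    intro x hx l
    rw [← map_coord_comul (R := R) coordOne
      (fun l => by rw [coordOne, symm_cons, der_one, map_zero]) coordOne_ι_mul l x]
    have := hc x hx
    generalize comul R x = y at this
    induction this using Submodule.span_induction with
    | mem y hy =>
      obtain ⟨a, b, hab, rfl⟩ := hy
      rw [TensorProduct.map_tmul, TensorProduct.rid_tmul, LinearMap.id_apply]
      rcases hab with ha | hb
      · rw [Algebra.smul_def]; exact I.mul_mem_left _ _ ha
      · rw [(hsub b hb).2, zero_smul]; exact zero_mem _
    | zero => rw [map_zero, map_zero]; exact zero_mem _
    | add y z _ _ hy hz => rw [map_add, map_add]; exact add_mem hy hz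
    | smul c y _ hy =>
      rw [map_smul, map_smul, Algebra.smul_def]; exact I.mul_mem_left _ _ hy
  intro x hx
  rw [mem_kernelIdeal, mem_kernelSubmodule]
  intro u
  induction u generalizing x with
  | nil => exact (hsub x hx).1
  | cons l u ih => exact ih (hder x hx l)

theorem nicholsIdeal_eq (hR : BraidCoeff R) : nicholsIdeal R = kernelIdeal hR := by
  apply le_antisymm
  · exact sSup_le fun I hI => le_kernelIdeal hR hI
  · exact le_sSup (isHopfIdeal_kernelIdeal hR)

theorem mem_nicholsIdeal (hR : BraidCoeff R) {x : T K} :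
    x ∈ nicholsIdeal R ↔ x ∈ kernelSubmodule R := by
  rw [nicholsIdeal_eq hR, mem_kernelIdeal]

end Kernel

/-! ### Computable polynomials -/

section Reflection

/-- A polynomial with integer coefficients: a list of terms, each given by its coefficient and its
list of exponents. -/
abbrev Poly : Type := List (ℤ × List ℕ)

namespace Poly

def addExp : List ℕ → List ℕ → List ℕ
  | [], m => m
  | m, [] => m
  | a :: m, b :: n => (a + b) :: addExp m n

def beqExp : List ℕ → List ℕ → Bool
  | [], [] => true
  | a :: m, b :: n => Nat.beq a b && beqExp m n
  | _, _ => false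

theorem eq_of_beqExp : ∀ {m n : List ℕ}, beqExp m n = true → m = n
  | [], [], _ => rfl
  | a :: m, b :: n, h => by
    simp only [beqExp, Bool.and_eq_true] at h
    rw [Nat.eq_of_beq_eq_true h.1, eq_of_beqExp h.2]
  | [], _ :: _, h => by simp [beqExp] at h
  | _ :: _, [], h => by simp [beqExp] at h

/-- Prepend a term, unless its coefficient is zero. -/
def consTerm (c : ℤ) (m : List ℕ) (p : Poly) : Poly :=
  match c with
  | .ofNat 0 => p
  | c => (c, m) :: p

def insert (c : ℤ) (m : List ℕ) : Poly → Poly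
  | [] => [(c, m)]
  | (d, n) :: p => bif beqExp m n then consTerm (c + d) n p else (d, n) :: insert c m p

def add : Poly → Poly → Poly
  | [], q => q
  | (c, m) :: p, q => insert c m (add p q)

def termMul (c : ℤ) (m : List ℕ) : Poly → Poly
  | [] => []
  | (d, n) :: p => (c * d, addExp m n) :: termMul c m p

def mul : Poly → Poly → Poly
  | [], _ => []
  | (c, m) :: p, q => add (termMul c m q) (mul p q)

def neg : Poly → Poly
  | [] => []
  | (c, m) :: p => (-c, m) :: neg p

variable {K : Type u} [Field K]

def evalMon : List K → List ℕ → K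
  | _, [] => 1
  | [], _ :: _ => 1
  | x :: v, a :: m => x ^ a * evalMon v m

def eval (v : List K) : Poly → K
  | [] => 0
  | (c, m) :: p => c * evalMon v m + eval v p

theorem evalMon_addExp (v : List K) (m n : List ℕ) :
    evalMon v (addExp m n) = evalMon v m * evalMon v n := by
  induction m generalizing v n with
  | nil => cases v <;> simp [addExp, evalMon]
  | cons a m ih =>
    cases n with
    | nil => cases v <;> simp [addExp, evalMon]
    | cons b n =>
      cases v with
      | nil => simp [addExp, evalMon]
      | cons x v => simp only [addExp, evalMon, ih]; ring

theorem eval_consTerm (v : List K) (c : ℤ) (m : List ℕ) (p : Poly) :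
    eval v (consTerm c m p) = c * evalMon v m + eval v p := by
  unfold consTerm
  split
  · simp
  · simp [eval]

theorem eval_insert (v : List K) (c : ℤ) (m : List ℕ) (p : Poly) :
    eval v (insert c m p) = c * evalMon v m + eval v p := by
  induction p with
  | nil => simp [insert, eval]
  | cons t p ih =>
    obtain ⟨d, n⟩ := t
    simp only [insert]
    cases h : beqExp m n with
    | true =>
      rw [cond_true, eval_consTerm, eq_of_beqExp h]
      simp only [eval, Int.cast_add]; ring
    | false => simp only [cond_false, eval, ih]; ring

theorem eval_add (v : List K) (p q : Poly) : eval v (add p q) = eval v p + eval v q := by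
  induction p with
  | nil => simp [add, eval]
  | cons t p ih => simp only [add, eval_insert, ih, eval]; ring

theorem eval_termMul (v : List K) (c : ℤ) (m : List ℕ) (p : Poly) :
    eval v (termMul c m p) = c * evalMon v m * eval v p := by
  induction p with
  | nil => simp [termMul, eval]
  | cons t p ih => simp only [termMul, ih, eval, evalMon_addExp, Int.cast_mul]; ring

theorem eval_mul (v : List K) (p q : Poly) : eval v (mul p q) = eval v p * eval v q := by
  induction p with
  | nil => simp [mul, eval]
  | cons t p ih => simp only [mul, eval_add, eval_termMul, ih, eval]; ring

theorem eval_neg (v : List K) (p : Poly) : eval v (neg p) = -eval v p := by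
  induction p with
  | nil => simp [neg, eval]
  | cons t p ih => simp only [neg, ih, eval, Int.cast_neg]; ring

def sum3 (f : Fin 3 → Poly) : Poly := add (f 0) (add (f 1) (f 2))

theorem eval_sum3 (v : List K) (f : Fin 3 → Poly) : eval v (sum3 f) = ∑ i, eval v (f i) := by
  simp only [sum3, eval_add, Fin.sum_univ_three, add_assoc]

/-- The matrix entry `r^{ij}_{ml}` of a matrix given by its rows. -/
def entry (M : List (List Poly)) (i j m l : Fin 3) : Poly :=
  ((M.getD (3 * m.val + l.val) []).getD (3 * j.val + i.val) [])

/-- The difference of the two sides of the braid equation in coordinates. -/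
def braidDefect (M : List (List Poly)) (i j k a b q : Fin 3) : Poly :=
  add (sum3 fun m => sum3 fun n => mul (entry M i j m n) (sum3 fun r =>
      mul (entry M n k r q) (entry M m r a b)))
    (neg (sum3 fun m => sum3 fun n => mul (entry M j k m n) (sum3 fun r =>
      mul (entry M i m a r) (entry M r n b q))))

end Poly

theorem braidCoeff_of_poly {K : Type u} [Field K] {R : Matrix (Fin 9) (Fin 9) K}
    (v : List K) (M : List (List Poly))
    (hM : ∀ i j m l, coeff R i j m l = Poly.eval v (Poly.entry M i j m l))
    (h : ∀ i j k a b q, Poly.braidDefect M i j k a b q = []) : BraidCoeff R := by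
  intro i j k a b q
  have := congrArg (Poly.eval v) (h i j k a b q)
  simp only [Poly.braidDefect, Poly.eval_add, Poly.eval_neg, Poly.eval_sum3, Poly.eval_mul, ← hM,
    Poly.eval, Finset.mul_sum, ← mul_assoc] at this
  linear_combination this

/-- The braiding is `t` times the flip, up to terms of lower total weight, where `x_i` has
weight `i`. -/
structure Triangular {K : Type u} [Field K] (R : Matrix (Fin 9) (Fin 9) K) (t : K) : Prop where
  diag : ∀ i j, coeff R i j j i = t
  eq_zero : ∀ i j m l : Fin 3, (m, l) ≠ (j, i) → i.val + j.val ≤ m.val + l.val →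
    coeff R i j m l = 0

theorem triangular_of_poly {K : Type u} [Field K] {R : Matrix (Fin 9) (Fin 9) K} {t : K}
    (v : List K) (M : List (List Poly))
    (hM : ∀ i j m l, coeff R i j m l = Poly.eval (t :: v) (Poly.entry M i j m l))
    (h : ∀ i j m l : Fin 3, Poly.entry M i j m l = [] ∨ m.val + l.val < i.val + j.val ∨
      (m = j ∧ l = i))
    (h' : ∀ i j, Poly.entry M i j j i = [(1, [1])]) : Triangular R t where
  diag i j := by simp [hM, h', Poly.eval, Poly.evalMon]
  eq_zero i j m l h1 h2 := by
    rcases h i j m l with h | h | h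
    · rw [hM, h, Poly.eval]
    · omega
    · exact absurd (by rw [h.1, h.2]) h1

end Reflection

/-! ### The ten families satisfy the braid equation -/

section Families

variable {K : Type u} [Field K]

def poly1 : List (List Poly) :=
  [
    [[(1, [1])], [], [(1, [1, 1])], [], [], [], [(-1, [1, 1])], [], [(-1, [1, 1, 1])]],
    [[], [(1, [1])], [], [], [], [(1, [1, 1]), (-1, [1, 0, 1])], [], [(-1, [1, 1])], [(1,
      [1, 0, 0, 1])]],
    [[], [], [(1, [1])], [], [], [], [], [], [(-1, [1, 0, 1])]],
    [[], [], [], [(1, [1])], [], [(1, [1, 1])], [], [(1, [1, 0, 1]), (-1, [1, 1])], [(-1,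
      [1, 0, 0, 1])]],
    [[], [], [], [], [(1, [1])], [], [], [], []],
    [[], [], [], [], [], [(1, [1])], [], [], []],
    [[], [], [], [], [], [], [(1, [1])], [], [(1, [1, 0, 1])]],
    [[], [], [], [], [], [], [], [(1, [1])], []],
    [[], [], [], [], [], [], [], [], [(1, [1])]]]

theorem coeff_R1 (t a b p : K) (i j m l : Fin 3) :
    coeff (R1 t a b p) i j m l = Poly.eval [t, a, b, p] (Poly.entry poly1 i j m l) := by
  fin_cases i <;> fin_cases j <;> fin_cases m <;> fin_cases l <;>
    first
    | rfl
    | (simp [coeff, R1, Poly.eval, Poly.entry, poly1, Poly.evalMon]; try ring)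

theorem braidCoeff_R1 (t a b p : K) : BraidCoeff (R1 t a b p) :=
  braidCoeff_of_poly _ poly1 (coeff_R1 t a b p) (by decide +kernel)

theorem triangular_R1 (t a b p : K) : Triangular (R1 t a b p) t :=
  triangular_of_poly _ poly1 (coeff_R1 t a b p) (by decide +kernel) (by decide +kernel)

def poly2 : List (List Poly) :=
  [
    [[(1, [1])], [], [(1, [1, 0, 1])], [], [], [], [(1, [1, 0, 0, 1])], [], [(1, [1, 1])]],
    [[], [(1, [1])], [], [], [], [(1, [1, 0, 0, 1]), (-1, [1, 0, 0, 0, 1])], [], [(1,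
      [1, 0, 0, 0, 1])], [(1, [1, 0, 0, 0, 0, 1])]],
    [[], [], [(1, [1])], [], [], [], [], [], [(1, [1, 0, 0, 1])]],
    [[], [], [], [(1, [1])], [], [(1, [1, 0, 1])], [], [], [(-1, [1, 0, 0, 0, 0, 1])]],
    [[], [], [], [], [(1, [1])], [], [], [], []],
    [[], [], [], [], [], [(1, [1])], [], [], []],
    [[], [], [], [], [], [], [(1, [1])], [], [(1, [1, 0, 1])]],
    [[], [], [], [], [], [], [], [(1, [1])], []],
    [[], [], [], [], [], [], [], [], [(1, [1])]]]

theorem coeff_R2 (t a b p q k : K) (i j m l : Fin 3) :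
    coeff (R2 t a b p q k) i j m l = Poly.eval [t, a, b, p, q, k] (Poly.entry poly2 i j m l) := by
  fin_cases i <;> fin_cases j <;> fin_cases m <;> fin_cases l <;>
    first
    | rfl
    | (simp [coeff, R2, Poly.eval, Poly.entry, poly2, Poly.evalMon]; try ring)

theorem braidCoeff_R2 (t a b p q k : K) : BraidCoeff (R2 t a b p q k) :=
  braidCoeff_of_poly _ poly2 (coeff_R2 t a b p q k) (by decide +kernel)

theorem triangular_R2 (t a b p q k : K) : Triangular (R2 t a b p q k) t :=
  triangular_of_poly _ poly2 (coeff_R2 t a b p q k) (by decide +kernel) (by decide +kernel)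

def poly3 : List (List Poly) :=
  [
    [[(1, [1])], [], [(1, [1, 1])], [], [], [], [(-1, [1, 1])], [], [(-1, [1, 1, 1])]],
    [[], [(1, [1])], [], [], [], [], [], [(-1, [1, 0, 1])], [(-1, [1, 0, 0, 1])]],
    [[], [], [(1, [1])], [], [], [], [], [], [(-1, [1, 0, 1])]],
    [[], [], [], [(1, [1])], [], [(1, [1, 0, 1])], [], [], [(1, [1, 0, 0, 1])]],
    [[], [], [], [], [(1, [1])], [], [], [], [(1, [1, 0, 0, 0, 1])]],
    [[], [], [], [], [], [(1, [1])], [], [], []],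
    [[], [], [], [], [], [], [(1, [1])], [], [(1, [1, 0, 1])]],
    [[], [], [], [], [], [], [], [(1, [1])], []],
    [[], [], [], [], [], [], [], [], [(1, [1])]]]

theorem coeff_R3 (t a b p q : K) (i j m l : Fin 3) :
    coeff (R3 t a b p q) i j m l = Poly.eval [t, a, b, p, q] (Poly.entry poly3 i j m l) := by
  fin_cases i <;> fin_cases j <;> fin_cases m <;> fin_cases l <;>
    first
    | rfl
    | (simp [coeff, R3, Poly.eval, Poly.entry, poly3, Poly.evalMon]; try ring)

theorem braidCoeff_R3 (t a b p q : K) : BraidCoeff (R3 t a b p q) :=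
  braidCoeff_of_poly _ poly3 (coeff_R3 t a b p q) (by decide +kernel)

theorem triangular_R3 (t a b p q : K) : Triangular (R3 t a b p q) t :=
  triangular_of_poly _ poly3 (coeff_R3 t a b p q) (by decide +kernel) (by decide +kernel)

def poly4 : List (List Poly) :=
  [
    [[(1, [1])], [], [(1, [1, 1])], [], [], [], [(-1, [1, 1])], [], [(-1, [1, 1, 1])]],
    [[], [(1, [1])], [], [], [], [], [], [(1, [1, 1]), (-2, [1, 0, 1])], [(1, [1, 0, 0, 1])]],
    [[], [], [(1, [1])], [], [], [], [], [], [(-1, [1, 0, 1])]],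
    [[], [], [], [(1, [1])], [], [(2, [1, 0, 1]), (-1, [1, 1])], [], [], []],
    [[], [], [], [], [(1, [1])], [], [], [], []],
    [[], [], [], [], [], [(1, [1])], [], [], []],
    [[], [], [], [], [], [], [(1, [1])], [], [(1, [1, 0, 1])]],
    [[], [], [], [], [], [], [], [(1, [1])], []],
    [[], [], [], [], [], [], [], [], [(1, [1])]]]

theorem coeff_R4 (t a b p : K) (i j m l : Fin 3) :
    coeff (R4 t a b p) i j m l = Poly.eval [t, a, b, p] (Poly.entry poly4 i j m l) := by
  fin_cases i <;> fin_cases j <;> fin_cases m <;> fin_cases l <;>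
    first
    | rfl
    | (simp [coeff, R4, Poly.eval, Poly.entry, poly4, Poly.evalMon]; try ring)

theorem braidCoeff_R4 (t a b p : K) : BraidCoeff (R4 t a b p) :=
  braidCoeff_of_poly _ poly4 (coeff_R4 t a b p) (by decide +kernel)

theorem triangular_R4 (t a b p : K) : Triangular (R4 t a b p) t :=
  triangular_of_poly _ poly4 (coeff_R4 t a b p) (by decide +kernel) (by decide +kernel)

def poly5 : List (List Poly) :=
  [
    [[(1, [1])], [(1, [1, 0, 0, 0, 0, 0, 1])], [], [(-1, [1, 0, 0, 0, 0, 0, 1])], [(-1,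
      [1, 0, 0, 0, 0, 0, 2])], [(1, [1, 0, 0, 0, 1, 0, 1]), (-1, [1, 0, 0, 0, 0, 1])], [(1,
      [1, 0, 0, 1])], [(1, [1, 0, 0, 0, 0, 1])], [(1, [1, 1])]],
    [[], [(1, [1])], [], [], [(-1, [1, 0, 0, 0, 0, 0, 1])], [], [], [(1, [1, 0, 0, 0, 1])],
      [(1, [1, 0, 1])]],
    [[], [], [(1, [1])], [], [], [(-1, [1, 0, 0, 0, 0, 0, 1])], [], [], [(1, [1, 0, 0, 1])]],
    [[], [], [], [(1, [1])], [(1, [1, 0, 0, 0, 0, 0, 1])], [], [], [(1, [1, 0, 0, 1]), (-1,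
      [1, 0, 0, 0, 1])], [(-1, [1, 0, 1])]],
    [[], [], [], [], [(1, [1])], [], [], [], []],
    [[], [], [], [], [], [(1, [1])], [], [], []],
    [[], [], [], [], [], [], [(1, [1])], [(1, [1, 0, 0, 0, 0, 0, 1])], []],
    [[], [], [], [], [], [], [], [(1, [1])], []],
    [[], [], [], [], [], [], [], [], [(1, [1])]]]

theorem coeff_R5 (t a b p q k ℓ : K) (i j m l : Fin 3) :
    coeff (R5 t a b p q k ℓ) i j m l = Poly.eval [t, a, b, p, q, k, ℓ] (Poly.entry poly5 i j m l) := by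
  fin_cases i <;> fin_cases j <;> fin_cases m <;> fin_cases l <;>
    first
    | rfl
    | (simp [coeff, R5, Poly.eval, Poly.entry, poly5, Poly.evalMon]; try ring)

theorem braidCoeff_R5 (t a b p q k ℓ : K) : BraidCoeff (R5 t a b p q k ℓ) :=
  braidCoeff_of_poly _ poly5 (coeff_R5 t a b p q k ℓ) (by decide +kernel)

theorem triangular_R5 (t a b p q k ℓ : K) : Triangular (R5 t a b p q k ℓ) t :=
  triangular_of_poly _ poly5 (coeff_R5 t a b p q k ℓ) (by decide +kernel) (by decide +kernel)

def poly6 : List (List Poly) :=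
  [
    [[(1, [1])], [(1, [1, 1])], [(1, [1, 0, 0, 1])], [(-1, [1, 1])], [(-1, [1, 1, 1])], [(-2,
      [1, 1, 0, 1]), (-1, [1, 0, 0, 0, 0, 1])], [(-1, [1, 0, 0, 1])], [(1,
      [1, 0, 0, 0, 0, 1])], [(-1, [1, 0, 0, 1, 1])]],
    [[], [(1, [1])], [], [], [(-1, [1, 0, 1])], [], [], [(-1, [1, 0, 0, 1])], []],
    [[], [], [(1, [1])], [], [], [(-1, [1, 1])], [], [], [(-1, [1, 0, 0, 0, 1])]],
    [[], [], [], [(1, [1])], [(1, [1, 0, 1])], [(1, [1, 0, 0, 1])], [], [], []],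
    [[], [], [], [], [(1, [1])], [], [], [], []],
    [[], [], [], [], [], [(1, [1])], [], [], []],
    [[], [], [], [], [], [], [(1, [1])], [(1, [1, 1])], [(1, [1, 0, 0, 0, 1])]],
    [[], [], [], [], [], [], [], [(1, [1])], []],
    [[], [], [], [], [], [], [], [], [(1, [1])]]]

theorem coeff_R6 (t a b p q k : K) (i j m l : Fin 3) :
    coeff (R6 t a b p q k) i j m l = Poly.eval [t, a, b, p, q, k] (Poly.entry poly6 i j m l) := by
  fin_cases i <;> fin_cases j <;> fin_cases m <;> fin_cases l <;>
    first
    | rfl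
    | (simp [coeff, R6, Poly.eval, Poly.entry, poly6, Poly.evalMon]; try ring)

theorem braidCoeff_R6 (t a b p q k : K) : BraidCoeff (R6 t a b p q k) :=
  braidCoeff_of_poly _ poly6 (coeff_R6 t a b p q k) (by decide +kernel)

theorem triangular_R6 (t a b p q k : K) : Triangular (R6 t a b p q k) t :=
  triangular_of_poly _ poly6 (coeff_R6 t a b p q k) (by decide +kernel) (by decide +kernel)

def poly7 : List (List Poly) :=
  [
    [[(1, [1])], [(1, [1, 0, 0, 0, 0, 1])], [(1, [1, 0, 0, 1])], [(-1, [1, 0, 0, 0, 0, 1])],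
      [(-1, [1, 0, 0, 0, 0, 1, 1])], [(1, [1, 0, 0, 0, 0, 0, 0, 1])], [(1, [1, 1])], [(1,
      [1, 1, 0, 0, 0, 1]), (-1, [1, 0, 0, 0, 1, 1]), (-1, [1, 0, 0, 0, 0, 0, 0, 1])], [(1,
      [1, 0, 1])]],
    [[], [(1, [1])], [], [], [(-1, [1, 0, 0, 0, 0, 0, 1])], [(1, [1, 0, 0, 1]), (-1,
      [1, 0, 0, 0, 1])], [], [(1, [1, 1])], []],
    [[], [], [(1, [1])], [], [], [(-1, [1, 0, 0, 0, 0, 1])], [], [], [(1, [1, 1])]],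
    [[], [], [], [(1, [1])], [(1, [1, 0, 0, 0, 0, 0, 1])], [(1, [1, 0, 0, 0, 1])], [], [], []],
    [[], [], [], [], [(1, [1])], [], [], [], []],
    [[], [], [], [], [], [(1, [1])], [], [], []],
    [[], [], [], [], [], [], [(1, [1])], [(1, [1, 0, 0, 0, 0, 1])], [(1, [1, 0, 0, 1])]],
    [[], [], [], [], [], [], [], [(1, [1])], []],
    [[], [], [], [], [], [], [], [], [(1, [1])]]]

theorem coeff_R7 (t a b p q k ℓ d : K) (i j m l : Fin 3) :
    coeff (R7 t a b p q k ℓ d) i j m l = Poly.eval [t, a, b, p, q, k, ℓ, d] (Poly.entry poly7 i j m l) := by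
  fin_cases i <;> fin_cases j <;> fin_cases m <;> fin_cases l <;>
    first
    | rfl
    | (simp [coeff, R7, Poly.eval, Poly.entry, poly7, Poly.evalMon]; try ring)

theorem braidCoeff_R7 (t a b p q k ℓ d : K) : BraidCoeff (R7 t a b p q k ℓ d) :=
  braidCoeff_of_poly _ poly7 (coeff_R7 t a b p q k ℓ d) (by decide +kernel)

theorem triangular_R7 (t a b p q k ℓ d : K) : Triangular (R7 t a b p q k ℓ d) t :=
  triangular_of_poly _ poly7 (coeff_R7 t a b p q k ℓ d) (by decide +kernel) (by decide +kernel)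

def poly8 : List (List Poly) :=
  [
    [[(1, [1])], [(1, [1, 1])], [(1, [1, 0, 0, 0, 1])], [(-1, [1, 1])], [(-1, [1, 2])], [(-1,
      [1, 0, 1])], [(-1, [1, 0, 0, 0, 1])], [(1, [1, 0, 1])], [(1, [1, 1, 0, 1])]],
    [[], [(1, [1])], [], [], [(-1, [1, 1])], [(1, [1, 0, 0, 0, 1])], [], [], [(1, [1, 0, 0, 1])]],
    [[], [], [(1, [1])], [], [], [(-1, [1, 1])], [], [], []],
    [[], [], [], [(1, [1])], [(1, [1, 1])], [], [], [(-1, [1, 0, 0, 0, 1])], [(-1,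
      [1, 0, 0, 1])]],
    [[], [], [], [], [(1, [1])], [], [], [], []],
    [[], [], [], [], [], [(1, [1])], [], [], []],
    [[], [], [], [], [], [], [(1, [1])], [(1, [1, 1])], []],
    [[], [], [], [], [], [], [], [(1, [1])], []],
    [[], [], [], [], [], [], [], [], [(1, [1])]]]

theorem coeff_R8 (t a b p q : K) (i j m l : Fin 3) :
    coeff (R8 t a b p q) i j m l = Poly.eval [t, a, b, p, q] (Poly.entry poly8 i j m l) := by
  fin_cases i <;> fin_cases j <;> fin_cases m <;> fin_cases l <;>
    first
    | rfl
    | (simp [coeff, R8, Poly.eval, Poly.entry, poly8, Poly.evalMon]; try ring)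

theorem braidCoeff_R8 (t a b p q : K) : BraidCoeff (R8 t a b p q) :=
  braidCoeff_of_poly _ poly8 (coeff_R8 t a b p q) (by decide +kernel)

theorem triangular_R8 (t a b p q : K) : Triangular (R8 t a b p q) t :=
  triangular_of_poly _ poly8 (coeff_R8 t a b p q) (by decide +kernel) (by decide +kernel)

def poly9 : List (List Poly) :=
  [
    [[(1, [1])], [(1, [1])], [], [(-1, [1])], [(-1, [1])], [(1, [1, 1])], [(1, [1, 0, 1])],
      [(1, [1, 0, 1]), (-1, [1, 1])], [(1, [1, 0, 0, 1])]],
    [[], [(1, [1])], [(1, [1])], [], [(-1, [1])], [(-1, [1])], [], [(1, [1, 0, 1])], [(1,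
      [1, 0, 1]), (-1, [1, 0, 0, 0, 1])]],
    [[], [], [(1, [1])], [], [], [(-1, [1])], [], [], [(1, [1, 0, 1])]],
    [[], [], [], [(1, [1])], [(1, [1])], [], [(-1, [1])], [(-1, [1])], [(1, [1, 0, 0, 0, 1])]],
    [[], [], [], [], [(1, [1])], [(1, [1])], [], [(-1, [1])], [(-1, [1])]],
    [[], [], [], [], [], [(1, [1])], [], [], [(-1, [1])]],
    [[], [], [], [], [], [], [(1, [1])], [(1, [1])], []],
    [[], [], [], [], [], [], [], [(1, [1])], [(1, [1])]],
    [[], [], [], [], [], [], [], [], [(1, [1])]]]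

theorem coeff_R9 (t a b p q : K) (i j m l : Fin 3) :
    coeff (R9 t a b p q) i j m l = Poly.eval [t, a, b, p, q] (Poly.entry poly9 i j m l) := by
  fin_cases i <;> fin_cases j <;> fin_cases m <;> fin_cases l <;>
    first
    | rfl
    | (simp [coeff, R9, Poly.eval, Poly.entry, poly9, Poly.evalMon]; try ring)

theorem braidCoeff_R9 (t a b p q : K) : BraidCoeff (R9 t a b p q) :=
  braidCoeff_of_poly _ poly9 (coeff_R9 t a b p q) (by decide +kernel)

theorem triangular_R9 (t a b p q : K) : Triangular (R9 t a b p q) t :=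
  triangular_of_poly _ poly9 (coeff_R9 t a b p q) (by decide +kernel) (by decide +kernel)

def poly10 : List (List Poly) :=
  [
    [[(1, [1])], [(2, [1])], [], [(-2, [1])], [(-4, [1, 1])], [(8, [1, 1])], [(4, [1])], [],
      [(-4, [1, 3]), (-28, [1, 2])]],
    [[], [(1, [1])], [(2, [1])], [], [(-2, [1, 1])], [(4, [1]), (-6, [1, 1]), (-2, [1, 2])],
      [], [(2, [1, 2]), (2, [1, 1])], [(6, [1, 3]), (6, [1, 2]), (-12, [1, 1])]],
    [[], [], [(1, [1])], [], [], [(2, [1]), (-4, [1, 1])], [], [], [(-4, [1, 1]), (8, [1, 2])]],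
    [[], [], [], [(1, [1])], [(2, [1, 1])], [(-2, [1, 1]), (2, [1, 2])], [(-2, [1])], [(-2,
      [1, 2]), (-2, [1, 1])], [(10, [1, 2]), (4, [1, 1]), (-6, [1, 3])]],
    [[], [], [], [], [(1, [1])], [(2, [1, 1])], [], [(-2, [1, 1])], [(4, [1, 1]), (-8, [1, 2])]],
    [[], [], [], [], [], [(1, [1])], [], [], [(2, [1]), (-4, [1, 1])]],
    [[], [], [], [], [], [], [(1, [1])], [(4, [1, 1]), (-2, [1])], [(4, [1]), (-12,
      [1, 1]), (8, [1, 2])]],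
    [[], [], [], [], [], [], [], [(1, [1])], [(4, [1, 1]), (-2, [1])]],
    [[], [], [], [], [], [], [], [], [(1, [1])]]]

theorem coeff_R10 (t a : K) (i j m l : Fin 3) :
    coeff (R10 t a) i j m l = Poly.eval [t, a] (Poly.entry poly10 i j m l) := by
  fin_cases i <;> fin_cases j <;> fin_cases m <;> fin_cases l <;>
    first
    | rfl
    | (simp [coeff, R10, Poly.eval, Poly.entry, poly10, Poly.evalMon]; try ring)

theorem braidCoeff_R10 (t a : K) : BraidCoeff (R10 t a) :=
  braidCoeff_of_poly _ poly10 (coeff_R10 t a) (by decide +kernel)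

theorem triangular_R10 (t a : K) : Triangular (R10 t a) t :=
  triangular_of_poly _ poly10 (coeff_R10 t a) (by decide +kernel) (by decide +kernel)

theorem IsFamilyMember.braidCoeff {t : K} {R : Matrix (Fin 9) (Fin 9) K}
    (h : IsFamilyMember t R) : BraidCoeff R := by
  cases h
  · exact braidCoeff_R1 _ _ _ _
  · exact braidCoeff_R2 _ _ _ _ _ _
  · exact braidCoeff_R3 _ _ _ _ _
  · exact braidCoeff_R4 _ _ _ _
  · exact braidCoeff_R5 _ _ _ _ _ _ _
  · exact braidCoeff_R6 _ _ _ _ _ _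
  · exact braidCoeff_R7 _ _ _ _ _ _ _ _
  · exact braidCoeff_R8 _ _ _ _ _
  · exact braidCoeff_R9 _ _ _ _ _
  · exact braidCoeff_R10 _ _

theorem IsFamilyMember.triangular {t : K} {R : Matrix (Fin 9) (Fin 9) K}
    (h : IsFamilyMember t R) : Triangular R t := by
  cases h
  · exact triangular_R1 _ _ _ _
  · exact triangular_R2 _ _ _ _ _ _
  · exact triangular_R3 _ _ _ _ _
  · exact triangular_R4 _ _ _ _
  · exact triangular_R5 _ _ _ _ _ _ _
  · exact triangular_R6 _ _ _ _ _ _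
  · exact triangular_R7 _ _ _ _ _ _ _ _
  · exact triangular_R8 _ _ _ _ _
  · exact triangular_R9 _ _ _ _ _
  · exact triangular_R10 _ _

end Families

/-! ### Rigidity and quadratic relations -/

section Rigid

variable {K : Type u} [Field K]

theorem bijective_of_triangular {X : Type*} [Fintype X] (ρ : X → ℤ)
    {V W : Type*} [AddCommGroup V] [Module K V] [AddCommGroup W] [Module K W]
    (bV : Module.Basis X K V) (bW : Module.Basis X K W) (f : V →ₗ[K] W) (M : X → X → K)
    (hf : ∀ x, f (bV x) = ∑ y, M x y • bW y) (hd : ∀ x, M x x ≠ 0)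
    (hl : ∀ x y, y ≠ x → ρ x ≤ ρ y → M x y = 0) : Function.Bijective f := by
  classical
  have hinj : Function.Injective f := by
    rw [← LinearMap.ker_eq_bot, LinearMap.ker_eq_bot']
    intro v hv
    by_contra hne
    have hcoord : ∀ y, ∑ x, bV.repr v x * M x y = 0 := by
      intro y
      have h : f v = ∑ x, bV.repr v x • f (bV x) := by
        conv_lhs => rw [← bV.sum_repr v]
        simp only [map_sum, map_smul]
      have h' := congrArg (fun w => bW.repr w y) (h.symm.trans hv)
      simpa [hf, Finsupp.single_apply] using h'
    have hex : (Finset.univ.filter fun x => bV.repr v x ≠ 0).Nonempty := by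
      by_contra hc
      rw [Finset.not_nonempty_iff_eq_empty, Finset.filter_eq_empty_iff] at hc
      apply hne
      rw [← bV.sum_repr v]
      exact Finset.sum_eq_zero fun x _ => by rw [not_not.mp (hc (Finset.mem_univ x)), zero_smul]
    obtain ⟨x, hx, hmax⟩ := Finset.exists_max_image _ ρ hex
    have hx0 := (Finset.mem_filter.mp hx).2
    have := hcoord x
    rw [Finset.sum_eq_single x] at this
    · exact (mul_ne_zero hx0 (hd x)) this
    · intro y _ hy
      by_cases hy0 : bV.repr v y = 0
      · rw [hy0, zero_mul]
      · rw [hl y x (Ne.symm hy) (hmax y (by simp [hy0])), mul_zero]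
    · simp
  have : FiniteDimensional K V := bV.finiteDimensional_of_finite
  have : FiniteDimensional K W := bW.finiteDimensional_of_finite
  exact ⟨hinj, (LinearMap.injective_iff_surjective_of_finrank_eq_finrank (by
    rw [Module.finrank_eq_card_basis bV, Module.finrank_eq_card_basis bW])).mp hinj⟩

variable {R : Matrix (Fin 9) (Fin 9) K}

theorem braiding_tmul (i j : Fin 3) :
    braiding R (e K i ⊗ₜ[K] e K j) = ∑ m, ∑ l, coeff R i j m l • (e K m ⊗ₜ[K] e K l) := by
  rw [braiding, ← Module.Basis.tensorProduct_apply, Module.Basis.constr_basis]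

theorem flatMap_tmul (f : Module.Dual K (Fin 3 → K)) (w : Fin 3 → K) :
    flatMap (e K) (braiding R) (f ⊗ₜ[K] w) = ∑ i, (TensorProduct.lid K (Fin 3 → K)
      (f.rTensor (Fin 3 → K) (braiding R (w ⊗ₜ[K] e K i)))) ⊗ₜ[K] (e K).coord i := by
  simp [flatMap]

theorem bijective_braiding {t : K} (ht : t ≠ 0) (h : Triangular R t) :
    Function.Bijective (braiding R) := by
  refine bijective_of_triangular (fun x : Fin 3 × Fin 3 => (x.1.val + x.2.val : ℤ))
    ((e K).tensorProduct (e K)) (((e K).tensorProduct (e K)).reindex (Equiv.prodComm _ _)) _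
    (fun x y => coeff R x.1 x.2 y.2 y.1) ?_ ?_ ?_
  · rintro ⟨i, j⟩
    rw [Module.Basis.tensorProduct_apply, braiding_tmul, Fintype.sum_prod_type, Finset.sum_comm]
    simp
  · rintro ⟨i, j⟩
    simpa [h.diag] using ht
  · rintro ⟨i, j⟩ ⟨l, m⟩ hne hle
    refine h.eq_zero i j m l (fun hc => hne ?_) ?_
    · simp only [Prod.mk.injEq] at hc ⊢; exact hc.symm
    · dsimp only at hle ⊢; omega

theorem bijective_flatMap {t : K} (ht : t ≠ 0) (h : Triangular R t) :
    Function.Bijective (flatMap (e K) (braiding R)) := by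
  refine bijective_of_triangular (V := Module.Dual K (Fin 3 → K) ⊗[K] (Fin 3 → K))
    (W := (Fin 3 → K) ⊗[K] Module.Dual K (Fin 3 → K))
    (fun x : Fin 3 × Fin 3 => (x.2.val - x.1.val : ℤ))
    ((e K).dualBasis.tensorProduct (e K))
    (((e K).tensorProduct (e K).dualBasis).reindex (Equiv.prodComm _ _)) _
    (fun x y => coeff R x.2 y.1 x.1 y.2) ?_ ?_ ?_
  · rintro ⟨m, i⟩
    rw [Module.Basis.tensorProduct_apply, flatMap_tmul, Fintype.sum_prod_type]
    refine Finset.sum_congr rfl fun j _ => ?_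
    simp only [braiding_tmul, map_sum, map_smul, LinearMap.rTensor_tmul, TensorProduct.lid_tmul,
      Module.Basis.coe_dualBasis, Module.Basis.coord_apply, Module.Basis.repr_self,
      Module.Basis.reindex_apply, Equiv.prodComm_symm, Equiv.prodComm_apply, Prod.swap_prod_mk,
      Module.Basis.tensorProduct_apply, TensorProduct.sum_tmul, ← TensorProduct.smul_tmul']
    rw [Finset.sum_comm]
    refine Finset.sum_congr rfl fun l _ => ?_
    rw [Finset.sum_eq_single m]
    · simp
    · intro x _ hx
      simp [hx]
    · simp
  · rintro ⟨m, i⟩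
    simpa [h.diag] using ht
  · rintro ⟨m, i⟩ ⟨j, l⟩ hne hle
    refine h.eq_zero i j m l (fun hc => hne ?_) ?_
    · simp only [Prod.mk.injEq] at hc ⊢; exact ⟨hc.1.symm, hc.2⟩
    · dsimp only at hle ⊢; omega

theorem braid_apply_of_braidCoeff (h : BraidCoeff R)
    {c₁₂ c₂₃ : (Fin 3 → K) ⊗[K] ((Fin 3 → K) ⊗[K] (Fin 3 → K)) →ₗ[K]
      (Fin 3 → K) ⊗[K] ((Fin 3 → K) ⊗[K] (Fin 3 → K))}
    (h12 : ∀ i j k : Fin 3, c₁₂ (e K i ⊗ₜ[K] (e K j ⊗ₜ[K] e K k)) =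
      ∑ m, ∑ n, coeff R i j m n • (e K m ⊗ₜ[K] (e K n ⊗ₜ[K] e K k)))
    (h23 : ∀ i j k : Fin 3, c₂₃ (e K i ⊗ₜ[K] (e K j ⊗ₜ[K] e K k)) =
      ∑ m, ∑ n, coeff R j k m n • (e K i ⊗ₜ[K] (e K m ⊗ₜ[K] e K n))) (i j k : Fin 3) :
    c₁₂ (c₂₃ (c₁₂ (e K i ⊗ₜ[K] (e K j ⊗ₜ[K] e K k)))) =
      c₂₃ (c₁₂ (c₂₃ (e K i ⊗ₜ[K] (e K j ⊗ₜ[K] e K k)))) := by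
  simp only [h12, h23, map_sum, map_smul, Finset.smul_sum, smul_smul]
  have e1 : ∀ f : Fin 3 → Fin 3 → Fin 3 → Fin 3 → Fin 3 → Fin 3 →
      (Fin 3 → K) ⊗[K] ((Fin 3 → K) ⊗[K] (Fin 3 → K)),
      ∑ m, ∑ n, ∑ r, ∑ q, ∑ a, ∑ b, f m n r q a b = ∑ a, ∑ b, ∑ q, ∑ m, ∑ n, ∑ r, f m n r q a b := by
    intro f
    simp only [← Fintype.sum_prod_type']
    refine Fintype.sum_equiv ⟨fun x => (x.2.2.2.2.1, x.2.2.2.2.2, x.2.2.2.1, x.1, x.2.1, x.2.2.1),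
      fun x => (x.2.2.2.1, x.2.2.2.2.1, x.2.2.2.2.2, x.2.2.1, x.1, x.2.1), fun _ => rfl,
      fun _ => rfl⟩ _ _ fun _ => rfl
  have e2 : ∀ f : Fin 3 → Fin 3 → Fin 3 → Fin 3 → Fin 3 → Fin 3 →
      (Fin 3 → K) ⊗[K] ((Fin 3 → K) ⊗[K] (Fin 3 → K)),
      ∑ m, ∑ n, ∑ a, ∑ r, ∑ b, ∑ q, f m n a r b q = ∑ a, ∑ b, ∑ q, ∑ m, ∑ n, ∑ r, f m n a r b q := by
    intro f
    simp only [← Fintype.sum_prod_type']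
    refine Fintype.sum_equiv ⟨fun x => (x.2.2.1, x.2.2.2.2.1, x.2.2.2.2.2, x.1, x.2.1, x.2.2.2.1),
      fun x => (x.2.2.2.1, x.2.2.2.2.1, x.1, x.2.2.2.2.2, x.2.1, x.2.2.1), fun _ => rfl,
      fun _ => rfl⟩ _ _ fun _ => rfl
  refine (e1 _).trans (Eq.trans ?_ (e2 _).symm)
  refine Finset.sum_congr rfl fun a _ => Finset.sum_congr rfl fun b _ =>
    Finset.sum_congr rfl fun q _ => ?_
  simp only [← Finset.sum_smul]
  rw [h i j k a b q]

theorem braidEquation_of_braidCoeff (h : BraidCoeff R) : BraidEquation (braiding R) := by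
  rw [BraidEquation]
  refine ((e K).tensorProduct ((e K).tensorProduct (e K))).ext ?_
  rintro ⟨i, j, k⟩
  have h12 : ∀ i j k : Fin 3, ((TensorProduct.assoc K (Fin 3 → K) (Fin 3 → K) (Fin 3 → K)).toLinearMap
      ∘ₗ (braiding R).rTensor (Fin 3 → K) ∘ₗ
      (TensorProduct.assoc K (Fin 3 → K) (Fin 3 → K) (Fin 3 → K)).symm.toLinearMap)
      (e K i ⊗ₜ[K] (e K j ⊗ₜ[K] e K k)) =
      ∑ m, ∑ n, coeff R i j m n • (e K m ⊗ₜ[K] (e K n ⊗ₜ[K] e K k)) := by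
    intro i j k
    rw [LinearMap.comp_apply, LinearMap.comp_apply, LinearEquiv.coe_coe, LinearEquiv.coe_coe,
      TensorProduct.assoc_symm_tmul, LinearMap.rTensor_tmul, braiding_tmul]
    simp only [TensorProduct.sum_tmul, map_sum, ← TensorProduct.smul_tmul', map_smul,
      TensorProduct.assoc_tmul]
  have h23 : ∀ i j k : Fin 3, ((braiding R).lTensor (Fin 3 → K))
      (e K i ⊗ₜ[K] (e K j ⊗ₜ[K] e K k)) =
      ∑ m, ∑ n, coeff R j k m n • (e K i ⊗ₜ[K] (e K m ⊗ₜ[K] e K n)) := by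
    intro i j k
    rw [LinearMap.lTensor_tmul, braiding_tmul]
    simp only [TensorProduct.tmul_sum, TensorProduct.tmul_smul]
  simp only [Module.Basis.tensorProduct_apply]
  exact braid_apply_of_braidCoeff h h12 h23 i j k

theorem isRigidBraided {t : K} (ht : t ≠ 0) (h : Triangular R t) (hR : BraidCoeff R) :
    IsRigidBraided R :=
  ⟨bijective_braiding ht h, braidEquation_of_braidCoeff hR, bijective_flatMap ht h⟩

/-- The quadratic element with coefficients `r`. -/
def quad (r : Matrix (Fin 3) (Fin 3) K) : T K :=
  ∑ i, ∑ j, r i j • (FreeAlgebra.ι K i * FreeAlgebra.ι K j)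

theorem quad_mem_degreePart (r : Matrix (Fin 3) (Fin 3) K) : quad r ∈ degreePart K 2 := by
  refine sum_mem fun i _ => sum_mem fun j _ => Submodule.smul_mem _ _ ?_
  rw [degreePart, pow_two]
  exact Submodule.mul_mem_mul (Submodule.subset_span ⟨i, rfl⟩) (Submodule.subset_span ⟨j, rfl⟩)

theorem exists_quad {x : T K} (hx : x ∈ degreePart K 2) : ∃ r, x = quad r := by
  have key : degreePart K 2 ≤ LinearMap.range
      (∑ i : Fin 3, ∑ j : Fin 3, (Matrix.entryLinearMap K K i j).smulRight
        (FreeAlgebra.ι K i * FreeAlgebra.ι K j)) := by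
    rw [degreePart, pow_two, Submodule.span_mul_span, Submodule.span_le]
    rintro _ ⟨_, ⟨i, rfl⟩, _, ⟨j, rfl⟩, rfl⟩
    refine ⟨Matrix.single i j 1, ?_⟩
    simp only [LinearMap.sum_apply, LinearMap.smulRight_apply, Matrix.entryLinearMap_apply,
      Matrix.single_apply, ite_smul, one_smul, zero_smul]
    rw [Finset.sum_eq_single i (by
      intro m _ hm; exact Finset.sum_eq_zero fun _ _ => if_neg fun h => hm h.1.symm) (by simp),
      Finset.sum_eq_single j (by
      intro m _ hm; exact if_neg fun h => hm h.2.symm) (by simp)]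
    simp
  obtain ⟨r, hr⟩ := key hx
  exact ⟨r, by rw [← hr]; simp [quad]⟩

theorem der_quad (r : Matrix (Fin 3) (Fin 3) K) (l : Fin 3) :
    der R l (quad r) = ∑ m, (r m l + ∑ i, ∑ j, r i j * coeff R i j m l) • FreeAlgebra.ι K m := by
  simp only [quad, map_sum, map_smul, der_ι_mul, der_ι, past_ι, smul_add, Finset.sum_add_distrib,
    add_smul, mul_ite, mul_one, mul_zero, smul_ite, smul_zero, Finset.sum_ite_eq',
    Finset.mem_univ, if_true, Finset.smul_sum, smul_smul, Finset.sum_smul]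
  congr 1
  exact (Finset.sum_congr rfl fun i _ => Finset.sum_comm).trans Finset.sum_comm

theorem quad_mem_nicholsIdeal (hR : BraidCoeff R) {r : Matrix (Fin 3) (Fin 3) K} :
    quad r ∈ nicholsIdeal R ↔ ∀ m l, r m l + ∑ i, ∑ j, r i j * coeff R i j m l = 0 := by
  rw [mem_nicholsIdeal hR]
  constructor
  · intro h m l
    have := mem_kernelSubmodule.mp h [l, m]
    rw [symm_cons, der_quad, symm_cons, symm_nil] at this
    simpa [der_ι, apply_ite] using this
  · intro h
    refine mem_kernel_of_der ?_ fun l => ?_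
    · simp [quad]
    · rw [der_quad]
      simp [h]

theorem quad_ne_zero {r : Matrix (Fin 3) (Fin 3) K} (i j : Fin 3) (h : r i j ≠ 0) :
    quad r ≠ 0 := by
  intro h0
  have h1 := congrArg (symm (0 : Matrix (Fin 9) (Fin 9) K) [j, i]) h0
  rw [map_zero, symm_cons, der_quad, symm_cons, symm_nil] at h1
  simp [der_ι, apply_ite, coeff] at h1
  exact h h1

theorem hasQuadraticRelation_iff [CharZero K] {t : K} (h : Triangular R t) (hR : BraidCoeff R) :
    HasQuadraticRelation R ↔ t ^ 2 = 1 := by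
  classical
  constructor
  · rintro ⟨x, hx, hx2, hx0⟩
    obtain ⟨r, rfl⟩ := exists_quad hx2
    rw [quad_mem_nicholsIdeal hR] at hx
    have hex : ((Finset.univ : Finset (Fin 3 × Fin 3)).filter
        fun x : Fin 3 × Fin 3 => r x.1 x.2 ≠ 0).Nonempty := by
      by_contra hc
      rw [Finset.not_nonempty_iff_eq_empty, Finset.filter_eq_empty_iff] at hc
      apply hx0
      refine Finset.sum_eq_zero fun i _ => Finset.sum_eq_zero fun j _ => ?_
      rw [not_not.mp (hc (Finset.mem_univ (i, j))), zero_smul]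
    obtain ⟨⟨i, j⟩, hij, hmax⟩ := Finset.exists_max_image _
      (fun x : Fin 3 × Fin 3 => x.1.val + x.2.val) hex
    have hij0 : r i j ≠ 0 := (Finset.mem_filter.mp hij).2
    have key : ∀ m l : Fin 3, m.val + l.val = i.val + j.val → r m l + r l m * t = 0 := by
      intro m l hml
      have h1 := hx m l
      rw [Finset.sum_eq_single l, Finset.sum_eq_single m, h.diag] at h1
      · exact h1
      · intro b _ hb
        by_cases hr : r l b = 0
        · rw [hr, zero_mul]
        · have := hmax (l, b) (by simp [hr])
          dsimp only at this
          rw [h.eq_zero l b m l (by simp [Ne.symm hb]) (by omega), mul_zero]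
      · simp
      · intro a _ ha
        refine Finset.sum_eq_zero fun b _ => ?_
        by_cases hr : r a b = 0
        · rw [hr, zero_mul]
        · have := hmax (a, b) (by simp [hr])
          dsimp only at this
          rw [h.eq_zero a b m l (by simp [Ne.symm ha]) (by omega), mul_zero]
      · simp
    have h1 := key i j rfl
    have h2 := key j i (by omega)
    have h3 : r i j * (t ^ 2 - 1) = 0 := by linear_combination t * h2 - h1
    rcases mul_eq_zero.mp h3 with h3 | h3
    · exact absurd h3 hij0
    · linear_combination h3
  · intro ht
    have hz := h.eq_zero
    have hd := h.diag
    rw [pow_two, mul_self_eq_one_iff] at ht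
    rcases ht with rfl | rfl
    · let r : Matrix (Fin 3) (Fin 3) K :=
        !![(coeff R 0 1 0 0 - coeff R 1 0 0 0) / 2, -1, 0; 1, 0, 0; 0, 0, 0]
      refine ⟨quad r, (quad_mem_nicholsIdeal hR).mpr ?_, quad_mem_degreePart r,
        quad_ne_zero 1 0 (by simp [r])⟩
      intro m l
      fin_cases m <;> fin_cases l <;> simp [r, Fin.sum_univ_three, hz, hd]
      ring
    · let r : Matrix (Fin 3) (Fin 3) K := !![1, 0, 0; 0, 0, 0; 0, 0, 0]
      refine ⟨quad r, (quad_mem_nicholsIdeal hR).mpr ?_, quad_mem_degreePart r,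
        quad_ne_zero 0 0 (by simp [r])⟩
      intro m l
      fin_cases m <;> fin_cases l <;> simp [r, Fin.sum_univ_three, hz, hd]

end Rigid

/-! ### Ordered monomials -/

section OrderedMonomials

variable {A : Type*} [Ring A] {ι : Type*} [LinearOrder ι]

theorem sort_support_eq_filter (n : ι →₀ ℕ) {L : List ι} (hL : L.Pairwise (· < ·))
    (hs : ∀ i, n i ≠ 0 → i ∈ L) : n.support.sort (· ≤ ·) = L.filter fun i => n i ≠ 0 := by
  have hnd : L.Nodup := hL.imp fun h => ne_of_lt h
  refine List.Perm.eq_of_pairwise (le := (· ≤ ·)) ?_ (Finset.pairwise_sort _ _)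
    ((hL.imp fun h => le_of_lt h).filter _) ?_
  · intro a b _ _ h h'
    exact le_antisymm h h'
  · rw [List.perm_ext_iff_of_nodup (Finset.sort_nodup _ _) (hnd.filter _)]
    intro a
    simp only [Finset.mem_sort, Finsupp.mem_support_iff, List.mem_filter, decide_eq_true_eq]
    exact ⟨fun h => ⟨hs a h, h⟩, fun h => h.2⟩

/-- An ordered monomial is the product over any increasing list containing its support. -/
theorem orderedMonomial_eq_prod (g : ι → A) (n : ι →₀ ℕ) {L : List ι} (hL : L.Pairwise (· < ·))
    (hs : ∀ i, n i ≠ 0 → i ∈ L) : orderedMonomial g n = (L.map fun i => g i ^ n i).prod := by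
  rw [orderedMonomial, sort_support_eq_filter n hL hs]
  clear hL hs
  induction L with
  | nil => rfl
  | cons a L ih =>
    by_cases h : n a = 0
    · rw [List.filter_cons_of_neg (by simpa using h), ih, List.map_cons, List.prod_cons, h,
        pow_zero, one_mul]
    · rw [List.filter_cons_of_pos (by simpa using h), List.map_cons, List.prod_cons, ih,
        List.map_cons, List.prod_cons]

theorem orderedMonomial_zero (g : ι → A) : orderedMonomial g 0 = 1 := by
  simp [orderedMonomial]

theorem orderedMonomial_single_add (g : ι → A) {i : ι} {n : ι →₀ ℕ} (h : ∀ j, n j ≠ 0 → i ≤ j) :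
    orderedMonomial g (Finsupp.single i 1 + n) = g i * orderedMonomial g n := by
  have hL : (i :: (n.support.erase i).sort (· ≤ ·)).Pairwise (· < ·) := by
    rw [List.pairwise_cons]
    refine ⟨fun j hj => ?_, Finset.sortedLT_sort _ |>.pairwise⟩
    rw [Finset.mem_sort, Finset.mem_erase, Finsupp.mem_support_iff] at hj
    exact lt_of_le_of_ne (h j hj.2) (Ne.symm hj.1)
  have hs : ∀ j, n j ≠ 0 → j ∈ i :: (n.support.erase i).sort (· ≤ ·) := by
    intro j hj
    by_cases hij : j = i
    · simp [hij]
    · simp [hij, hj]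
  rw [orderedMonomial_eq_prod g n hL hs, orderedMonomial_eq_prod g _ hL]
  · rw [List.map_cons, List.prod_cons, List.map_cons, List.prod_cons, ← mul_assoc, ← pow_succ',
      Finsupp.add_apply, Finsupp.single_eq_same, add_comm 1]
    congr 2
    refine List.map_congr_left fun j hj => ?_
    rw [Finset.mem_sort, Finset.mem_erase] at hj
    rw [Finsupp.add_apply, Finsupp.single_eq_of_ne hj.1, zero_add]
  · intro j hj
    by_cases hij : j = i
    · simp [hij]
    · refine hs j ?_
      rwa [Finsupp.add_apply, Finsupp.single_eq_of_ne hij, zero_add] at hj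

theorem prod_map_eq_orderedMonomial (g : ι → A) {l : List ι} (hl : l.Pairwise (· ≤ ·)) :
    (l.map g).prod = orderedMonomial g (Multiset.toFinsupp (l : Multiset ι)) := by
  induction l with
  | nil => simp [orderedMonomial_zero]
  | cons i l ih =>
    rw [List.pairwise_cons] at hl
    rw [List.map_cons, List.prod_cons, ih hl.2, ← Multiset.cons_coe, ← Multiset.singleton_add,
      map_add, Multiset.toFinsupp_singleton, orderedMonomial_single_add]
    intro j hj
    apply hl.1
    rw [Multiset.toFinsupp_apply] at hj
    exact Multiset.mem_coe.mp (Multiset.count_ne_zero.mp hj)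

theorem map_orderedMonomial {B : Type*} [Ring B] {F : Type*} [FunLike F A B] [RingHomClass F A B]
    (f : F) (g : ι → A) (n : ι →₀ ℕ) :
    f (orderedMonomial g n) = orderedMonomial (fun i => f (g i)) n := by
  simp only [orderedMonomial, map_list_prod, List.map_map]
  congr 1
  refine List.map_congr_left fun i _ => ?_
  simp

theorem orderedMonomial_fin_three (g : Fin 3 → A) (n : Fin 3 →₀ ℕ) :
    orderedMonomial g n = g 0 ^ n 0 * g 1 ^ n 1 * g 2 ^ n 2 := by
  rw [orderedMonomial_eq_prod g n (L := [0, 1, 2]) (by decide) (by intro i _; fin_cases i <;> simp)]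
  simp [mul_assoc]

theorem orderedMonomial_withLast (g : ι → A) (x : A) (n : WithTop ι →₀ ℕ) :
    orderedMonomial (withLast x g) n =
      orderedMonomial g (n.comapDomain WithTop.some WithTop.coe_injective.injOn) * x ^ n ⊤ := by
  have hsup : ((n.comapDomain WithTop.some WithTop.coe_injective.injOn).support.sort
      (· ≤ ·)).Pairwise (· < ·) := Finset.sortedLT_sort _ |>.pairwise
  rw [orderedMonomial_eq_prod (withLast x g) n (L :=
    ((n.comapDomain WithTop.some WithTop.coe_injective.injOn).support.sort
      (· ≤ ·)).map WithTop.some ++ [⊤])]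
  · rw [List.map_append, List.prod_append, List.map_map, orderedMonomial]
    simp [withLast, Function.comp_def]
  · rw [List.pairwise_append]
    refine ⟨?_, by simp, ?_⟩
    · rw [List.pairwise_map]
      exact hsup.imp fun h => WithTop.coe_lt_coe.mpr h
    · simp only [List.mem_map, List.mem_singleton]
      rintro _ ⟨a, _, rfl⟩ _ rfl
      exact WithTop.coe_lt_top a
  · intro i hi
    induction i using WithTop.recTopCoe with
    | top => simp
    | coe i =>
      simp only [List.mem_append, List.mem_map]
      left
      exact ⟨i, by simpa using hi, rfl⟩

variable {K : Type*} [Field K] [Algebra K A]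

theorem prod_perm_of_skew {g : ι → A} (hc : ∀ i j, ∃ c : K, g i * g j = c • (g j * g i))
    {l l' : List ι} (h : l.Perm l') : ∃ c : K, (l.map g).prod = c • (l'.map g).prod := by
  induction h with
  | nil => exact ⟨1, by simp⟩
  | cons a _ ih =>
    obtain ⟨c, hc⟩ := ih
    exact ⟨c, by simp [hc]⟩
  | swap a b l =>
    obtain ⟨c, hc⟩ := hc b a
    exact ⟨c, by simp only [List.map_cons, List.prod_cons, ← mul_assoc, hc, smul_mul_assoc]⟩
  | trans _ _ ih ih' =>
    obtain ⟨c, hc⟩ := ih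
    obtain ⟨c', hc'⟩ := ih'
    exact ⟨c * c', by rw [hc, hc', smul_smul]⟩

theorem exists_perm_cons_cons [DecidableEq ι] {l : List ι} {i : ι} (h : 2 ≤ l.count i) :
    ∃ l', l.Perm (i :: i :: l') := by
  have h1 : i ∈ l := List.count_pos_iff.mp (by omega)
  have h2 : i ∈ l.erase i := List.count_pos_iff.mp (by rw [List.count_erase_self]; omega)
  exact ⟨_, (List.perm_cons_erase h1).trans ((List.perm_cons_erase h2).cons i)⟩

/-- Products of skew-commuting generators are combinations of ordered monomials. -/
theorem prod_mem_span_of_skew {g : ι → A} {h : ι → ℕ∞}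
    (hc : ∀ i j, ∃ c : K, g i * g j = c • (g j * g i))
    (hsq : ∀ i, h i = ⊤ ∨ (h i = 2 ∧ g i * g i = 0)) (l : List ι) :
    (l.map g).prod ∈ Submodule.span K (Set.range
      fun n : {n : ι →₀ ℕ // ∀ i, (n i : ℕ∞) < h i} => orderedMonomial g n.1) := by
  obtain ⟨c, hl⟩ := prod_perm_of_skew (K := K) hc (List.perm_insertionSort (· ≤ ·) l).symm
  have hsort : (l.insertionSort (· ≤ ·)).Pairwise (· ≤ ·) := List.pairwise_insertionSort (· ≤ ·) l
  rw [hl]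
  refine Submodule.smul_mem _ _ ?_
  by_cases hn : ∀ i, ((Multiset.toFinsupp (l.insertionSort (· ≤ ·) : Multiset ι) i : ℕ) : ℕ∞) < h i
  · exact Submodule.subset_span ⟨⟨_, hn⟩, (prod_map_eq_orderedMonomial g hsort).symm⟩
  · push Not at hn
    obtain ⟨i, hi⟩ := hn
    rcases hsq i with ht | ⟨h2, h0⟩
    · rw [ht] at hi
      exact absurd hi (by simp)
    · rw [h2, Multiset.toFinsupp_apply, Multiset.coe_count] at hi
      obtain ⟨l', hl'⟩ := exists_perm_cons_cons (i := i) (l := l.insertionSort (· ≤ ·))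
        (by exact_mod_cast hi)
      obtain ⟨c', hc'⟩ := prod_perm_of_skew (K := K) hc hl'
      rw [hc', List.map_cons, List.prod_cons, List.map_cons, List.prod_cons, ← mul_assoc, h0,
        zero_mul, smul_zero]
      exact zero_mem _

theorem adjoin_le_span_of_skew {g : ι → A} {h : ι → ℕ∞}
    (hc : ∀ i j, ∃ c : K, g i * g j = c • (g j * g i))
    (hsq : ∀ i, h i = ⊤ ∨ (h i = 2 ∧ g i * g i = 0)) :
    Subalgebra.toSubmodule (Algebra.adjoin K (Set.range g)) ≤ Submodule.span K (Set.range
      fun n : {n : ι →₀ ℕ // ∀ i, (n i : ℕ∞) < h i} => orderedMonomial g n.1) := by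
  rw [Algebra.adjoin_eq_span, Submodule.span_le]
  intro x hx
  obtain ⟨l, hl, rfl⟩ := Submonoid.exists_list_of_mem_closure hx
  have : ∃ l' : List ι, l = l'.map g := by
    clear hx
    induction l with
    | nil => exact ⟨[], rfl⟩
    | cons a l ih =>
      obtain ⟨l', rfl⟩ := ih fun y hy => hl y (List.mem_cons_of_mem _ hy)
      obtain ⟨i, rfl⟩ := hl a List.mem_cons_self
      exact ⟨i :: l', rfl⟩
  obtain ⟨l', rfl⟩ := this
  exact prod_mem_span_of_skew hc hsq l'

end OrderedMonomials

/-! ### From spanning and independence to a presentation -/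

section Presentation

variable {K : Type u} [Field K] {R : Matrix (Fin 9) (Fin 9) K}

/-- The quotient of `T(V)` by the ideal generated by a set of relations. -/
abbrev Presented (rels : Set (T K)) : Type u := (TwoSidedIdeal.span rels).ringCon.Quotient

/-- The canonical projection to the presented algebra. -/
def toPresented (rels : Set (T K)) : T K →ₐ[K] Presented rels :=
  (TwoSidedIdeal.span rels).ringCon.mkₐ K

theorem toPresented_eq_zero {rels : Set (T K)} {x : T K} :
    toPresented rels x = 0 ↔ x ∈ TwoSidedIdeal.span rels := by
  rw [TwoSidedIdeal.mem_iff, ← RingCon.eq]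
  rfl

theorem toPresented_of_mem {rels : Set (T K)} {x : T K} (hx : x ∈ rels) :
    toPresented rels x = 0 :=
  toPresented_eq_zero.mpr (TwoSidedIdeal.subset_span hx)

theorem toPresented_surjective (rels : Set (T K)) : Function.Surjective (toPresented rels) :=
  RingCon.mkₐ_surjective _

theorem proj_eq_zero {x : T K} : proj R x = 0 ↔ x ∈ nicholsIdeal R := by
  rw [TwoSidedIdeal.mem_iff, ← RingCon.eq]
  rfl

theorem proj_surjective : Function.Surjective (proj R) := RingCon.mkₐ_surjective _

theorem presentation_of_span_of_linearIndependent {rels : Set (T K)} {ι : Type} [LinearOrder ι]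
    {g : ι → T K} {h : ι → ℕ∞} (hrels : ∀ x ∈ rels, x ∈ nicholsIdeal R)
    (hspan : Submodule.span K (Set.range fun n : {n : ι →₀ ℕ // ∀ i, (n i : ℕ∞) < h i} =>
      orderedMonomial (fun i => toPresented rels (g i)) n.1) = ⊤)
    (hind : LinearIndependent K fun n : {n : ι →₀ ℕ // ∀ i, (n i : ℕ∞) < h i} =>
      orderedMonomial (fun i => proj R (g i)) n.1) :
    nicholsIdeal R = TwoSidedIdeal.span rels ∧ IsPBWBasis K (fun i => proj R (g i)) h := by
  have hle : TwoSidedIdeal.span rels ≤ nicholsIdeal R := TwoSidedIdeal.span_le.mpr hrels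
  have hdec : ∀ x : T K, ∃ c : {n : ι →₀ ℕ // ∀ i, (n i : ℕ∞) < h i} →₀ K,
      x - c.linearCombination K (fun n => orderedMonomial g n.1) ∈ TwoSidedIdeal.span rels := by
    intro x
    have hx : toPresented rels x ∈ Submodule.span K (Set.range
        fun n : {n : ι →₀ ℕ // ∀ i, (n i : ℕ∞) < h i} =>
          orderedMonomial (fun i => toPresented rels (g i)) n.1) := hspan ▸ Submodule.mem_top
    obtain ⟨c, hc⟩ := Finsupp.mem_span_range_iff_exists_finsupp.mp hx
    refine ⟨c, ?_⟩
    rw [← toPresented_eq_zero, map_sub, ← hc, sub_eq_zero, Finsupp.linearCombination_apply,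
      map_finsuppSum]
    simp only [map_smul, map_orderedMonomial]
  have hprojc : ∀ c : {n : ι →₀ ℕ // ∀ i, (n i : ℕ∞) < h i} →₀ K,
      proj R (c.linearCombination K (fun n => orderedMonomial g n.1)) =
      c.linearCombination K (fun n => orderedMonomial (fun i => proj R (g i)) n.1) := by
    intro c
    simp only [Finsupp.linearCombination_apply, map_finsuppSum, map_smul, map_orderedMonomial]
  refine ⟨le_antisymm ?_ hle, hind, ?_⟩
  · intro x hx
    obtain ⟨c, hc⟩ := hdec x
    have h0 : proj R (c.linearCombination K (fun n => orderedMonomial g n.1)) = 0 := by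
      have h1 := proj_eq_zero.mpr (hle hc)
      rw [map_sub, proj_eq_zero.mpr hx, zero_sub, neg_eq_zero] at h1
      exact h1
    rw [hprojc] at h0
    rw [linearIndependent_iff.mp hind c h0, map_zero, sub_zero] at hc
    exact hc
  · rw [eq_top_iff]
    intro y _
    obtain ⟨x, rfl⟩ := proj_surjective y
    obtain ⟨c, hc⟩ := hdec x
    have h1 := proj_eq_zero.mpr (hle hc)
    rw [map_sub, sub_eq_zero, hprojc] at h1
    rw [h1]
    exact Finsupp.mem_span_range_iff_exists_finsupp.mpr ⟨c, rfl⟩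

end Presentation

/-! ### Gelfand–Kirillov dimension -/

section Growth

variable {K : Type u} [Field K] {A : Type u} [Ring A] [Algebra K A]

theorem tendsto_log_const_mul_pow_div_log (C : ℝ) (hC : 0 < C) (r : ℕ) :
    Filter.Tendsto (fun n : ℕ => ((Real.log (C * (n : ℝ) ^ r) / Real.log n : ℝ) : EReal))
      Filter.atTop (nhds ((r : ℕ) : EReal)) := by
  have h1 : Filter.Tendsto (fun n : ℕ => Real.log C / Real.log n + r) Filter.atTop
      (nhds (0 + r)) :=
    ((Real.tendsto_log_atTop.comp tendsto_natCast_atTop_atTop).const_div_atTop _).add_const _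
  rw [zero_add] at h1
  refine (EReal.tendsto_coe.mpr h1).congr' ?_
  filter_upwards [Filter.eventually_ge_atTop 2] with n hn
  have hn' : (0 : ℝ) < n := by positivity
  have hlog : Real.log n ≠ 0 := (Real.log_pos (by exact_mod_cast hn)).ne'
  rw [Real.log_mul hC.ne' (by positivity), Real.log_pow, add_div, mul_div_assoc, div_self hlog,
    mul_one]

theorem fg_one_submodule : (1 : Submodule K A).FG := by
  rw [Submodule.one_eq_span]
  exact Submodule.fg_span_singleton 1

theorem one_le_finrank_pow [Nontrivial A] {W : Submodule K A} (hW : W.FG) (n : ℕ) :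
    1 ≤ Module.finrank K ↥((1 ⊔ W) ^ n) := by
  have hfg : ((1 ⊔ W) ^ n).FG := (Submodule.FG.sup fg_one_submodule hW).pow n
  have : Module.Finite K ↥((1 ⊔ W) ^ n) := Module.Finite.iff_fg.mpr hfg
  have hone : (1 : A) ∈ (1 ⊔ W) ^ n := by
    have := Submodule.pow_mem_pow (1 ⊔ W) (Submodule.mem_sup_left (Submodule.one_le.mp le_rfl)) n
    rwa [one_pow] at this
  have : Nontrivial ↥((1 ⊔ W) ^ n) := ⟨⟨⟨1, hone⟩, 0, by simp [Subtype.ext_iff]⟩⟩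
  exact Module.finrank_pos

theorem GKdim_le [Nontrivial A] (r : ℕ) (h : ∀ W : Submodule K A, W.FG → ∃ C : ℝ, 0 < C ∧
    ∀ n : ℕ, 1 ≤ n → (Module.finrank K ↥((1 ⊔ W) ^ n) : ℝ) ≤ C * (n : ℝ) ^ r) :
    GKdim K A ≤ r := by
  refine iSup₂_le fun W hW => ?_
  obtain ⟨C, hC, hle⟩ := h W hW
  rw [← (tendsto_log_const_mul_pow_div_log C hC r).limsup_eq]
  refine Filter.limsup_le_limsup ?_
  filter_upwards [Filter.eventually_ge_atTop 2] with n hn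
  refine EReal.coe_le_coe_iff.mpr ?_
  have h1 := one_le_finrank_pow (K := K) hW n
  have hlog : 0 < Real.log n := Real.log_pos (by exact_mod_cast hn)
  exact div_le_div_of_nonneg_right (Real.log_le_log (by exact_mod_cast h1) (hle n (by omega)))
    hlog.le

theorem le_GKdim (s : ℕ) {W : Submodule K A} (hW : W.FG) {c : ℝ} (hc : 0 < c)
    (h : ∀ n : ℕ, c * (n : ℝ) ^ s ≤ Module.finrank K ↥((1 ⊔ W) ^ n)) : s ≤ GKdim K A := by
  refine le_trans ?_ (le_iSup₂ (f := fun (W : Submodule K A) (_ : W.FG) =>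
    Filter.limsup (fun n : ℕ =>
      ((Real.log (Module.finrank K ↥((1 ⊔ W) ^ n)) / Real.log n : ℝ) : EReal)) Filter.atTop) W hW)
  rw [← (tendsto_log_const_mul_pow_div_log c hc s).limsup_eq]
  refine Filter.limsup_le_limsup ?_
  filter_upwards [Filter.eventually_ge_atTop 2] with n hn
  refine EReal.coe_le_coe_iff.mpr ?_
  have hlog : 0 < Real.log n := Real.log_pos (by exact_mod_cast hn)
  have hn' : (0 : ℝ) < n := by positivity
  exact div_le_div_of_nonneg_right (Real.log_le_log (by positivity) (h n)) hlog.le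

variable {ι : Type*} [LinearOrder ι]

theorem orderedMonomial_mem_pow {g : ι → A} {M : Submodule K A} {n : ι →₀ ℕ}
    (hg : ∀ i, n i ≠ 0 → g i ∈ M) : orderedMonomial g n ∈ M ^ n.sum fun _ k => k := by
  have h : ∀ L : List ι, (∀ i ∈ L, n i ≠ 0) →
      (L.map fun i => g i ^ n i).prod ∈ M ^ (L.map n).sum := by
    intro L
    induction L with
    | nil => intro _; simpa using ⟨1, map_one _⟩
    | cons i L ih =>
      intro hL
      simp only [List.map_cons, List.prod_cons, List.sum_cons, pow_add]
      exact Submodule.mul_mem_mul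
        (Submodule.pow_mem_pow M (hg i (hL i List.mem_cons_self)) _)
        (ih fun j hj => hL j (List.mem_cons_of_mem _ hj))
  have h1 := h (n.support.sort (· ≤ ·)) (by simp)
  rw [orderedMonomial, Finsupp.sum]
  convert h1 using 2
  rw [← Finset.sum_map_toList, ← Multiset.sum_coe, ← Multiset.sum_coe]
  congr 1
  simp [← Multiset.map_coe, Finset.sort_eq]

/-- A PBW basis with `s` generators of infinite height forces `GKdim ≥ s`. -/
theorem card_le_GKdim {g : ι → A} {h : ι → ℕ∞} (hg : IsPBWBasis K g h) (S : Finset ι)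
    (hS : ∀ i ∈ S, h i = ⊤) (h0 : ∀ i, 0 < h i) : (S.card : EReal) ≤ GKdim K A := by
  classical
  set W : Submodule K A := Submodule.span K (g '' S) with hWdef
  have hW : W.FG := Submodule.fg_span (S.finite_toSet.image g)
  refine le_GKdim (S.card) hW (c := (1 / (S.card : ℝ)) ^ S.card) ?_ ?_
  · rcases Nat.eq_zero_or_pos S.card with h | h
    · simp [h]
    · positivity
  intro n
  set k := n / S.card with hk
  have hfg : ((1 ⊔ W) ^ n).FG := (Submodule.FG.sup fg_one_submodule hW).pow n
  have : Module.Finite K ↥((1 ⊔ W) ^ n) := Module.Finite.iff_fg.mpr hfg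
  let ext : (S → Fin (k + 1)) → ι →₀ ℕ := fun f =>
    Finsupp.onFinset S (fun i => if hi : i ∈ S then (f ⟨i, hi⟩ : ℕ) else 0)
      (fun i hi => by by_contra hne; simp [hne] at hi)
  have hext : ∀ f i, ((ext f i : ℕ) : ℕ∞) < h i := by
    intro f i
    by_cases hi : i ∈ S
    · rw [hS i hi]; exact ENat.natCast_lt_top _
    · simp [ext, hi, h0]
  have hinj : Function.Injective ext := by
    intro f f' hff
    funext ⟨i, hi⟩
    have := DFunLike.congr_fun hff i
    simpa [ext, hi, Fin.ext_iff] using this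
  have hmem : ∀ f, orderedMonomial g (ext f) ∈ (1 ⊔ W) ^ n := by
    intro f
    have h1 : orderedMonomial g (ext f) ∈ (1 ⊔ W) ^ ((ext f).sum fun _ k => k) := by
      refine orderedMonomial_mem_pow fun i hi => Submodule.mem_sup_right ?_
      refine Submodule.subset_span ⟨i, ?_, rfl⟩
      by_contra hne
      exact hi (by simp [ext, show i ∉ S from hne])
    refine pow_le_pow_right' (a := 1 ⊔ W) le_sup_left ?_ h1
    have h2 : ((ext f).sum fun _ k => k) = ∑ i ∈ S, ext f i :=
      Finsupp.sum_of_support_subset _ Finsupp.support_onFinset_subset _ (by simp)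
    rw [h2]
    calc ∑ i ∈ S, ext f i ≤ ∑ i ∈ S, k := by
          refine Finset.sum_le_sum fun i hi => ?_
          have : ext f i = (f ⟨i, hi⟩ : ℕ) := by simp [ext, hi]
          rw [this]; omega
      _ = S.card * k := by simp
      _ ≤ n := Nat.mul_div_le n _
  have hli : LinearIndependent K fun f : S → Fin (k + 1) =>
      (⟨orderedMonomial g (ext f), hmem f⟩ : ↥((1 ⊔ W) ^ n)) := by
    refine LinearIndependent.of_comp ((1 ⊔ W) ^ n).subtype ?_
    exact hg.1.comp (fun f => ⟨ext f, hext f⟩) fun f f' hff => hinj (Subtype.ext_iff.mp hff)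
  have hcard := hli.fintype_card_le_finrank
  rw [Fintype.card_fun, Fintype.card_fin, Fintype.card_coe] at hcard
  calc (1 / (S.card : ℝ)) ^ S.card * (n : ℝ) ^ S.card = ((n : ℝ) / S.card) ^ S.card := by
        rw [← mul_pow]; congr 1; ring
    _ ≤ ((k : ℝ) + 1) ^ S.card := by
        refine pow_le_pow_left₀ (by positivity) ?_ _
        rcases Nat.eq_zero_or_pos S.card with h | h
        · simp [h, hk]
        · rw [div_le_iff₀ (by exact_mod_cast h)]
          have := Nat.lt_div_mul_add (a := n) h
          rw [← hk] at this
          have h3 : (n : ℝ) < k * S.card + S.card := by exact_mod_cast this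
          linarith
    _ ≤ _ := by exact_mod_cast hcard

theorem GKdim_eq_top {g : ι → A} {h : ι → ℕ∞} (hg : IsPBWBasis K g h)
    (hS : {i | h i = ⊤}.Infinite) (h0 : ∀ i, 0 < h i) : GKdim K A = ⊤ := by
  rw [EReal.eq_top_iff_forall_lt]
  intro y
  obtain ⟨m, hm⟩ := exists_nat_gt y
  obtain ⟨S, hS', hcard⟩ := hS.exists_subset_card_eq m
  have := card_le_GKdim hg S (fun i hi => hS' hi) h0
  rw [hcard] at this
  refine lt_of_lt_of_le ?_ this
  exact_mod_cast hm

end Growth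

section GradedGrowth

variable {K : Type u} [Field K] {R : Matrix (Fin 9) (Fin 9) K}

/-- The elements of degree at most `m`. -/
def degreeLE (K : Type u) [Field K] (m : ℕ) : Submodule K (T K) where
  carrier := {x | (gradeHom K x).natDegree ≤ m}
  zero_mem' := by simp
  add_mem' := by
    intro a b ha hb
    simp only [Set.mem_ofPred_eq, map_add] at *
    exact Polynomial.natDegree_add_le_of_degree_le ha hb
  smul_mem' := by
    intro c x hx
    simp only [Set.mem_ofPred_eq, map_smul] at *
    exact (Polynomial.natDegree_smul_le c _).trans hx

theorem mem_degreeLE {m : ℕ} {x : T K} : x ∈ degreeLE K m ↔ (gradeHom K x).natDegree ≤ m :=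
  Iff.rfl

theorem degreeLE_mul_le (a b : ℕ) : degreeLE K a * degreeLE K b ≤ degreeLE K (a + b) := by
  refine Submodule.mul_le.mpr fun x hx y hy => ?_
  rw [mem_degreeLE] at *
  rw [map_mul]
  exact Polynomial.natDegree_mul_le_of_le hx hy

theorem degreeLE_pow_le (m n : ℕ) : degreeLE K m ^ n ≤ degreeLE K (m * n) := by
  induction n with
  | zero =>
    rw [pow_zero, Submodule.one_le, mem_degreeLE]
    simp
  | succ n ih =>
    rw [pow_succ]
    exact (mul_le_mul_left ih _).trans (degreeLE_mul_le _ _)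

theorem degreeLE_mono {m n : ℕ} (h : m ≤ n) : degreeLE K m ≤ degreeLE K n :=
  fun _ hx => le_trans hx h

theorem exists_le_map_degreeLE {W : Submodule K (NicholsAlgebra R)} (hW : W.FG) :
    ∃ m, W ≤ (degreeLE K m).map (proj R).toLinearMap := by
  induction W, hW using Submodule.fg_induction with
  | singleton x =>
    obtain ⟨y, rfl⟩ := proj_surjective x
    exact ⟨(gradeHom K y).natDegree, by
      rw [Submodule.span_singleton_le_iff_mem]
      exact ⟨y, mem_degreeLE.mpr le_rfl, rfl⟩⟩
  | sup M N _ _ hM hN =>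
    obtain ⟨m, hm⟩ := hM
    obtain ⟨n, hn⟩ := hN
    exact ⟨max m n, sup_le
      (hm.trans (Submodule.map_mono (degreeLE_mono (le_max_left _ _))))
      (hn.trans (Submodule.map_mono (degreeLE_mono (le_max_right _ _))))⟩

variable {ι : Type} [LinearOrder ι]

theorem mul_mem_degreePart {m n : ℕ} {x y : T K} (hx : x ∈ degreePart K m)
    (hy : y ∈ degreePart K n) : x * y ∈ degreePart K (m + n) := by
  rw [degreePart, pow_add]
  exact Submodule.mul_mem_mul hx hy

theorem pow_mem_degreePart {m : ℕ} {x : T K} (hx : x ∈ degreePart K m) (k : ℕ) :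
    x ^ k ∈ degreePart K (k * m) := by
  rw [degreePart, mul_comm, pow_mul]
  exact Submodule.pow_mem_pow _ hx k

theorem orderedMonomial_mem_degreePart {g : ι → T K} {d : ι → ℕ}
    (hd : ∀ i, g i ∈ degreePart K (d i)) (n : ι →₀ ℕ) :
    orderedMonomial g n ∈ degreePart K (n.sum fun i k => k * d i) := by
  have h : ∀ L : List ι,
      (L.map fun i => g i ^ n i).prod ∈ degreePart K (L.map fun i => n i * d i).sum := by
    intro L
    induction L with
    | nil => simp [degreePart]
    | cons i L ih =>
      simp only [List.map_cons, List.prod_cons, List.sum_cons]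
      exact mul_mem_degreePart (pow_mem_degreePart (hd i) _) ih
  have h1 := h (n.support.sort (· ≤ ·))
  rw [orderedMonomial, Finsupp.sum]
  convert h1 using 2
  rw [← Finset.sum_map_toList, ← Multiset.sum_coe, ← Multiset.sum_coe]
  congr 1
  simp [← Multiset.map_coe, Finset.sort_eq]

theorem component_mem_nicholsIdeal (hR : BraidCoeff R) {x : T K} (hx : x ∈ nicholsIdeal R) (n : ℕ) :
    component n x ∈ nicholsIdeal R := by
  rw [mem_nicholsIdeal hR] at *
  exact component_mem_kernel hx n

/-- With homogeneous generators, an element of degree at most `N` is a combination of PBW monomials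
of degree at most `N`. -/
theorem map_degreeLE_le_span (hR : BraidCoeff R) {g : ι → T K} {h : ι → ℕ∞} {d : ι → ℕ}
    (hd : ∀ i, g i ∈ degreePart K (d i)) (hg : IsPBWBasis K (fun i => proj R (g i)) h) (N : ℕ) :
    (degreeLE K N).map (proj R).toLinearMap ≤ Submodule.span K
      ((fun n => orderedMonomial (fun i => proj R (g i)) n) ''
        {n : ι →₀ ℕ | (∀ i, (n i : ℕ∞) < h i) ∧ (n.sum fun i k => k * d i) ≤ N}) := by
  rintro _ ⟨x, hx, rfl⟩
  have hpx : proj R x ∈ Submodule.span K (Set.range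
      fun n : {n : ι →₀ ℕ // ∀ i, (n i : ℕ∞) < h i} =>
        orderedMonomial (fun i => proj R (g i)) n.1) := hg.2 ▸ Submodule.mem_top
  obtain ⟨c, hc⟩ := Finsupp.mem_span_range_iff_exists_finsupp.mp hpx
  set y : T K := c.linearCombination K (fun n => orderedMonomial g n.1) with hy
  have hxy : x - y ∈ nicholsIdeal R := by
    rw [← proj_eq_zero, map_sub, ← hc, sub_eq_zero, hy, Finsupp.linearCombination_apply,
      map_finsuppSum]
    simp only [map_smul, map_orderedMonomial]
  have hcomp : ∀ k, proj R (component k x) = proj R (component k y) := by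
    intro k
    have := proj_eq_zero.mpr (component_mem_nicholsIdeal hR hxy k)
    rwa [map_sub, map_sub, sub_eq_zero] at this
  have hxs : proj R x = ∑ k ∈ (gradeHom K x).support, proj R (component k y) := by
    conv_lhs => rw [← sum_component x, map_sum]
    exact Finset.sum_congr rfl fun k _ => hcomp k
  change proj R x ∈ _
  rw [hxs]
  refine Submodule.sum_mem _ fun k hk => ?_
  have hkN : k ≤ N := (Polynomial.le_natDegree_of_mem_supp k hk).trans hx
  rw [hy, Finsupp.linearCombination_apply, map_finsuppSum, map_finsuppSum]
  refine Submodule.sum_mem _ fun n _ => ?_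
  simp only [map_smul]
  refine Submodule.smul_mem _ _ ?_
  rw [component_of_mem (orderedMonomial_mem_degreePart hd n.1)]
  split_ifs with hkn
  · rw [map_orderedMonomial]
    exact Submodule.subset_span ⟨n.1, ⟨n.2, hkn ▸ hkN⟩, rfl⟩
  · rw [map_zero]
    exact zero_mem _

theorem GKdim_eq_card [Fintype ι] (hR : BraidCoeff R) {g : ι → T K} {h : ι → ℕ∞} {d : ι → ℕ}
    (hd : ∀ i, g i ∈ degreePart K (d i)) (hd1 : ∀ i, 1 ≤ d i) (hh : ∀ i, h i = 2 ∨ h i = ⊤)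
    (hg : IsPBWBasis K (fun i => proj R (g i)) h) :
    GKdim K (NicholsAlgebra R) = (Finset.univ.filter fun i => h i = ⊤).card := by
  classical
  have h0 : ∀ i, 0 < h i := fun i => by rcases hh i with h | h <;> simp [h]
  have : Nontrivial (NicholsAlgebra R) := by
    refine ⟨⟨_, 0, hg.1.ne_zero ⟨0, fun i => by simpa using h0 i⟩⟩⟩
  refine le_antisymm (GKdim_le _ fun W hW => ?_)
    (card_le_GKdim hg _ (fun i hi => (Finset.mem_filter.mp hi).2) h0)
  set r := (Finset.univ.filter fun i => h i = ⊤).card with hr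
  obtain ⟨m, hm⟩ := exists_le_map_degreeLE (hW)
  refine ⟨2 ^ Fintype.card ι * ((m : ℝ) + 1) ^ r, by positivity, fun n hn => ?_⟩
  have hle : (1 ⊔ W) ^ n ≤ (degreeLE K (m * n)).map (proj R).toLinearMap := by
    have h1 : (1 ⊔ W) ≤ (degreeLE K m).map (proj R).toLinearMap := by
      refine sup_le (Submodule.one_le.mpr ⟨1, ?_, map_one (proj R)⟩) hm
      simp [degreeLE]
    calc (1 ⊔ W) ^ n ≤ ((degreeLE K m).map (proj R).toLinearMap) ^ n := pow_le_pow_left' h1 n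
      _ = (degreeLE K m ^ n).map (proj R).toLinearMap := (Submodule.map_pow _ _ _).symm
      _ ≤ _ := Submodule.map_mono (degreeLE_pow_le m n)
  set B : ι → Finset ℕ := fun i => Finset.range (if h i = ⊤ then m * n + 1 else 2) with hB
  set F : Finset (NicholsAlgebra R) := (Fintype.piFinset B).image fun f =>
    orderedMonomial (fun i => proj R (g i)) (Finsupp.equivFunOnFinite.symm f) with hF
  have hspan : (1 ⊔ W) ^ n ≤ Submodule.span K (F : Set (NicholsAlgebra R)) := by
    refine (hle.trans (map_degreeLE_le_span hR hd hg _)).trans (Submodule.span_mono ?_)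
    rintro _ ⟨k, ⟨hk, hkd⟩, rfl⟩
    rw [hF, Finset.coe_image]
    refine ⟨k, ?_, by simp⟩
    rw [Finset.mem_coe, Fintype.mem_piFinset]
    intro i
    rw [hB, Finset.mem_range]
    rcases hh i with h2 | ht
    · have := hk i
      rw [h2] at this
      simp only [h2, ENat.ofNat_ne_top, if_false]
      exact_mod_cast this
    · simp only [ht, if_true]
      rw [Finsupp.sum_fintype _ _ (by simp)] at hkd
      have h1 : k i * d i ≤ ∑ i, k i * d i :=
        Finset.single_le_sum (f := fun i => k i * d i) (fun _ _ => Nat.zero_le _) (Finset.mem_univ i)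
      have := Nat.mul_le_mul_left (k i) (hd1 i)
      omega
  have hfin : Module.finrank K ↥((1 ⊔ W) ^ n) ≤ 2 ^ Fintype.card ι * ((m + 1) * n) ^ r := by
    calc Module.finrank K ↥((1 ⊔ W) ^ n)
        ≤ Module.finrank K ↥(Submodule.span K (F : Set (NicholsAlgebra R))) :=
          Submodule.finrank_mono hspan
      _ ≤ F.card := finrank_span_finset_le_card F
      _ ≤ ∏ i, (B i).card := Finset.card_image_le.trans (Fintype.card_piFinset B).le
      _ ≤ ∏ i, 2 * (if h i = ⊤ then (m + 1) * n else 1) := by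
          refine Finset.prod_le_prod' fun i _ => ?_
          simp only [hB, Finset.card_range]
          split_ifs
          · nlinarith
          · norm_num
      _ = 2 ^ Fintype.card ι * ((m + 1) * n) ^ r := by
          rw [Finset.prod_mul_distrib, Finset.prod_const, Finset.card_univ, Finset.prod_ite,
            Finset.prod_const, Finset.prod_const_one, mul_one]
  calc (Module.finrank K ↥((1 ⊔ W) ^ n) : ℝ) ≤ (2 ^ Fintype.card ι * ((m + 1) * n) ^ r : ℕ) := by
        exact_mod_cast hfin
    _ = _ := by push_cast; rw [mul_pow]; ring

end GradedGrowth

/-! ### Straightening words -/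

section Straightening

variable {K : Type u} [Field K] {A : Type*} [Ring A] [Algebra K A] (X : Fin 3 → A)

/-- The weight of a word, where `x_i` has weight `i` and indices start from `0`. -/
def weight (l : List (Fin 3)) : ℕ := (l.map Fin.val).sum

@[simp] theorem weight_nil : weight [] = 0 := rfl

@[simp] theorem weight_cons (i : Fin 3) (l : List (Fin 3)) : weight (i :: l) = i.val + weight l := by
  simp [weight]

@[simp] theorem weight_append (l l' : List (Fin 3)) : weight (l ++ l') = weight l + weight l' := by
  simp [weight]

theorem weight_perm {l l' : List (Fin 3)} (h : l.Perm l') : weight l = weight l' :=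
  (h.map _).sum_eq

/-- The span of the words `v` with `weight v + s < w`. -/
def weightLT (s w : ℕ) : Submodule K A :=
  Submodule.span K ((fun v : List (Fin 3) => (v.map X).prod) '' {v | weight v + s < w})

variable {X}

theorem word_mem_weightLT {s w : ℕ} {v : List (Fin 3)} (h : weight v + s < w) :
    (v.map X).prod ∈ weightLT (K := K) X s w := Submodule.subset_span ⟨v, h, rfl⟩

theorem word_mul_mem_weightLT {s w s' w' : ℕ} (l : List (Fin 3)) (h : weight l + w + s' ≤ w' + s)
    {x : A} (hx : x ∈ weightLT (K := K) X s w) : (l.map X).prod * x ∈ weightLT (K := K) X s' w' := by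
  refine Submodule.span_induction (p := fun x _ => (l.map X).prod * x ∈ weightLT (K := K) X s' w')
    ?_ (by simp) (fun x y _ _ hx hy => by simpa [mul_add] using add_mem hx hy)
    (fun c x _ hx => by simpa using Submodule.smul_mem _ c hx) hx
  rintro _ ⟨v, hv, rfl⟩
  simp only [← List.prod_append, ← List.map_append]
  refine word_mem_weightLT ?_
  have hv' : weight v + s < w := hv
  rw [weight_append]
  omega

theorem mul_word_mem_weightLT {s w s' w' : ℕ} (l : List (Fin 3)) (h : weight l + w + s' ≤ w' + s)
    {x : A} (hx : x ∈ weightLT (K := K) X s w) : x * (l.map X).prod ∈ weightLT (K := K) X s' w' := by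
  refine Submodule.span_induction (p := fun x _ => x * (l.map X).prod ∈ weightLT (K := K) X s' w')
    ?_ (by simp) (fun x y _ _ hx hy => by simpa [add_mul] using add_mem hx hy)
    (fun c x _ hx => by simpa using Submodule.smul_mem _ c hx) hx
  rintro _ ⟨v, hv, rfl⟩
  simp only [← List.prod_append, ← List.map_append]
  refine word_mem_weightLT ?_
  have hv' : weight v + s < w := hv
  rw [weight_append]
  omega

theorem exists_perm_sub_mem
    (hc : ∀ i j, ∃ c : K, X i * X j - c • (X j * X i) ∈ weightLT (K := K) X 0 (i.val + j.val))
    {l l' : List (Fin 3)} (h : l.Perm l') :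
    ∃ c : K, (l.map X).prod - c • (l'.map X).prod ∈ weightLT (K := K) X 0 (weight l) := by
  induction h with
  | nil => exact ⟨1, by simp⟩
  | @cons a l l' _ ih =>
    obtain ⟨c, hc⟩ := ih
    refine ⟨c, ?_⟩
    have := word_mul_mem_weightLT (s' := 0) (w' := weight (a :: l)) [a] (by simp) hc
    simpa [mul_sub] using this
  | swap a b l =>
    obtain ⟨c, hc⟩ := hc b a
    refine ⟨c, ?_⟩
    have := mul_word_mem_weightLT (s' := 0) (w' := weight (b :: a :: l)) l
      (by simp; omega) hc
    simpa [sub_mul, mul_assoc] using this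
  | @trans l₁ l₂ l₃ h₁ _ ih ih' =>
    obtain ⟨c, hc⟩ := ih
    obtain ⟨c', hc'⟩ := ih'
    refine ⟨c * c', ?_⟩
    rw [← weight_perm h₁] at hc'
    have := add_mem hc (Submodule.smul_mem _ c hc')
    rwa [smul_sub, smul_smul, sub_add_sub_cancel] at this

theorem word_mem_span {h : Fin 3 → ℕ∞}
    (hc : ∀ i j, ∃ c : K, X i * X j - c • (X j * X i) ∈ weightLT (K := K) X 0 (i.val + j.val))
    (hsq : ∀ i, h i = ⊤ ∨ (h i = 2 ∧ X i * X i ∈ weightLT (K := K) X 0 (i.val + i.val)))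
    (l : List (Fin 3)) :
    (l.map X).prod ∈ Submodule.span K (Set.range
      fun n : {n : Fin 3 →₀ ℕ // ∀ i, (n i : ℕ∞) < h i} => orderedMonomial X n.1) := by
  induction hw : weight l using Nat.strong_induction_on generalizing l with
  | _ w ih =>
    have hlow : weightLT (K := K) X 0 w ≤ Submodule.span K (Set.range
        fun n : {n : Fin 3 →₀ ℕ // ∀ i, (n i : ℕ∞) < h i} => orderedMonomial X n.1) := by
      refine Submodule.span_le.mpr ?_
      rintro _ ⟨v, hv, rfl⟩
      exact ih (weight v) hv v rfl
    have reduce : ∀ l', l.Perm l' → (l'.map X).prod ∈ Submodule.span K (Set.range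
        fun n : {n : Fin 3 →₀ ℕ // ∀ i, (n i : ℕ∞) < h i} => orderedMonomial X n.1) →
        (l.map X).prod ∈ Submodule.span K (Set.range
        fun n : {n : Fin 3 →₀ ℕ // ∀ i, (n i : ℕ∞) < h i} => orderedMonomial X n.1) := by
      intro l' hl' hmem
      obtain ⟨c, hc⟩ := exists_perm_sub_mem hc hl'
      rw [hw] at hc
      have := add_mem (hlow hc) (Submodule.smul_mem _ c hmem)
      rwa [sub_add_cancel] at this
    have hsort : (l.insertionSort (· ≤ ·)).Pairwise (· ≤ ·) := List.pairwise_insertionSort (· ≤ ·) l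
    by_cases hn : ∀ i, ((Multiset.toFinsupp
        (l.insertionSort (· ≤ ·) : Multiset (Fin 3)) i : ℕ) : ℕ∞) < h i
    · exact reduce _ (List.perm_insertionSort (· ≤ ·) l).symm
        (Submodule.subset_span ⟨⟨_, hn⟩, (prod_map_eq_orderedMonomial X hsort).symm⟩)
    · push Not at hn
      obtain ⟨i, hi⟩ := hn
      rcases hsq i with ht | ⟨h2, h0⟩
      · rw [ht] at hi
        exact absurd hi (by simp)
      · rw [h2, Multiset.toFinsupp_apply, Multiset.coe_count] at hi
        obtain ⟨l', hl'⟩ := exists_perm_cons_cons (i := i) (l := l.insertionSort (· ≤ ·))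
          (by exact_mod_cast hi)
        have hl'' := (List.perm_insertionSort (· ≤ ·) l).symm.trans hl'
        refine reduce _ hl'' (hlow ?_)
        have hwl := weight_perm hl''
        simp only [weight_cons] at hwl
        have := mul_word_mem_weightLT (s' := 0) (w' := w) l' (by omega) h0
        simpa [mul_assoc] using this

end Straightening

section PresentedSpan

variable {K : Type u} [Field K]

theorem toPresented_quad (rels : Set (T K)) (r : Matrix (Fin 3) (Fin 3) K) :
    toPresented rels (quad r) = ∑ i, ∑ j, r i j •
      (toPresented rels (FreeAlgebra.ι K i) * toPresented rels (FreeAlgebra.ι K j)) := by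
  simp only [quad, map_sum, map_smul, map_mul]

/-- Quadratic relations whose leading terms are those of a (skew) polynomial algebra, possibly with
some squares, allow to write every element through ordered monomials. -/
theorem span_eq_top_of_quad {rels : Set (T K)} {t : K} (ht : t ^ 2 = 1) {h : Fin 3 → ℕ∞}
    (hc : ∀ i j : Fin 3, i < j → ∃ r : Matrix (Fin 3) (Fin 3) K, quad r ∈ rels ∧ r j i = 1 ∧
      r i j = -t ∧ ∀ k l : Fin 3, (k, l) ≠ (j, i) → (k, l) ≠ (i, j) →
        i.val + j.val ≤ k.val + l.val → r k l = 0)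
    (hsq : ∀ i, h i = ⊤ ∨ (h i = 2 ∧ ∃ r : Matrix (Fin 3) (Fin 3) K, quad r ∈ rels ∧ r i i = 1 ∧
      ∀ k l : Fin 3, (k, l) ≠ (i, i) → i.val + i.val ≤ k.val + l.val → r k l = 0)) :
    Submodule.span K (Set.range fun n : {n : Fin 3 →₀ ℕ // ∀ i, (n i : ℕ∞) < h i} =>
      orderedMonomial (fun i => toPresented rels ((![x₁, x₂, x₃] : Fin 3 → T K) i)) n.1) = ⊤ := by
  set X : Fin 3 → Presented rels := fun i => toPresented rels (FreeAlgebra.ι K i) with hX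
  have hX' : (fun i => toPresented rels ((![x₁, x₂, x₃] : Fin 3 → T K) i)) = X := by
    funext i
    fin_cases i <;> rfl
  rw [hX']
  have hlow : ∀ (r : Matrix (Fin 3) (Fin 3) K) (w : ℕ),
      (∀ k l : Fin 3, w ≤ k.val + l.val → r k l = 0) →
      ∑ k, ∑ l, r k l • (X k * X l) ∈ weightLT (K := K) X 0 w := by
    intro r w hr
    refine sum_mem fun k _ => sum_mem fun l _ => ?_
    by_cases hkl : w ≤ k.val + l.val
    · rw [hr k l hkl, zero_smul]
      exact zero_mem _
    · refine Submodule.smul_mem _ _ ?_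
      have := word_mem_weightLT (K := K) (X := X) (s := 0) (w := w) (v := [k, l]) (by simp; omega)
      simpa using this
  have hsum : ∀ (r : Matrix (Fin 3) (Fin 3) K) (i j : Fin 3) (c : K),
      ∑ k, ∑ l, (Matrix.single i j c) k l • (X k * X l) = c • (X i * X j) := by
    intro r i j c
    rw [Finset.sum_eq_single i, Finset.sum_eq_single j]
    · simp
    · intro l _ hl; simp [Ne.symm hl]
    · simp
    · intro k _ hk; simp [Ne.symm hk]
    · simp
  have hlt : ∀ i j : Fin 3, i < j →
      X j * X i - t • (X i * X j) ∈ weightLT (K := K) X 0 (i.val + j.val) := by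
    intro i j hij
    obtain ⟨r, hr, h1, h2, h3⟩ := hc i j hij
    have h0 := toPresented_of_mem hr
    rw [toPresented_quad] at h0
    have := hlow (r - Matrix.single j i 1 - Matrix.single i j (-t)) (i.val + j.val) (by
      intro k l hkl
      by_cases e1 : (k, l) = (j, i)
      · obtain ⟨rfl, rfl⟩ := Prod.mk.inj e1
        simp [h1, hij.ne]
      · by_cases e2 : (k, l) = (i, j)
        · obtain ⟨rfl, rfl⟩ := Prod.mk.inj e2
          simp [h2, hij.ne']
        · rw [Matrix.sub_apply, Matrix.sub_apply, h3 k l e1 e2 hkl, Matrix.single_apply,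
            Matrix.single_apply, if_neg, if_neg]
          · simp
          · rintro ⟨rfl, rfl⟩; exact e2 rfl
          · rintro ⟨rfl, rfl⟩; exact e1 rfl)
    simp only [Matrix.sub_apply, sub_smul, Finset.sum_sub_distrib] at this
    rw [hsum r, hsum r, h0] at this
    rw [← neg_mem_iff]
    convert this using 1
    simp only [neg_smul, one_smul]
    abel
  rw [eq_top_iff]
  have hword : ∀ l : List (Fin 3), (l.map X).prod ∈ Submodule.span K (Set.range
      fun n : {n : Fin 3 →₀ ℕ // ∀ i, (n i : ℕ∞) < h i} => orderedMonomial X n.1) := by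
    refine word_mem_span ?_ ?_
    · intro i j
      rcases lt_trichotomy i j with hij | rfl | hij
      · refine ⟨t, ?_⟩
        have := Submodule.smul_mem _ (-t) (hlt i j hij)
        convert this using 1
        rw [smul_sub, smul_smul, neg_mul, ← pow_two, ht, neg_smul, neg_smul, one_smul]
        abel
      · exact ⟨1, by simp⟩
      · exact ⟨t, by rw [add_comm]; exact hlt j i hij⟩
    · intro i
      rcases hsq i with h | ⟨h2, r, hr, h1, h3⟩
      · exact Or.inl h
      · refine Or.inr ⟨h2, ?_⟩
        have h0 := toPresented_of_mem hr
        rw [toPresented_quad] at h0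
        have := hlow (r - Matrix.single i i 1) (i.val + i.val) (by
          intro k l hkl
          by_cases e1 : (k, l) = (i, i)
          · obtain ⟨rfl, rfl⟩ := Prod.mk.inj e1
            simp [h1]
          · rw [Matrix.sub_apply, h3 k l e1 hkl, Matrix.single_apply, if_neg]
            · simp
            · rintro ⟨rfl, rfl⟩; exact e1 rfl)
        simp only [Matrix.sub_apply, sub_smul, Finset.sum_sub_distrib] at this
        rw [hsum r, h0, zero_sub, one_smul, neg_mem_iff] at this
        exact this
  rintro y -
  obtain ⟨x, rfl⟩ := toPresented_surjective rels y
  have key : ∀ l : List (Fin 3), toPresented rels ((l.map (FreeAlgebra.ι K)).prod) =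
      (l.map X).prod := by
    intro l
    rw [map_list_prod, List.map_map]
    rfl
  suffices hx : ∀ l : List (Fin 3), toPresented rels ((l.map (FreeAlgebra.ι K)).prod * x) ∈
      Submodule.span K (Set.range
      fun n : {n : Fin 3 →₀ ℕ // ∀ i, (n i : ℕ∞) < h i} => orderedMonomial X n.1) by
    simpa using hx []
  induction x using left_induction with
  | one => intro l; rw [mul_one, key]; exact hword l
  | smul c w hw => intro l; rw [mul_smul_comm, map_smul]; exact Submodule.smul_mem _ _ (hw l)
  | add v w hv hw => intro l; rw [mul_add, map_add]; exact add_mem (hv l) (hw l)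
  | mul i w hw => intro l; rw [← mul_assoc]; simpa using hw (l ++ [i])

end PresentedSpan

/-! ### Leading terms of skew derivations -/

section LeadingTerms

variable {K : Type u} [Field K] {R : Matrix (Fin 9) (Fin 9) K} {t : K}

/-- The word `x_{i_1} ⋯ x_{i_n}`. -/
abbrev word (K : Type u) [Field K] (l : List (Fin 3)) : T K := (l.map (FreeAlgebra.ι K)).prod

/-- The span of the words `v` with `weight v + s < w` in the tensor algebra. -/
abbrev lower (K : Type u) [Field K] (s w : ℕ) : Submodule K (T K) :=
  weightLT (K := K) (FreeAlgebra.ι K) s w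

/-- The matrix of `t` times the flip. -/
abbrev flipMatrix (t : K) : Matrix (Fin 9) (Fin 9) K := t • 1

theorem coeff_flipMatrix (i j m l : Fin 3) :
    coeff (flipMatrix t) i j m l = if m = j ∧ l = i then t else 0 := by
  rw [coeff, flipMatrix, Matrix.smul_apply, Matrix.one_apply]
  have : (⟨3 * m.val + l.val, by omega⟩ : Fin 9) = ⟨3 * j.val + i.val, by omega⟩ ↔ m = j ∧ l = i := by
    simp only [Fin.ext_iff]
    omega
  simp only [this]
  split_ifs <;> simp

theorem past_flipMatrix_word (i l : Fin 3) (u : List (Fin 3)) :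
    past (flipMatrix t) i l (word K u) = if i = l then t ^ u.length • word K u else 0 := by
  induction u generalizing i with
  | nil =>
    rw [word, List.map_nil, List.prod_nil, past_one]
    simp
  | cons j u ih =>
    rw [word, List.map_cons, List.prod_cons, past_ι_mul]
    simp only [ih, coeff_flipMatrix]
    simp only [ite_and, ite_smul, zero_smul, mul_ite, mul_zero, Finset.sum_ite_eq',
      Finset.mem_univ, if_true]
    split_ifs with h
    · simp [pow_succ, smul_smul, mul_comm]
    · rw [smul_zero]

theorem lower_mono {s w s' w' : ℕ} (h : w + s' ≤ w' + s) : lower K s w ≤ lower K s' w' := by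
  intro x hx
  have := word_mul_mem_weightLT (s' := s') (w' := w') [] (by simpa using h) hx
  simpa using this

theorem ι_mul_mem_lower {s w s' w' : ℕ} (i : Fin 3) (h : i.val + w + s' ≤ w' + s) {x : T K}
    (hx : x ∈ lower K s w) : FreeAlgebra.ι K i * x ∈ lower K s' w' := by
  have := word_mul_mem_weightLT (s' := s') (w' := w') [i] (by simpa using h) hx
  simpa using this

theorem past_flipMatrix_mem_lower (i l : Fin 3) (u : List (Fin 3)) :
    past (flipMatrix t) i l (word K u) ∈ lower K l.val (weight u + i.val + 1) := by
  rw [past_flipMatrix_word]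
  split_ifs with h
  · refine Submodule.smul_mem _ _ (word_mem_weightLT ?_)
    rw [h]
    omega
  · exact zero_mem _

theorem past_sub_mem_lower (h : Triangular R t) (i l : Fin 3) (u : List (Fin 3)) :
    past R i l (word K u) - past (flipMatrix t) i l (word K u) ∈
      lower K l.val (weight u + i.val) := by
  induction u generalizing i with
  | nil =>
    rw [word, List.map_nil, List.prod_nil, past_one, past_one, sub_self]
    exact zero_mem _
  | cons j u ih =>
    rw [word, List.map_cons, List.prod_cons, past_ι_mul, past_ι_mul, ← Finset.sum_sub_distrib]
    refine sum_mem fun s _ => ?_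
    rw [← Finset.sum_sub_distrib]
    refine sum_mem fun m _ => ?_
    rw [coeff_flipMatrix, weight_cons]
    by_cases hms : m = j ∧ s = i
    · obtain ⟨rfl, rfl⟩ := hms
      rw [if_pos ⟨rfl, rfl⟩, h.diag, ← smul_sub, ← mul_sub]
      exact Submodule.smul_mem _ _ (ι_mul_mem_lower m (by omega) (ih s))
    · rw [if_neg hms, zero_smul, sub_zero]
      by_cases hw : i.val + j.val ≤ m.val + s.val
      · rw [h.eq_zero i j m s (by rintro hne; exact hms (Prod.mk.inj hne)) hw, zero_smul]
        exact zero_mem _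
      · refine Submodule.smul_mem _ _ (ι_mul_mem_lower (s := l.val) (w := weight u + s.val + 1) m
          (by omega) ?_)
        have := add_mem (lower_mono (s' := l.val) (w' := weight u + s.val + 1) (by omega) (ih s))
          (past_flipMatrix_mem_lower (t := t) s l u)
        rwa [sub_add_cancel] at this

theorem der_flipMatrix_mem_lower (l : Fin 3) (u : List (Fin 3)) :
    der (flipMatrix t) l (word K u) ∈ lower K l.val (weight u + 1) := by
  induction u with
  | nil =>
    rw [word, List.map_nil, List.prod_nil, der_one]
    exact zero_mem _
  | cons j u ih =>
    rw [word, List.map_cons, List.prod_cons, der_ι_mul, weight_cons]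
    refine add_mem (ι_mul_mem_lower j (by omega) ih) ?_
    exact lower_mono (by omega) (past_flipMatrix_mem_lower j l u)

theorem der_sub_mem_lower (h : Triangular R t) (l : Fin 3) (u : List (Fin 3)) :
    der R l (word K u) - der (flipMatrix t) l (word K u) ∈ lower K l.val (weight u) := by
  induction u with
  | nil =>
    rw [word, List.map_nil, List.prod_nil, der_one, der_one, sub_zero]
    exact zero_mem _
  | cons j u ih =>
    rw [word, List.map_cons, List.prod_cons, der_ι_mul, der_ι_mul, weight_cons, add_sub_add_comm,
      ← mul_sub]
    refine add_mem (ι_mul_mem_lower j (by omega) ih) ?_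
    exact lower_mono (by omega) (past_sub_mem_lower h j l u)

theorem map_lower_le {f : T K →ₗ[K] T K} {s w s' w' : ℕ}
    (h : ∀ u, weight u + s < w → f (word K u) ∈ lower K s' w') {x : T K} (hx : x ∈ lower K s w) :
    f x ∈ lower K s' w' := by
  have : lower K s w ≤ (lower K s' w').comap f := by
    refine Submodule.span_le.mpr ?_
    rintro _ ⟨u, hu, rfl⟩
    exact h u hu
  exact this hx

theorem der_flipMatrix_mem (l : Fin 3) {s w : ℕ} {x : T K} (hx : x ∈ lower K s w) :
    der (flipMatrix t) l x ∈ lower K (s + l.val) w :=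
  map_lower_le (fun u hu => lower_mono (by omega) (der_flipMatrix_mem_lower l u)) hx

theorem der_sub_der_mem (h : Triangular R t) (l : Fin 3) {s w : ℕ} {x : T K}
    (hx : x ∈ lower K s (w + 1)) :
    der R l x - der (flipMatrix t) l x ∈ lower K (s + l.val) w :=
  map_lower_le (f := der R l - der (flipMatrix t) l)
    (fun u hu => lower_mono (by omega) (der_sub_mem_lower h l u)) hx

theorem der_mem_lower (h : Triangular R t) (l : Fin 3) {s w : ℕ} {x : T K} (hx : x ∈ lower K s w) :
    der R l x ∈ lower K (s + l.val) w := by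
  have := add_mem (der_sub_der_mem h l (lower_mono (w' := w + 1) (s' := s) (by omega) hx))
    (der_flipMatrix_mem (t := t) l hx)
  rwa [sub_add_cancel] at this

theorem symm_eq_zero_of_mem_lower (h : Triangular R t) (u : List (Fin 3)) {s w : ℕ} {x : T K}
    (hx : x ∈ lower K s w) (hw : w ≤ weight u + s) : symm R u x = 0 := by
  induction u generalizing s x with
  | nil =>
    have hbot : lower K s w = ⊥ := by
      refine Submodule.span_eq_bot.mpr ?_
      rintro _ ⟨v, hv, rfl⟩
      have hv' : weight v + s < w := hv
      simp only [weight_nil] at hw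
      omega
    rw [hbot, Submodule.mem_bot] at hx
    rw [hx, map_zero]
  | cons l u ih =>
    rw [symm_cons]
    exact ih (der_mem_lower h l hx) (by rw [weight_cons] at hw; omega)

/-- On words of weight at most that of `u`, the functional `ε ∂_u` only depends on `t`. -/
theorem symm_eq_symm_flipMatrix (h : Triangular R t) (u : List (Fin 3)) {s w : ℕ} {x : T K}
    (hx : x ∈ lower K s (w + 1)) (hw : w = weight u + s) : symm R u x = symm (flipMatrix t) u x := by
  induction u generalizing s x with
  | nil => rfl
  | cons l u ih =>
    rw [weight_cons] at hw
    rw [symm_cons, symm_cons, ← ih (der_flipMatrix_mem l hx) (by omega)]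
    have := symm_eq_zero_of_mem_lower h u (der_sub_der_mem h l hx) (by omega)
    rwa [map_sub, sub_eq_zero] at this

/-- The abelianization of the tensor algebra. -/
def abelianize (K : Type u) [Field K] : T K →ₐ[K] MvPolynomial (Fin 3) K :=
  FreeAlgebra.lift K MvPolynomial.X

theorem past_flipMatrix_one (i l : Fin 3) (x : T K) :
    past (flipMatrix (1 : K)) i l x = if i = l then x else 0 := by
  induction x using left_induction generalizing i with
  | one => exact past_one _ i l
  | smul c w hw => rw [map_smul, hw]; split_ifs <;> simp
  | add v w hv hw => rw [map_add, hv, hw]; split_ifs <;> simp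
  | mul j w hw =>
    rw [past_ι_mul]
    simp only [hw, coeff_flipMatrix]
    simp only [ite_and, ite_smul, zero_smul, mul_ite, mul_zero, Finset.sum_ite_eq',
      Finset.mem_univ, if_true, one_smul]

theorem abelianize_der (l : Fin 3) (x : T K) :
    abelianize K (der (flipMatrix (1 : K)) l x) = MvPolynomial.pderiv l (abelianize K x) := by
  induction x using left_induction with
  | one => simp
  | smul c w hw => rw [map_smul, map_smul, map_smul, hw, Derivation.map_smul]
  | add v w hv hw => simp only [map_add, hv, hw]
  | mul j w hw =>
    rw [der_ι_mul, past_flipMatrix_one, map_add, map_mul, map_mul, hw]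
    simp only [abelianize, FreeAlgebra.lift_ι_apply, Derivation.leibniz, smul_eq_mul,
      MvPolynomial.pderiv_X, Pi.single_apply]
    split_ifs <;> simp

theorem counit_eq_coeff_abelianize (x : T K) :
    counit x = MvPolynomial.coeff 0 (abelianize K x) := by
  induction x using left_induction with
  | one => simp
  | smul c w hw => simp [hw]
  | add v w hv hw => simp [hv, hw]
  | mul j w hw => simp [abelianize, ← MvPolynomial.constantCoeff_eq]

theorem exists_symm_flipMatrix_one [CharZero K] (u : List (Fin 3)) : ∃ c : K, c ≠ 0 ∧ ∀ x : T K,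
    symm (flipMatrix (1 : K)) u x =
      c * MvPolynomial.coeff (Multiset.toFinsupp (u : Multiset (Fin 3))) (abelianize K x) := by
  have key : ∀ (u : List (Fin 3)) (m : Fin 3 →₀ ℕ), ∃ c : K, c ≠ 0 ∧ ∀ x : T K,
      MvPolynomial.coeff m (abelianize K (iterDer (flipMatrix (1 : K)) u x)) =
      c * MvPolynomial.coeff (m + Multiset.toFinsupp (u : Multiset (Fin 3))) (abelianize K x) := by
    intro u
    induction u with
    | nil => intro m; exact ⟨1, one_ne_zero, fun x => by simp [iterDer]⟩
    | cons l u ih =>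
      intro m
      obtain ⟨c, hc, h⟩ := ih m
      refine ⟨c * (((m + Multiset.toFinsupp (u : Multiset (Fin 3))) l : ℕ) + 1 : K),
        mul_ne_zero hc (Nat.cast_add_one_ne_zero _), fun x => ?_⟩
      rw [iterDer, LinearMap.comp_apply, h, abelianize_der, MvPolynomial.coeff_pderiv,
        ← Multiset.cons_coe, ← Multiset.singleton_add, map_add, Multiset.toFinsupp_singleton,
        add_assoc, add_comm (Multiset.toFinsupp _) (Finsupp.single l 1)]
      ring
  obtain ⟨c, hc, h⟩ := key u 0
  refine ⟨c, hc, fun x => ?_⟩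
  rw [symm, LinearMap.comp_apply]
  change counit _ = _
  rw [counit_eq_coeff_abelianize, h, zero_add]

end LeadingTerms

/-! ### Independence of ordered monomials for `t = 1` -/

section Polynomial

variable {K : Type u} [Field K] {R : Matrix (Fin 9) (Fin 9) K}

theorem abelianize_word (l : List (Fin 3)) :
    abelianize K (word K l) =
      MvPolynomial.monomial (Multiset.toFinsupp (l : Multiset (Fin 3))) 1 := by
  induction l with
  | nil => simp [word]
  | cons i l ih =>
    rw [word, List.map_cons, List.prod_cons, map_mul, ih, ← Multiset.cons_coe,
      ← Multiset.singleton_add, map_add, Multiset.toFinsupp_singleton, abelianize,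
      FreeAlgebra.lift_ι_apply, MvPolynomial.X, MvPolynomial.monomial_mul, one_mul]

/-- The sorted word with exponents `n`. -/
def sortedWord (n : Fin 3 →₀ ℕ) : List (Fin 3) := (Finsupp.toMultiset n).sort (· ≤ ·)

theorem toFinsupp_sortedWord (n : Fin 3 →₀ ℕ) :
    Multiset.toFinsupp (sortedWord n : Multiset (Fin 3)) = n := by
  rw [sortedWord, Multiset.sort_eq, Finsupp.toMultiset_toFinsupp]

theorem word_sortedWord (n : Fin 3 →₀ ℕ) :
    word K (sortedWord n) = orderedMonomial (FreeAlgebra.ι K) n := by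
  have h : (sortedWord n).Pairwise (· ≤ ·) := Multiset.pairwise_sort _ _
  rw [word, prod_map_eq_orderedMonomial _ h, toFinsupp_sortedWord]

theorem generators_eq : (![x₁, x₂, x₃] : Fin 3 → T K) = FreeAlgebra.ι K := by
  funext i
  fin_cases i <;> rfl

theorem linearIndependent_of_triangular_one [CharZero K] (h : Triangular R 1) (hR : BraidCoeff R)
    (ht : Fin 3 → ℕ∞) : LinearIndependent K fun n : {n : Fin 3 →₀ ℕ // ∀ i, (n i : ℕ∞) < ht i} =>
      orderedMonomial (fun i => proj R ((![x₁, x₂, x₃] : Fin 3 → T K) i)) n.1 := by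
  rw [generators_eq, linearIndependent_iff]
  intro c hc
  by_contra hne
  obtain ⟨a, ha, hmax⟩ := Finset.exists_max_image c.support (fun b => weight (sortedWord b.1))
    (Finsupp.support_nonempty_iff.mpr hne)
  set x : T K := c.linearCombination K (fun n => word K (sortedWord n.1)) with hx
  have hxJ : x ∈ kernelSubmodule R := by
    rw [← mem_nicholsIdeal hR, ← proj_eq_zero, ← hc, hx, Finsupp.linearCombination_apply,
      Finsupp.linearCombination_apply, map_finsuppSum]
    simp only [map_smul, word_sortedWord, map_orderedMonomial]
  have hxl : x ∈ lower K 0 (weight (sortedWord a.1) + 1) := by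
    rw [hx, Finsupp.linearCombination_apply]
    refine sum_mem fun b hb => Submodule.smul_mem _ _ (word_mem_weightLT ?_)
    have := hmax b hb
    omega
  have h1 := symm_eq_symm_flipMatrix h (sortedWord a.1) hxl (by simp)
  obtain ⟨C, hC, hCx⟩ := exists_symm_flipMatrix_one (K := K) (sortedWord a.1)
  rw [mem_kernelSubmodule.mp hxJ, hCx, toFinsupp_sortedWord] at h1
  have h2 : MvPolynomial.coeff a.1 (abelianize K x) = c a := by
    rw [hx, Finsupp.linearCombination_apply, map_finsuppSum, Finsupp.sum, MvPolynomial.coeff_sum,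
      Finset.sum_eq_single a]
    · rw [map_smul, abelianize_word, toFinsupp_sortedWord, MvPolynomial.coeff_smul,
        MvPolynomial.coeff_monomial, if_pos rfl, smul_eq_mul, mul_one]
    · intro b _ hb
      rw [map_smul, abelianize_word, toFinsupp_sortedWord, MvPolynomial.coeff_smul,
        MvPolynomial.coeff_monomial, if_neg fun h => hb (Subtype.ext h), smul_zero]
    · intro ha'
      exact absurd ha ha'
  rw [h2] at h1
  exact Finsupp.mem_support_iff.mp ha ((mul_eq_zero.mp h1.symm).resolve_left hC)

end Polynomial

/-! ### The skew derivations of the Nichols algebra -/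

section Descend

variable {K : Type u} [Field K] {R : Matrix (Fin 9) (Fin 9) K}

/-- A linear map which preserves the defining ideal, on the Nichols algebra. -/
def descend {M : Type*} [AddCommGroup M] [Module K M] (f : T K →ₗ[K] M)
    (h : ∀ x ∈ nicholsIdeal R, f x = 0) : NicholsAlgebra R →ₗ[K] M :=
  (LinearMap.ker (proj R).toLinearMap).liftQ f (fun x hx => h x (proj_eq_zero.mp hx)) ∘ₗ
    ((proj R).toLinearMap.quotKerEquivOfSurjective proj_surjective).symm.toLinearMap

theorem descend_proj {M : Type*} [AddCommGroup M] [Module K M] (f : T K →ₗ[K] M)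
    (h : ∀ x ∈ nicholsIdeal R, f x = 0) (x : T K) : descend f h (proj R x) = f x := by
  have : ((proj R).toLinearMap.quotKerEquivOfSurjective proj_surjective).symm (proj R x) =
      (LinearMap.ker (proj R).toLinearMap).mkQ x := by
    rw [LinearEquiv.symm_apply_eq]
    rfl
  rw [descend, LinearMap.comp_apply, LinearEquiv.coe_coe, this]
  rfl

variable (R) [hR : Fact (BraidCoeff R)]

/-- The generators of the Nichols algebra. -/
def gen (i : Fin 3) : NicholsAlgebra R := proj R (FreeAlgebra.ι K i)

/-- The skew derivations of the Nichols algebra. -/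
def nder (l : Fin 3) : NicholsAlgebra R →ₗ[K] NicholsAlgebra R :=
  descend ((proj R).toLinearMap ∘ₗ der R l) fun _ hx => proj_eq_zero.mpr
    ((mem_nicholsIdeal hR.out).mpr (der_mem_kernel ((mem_nicholsIdeal hR.out).mp hx) l))

/-- The components of the braiding with `V` on the Nichols algebra. -/
def npast (i l : Fin 3) : NicholsAlgebra R →ₗ[K] NicholsAlgebra R :=
  descend ((proj R).toLinearMap ∘ₗ past R i l) fun _ hx => proj_eq_zero.mpr
    ((mem_nicholsIdeal hR.out).mpr (past_mem_kernel hR.out ((mem_nicholsIdeal hR.out).mp hx) i l))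

/-- The counit of the Nichols algebra. -/
def ncounit : NicholsAlgebra R →ₗ[K] K :=
  descend (counit (K := K)).toLinearMap fun _ hx =>
    counit_eq_zero_of_mem ((mem_nicholsIdeal hR.out).mp hx)

variable {R}

theorem nder_proj (l : Fin 3) (x : T K) : nder R l (proj R x) = proj R (der R l x) :=
  descend_proj _ _ x

theorem npast_proj (i l : Fin 3) (x : T K) : npast R i l (proj R x) = proj R (past R i l x) :=
  descend_proj _ _ x

theorem ncounit_proj (x : T K) : ncounit R (proj R x) = counit x := descend_proj _ _ x

theorem nder_mul (l : Fin 3) (x y : NicholsAlgebra R) :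
    nder R l (x * y) = x * nder R l y + ∑ m, nder R m x * npast R m l y := by
  obtain ⟨x, rfl⟩ := proj_surjective x
  obtain ⟨y, rfl⟩ := proj_surjective y
  simp only [← map_mul, nder_proj, npast_proj, der_mul, map_add, map_sum]

theorem npast_mul (i l : Fin 3) (x y : NicholsAlgebra R) :
    npast R i l (x * y) = ∑ m, npast R i m x * npast R m l y := by
  obtain ⟨x, rfl⟩ := proj_surjective x
  obtain ⟨y, rfl⟩ := proj_surjective y
  simp only [← map_mul, npast_proj, past_mul, map_sum]

theorem ncounit_mul (x y : NicholsAlgebra R) : ncounit R (x * y) = ncounit R x * ncounit R y := by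
  obtain ⟨x, rfl⟩ := proj_surjective x
  obtain ⟨y, rfl⟩ := proj_surjective y
  simp only [← map_mul, ncounit_proj]

@[simp] theorem nder_one (l : Fin 3) : nder R l 1 = 0 := by
  rw [← map_one (proj R), nder_proj, der_one, map_zero]

@[simp] theorem ncounit_one : ncounit R 1 = 1 := by
  rw [← map_one (proj R), ncounit_proj, map_one]

@[simp] theorem ncounit_gen (i : Fin 3) : ncounit R (gen R i) = 0 := by
  rw [gen, ncounit_proj, counit_ι]

theorem npast_one (i l : Fin 3) : npast R i l 1 = if i = l then 1 else 0 := by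
  rw [← map_one (proj R), npast_proj, past_one]
  split_ifs <;> simp

theorem nder_gen (l i : Fin 3) : nder R l (gen R i) = if i = l then 1 else 0 := by
  rw [gen, nder_proj, der_ι]
  split_ifs <;> simp

theorem npast_gen (i j l : Fin 3) :
    npast R i l (gen R j) = ∑ m, coeff R i j m l • gen R m := by
  rw [gen, npast_proj, past_ι]
  simp only [map_sum, map_smul, gen]

theorem nder_gen_mul (l i : Fin 3) (x : NicholsAlgebra R) :
    nder R l (gen R i * x) = gen R i * nder R l x + npast R i l x := by
  rw [nder_mul]
  simp [nder_gen]

/-- An element without constant term which is killed by all skew derivations vanishes. -/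
theorem eq_zero_of_nder {x : NicholsAlgebra R} (h0 : ncounit R x = 0)
    (h : ∀ l, nder R l x = 0) : x = 0 := by
  obtain ⟨x, rfl⟩ := proj_surjective x
  rw [proj_eq_zero, mem_nicholsIdeal hR.out]
  refine mem_kernel_of_der (by rwa [ncounit_proj] at h0) fun l => ?_
  rw [← mem_nicholsIdeal hR.out, ← proj_eq_zero, ← nder_proj, h]

theorem eq_of_nder {x y : NicholsAlgebra R} (h0 : ncounit R x = ncounit R y)
    (h : ∀ l, nder R l x = nder R l y) : x = y := by
  rw [← sub_eq_zero]
  exact eq_zero_of_nder (by rw [map_sub, h0, sub_self]) fun l => by rw [map_sub, h, sub_self]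

/-- Linear relations between images of homogeneous elements split into homogeneous parts. -/
theorem sum_filter_degree_eq_zero {σ : Type*} (s : Finset σ) (c : σ → K) (y : σ → T K) (d : σ → ℕ)
    (hy : ∀ n, y n ∈ degreePart K (d n)) (h : ∑ n ∈ s, c n • proj R (y n) = 0) (k : ℕ) :
    ∑ n ∈ s with d n = k, c n • proj R (y n) = 0 := by
  have h1 : ∑ n ∈ s, c n • y n ∈ nicholsIdeal R := by
    rw [← proj_eq_zero, ← h]
    simp
  have h2 := proj_eq_zero.mpr (component_mem_nicholsIdeal hR.out h1 k)
  rw [← h2, map_sum, map_sum, Finset.sum_filter]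
  refine Finset.sum_congr rfl fun n _ => ?_
  rw [map_smul, map_smul, component_of_mem (hy n)]
  by_cases hk : d n = k
  · simp [hk]
  · simp [hk, Ne.symm hk]

end Descend

/-! ### Independence of ordered monomials for `t = -1` -/

section Exterior

variable {K : Type u} [Field K] {R : Matrix (Fin 9) (Fin 9) K}

theorem ι_mem_degreePart (i : Fin 3) : FreeAlgebra.ι K i ∈ degreePart K 1 := by
  rw [degreePart, pow_one]
  exact Submodule.subset_span ⟨i, rfl⟩

variable [hR : Fact (BraidCoeff R)]

theorem linearIndependent_of_mul_ne_zero {c : K} {h : Fin 3 → ℕ∞} (h0 : h 0 = 2) (h1 : h 1 = 2)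
    (h11 : gen R 0 * gen R 0 = 0) (h21 : gen R 1 * gen R 0 = -(gen R 0 * gen R 1))
    (h22 : gen R 1 * gen R 1 = c • (gen R 0 * gen R 1))
    (hne : ∀ n : ℕ, (n : ℕ∞) < h 2 → gen R 0 * gen R 1 * gen R 2 ^ n ≠ 0) :
    LinearIndependent K fun n : {n : Fin 3 →₀ ℕ // ∀ i, (n i : ℕ∞) < h i} =>
      orderedMonomial (fun i => proj R ((![x₁, x₂, x₃] : Fin 3 → T K) i)) n.1 := by
  rw [linearIndependent_iff']
  intro s a ha n₀ hn₀
  have lt2 : ∀ (n : {n : Fin 3 →₀ ℕ // ∀ i, (n i : ℕ∞) < h i}), n.1 0 < 2 ∧ n.1 1 < 2 := by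
    intro n
    have e0 := n.2 0
    have e1 := n.2 1
    rw [h0] at e0
    rw [h1] at e1
    exact ⟨by exact_mod_cast e0, by exact_mod_cast e1⟩
  set d : {n : Fin 3 →₀ ℕ // ∀ i, (n i : ℕ∞) < h i} → ℕ := fun n => n.1 0 + n.1 1 + n.1 2 with hd
  have hdeg := sum_filter_degree_eq_zero (R := R) s a
    (fun n => orderedMonomial (FreeAlgebra.ι K) n.1) d (by
      intro n
      rw [orderedMonomial_fin_three]
      refine mul_mem_degreePart (mul_mem_degreePart ?_ ?_) ?_ <;>
        first
        | simpa using pow_mem_degreePart (ι_mem_degreePart (K := K) 0) (n.1 0)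
        | simpa using pow_mem_degreePart (ι_mem_degreePart (K := K) 1) (n.1 1)
        | simpa using pow_mem_degreePart (ι_mem_degreePart (K := K) 2) (n.1 2)) (by
      rw [← ha]
      simp only [map_orderedMonomial, generators_eq]) (d n₀)
  simp only [orderedMonomial_fin_three, map_mul, map_pow] at hdeg
  change ∑ n ∈ s with d n = d n₀, a n • (gen R 0 ^ n.1 0 * gen R 1 ^ n.1 1 * gen R 2 ^ n.1 2) = 0
    at hdeg
  have e011 : gen R 0 * gen R 1 * gen R 1 = 0 := by
    rw [mul_assoc, h22, mul_smul_comm, ← mul_assoc, h11, zero_mul, smul_zero]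
  have e010 : gen R 0 * gen R 1 * gen R 0 = 0 := by
    rw [mul_assoc, h21, mul_neg, ← mul_assoc, h11, zero_mul, neg_zero]
  -- isolating one monomial by a left multiplication which kills the others
  have isolate : ∀ (w : NicholsAlgebra R) (n₁ : {n : Fin 3 →₀ ℕ // ∀ i, (n i : ℕ∞) < h i}),
      n₁ ∈ s → d n₁ = d n₀ →
      (∀ n ∈ s, d n = d n₀ → n ≠ n₁ → a n = 0 ∨
        w * (gen R 0 ^ n.1 0 * gen R 1 ^ n.1 1) = 0) →
      w * (gen R 0 ^ n₁.1 0 * gen R 1 ^ n₁.1 1 * gen R 2 ^ n₁.1 2) ≠ 0 → a n₁ = 0 := by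
    intro w n₁ hn₁ hdn hk hne'
    have := congrArg (w * ·) hdeg
    simp only [Finset.mul_sum, mul_smul_comm, mul_zero] at this
    rw [Finset.sum_eq_single n₁] at this
    · exact (smul_eq_zero.mp this).resolve_right hne'
    · intro n hn hnn
      rw [Finset.mem_filter] at hn
      rcases hk n hn.1 hn.2 hnn with h | h
      · rw [h, zero_smul]
      · rw [← mul_assoc, h, zero_mul, smul_zero]
    · intro h
      exact absurd (Finset.mem_filter.mpr ⟨hn₁, hdn⟩) h
  have hext : ∀ n n' : {n : Fin 3 →₀ ℕ // ∀ i, (n i : ℕ∞) < h i}, d n = d n' → n.1 0 = n'.1 0 →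
      n.1 1 = n'.1 1 → n = n' := by
    intro n n' hdd e0 e1
    refine Subtype.ext (Finsupp.ext fun i => ?_)
    simp only [hd] at hdd
    fin_cases i
    · exact e0
    · exact e1
    · change n.1 2 = n'.1 2
      omega
  have step00 : ∀ n ∈ s, d n = d n₀ → n.1 0 = 0 → n.1 1 = 0 → a n = 0 := by
    intro n hn hdn e0 e1
    refine isolate (gen R 0 * gen R 1) n hn hdn ?_ ?_
    · intro m _ hdm hmn
      right
      have hm := lt2 m
      have : m.1 0 = 1 ∨ (m.1 0 = 0 ∧ m.1 1 = 1) := by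
        by_contra hcon
        exact hmn (hext m n (hdm.trans hdn.symm) (by omega) (by omega))
      rcases this with h | ⟨h, h'⟩
      · rw [h, pow_one, ← mul_assoc, e010, zero_mul]
      · rw [h, h', pow_zero, one_mul, pow_one, e011]
    · rw [e0, e1, pow_zero, pow_zero, one_mul, one_mul]
      exact hne _ (n.2 2)
  have step01 : ∀ n ∈ s, d n = d n₀ → n.1 0 = 0 → n.1 1 = 1 → a n = 0 := by
    intro n hn hdn e0 e1
    refine isolate (gen R 0) n hn hdn ?_ ?_
    · intro m hms hdm hmn
      have hm := lt2 m
      have : (m.1 0 = 0 ∧ m.1 1 = 0) ∨ m.1 0 = 1 := by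
        by_contra hcon
        exact hmn (hext m n (hdm.trans hdn.symm) (by omega) (by omega))
      rcases this with ⟨h, h'⟩ | h
      · exact Or.inl (step00 m hms hdm h h')
      · right
        rw [h, pow_one, ← mul_assoc, h11, zero_mul]
    · rw [e0, e1, pow_zero, one_mul, pow_one, ← mul_assoc]
      exact hne _ (n.2 2)
  have step10 : ∀ n ∈ s, d n = d n₀ → n.1 0 = 1 → n.1 1 = 0 → a n = 0 := by
    intro n hn hdn e0 e1
    refine isolate (gen R 1) n hn hdn ?_ ?_
    · intro m hms hdm hmn
      have hm := lt2 m
      have : (m.1 0 = 0 ∧ m.1 1 = 0) ∨ (m.1 0 = 0 ∧ m.1 1 = 1) ∨ (m.1 0 = 1 ∧ m.1 1 = 1) := by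
        by_contra hcon
        exact hmn (hext m n (hdm.trans hdn.symm) (by omega) (by omega))
      rcases this with ⟨h, h'⟩ | ⟨h, h'⟩ | ⟨h, h'⟩
      · exact Or.inl (step00 m hms hdm h h')
      · exact Or.inl (step01 m hms hdm h h')
      · right
        rw [h, h', pow_one, pow_one, ← mul_assoc, h21, neg_mul, e011, neg_zero]
    · rw [e0, e1, pow_zero, mul_one, pow_one, ← mul_assoc, h21, neg_mul]
      exact neg_ne_zero.mpr (hne _ (n.2 2))
  have hm := lt2 n₀
  by_cases e0 : n₀.1 0 = 0
  · by_cases e1 : n₀.1 1 = 0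
    · exact step00 n₀ hn₀ rfl e0 e1
    · exact step01 n₀ hn₀ rfl e0 (by omega)
  · by_cases e1 : n₀.1 1 = 0
    · exact step10 n₀ hn₀ rfl (by omega) e1
    · refine isolate 1 n₀ hn₀ rfl ?_ ?_
      · intro m hms hdm hmn
        left
        have hm := lt2 m
        have : (m.1 0 = 0 ∧ m.1 1 = 0) ∨ (m.1 0 = 0 ∧ m.1 1 = 1) ∨ (m.1 0 = 1 ∧ m.1 1 = 0) := by
          by_contra hcon
          exact hmn (hext m n₀ hdm (by omega) (by omega))
        rcases this with ⟨h, h'⟩ | ⟨h, h'⟩ | ⟨h, h'⟩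
        · exact step00 m hms hdm h h'
        · exact step01 m hms hdm h h'
        · exact step10 m hms hdm h h'
      · rw [show n₀.1 0 = 1 by omega, show n₀.1 1 = 1 by omega, pow_one, pow_one, one_mul]
        exact hne _ (n₀.2 2)

theorem mul_mul_ne_zero {t : K} (h : Triangular R t) : gen R 0 * gen R 1 * gen R 2 ≠ 0 := by
  intro h0
  rw [gen, gen, gen, ← map_mul, ← map_mul, proj_eq_zero, mem_nicholsIdeal hR.out] at h0
  have h1 := mem_kernelSubmodule.mp h0 [2, 1, 0]
  have h2 := symm_eq_symm_flipMatrix h [2, 1, 0] (s := 0) (w := 3) (x := word K [0, 1, 2])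
    (word_mem_weightLT (by decide)) (by decide)
  have h3 : word K [0, 1, 2] =
      FreeAlgebra.ι K 0 * FreeAlgebra.ι K 1 * FreeAlgebra.ι K 2 := by
    simp [word, mul_assoc]
  have h4 : symm (flipMatrix t) [2, 1, 0] (word K [0, 1, 2]) = 1 := by
    rw [h3, mul_assoc, symm_cons, symm_cons, symm_cons, symm_nil]
    simp only [der_ι_mul, der_ι, past_ι_mul, past_ι, coeff_flipMatrix, Fin.sum_univ_three]
    simp [der_ι_mul, der_ι, past_ι, coeff_flipMatrix]
  rw [h4, h3, h1] at h2
  exact zero_ne_one h2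

/-- If `c(x_v ⊗ x_j) ∈ V ⊗ x_v` for all `j`, then `c(x_v ⊗ x) ∈ 𝔅(V) ⊗ x_v` for all `x`. -/
theorem npast_eq_zero {v : Fin 3} (hp : ∀ j l, l ≠ v → npast R v l (gen R j) = 0) {l : Fin 3}
    (hl : l ≠ v) (x : NicholsAlgebra R) : npast R v l x = 0 := by
  obtain ⟨x, rfl⟩ := proj_surjective x
  induction x using left_induction with
  | one => rw [map_one, npast_one, if_neg (Ne.symm hl)]
  | smul c w hw => rw [map_smul, map_smul, hw, smul_zero]
  | add v w hv hw => rw [map_add, map_add, hv, hw, add_zero]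
  | mul j w hw =>
    rw [map_mul, npast_mul]
    refine Finset.sum_eq_zero fun m _ => ?_
    by_cases hm : m = v
    · rw [hm, hw, mul_zero]
    · have := hp j m hm
      rw [gen] at this
      rw [this, zero_mul]

theorem npast_self_mul {v : Fin 3} (hp : ∀ j l, l ≠ v → npast R v l (gen R j) = 0)
    (x y : NicholsAlgebra R) : npast R v v (x * y) = npast R v v x * npast R v v y := by
  rw [npast_mul, Finset.sum_eq_single v]
  · intro m _ hm
    rw [npast_eq_zero hp hm, zero_mul]
  · simp

theorem nder_pow {Y : NicholsAlgebra R} {u v : Fin 3} {μ : K}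
    (hp : ∀ j l, l ≠ v → npast R v l (gen R j) = 0)
    (hY : ∀ l, nder R l Y = if l = v then μ • gen R u else 0) (hφ : npast R v v Y = Y)
    (hc : Y * gen R u = gen R u * Y) (n : ℕ) (l : Fin 3) :
    nder R l (Y ^ (n + 1)) = if l = v then ((n + 1 : ℕ) * μ : K) • (Y ^ n * gen R u) else 0 := by
  have hφn : ∀ n, npast R v v (Y ^ n) = Y ^ n := by
    intro n
    induction n with
    | zero => rw [pow_zero, npast_one, if_pos rfl]
    | succ n ih => rw [pow_succ, npast_self_mul hp, ih, hφ]
  have hcn : ∀ n, gen R u * Y ^ n = Y ^ n * gen R u := fun n => by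
    exact (Commute.pow_left hc n).symm
  induction n with
  | zero => simp [hY]
  | succ n ih =>
    rw [pow_succ', nder_mul, ih, Finset.sum_eq_single v]
    · rw [hY, if_pos rfl]
      split_ifs with hl
      · rw [hl, hφn, smul_mul_assoc, hcn, mul_smul_comm, ← mul_assoc, ← pow_succ', ← add_smul]
        congr 1
        push_cast
        ring
      · rw [npast_eq_zero hp hl, mul_zero, mul_zero, add_zero]
    · intro m _ hm
      rw [hY, if_neg hm, zero_mul]
    · simp

theorem pow_mul_ne_zero [CharZero K] (h : Triangular R (-1)) {Y : NicholsAlgebra R} {u v : Fin 3}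
    {μ c : K} (hμ : μ ≠ 0) (huv : (u = 0 ∧ (v = 0 ∨ v = 1)) ∨ (u = 1 ∧ v = 1))
    (h11 : gen R 0 * gen R 0 = 0) (h21 : gen R 1 * gen R 0 = -(gen R 0 * gen R 1))
    (h22 : gen R 1 * gen R 1 = c • (gen R 0 * gen R 1))
    (hp : ∀ j l, l ≠ v → npast R v l (gen R j) = 0)
    (hY : ∀ l, nder R l Y = if l = v then μ • gen R u else 0) (hφ : npast R v v Y = Y)
    (hc : Y * gen R u = gen R u * Y) (hφ0 : npast R v v (gen R 0) = -gen R 0)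
    (hφ1 : ∃ e : K, npast R v v (gen R 1) = -gen R 1 + e • gen R 0) (n : ℕ) :
    Y ^ n * (gen R 0 * gen R 1) ≠ 0 := by
  have d2 : nder R 2 (gen R 0 * gen R 1 * gen R 2) = gen R 0 * gen R 1 := by
    have c1 : ∀ m, gen R 0 * (coeff R 1 2 m 2 • gen R m) = 0 := by
      intro m
      by_cases hm : m = 0
      · rw [hm, mul_smul_comm, h11, smul_zero]
      · rw [h.eq_zero 1 2 m 2 (by simp) (by have := Fin.pos_of_ne_zero hm; simp; omega), zero_smul,
          mul_zero]
    have c2 : ∀ m, npast R 0 m (gen R 1) * npast R m 2 (gen R 2) = 0 := by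
      intro m
      by_cases hm : m = 0
      · rw [hm, npast_gen 0 2 2, Finset.sum_eq_zero, mul_zero]
        intro k _
        rw [h.eq_zero 0 2 k 2 (by simp) (by simp), zero_smul]
      · rw [npast_gen, Finset.sum_eq_zero, zero_mul]
        intro k _
        have hm' := Fin.pos_of_ne_zero hm
        rw [h.eq_zero 0 1 k m (by simp [hm]) (by simp; omega), zero_smul]
    rw [mul_assoc, nder_gen_mul, nder_gen_mul, nder_gen, if_pos rfl, npast_mul 0 2,
      Finset.sum_eq_zero fun m _ => c2 m, npast_gen, mul_one, add_zero, mul_add, Finset.mul_sum,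
      Finset.sum_eq_zero fun m _ => c1 m, add_zero]
  have d1 : nder R 1 (gen R 0 * gen R 1) = gen R 0 := by
    rw [nder_gen_mul, nder_gen, if_pos rfl, npast_gen, Finset.sum_eq_zero, mul_one, add_zero]
    intro k _
    rw [h.eq_zero 0 1 k 1 (by simp) (by simp), zero_smul]
  have leib : ∀ (n : ℕ) (l : Fin 3) (w : NicholsAlgebra R), nder R l (Y ^ (n + 1) * w) =
      Y ^ (n + 1) * nder R l w +
        ((n + 1 : ℕ) * μ : K) • (Y ^ n * (gen R u * npast R v l w)) := by
    intro n l w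
    rw [nder_mul, Finset.sum_eq_single v]
    · rw [nder_pow hp hY hφ hc, if_pos rfl, smul_mul_assoc, mul_assoc]
    · intro m _ hm
      rw [nder_pow hp hY hφ hc, if_neg hm, zero_mul]
    · simp
  have hv2 : v ≠ 2 := by rintro rfl; simp at huv
  have e011 : gen R 0 * gen R 1 * gen R 1 = 0 := by
    rw [mul_assoc, h22, mul_smul_comm, ← mul_assoc, h11, zero_mul, smul_zero]
  have key : ∀ n : ℕ, Y ^ n * (gen R 0 * gen R 1 * gen R 2) ≠ 0 := by
    intro n
    induction n with
    | zero => rw [pow_zero, one_mul]; exact mul_mul_ne_zero h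
    | succ n ih =>
      intro h3
      have e2 : Y ^ (n + 1) * (gen R 0 * gen R 1) = 0 := by
        have := congrArg (nder R 2) h3
        rwa [leib, d2, npast_eq_zero hp (Ne.symm hv2), mul_zero, mul_zero, smul_zero, add_zero,
          map_zero] at this
      have e1 : Y ^ (n + 1) * gen R 0 = 0 := by
        have := congrArg (nder R 1) e2
        rw [leib, d1, map_zero] at this
        have hz : gen R u * npast R v 1 (gen R 0 * gen R 1) = 0 := by
          by_cases hv : v = 1
          · obtain ⟨e, he⟩ := hφ1
            rw [hv] at hp hφ0 he ⊢
            rw [npast_self_mul hp, hφ0, he, neg_mul, mul_add, mul_smul_comm, h11, smul_zero,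
              add_zero, mul_neg, mul_neg, mul_neg, neg_neg]
            rcases huv with ⟨hu, _⟩ | ⟨hu, _⟩
            · rw [hu, ← mul_assoc, h11, zero_mul]
            · rw [hu, ← mul_assoc, h21, neg_mul, e011, neg_zero]
          · rw [npast_eq_zero hp (Ne.symm hv), mul_zero]
        rwa [hz, mul_zero, smul_zero, add_zero] at this
      have e0 : Y ^ (n + 1) = 0 := by
        have := congrArg (nder R 0) e1
        rw [leib, nder_gen, if_pos rfl, mul_one, map_zero] at this
        have hz : gen R u * npast R v 0 (gen R 0) = 0 := by
          by_cases hv : v = 0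
          · rw [hv] at hφ0 ⊢
            rcases huv with ⟨hu, _⟩ | ⟨_, hv'⟩
            · rw [hφ0, hu, mul_neg, h11, neg_zero]
            · rw [hv] at hv'
              exact absurd hv' (by decide)
          · rw [npast_eq_zero hp (Ne.symm hv), mul_zero]
        rwa [hz, mul_zero, smul_zero, add_zero] at this
      have eu : Y ^ n * gen R u = 0 := by
        have := congrArg (nder R v) e0
        rw [nder_pow hp hY hφ hc, if_pos rfl, map_zero, smul_eq_zero] at this
        exact this.resolve_left (mul_ne_zero (Nat.cast_ne_zero.mpr (Nat.succ_ne_zero n)) hμ)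
      rcases huv with ⟨hu, _⟩ | ⟨hu, _⟩
      · exact ih (by rw [mul_assoc, ← mul_assoc, ← hu, eu, zero_mul])
      · refine ih (neg_eq_zero.mp ?_)
        rw [← mul_neg, ← neg_mul, ← h21, mul_assoc, ← mul_assoc, ← hu, eu, zero_mul]
  intro h0
  exact key n (by rw [← mul_assoc, h0, zero_mul])

end Exterior

/-! ### Nichols algebras with quadratic relations in normal form -/

section NormalForm

variable {K : Type u} [Field K] {R : Matrix (Fin 9) (Fin 9) K}

/-- The matrix of the skew derivations of a quadratic element. -/
def pairing (R : Matrix (Fin 9) (Fin 9) K) (r : Matrix (Fin 3) (Fin 3) K) :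
    Matrix (Fin 3) (Fin 3) K :=
  Matrix.of fun m l => r m l + ∑ i, ∑ j, r i j * coeff R i j m l

theorem quad_mem_of_pairing (hR : BraidCoeff R) {r : Matrix (Fin 3) (Fin 3) K}
    (h : pairing R r = 0) : quad r ∈ nicholsIdeal R :=
  (quad_mem_nicholsIdeal hR).mpr fun m l => congrFun (congrFun h m) l

/-- The relation `x₂x₁ - t x₁x₂ - A x₁²`. -/
def rel21 (t A : K) : Matrix (Fin 3) (Fin 3) K := !![-A, -t, 0; 1, 0, 0; 0, 0, 0]

/-- The relation `x₃x₁ - t x₁x₃ - B x₁x₂ - C x₁²`. -/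
def rel31 (t B C : K) : Matrix (Fin 3) (Fin 3) K := !![-C, -B, -t; 0, 0, 0; 1, 0, 0]

/-- The relation `x₃x₂ - t x₂x₃ - D x₁x₃ - E x₂² - F x₁x₂ - G x₁²`. -/
def rel32 (t D E F G : K) : Matrix (Fin 3) (Fin 3) K := !![-G, -F, -D; 0, -E, -t; 0, 1, 0]

/-- The relation `x₁²`. -/
def rel11 : Matrix (Fin 3) (Fin 3) K := !![1, 0, 0; 0, 0, 0; 0, 0, 0]

/-- The relation `x₂² - H x₁x₂`. -/
def rel22 (H : K) : Matrix (Fin 3) (Fin 3) K := !![0, -H, 0; 0, 1, 0; 0, 0, 0]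

/-- The relation `x₃² - I x₂x₃ - J x₁x₃ - L x₁x₂`. -/
def rel33 (I J L : K) : Matrix (Fin 3) (Fin 3) K := !![0, -L, -J; 0, 0, -I; 0, 0, 1]

theorem leading_of_mem {rels : Set (T K)} {t A B C D E F G : K} (m21 : quad (rel21 t A) ∈ rels)
    (m31 : quad (rel31 t B C) ∈ rels) (m32 : quad (rel32 t D E F G) ∈ rels) (i j : Fin 3)
    (hij : i < j) : ∃ r : Matrix (Fin 3) (Fin 3) K, quad r ∈ rels ∧ r j i = 1 ∧
      r i j = -t ∧ ∀ k l : Fin 3, (k, l) ≠ (j, i) → (k, l) ≠ (i, j) →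
        i.val + j.val ≤ k.val + l.val → r k l = 0 := by
  have : (i = 0 ∧ j = 1) ∨ (i = 0 ∧ j = 2) ∨ (i = 1 ∧ j = 2) := by
    revert hij; revert i j; decide
  rcases this with ⟨rfl, rfl⟩ | ⟨rfl, rfl⟩ | ⟨rfl, rfl⟩
  · refine ⟨_, m21, rfl, rfl, fun k l => ?_⟩
    fin_cases k <;> fin_cases l <;> simp [rel21]
  · refine ⟨_, m31, rfl, rfl, fun k l => ?_⟩
    fin_cases k <;> fin_cases l <;> simp [rel31]
  · refine ⟨_, m32, rfl, rfl, fun k l => ?_⟩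
    fin_cases k <;> fin_cases l <;> simp [rel32]

theorem describedB3_of_pairing [CharZero K] (hR : BraidCoeff R) (h : Triangular R 1)
    {A B C D E F G : K} (p21 : pairing R (rel21 1 A) = 0) (p31 : pairing R (rel31 1 B C) = 0)
    (p32 : pairing R (rel32 1 D E F G) = 0) :
    DescribedB3 R {quad (rel21 1 A), quad (rel31 1 B C), quad (rel32 1 D E F G)} := by
  have key := presentation_of_span_of_linearIndependent (R := R)
    (rels := {quad (rel21 1 A), quad (rel31 1 B C), quad (rel32 1 D E F G)})
    (g := ![x₁, x₂, x₃]) (h := ![⊤, ⊤, ⊤]) (by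
      rintro x (rfl | rfl | rfl)
      · exact quad_mem_of_pairing hR p21
      · exact quad_mem_of_pairing hR p31
      · exact quad_mem_of_pairing hR p32)
    (span_eq_top_of_quad (t := 1) (one_pow 2)
      (leading_of_mem (A := A) (B := B) (C := C) (D := D) (E := E) (F := F) (G := G)
        (by simp) (by simp) (by simp))
      (by intro i; fin_cases i <;> simp))
    (linearIndependent_of_triangular_one h hR _)
  refine ⟨key.1, key.2, ?_⟩
  rw [GKdim_eq_card hR (d := fun _ => 1) (fun i => ?_) (fun _ => le_rfl) (fun i => ?_) key.2]
  · rw [Finset.card_filter, Fin.sum_univ_three]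
    simp
  · rw [generators_eq]; exact ι_mem_degreePart i
  · fin_cases i <;> simp

theorem superspan {rels : Set (T K)} {B D F H : K} {h : Fin 3 → ℕ∞} (h0 : h 0 = 2) (h1 : h 1 = 2)
    (m21 : quad (rel21 (-1) 0) ∈ rels)
    (m31 : quad (rel31 (-1) B 0) ∈ rels) (m32 : quad (rel32 (-1) D 0 F 0) ∈ rels)
    (m11 : quad rel11 ∈ rels) (m22 : quad (rel22 H) ∈ rels)
    (m33 : h 2 = ⊤ ∨ (h 2 = 2 ∧ ∃ I J L, quad (rel33 I J L) ∈ rels)) :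
    Submodule.span K (Set.range fun n : {n : Fin 3 →₀ ℕ // ∀ i, (n i : ℕ∞) < h i} =>
      orderedMonomial (fun i => toPresented rels ((![x₁, x₂, x₃] : Fin 3 → T K) i)) n.1) = ⊤ := by
  refine span_eq_top_of_quad (t := -1) (by norm_num) (leading_of_mem m21 m31 m32) fun i => ?_
  have : i = 0 ∨ i = 1 ∨ i = 2 := by revert i; decide
  rcases this with rfl | rfl | rfl
  · refine Or.inr ⟨h0, _, m11, rfl, fun k l => ?_⟩
    fin_cases k <;> fin_cases l <;> simp [rel11]
  · refine Or.inr ⟨h1, _, m22, rfl, fun k l => ?_⟩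
    fin_cases k <;> fin_cases l <;> simp [rel22]
  · refine m33.imp_right fun ⟨h2, I, J, L, m⟩ => ⟨h2, _, m, rfl, fun k l => ?_⟩
    fin_cases k <;> fin_cases l <;> simp [rel33]

theorem proj_quad (r : Matrix (Fin 3) (Fin 3) K) :
    proj R (quad r) = ∑ i, ∑ j, r i j • (gen R i * gen R j) := by
  simp only [quad, map_sum, map_smul, map_mul, gen]

theorem gen_mul_relations (hR : BraidCoeff R) {B D F H : K}
    (p21 : pairing R (rel21 (-1) 0) = 0) (p31 : pairing R (rel31 (-1) B 0) = 0)
    (p32 : pairing R (rel32 (-1) D 0 F 0) = 0) (p11 : pairing R rel11 = 0)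
    (p22 : pairing R (rel22 H) = 0) :
    gen R 0 * gen R 0 = 0 ∧ gen R 1 * gen R 0 = -(gen R 0 * gen R 1) ∧
    gen R 1 * gen R 1 = H • (gen R 0 * gen R 1) ∧
    gen R 2 * gen R 0 = -(gen R 0 * gen R 2) + B • (gen R 0 * gen R 1) ∧
    gen R 2 * gen R 1 = -(gen R 1 * gen R 2) + D • (gen R 0 * gen R 2) + F • (gen R 0 * gen R 1) := by
  have e21 := proj_eq_zero.mpr (quad_mem_of_pairing hR p21)
  have e31 := proj_eq_zero.mpr (quad_mem_of_pairing hR p31)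
  have e32 := proj_eq_zero.mpr (quad_mem_of_pairing hR p32)
  have e11 := proj_eq_zero.mpr (quad_mem_of_pairing hR p11)
  have e22 := proj_eq_zero.mpr (quad_mem_of_pairing hR p22)
  rw [proj_quad] at e21 e31 e32 e11 e22
  simp only [Fin.sum_univ_three, rel21] at e21
  simp only [Fin.sum_univ_three, rel31] at e31
  simp only [Fin.sum_univ_three, rel32] at e32
  simp only [Fin.sum_univ_three, rel11] at e11
  simp only [Fin.sum_univ_three, rel22] at e22
  refine ⟨by simpa using e11, ?_, ?_, ?_, ?_⟩ <;> rw [← sub_eq_zero]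
  · rw [← e21]; simp; abel
  · rw [← e22]; simp; abel
  · rw [← e31]; simp; abel
  · rw [← e32]; simp; abel

theorem describedB0_of_pairing (hR : BraidCoeff R) (h : Triangular R (-1))
    {B D F H I J L : K} (p21 : pairing R (rel21 (-1) 0) = 0) (p31 : pairing R (rel31 (-1) B 0) = 0)
    (p32 : pairing R (rel32 (-1) D 0 F 0) = 0) (p11 : pairing R rel11 = 0)
    (p22 : pairing R (rel22 H) = 0) (p33 : pairing R (rel33 I J L) = 0) :
    DescribedB0 R {quad (rel21 (-1) 0), quad (rel31 (-1) B 0), quad (rel32 (-1) D 0 F 0),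
      quad rel11, quad (rel22 H), quad (rel33 I J L)} := by
  have : Fact (BraidCoeff R) := ⟨hR⟩
  obtain ⟨h11, h21, h22, -, -⟩ := gen_mul_relations hR p21 p31 p32 p11 p22
  have key := presentation_of_span_of_linearIndependent (R := R)
    (rels := {quad (rel21 (-1) 0), quad (rel31 (-1) B 0), quad (rel32 (-1) D 0 F 0),
      quad rel11, quad (rel22 H), quad (rel33 I J L)})
    (g := ![x₁, x₂, x₃]) (h := ![2, 2, 2]) (by
      rintro x (rfl | rfl | rfl | rfl | rfl | rfl)
      · exact quad_mem_of_pairing hR p21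
      · exact quad_mem_of_pairing hR p31
      · exact quad_mem_of_pairing hR p32
      · exact quad_mem_of_pairing hR p11
      · exact quad_mem_of_pairing hR p22
      · exact quad_mem_of_pairing hR p33)
    (superspan (B := B) (D := D) (F := F) (H := H) rfl rfl (by simp) (by simp) (by simp) (by simp)
      (by simp) (Or.inr ⟨rfl, I, J, L, by simp⟩))
    (linearIndependent_of_mul_ne_zero rfl rfl h11 h21 h22 (by
      intro n hn h0
      have hn' : n < 2 := by
        have : (n : ℕ∞) < 2 := hn
        exact_mod_cast this
      refine mul_mul_ne_zero h ?_
      have := congrArg (· * gen R 2 ^ (1 - n)) h0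
      simp only [zero_mul, mul_assoc, ← pow_add] at this
      rwa [show n + (1 - n) = 1 by omega, pow_one, ← mul_assoc] at this))
  refine ⟨⟨key.1, key.2, ?_⟩, ?_⟩
  · rw [GKdim_eq_card hR (d := fun _ => 1) (fun i => ?_) (fun _ => le_rfl) (fun i => ?_) key.2]
    · rw [Finset.card_filter, Fin.sum_univ_three]
      simp
    · rw [generators_eq]; exact ι_mem_degreePart i
    · fin_cases i <;> simp
  · have hb := Module.finrank_eq_nat_card_basis (Module.Basis.mk key.2.1 key.2.2.ge)
    rw [hb]
    have e : {n : Fin 3 →₀ ℕ // ∀ i, (n i : ℕ∞) < (![2, 2, 2] : Fin 3 → ℕ∞) i} ≃ (Fin 3 → Fin 2) :=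
      { toFun := fun n i => ⟨n.1 i, by
          have := n.2 i
          have h2 : (![2, 2, 2] : Fin 3 → ℕ∞) i = 2 := by fin_cases i <;> rfl
          rw [h2] at this
          exact_mod_cast this⟩
        invFun := fun f => ⟨Finsupp.equivFunOnFinite.symm fun i => (f i : ℕ), fun i => by
          have h2 : (![2, 2, 2] : Fin 3 → ℕ∞) i = 2 := by fin_cases i <;> rfl
          rw [h2]
          have := (f i).2
          simp only [Finsupp.equivFunOnFinite_symm_apply_apply]
          exact_mod_cast this⟩
        left_inv := fun n => by ext i; simp
        right_inv := fun f => by ext i; simp }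
    rw [Nat.card_congr e]
    simp

theorem describedB1_of_pairing [CharZero K] (hR : BraidCoeff R) (h : Triangular R (-1))
    {B D F H : K} (p21 : pairing R (rel21 (-1) 0) = 0) (p31 : pairing R (rel31 (-1) B 0) = 0)
    (p32 : pairing R (rel32 (-1) D 0 F 0) = 0) (p11 : pairing R rel11 = 0)
    (p22 : pairing R (rel22 H) = 0) (I J L : K) {u v : Fin 3} {μ : K} (hμ : μ ≠ 0)
    (huv : (u = 0 ∧ (v = 0 ∨ v = 1)) ∨ (u = 1 ∧ v = 1 ∧ B = 0 ∧ D = 0 ∧ H = 0 ∧ I = 0))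
    (p33 : pairing R (rel33 I J L) = Matrix.single u v μ) (e α β : K)
    (hc : ∀ j m l, l ≠ v → coeff R v j m l = 0)
    (hφ : (Matrix.of fun j m => coeff R v j m v) = !![-1, 0, 0; e, -1, 0; α, β, -1])
    (c13 : I * e = β * D)
    (c12 : -(α * B) - β * F + β ^ 2 * H - I * (α - β * H + e * β) + J * β = 0) :
    DescribedB1 R {quad (rel21 (-1) 0), quad (rel31 (-1) B 0), quad (rel32 (-1) D 0 F 0),
      quad rel11, quad (rel22 H)} := by
  have : Fact (BraidCoeff R) := ⟨hR⟩
  obtain ⟨h11, h21, h22, h31, h32⟩ := gen_mul_relations hR p21 p31 p32 p11 p22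
  set X : Fin 3 → NicholsAlgebra R := gen R with hX
  have h11' : ∀ w, X 0 * (X 0 * w) = 0 := fun w => by rw [← mul_assoc, h11, zero_mul]
  have h21' : ∀ w, X 1 * (X 0 * w) = -(X 0 * (X 1 * w)) := fun w => by
    rw [← mul_assoc, h21, neg_mul, mul_assoc]
  have h22' : ∀ w, X 1 * (X 1 * w) = H • (X 0 * (X 1 * w)) := fun w => by
    rw [← mul_assoc, h22, smul_mul_assoc, mul_assoc]
  have h31' : ∀ w, X 2 * (X 0 * w) = -(X 0 * (X 2 * w)) + B • (X 0 * (X 1 * w)) := fun w => by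
    rw [← mul_assoc, h31]; simp only [add_mul, neg_mul, smul_mul_assoc, mul_assoc]
  have h32' : ∀ w, X 2 * (X 1 * w) = -(X 1 * (X 2 * w)) + D • (X 0 * (X 2 * w)) +
      F • (X 0 * (X 1 * w)) := fun w => by
    rw [← mul_assoc, h32]; simp only [add_mul, neg_mul, smul_mul_assoc, mul_assoc]
  set Y : NicholsAlgebra R := proj R (quad (rel33 I J L)) with hYdef
  have hYe : Y = X 2 * X 2 - I • (X 1 * X 2) - J • (X 0 * X 2) - L • (X 0 * X 1) := by
    rw [hYdef, proj_quad]
    simp only [Fin.sum_univ_three, rel33]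
    simp
    abel
  have hp : ∀ j l, l ≠ v → npast R v l (gen R j) = 0 := by
    intro j l hl
    rw [npast_gen]
    exact Finset.sum_eq_zero fun m _ => by rw [hc j m l hl, zero_smul]
  have hφg : ∀ j m, coeff R v j m v = (!![-1, 0, 0; e, -1, 0; α, β, -1] : Matrix _ _ K) j m :=
    fun j m => congrFun (congrFun hφ j) m
  have φ0 : npast R v v (X 0) = -X 0 := by
    rw [npast_gen]; simp only [hφg, Fin.sum_univ_three]; simp [hX]
  have φ1 : npast R v v (X 1) = -X 1 + e • X 0 := by
    rw [npast_gen]; simp only [hφg, Fin.sum_univ_three]; simp [hX]; abel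
  have φ2 : npast R v v (X 2) = -X 2 + α • X 0 + β • X 1 := by
    rw [npast_gen]; simp only [hφg, Fin.sum_univ_three]; simp [hX]; abel
  have hφY : npast R v v Y = Y := by
    have hJ : (-(α * B) - β * F + β ^ 2 * H - I * (α - β * H + e * β) + J * β) • (X 0 * X 1) = 0 := by
      rw [c12, zero_smul]
    have hI : (I * e - β * D) • (X 0 * X 2) = 0 := by rw [c13, sub_self, zero_smul]
    rw [hYe]
    simp only [map_sub, map_smul, npast_self_mul hp, φ0, φ1, φ2]
    simp only [mul_add, add_mul, neg_mul, mul_neg, smul_mul_assoc, mul_smul_comm, h11, h21, h22,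
      h31, h32]
    linear_combination (norm := module) hJ + hI
  have hYd : ∀ l, nder R l Y = if l = v then μ • gen R u else 0 := by
    intro l
    rw [hYdef, nder_proj, der_quad]
    have : ∀ m, rel33 I J L m l + ∑ i, ∑ j, rel33 I J L i j * coeff R i j m l =
        Matrix.single u v μ m l := fun m => congrFun (congrFun p33 m) l
    simp only [this, map_sum, map_smul]
    rw [Finset.sum_eq_single u]
    · simp only [Matrix.single_apply, true_and, eq_comm (a := v)]
      split_ifs
      · rfl
      · rw [zero_smul]
    · intro m _ hm
      rw [Matrix.single_apply, if_neg fun h => hm h.1.symm, zero_smul]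
    · simp
  have hY0 : Y * X 0 = X 0 * Y := by
    rw [hYe]
    simp only [mul_sub, sub_mul, mul_add, mul_neg, smul_mul_assoc, mul_smul_comm,
      mul_assoc, h11, h11', h21, h21', h22, h22', h31, h31', h32, h32', smul_zero, mul_zero]
    module
  have hYu : Y * gen R u = gen R u * Y := by
    rcases huv with ⟨rfl, _⟩ | ⟨rfl, _, rfl, rfl, rfl, rfl⟩
    · exact hY0
    · change Y * X 1 = X 1 * Y
      rw [hYe]
      simp only [mul_sub, sub_mul, mul_add, mul_neg, smul_mul_assoc, mul_smul_comm,
        mul_assoc, h11, h11', h21, h21', h22, h22', h31, h31', h32, h32', smul_zero, mul_zero]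
      module
  have hY01 : Y * (X 0 * X 1) = X 0 * X 1 * Y := by
    rw [← mul_assoc, hY0, hYe]
    simp only [mul_sub, sub_mul, mul_add, mul_neg, smul_mul_assoc, mul_smul_comm,
      mul_assoc, h11, h11', h21, h21', h22, h22', h31, h31', h32, h32', smul_zero, mul_zero,
      zero_mul]
    module
  have hkill : ∀ n, X 0 * X 1 * X 2 ^ n * X 0 = 0 ∧ X 0 * X 1 * X 2 ^ n * X 1 = 0 := by
    intro n
    induction n with
    | zero =>
      simp only [pow_zero, mul_one, mul_assoc, h21, h22, h11', mul_neg, mul_smul_comm, neg_zero,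
        smul_zero, and_self]
    | succ n ih =>
      rw [pow_succ, ← mul_assoc, mul_assoc _ (X 2) (X 0), mul_assoc _ (X 2) (X 1), h31, h32]
      simp only [mul_add, mul_neg, mul_smul_comm, ← mul_assoc, ih.1, ih.2, zero_mul, smul_zero,
        neg_zero, add_zero, and_self]
  have hpow : ∀ n, X 0 * X 1 * Y ^ n = X 0 * X 1 * X 2 ^ (2 * n) := by
    intro n
    induction n with
    | zero => simp
    | succ n ih =>
      rw [pow_succ, ← mul_assoc, ih, hYe]
      simp only [mul_sub, mul_smul_comm, ← mul_assoc, (hkill (2 * n)).1, (hkill (2 * n)).2,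
        zero_mul, smul_zero, sub_zero]
      rw [show 2 * (n + 1) = 2 * n + 1 + 1 by ring, pow_succ, pow_succ]
      simp only [← mul_assoc]
  have hcomm : ∀ n, Y ^ n * (X 0 * X 1) = X 0 * X 1 * Y ^ n := fun n =>
    Commute.pow_left hY01 n
  have hne : ∀ n, X 0 * X 1 * X 2 ^ n ≠ 0 := by
    intro n h0
    refine pow_mul_ne_zero h hμ (by tauto) h11 h21 h22 hp hYd hφY hYu φ0 ⟨e, φ1⟩ n ?_
    change Y ^ n * (X 0 * X 1) = 0
    rw [hcomm, hpow, two_mul, pow_add, ← mul_assoc, h0, zero_mul]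
  have key := presentation_of_span_of_linearIndependent (R := R)
    (rels := {quad (rel21 (-1) 0), quad (rel31 (-1) B 0), quad (rel32 (-1) D 0 F 0),
      quad rel11, quad (rel22 H)})
    (g := ![x₁, x₂, x₃]) (h := ![2, 2, ⊤]) (by
      rintro x (rfl | rfl | rfl | rfl | rfl)
      · exact quad_mem_of_pairing hR p21
      · exact quad_mem_of_pairing hR p31
      · exact quad_mem_of_pairing hR p32
      · exact quad_mem_of_pairing hR p11
      · exact quad_mem_of_pairing hR p22)
    (superspan (B := B) (D := D) (F := F) (H := H) rfl rfl (by simp) (by simp) (by simp) (by simp)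
      (by simp) (Or.inl rfl))
    (linearIndependent_of_mul_ne_zero rfl rfl h11 h21 h22 fun n _ => hne n)
  refine ⟨key.1, key.2, ?_⟩
  rw [GKdim_eq_card hR (d := fun _ => 1) (fun i => ?_) (fun _ => le_rfl) (fun i => ?_) key.2]
  · rw [Finset.card_filter, Fin.sum_univ_three]
    simp
  · rw [generators_eq]; exact ι_mem_degreePart i
  · fin_cases i <;> simp

end NormalForm

/-! ### Checking quadratic relations by computation -/

section PolyRelations

variable {K : Type u} [Field K]

namespace Poly

def const (c : ℤ) : Poly := [(c, [])]

def pow (p : Poly) : ℕ → Poly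
  | 0 => const 1
  | n + 1 => mul p (pow p n)

def substMon : List Poly → List ℕ → Poly
  | _, [] => const 1
  | [], _ :: _ => const 1
  | p :: s, a :: m => mul (pow p a) (substMon s m)

/-- Substitution of polynomials for the variables. -/
def subst (s : List Poly) : Poly → Poly
  | [] => []
  | (c, m) :: p => add (mul (const c) (substMon s m)) (subst s p)

theorem eval_const (v : List K) (c : ℤ) : eval v (const c) = c := by
  cases v <;> simp [const, eval, evalMon]

theorem eval_pow (v : List K) (p : Poly) (n : ℕ) : eval v (pow p n) = eval v p ^ n := by
  induction n with
  | zero => simp [pow, eval_const]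
  | succ n ih => rw [pow, eval_mul, ih, pow_succ']

theorem eval_substMon (v : List K) (s : List Poly) (m : List ℕ) :
    eval v (substMon s m) = evalMon (s.map (eval v)) m := by
  induction s generalizing m with
  | nil => cases m <;> simp [substMon, evalMon, eval_const]
  | cons p s ih =>
    cases m with
    | nil => simp [substMon, evalMon, eval_const]
    | cons a m => rw [substMon, eval_mul, eval_pow, ih, List.map_cons, evalMon]

theorem eval_subst (v : List K) (s : List Poly) (p : Poly) :
    eval v (subst s p) = eval (s.map (eval v)) p := by
  induction p with
  | nil => rfl
  | cons t p ih => rw [subst, eval_add, eval_mul, eval_const, eval_substMon, ih, eval]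

/-- The entries of `pairing`, as polynomials. -/
def pairDefect (s : List Poly) (M : List (List Poly)) (r : Fin 3 → Fin 3 → Poly) (m l : Fin 3) :
    Poly :=
  add (r m l) (sum3 fun i => sum3 fun j => mul (r i j) (subst s (entry M i j m l)))

def rel21P (t A : Poly) (i j : Fin 3) : Poly :=
  match i, j with
  | 0, 0 => neg A
  | 0, 1 => neg t
  | 1, 0 => const 1
  | _, _ => []

def rel31P (t B C : Poly) (i j : Fin 3) : Poly :=
  match i, j with
  | 0, 0 => neg C
  | 0, 1 => neg B
  | 0, 2 => neg t
  | 2, 0 => const 1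
  | _, _ => []

def rel32P (t D E F G : Poly) (i j : Fin 3) : Poly :=
  match i, j with
  | 0, 0 => neg G
  | 0, 1 => neg F
  | 0, 2 => neg D
  | 1, 1 => neg E
  | 1, 2 => neg t
  | 2, 1 => const 1
  | _, _ => []

def rel11P (i j : Fin 3) : Poly :=
  match i, j with
  | 0, 0 => const 1
  | _, _ => []

def rel22P (H : Poly) (i j : Fin 3) : Poly :=
  match i, j with
  | 0, 1 => neg H
  | 1, 1 => const 1
  | _, _ => []

def rel33P (I J L : Poly) (i j : Fin 3) : Poly :=
  match i, j with
  | 0, 1 => neg L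
  | 0, 2 => neg J
  | 1, 2 => neg I
  | 2, 2 => const 1
  | _, _ => []

/-- The matrix of the restriction of the braiding to `x_v ⊗ V → V ⊗ x_v`. -/
def twistP (e α β : Poly) (j m : Fin 3) : Poly :=
  match j, m with
  | 0, 0 => const (-1)
  | 1, 0 => e
  | 1, 1 => const (-1)
  | 2, 0 => α
  | 2, 1 => β
  | 2, 2 => const (-1)
  | _, _ => []

end Poly

open Hietarinta.Poly

theorem eval_rel21P (v : List K) (t A : Poly) (i j : Fin 3) :
    rel21 (eval v t) (eval v A) i j = eval v (rel21P t A i j) := by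
  fin_cases i <;> fin_cases j <;> simp [rel21, rel21P, eval_neg, eval_const] <;> rfl

theorem eval_rel31P (v : List K) (t B C : Poly) (i j : Fin 3) :
    rel31 (eval v t) (eval v B) (eval v C) i j = eval v (rel31P t B C i j) := by
  fin_cases i <;> fin_cases j <;> simp [rel31, rel31P, eval_neg, eval_const] <;> rfl

theorem eval_rel32P (v : List K) (t D E F G : Poly) (i j : Fin 3) :
    rel32 (eval v t) (eval v D) (eval v E) (eval v F) (eval v G) i j =
      eval v (rel32P t D E F G i j) := by
  fin_cases i <;> fin_cases j <;> simp [rel32, rel32P, eval_neg, eval_const] <;> rfl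

theorem eval_rel11P (v : List K) (i j : Fin 3) : (rel11 : Matrix _ _ K) i j = eval v (rel11P i j) := by
  fin_cases i <;> fin_cases j <;> simp [rel11, rel11P, eval_const] <;> rfl

theorem eval_rel22P (v : List K) (H : Poly) (i j : Fin 3) :
    rel22 (eval v H) i j = eval v (rel22P H i j) := by
  fin_cases i <;> fin_cases j <;> simp [rel22, rel22P, eval_neg, eval_const] <;> rfl

theorem eval_rel33P (v : List K) (I J L : Poly) (i j : Fin 3) :
    rel33 (eval v I) (eval v J) (eval v L) i j = eval v (rel33P I J L i j) := by
  fin_cases i <;> fin_cases j <;> simp [rel33, rel33P, eval_neg, eval_const] <;> rfl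

theorem eval_twistP (v : List K) (e α β : Poly) (j m : Fin 3) :
    (!![-1, 0, 0; eval v e, -1, 0; eval v α, eval v β, -1] : Matrix (Fin 3) (Fin 3) K) j m =
      eval v (twistP e α β j m) := by
  fin_cases j <;> fin_cases m <;> simp [twistP, eval_const] <;> rfl

variable {R : Matrix (Fin 9) (Fin 9) K} {v w : List K} {s : List Poly} {M : List (List Poly)}

theorem pairing_apply_of_poly (hM : ∀ i j m l, coeff R i j m l = eval w (entry M i j m l))
    (hw : w = s.map (eval v)) {r : Matrix (Fin 3) (Fin 3) K} {rP : Fin 3 → Fin 3 → Poly}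
    (hr : ∀ i j, r i j = eval v (rP i j)) (m l : Fin 3) :
    pairing R r m l = eval v (pairDefect s M rP m l) := by
  simp only [pairing, Matrix.of_apply, pairDefect, eval_add, eval_sum3, eval_mul, eval_subst, ← hw,
    ← hM, ← hr]

theorem pairing_eq_zero_of_poly (hM : ∀ i j m l, coeff R i j m l = eval w (entry M i j m l))
    (hw : w = s.map (eval v)) {r : Matrix (Fin 3) (Fin 3) K} {rP : Fin 3 → Fin 3 → Poly}
    (hr : ∀ i j, r i j = eval v (rP i j)) (h : ∀ m l, pairDefect s M rP m l = []) :
    pairing R r = 0 := by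
  ext m l
  rw [pairing_apply_of_poly hM hw hr, h]
  rfl

theorem quad_rel21 (t A : K) :
    quad (rel21 t A) = x₂ * x₁ - t • (x₁ * x₂) - A • x₁ ^ 2 := by
  simp only [quad, rel21, Fin.sum_univ_three, pow_two]
  simp
  module

theorem quad_rel31 (t B C : K) :
    quad (rel31 t B C) = x₃ * x₁ - t • (x₁ * x₃) - B • (x₁ * x₂) - C • x₁ ^ 2 := by
  simp only [quad, rel31, Fin.sum_univ_three, pow_two]
  simp
  module

theorem quad_rel32 (t D E F G : K) :
    quad (rel32 t D E F G) = x₃ * x₂ - t • (x₂ * x₃) - D • (x₁ * x₃) - E • x₂ ^ 2 -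
      F • (x₁ * x₂) - G • x₁ ^ 2 := by
  simp only [quad, rel32, Fin.sum_univ_three, pow_two]
  simp
  module

theorem quad_rel11 : quad (rel11 : Matrix _ _ K) = x₁ ^ 2 := by
  simp only [quad, rel11, Fin.sum_univ_three, pow_two]
  simp

theorem quad_rel22 (H : K) : quad (rel22 H) = x₂ ^ 2 - H • (x₁ * x₂) := by
  simp only [quad, rel22, Fin.sum_univ_three, pow_two]
  simp
  module

theorem quad_rel33 (I J L : K) :
    quad (rel33 I J L) = x₃ ^ 2 - I • (x₂ * x₃) - J • (x₁ * x₃) - L • (x₁ * x₂) := by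
  simp only [quad, rel33, Fin.sum_univ_three, pow_two]
  simp
  module

theorem describedB3_of_poly [CharZero K] (hR : BraidCoeff R) (h : Triangular R 1)
    (hM : ∀ i j m l, coeff R i j m l = eval w (entry M i j m l))
    {A B C D E F G : K} {AP BP CP DP EP FP GP : Poly}
    (check : ∀ m l, pairDefect s M (rel21P (const 1) AP) m l = [] ∧
      pairDefect s M (rel31P (const 1) BP CP) m l = [] ∧
      pairDefect s M (rel32P (const 1) DP EP FP GP) m l = []) {r21 r31 r32 : T K}
    (e21 : r21 = x₂ * x₁ - x₁ * x₂ - A • x₁ ^ 2)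
    (e31 : r31 = x₃ * x₁ - x₁ * x₃ - B • (x₁ * x₂) - C • x₁ ^ 2)
    (e32 : r32 = x₃ * x₂ - x₂ * x₃ - D • (x₁ * x₃) - E • x₂ ^ 2 - F • (x₁ * x₂) - G • x₁ ^ 2)
    (hw : w = s.map (eval v) := by
      simp only [List.map_cons, List.map_nil, eval, evalMon, List.cons.injEq, and_true]
      repeat' apply And.intro
      all_goals first | rfl | (push_cast; try ring))
    (hp : [A, B, C, D, E, F, G] = [AP, BP, CP, DP, EP, FP, GP].map (eval v) := by
      simp only [List.map_cons, List.map_nil, eval, evalMon, List.cons.injEq, and_true]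
      repeat' apply And.intro
      all_goals first | rfl | (push_cast; try ring)) :
    DescribedB3 R {r21, r31, r32} := by
  simp only [List.map_cons, List.map_nil, List.cons.injEq, and_true] at hp
  obtain ⟨rfl, rfl, rfl, rfl, rfl, rfl, rfl⟩ := hp
  have h1 : (1 : K) = eval v (const 1) := by simp [eval_const]
  have key := describedB3_of_pairing hR h (A := eval v AP) (B := eval v BP) (C := eval v CP)
    (D := eval v DP) (E := eval v EP) (F := eval v FP) (G := eval v GP)
    (pairing_eq_zero_of_poly hM hw (fun i j => by rw [h1]; exact eval_rel21P _ _ _ i j)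
      fun m l => (check m l).1)
    (pairing_eq_zero_of_poly hM hw (fun i j => by rw [h1]; exact eval_rel31P _ _ _ _ i j)
      fun m l => (check m l).2.1)
    (pairing_eq_zero_of_poly hM hw (fun i j => by rw [h1]; exact eval_rel32P _ _ _ _ _ _ i j)
      fun m l => (check m l).2.2)
  rw [quad_rel21, quad_rel31, quad_rel32, one_smul, one_smul, one_smul, ← e21, ← e31, ← e32] at key
  exact key

theorem describedB0_of_poly (hR : BraidCoeff R) (h : Triangular R (-1))
    (hM : ∀ i j m l, coeff R i j m l = eval w (entry M i j m l))
    {B D F H I J L : K} {BP DP FP HP IP JP LP : Poly}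
    (check : ∀ m l, pairDefect s M (rel21P (const (-1)) []) m l = [] ∧
      pairDefect s M (rel31P (const (-1)) BP []) m l = [] ∧
      pairDefect s M (rel32P (const (-1)) DP [] FP []) m l = [] ∧
      pairDefect s M rel11P m l = [] ∧ pairDefect s M (rel22P HP) m l = [] ∧
      pairDefect s M (rel33P IP JP LP) m l = []) {r21 r31 r32 r11 r22 r33 : T K}
    (e21 : r21 = x₂ * x₁ + x₁ * x₂)
    (e31 : r31 = x₃ * x₁ + x₁ * x₃ - B • (x₁ * x₂))
    (e32 : r32 = x₃ * x₂ + x₂ * x₃ - D • (x₁ * x₃) - F • (x₁ * x₂))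
    (e11 : r11 = x₁ ^ 2) (e22 : r22 = x₂ ^ 2 - H • (x₁ * x₂))
    (e33 : r33 = x₃ ^ 2 - I • (x₂ * x₃) - J • (x₁ * x₃) - L • (x₁ * x₂))
    (hw : w = s.map (eval v) := by
      simp only [List.map_cons, List.map_nil, eval, evalMon, List.cons.injEq, and_true]
      repeat' apply And.intro
      all_goals first | rfl | (push_cast; try ring))
    (hp : [B, D, F, H, I, J, L] = [BP, DP, FP, HP, IP, JP, LP].map (eval v) := by
      simp only [List.map_cons, List.map_nil, eval, evalMon, List.cons.injEq, and_true]
      repeat' apply And.intro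
      all_goals first | rfl | (push_cast; try ring)) :
    DescribedB0 R {r21, r31, r32, r11, r22, r33} := by
  simp only [List.map_cons, List.map_nil, List.cons.injEq, and_true] at hp
  obtain ⟨rfl, rfl, rfl, rfl, rfl, rfl, rfl⟩ := hp
  have h1 : (-1 : K) = eval v (const (-1)) := by simp [eval_const]
  have h0 : (0 : K) = eval v [] := rfl
  have key := describedB0_of_pairing hR h (B := eval v BP) (D := eval v DP)
    (F := eval v FP) (H := eval v HP) (I := eval v IP) (J := eval v JP) (L := eval v LP)
    (pairing_eq_zero_of_poly hM hw (fun i j => by rw [h1, h0]; exact eval_rel21P _ _ _ i j)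
      fun m l => (check m l).1)
    (pairing_eq_zero_of_poly hM hw (fun i j => by rw [h1, h0]; exact eval_rel31P _ _ _ _ i j)
      fun m l => (check m l).2.1)
    (pairing_eq_zero_of_poly hM hw (fun i j => by rw [h1, h0]; exact eval_rel32P _ _ _ _ _ _ i j)
      fun m l => (check m l).2.2.1)
    (pairing_eq_zero_of_poly hM hw (eval_rel11P _) fun m l => (check m l).2.2.2.1)
    (pairing_eq_zero_of_poly hM hw (eval_rel22P _ _) fun m l => (check m l).2.2.2.2.1)
    (pairing_eq_zero_of_poly hM hw (eval_rel33P _ _ _ _) fun m l => (check m l).2.2.2.2.2)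
  rw [quad_rel21, quad_rel31, quad_rel32, quad_rel11, quad_rel22, quad_rel33, ← e11, ← e22,
    ← e33] at key
  convert key using 3
  · rw [e21]; module
  · rw [e31]; module
  · congr 1
    rw [e32]; module

theorem describedB1_of_poly [CharZero K] (hR : BraidCoeff R) (h : Triangular R (-1))
    (hM : ∀ i j m l, coeff R i j m l = eval w (entry M i j m l))
    {B D F H : K} {BP DP FP HP : Poly}
     (IP JP LP μP eP αP βP : Poly) (u y : Fin 3)
    (huy : (u = 0 ∧ (y = 0 ∨ y = 1)) ∨ (u = 1 ∧ y = 1 ∧ BP = [] ∧ DP = [] ∧ HP = [] ∧ IP = []))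
    (hμ : eval v μP ≠ 0)
    (check : ∀ m l, pairDefect s M (rel21P (const (-1)) []) m l = [] ∧
      pairDefect s M (rel31P (const (-1)) BP []) m l = [] ∧
      pairDefect s M (rel32P (const (-1)) DP [] FP []) m l = [] ∧
      pairDefect s M rel11P m l = [] ∧ pairDefect s M (rel22P HP) m l = [] ∧
      add (pairDefect s M (rel33P IP JP LP) m l) (if m = u ∧ l = y then neg μP else []) = [])
    (check' : ∀ j m, add (subst s (entry M y j m y)) (neg (twistP eP αP βP j m)) = [] ∧
      ∀ l, l = y ∨ subst s (entry M y j m l) = [])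
    (check'' : add (mul IP eP) (neg (mul βP DP)) = [] ∧
      add (add (add (neg (mul αP BP)) (neg (mul βP FP))) (mul (mul βP βP) HP))
        (add (neg (mul IP (add (add αP (neg (mul βP HP))) (mul eP βP)))) (mul JP βP)) = [])
    {r21 r31 r32 r11 r22 : T K}
    (e21 : r21 = x₂ * x₁ + x₁ * x₂)
    (e31 : r31 = x₃ * x₁ + x₁ * x₃ - B • (x₁ * x₂))
    (e32 : r32 = x₃ * x₂ + x₂ * x₃ - D • (x₁ * x₃) - F • (x₁ * x₂))
    (e11 : r11 = x₁ ^ 2) (e22 : r22 = x₂ ^ 2 - H • (x₁ * x₂))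
    (hw : w = s.map (eval v) := by
      simp only [List.map_cons, List.map_nil, eval, evalMon, List.cons.injEq, and_true]
      repeat' apply And.intro
      all_goals first | rfl | (push_cast; try ring))
    (hp : [B, D, F, H] = [BP, DP, FP, HP].map (eval v) := by
      simp only [List.map_cons, List.map_nil, eval, evalMon, List.cons.injEq, and_true]
      repeat' apply And.intro
      all_goals first | rfl | (push_cast; try ring)) :
    DescribedB1 R {r21, r31, r32, r11, r22} := by
  simp only [List.map_cons, List.map_nil, List.cons.injEq, and_true] at hp
  obtain ⟨rfl, rfl, rfl, rfl⟩ := hp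
  have h1 : (-1 : K) = eval v (const (-1)) := by simp [eval_const]
  have h0 : (0 : K) = eval v [] := rfl
  have key := describedB1_of_pairing hR h (B := eval v BP) (D := eval v DP)
    (F := eval v FP) (H := eval v HP)
    (pairing_eq_zero_of_poly hM hw (fun i j => by rw [h1, h0]; exact eval_rel21P _ _ _ i j)
      fun m l => (check m l).1)
    (pairing_eq_zero_of_poly hM hw (fun i j => by rw [h1, h0]; exact eval_rel31P _ _ _ _ i j)
      fun m l => (check m l).2.1)
    (pairing_eq_zero_of_poly hM hw (fun i j => by rw [h1, h0]; exact eval_rel32P _ _ _ _ _ _ i j)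
      fun m l => (check m l).2.2.1)
    (pairing_eq_zero_of_poly hM hw (eval_rel11P _) fun m l => (check m l).2.2.2.1)
    (pairing_eq_zero_of_poly hM hw (eval_rel22P _ _) fun m l => (check m l).2.2.2.2.1)
    (eval v IP) (eval v JP) (eval v LP) (u := u) (v := y) hμ
    (huy.imp_right fun ⟨h1, h2, h3, h4, h5, h6⟩ => ⟨h1, h2, by rw [h3]; rfl, by rw [h4]; rfl,
      by rw [h5]; rfl, by rw [h6]; rfl⟩)
    (by
      ext m l
      have := congrArg (eval v) (check m l).2.2.2.2.2
      rw [eval_add, ← pairing_apply_of_poly hM hw (eval_rel33P v IP JP LP), ← h0] at this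
      rw [eq_neg_of_add_eq_zero_left this, Matrix.single_apply]
      simp only [eq_comm (a := u), eq_comm (a := y)]
      split_ifs
      · rw [eval_neg, neg_neg]
      · rw [← h0, neg_zero])
    (eval v eP) (eval v αP) (eval v βP)
    (fun j m l hl => by
      rw [hM, hw, ← eval_subst, ((check' j m).2 l).resolve_left hl]
      rfl)
    (by
      ext j m
      have := congrArg (eval v) (check' j m).1
      rw [eval_add, eval_neg, eval_subst, ← hw, ← hM, ← eval_twistP, ← h0, ← sub_eq_add_neg,
        sub_eq_zero] at this
      exact this)
    (by
      have := congrArg (eval v) check''.1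
      simp only [eval_add, eval_neg, eval_mul, ← h0] at this
      linear_combination this)
    (by
      have := congrArg (eval v) check''.2
      simp only [eval_add, eval_neg, eval_mul, ← h0] at this
      linear_combination this)
  rw [quad_rel21, quad_rel31, quad_rel32, quad_rel11, quad_rel22, ← e11, ← e22] at key
  convert key using 3
  · rw [e21]; module
  · rw [e31]; module
  · congr 1
    rw [e32]; module

end PolyRelations

/-! ### The families with a basis of monomials in `x₁, x₂, x₃` -/

section FamiliesB

variable {K : Type u} [Field K]

open Hietarinta.Poly

theorem describedB0_R1 (a b p : K) :
    DescribedB0 (R1 (-1) a b p) (rels1B0 b p) :=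
  describedB0_of_poly (braidCoeff_R1 (-1) a b p) (triangular_R1 (-1) a b p) (coeff_R1 (-1) a b p)
    (v := [a, b, p]) (s := [[(-1, [])], [(1, [1])], [(1, [0, 1])], [(1, [0, 0, 1])]])
    (B := 0) (BP := []) (D := 0) (DP := []) (F := b) (FP := [(1, [0, 1])]) (H := 0) (HP := [])
    (I := 0) (IP := []) (J := b) (JP := [(1, [0, 1])]) (L := -p) (LP := [(-1, [0, 0, 1])])
    (by decide +kernel)
    (by module) (by module) (by module) (by module) (by module) (by module)

theorem describedB3_R1 [CharZero K] (a b p : K) :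
    DescribedB3 (R1 1 a b p) (rels1B3 a b) :=
  describedB3_of_poly (braidCoeff_R1 1 a b p) (triangular_R1 1 a b p) (coeff_R1 1 a b p)
    (v := [a, b, p]) (s := [[(1, [])], [(1, [1])], [(1, [0, 1])], [(1, [0, 0, 1])]])
    (A := 0) (AP := []) (B := 0) (BP := []) (C := a) (CP := [(1, [1])]) (D := 0) (DP := [])
    (E := 0) (EP := []) (F := 2 * a - b) (FP := [(2, [1]), (-1, [0, 1])]) (G := 0) (GP := [])
    (by decide +kernel)
    (by module) (by module) (by module)

theorem describedB3_R2 [CharZero K] (a p q k : K) :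
    DescribedB3 (R2 1 a (p - 2 * q) p q k) (rels2B3 p q) :=
  describedB3_of_poly (braidCoeff_R2 1 a (p - 2 * q) p q k) (triangular_R2 1 a (p - 2 * q) p q k) (coeff_R2 1 a (p - 2 * q) p q k)
    (v := [a, p, q, k]) (s := [[(1, [])], [(1, [1])], [(1, [0, 1]), (-2, [0, 0, 1])], [(1, [0, 1])], [(1, [0, 0, 1])], [(1, [0, 0, 0, 1])]])
    (A := 0) (AP := []) (B := 0) (BP := []) (C := -q) (CP := [(-1, [0, 0, 1])]) (D := 0) (DP := [])
    (E := 0) (EP := []) (F := p - 2 * q) (FP := [(1, [0, 1]), (-2, [0, 0, 1])]) (G := 0) (GP := [])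
    (by decide +kernel)
    (by module) (by module) (by module)

theorem describedB1_R2 [CharZero K] (a p q k : K) (h : a ≠ -p ^ 2) :
    DescribedB1 (R2 (-1) a (-p) p q k) (rels2B1 p) :=
  describedB1_of_poly (braidCoeff_R2 (-1) a (-p) p q k) (triangular_R2 (-1) a (-p) p q k) (coeff_R2 (-1) a (-p) p q k)
    (v := [a, p, q, k]) (s := [[(-1, [])], [(1, [1])], [(-1, [0, 1])], [(1, [0, 1])], [(1, [0, 0, 1])], [(1, [0, 0, 0, 1])]])
    (B := 0) (BP := []) (D := 0) (DP := []) (F := -p) (FP := [(-1, [0, 1])]) (H := 0) (HP := []) []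
    [(-1, [0, 1])] [(-1, [0, 0, 0, 1])] [(-1, [1]), (-1, [0, 2])] [] [(-1, [0, 1])] [] 0 0
    (by decide)
    (fun h0 => h (by
      simp only [eval, evalMon] at h0
      push_cast at h0
      linear_combination -h0))
    (by decide +kernel) (by decide +kernel) (by decide +kernel)
    (by module) (by module) (by module) (by module) (by module)

theorem describedB0_R2 (p q k : K) :
    DescribedB0 (R2 (-1) (-p ^ 2) (-p) p q k) (rels2B0 p k) :=
  describedB0_of_poly (braidCoeff_R2 (-1) (-p ^ 2) (-p) p q k) (triangular_R2 (-1) (-p ^ 2) (-p) p q k) (coeff_R2 (-1) (-p ^ 2) (-p) p q k)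
    (v := [p, q, k]) (s := [[(-1, [])], [(-1, [2])], [(-1, [1])], [(1, [1])], [(1, [0, 1])], [(1, [0, 0, 1])]])
    (B := 0) (BP := []) (D := 0) (DP := []) (F := -p) (FP := [(-1, [1])]) (H := 0) (HP := [])
    (I := 0) (IP := []) (J := -p) (JP := [(-1, [1])]) (L := -k) (LP := [(-1, [0, 0, 1])])
    (by decide +kernel)
    (by module) (by module) (by module) (by module) (by module) (by module)

theorem describedB3_R3 [CharZero K] (a b p q : K) :
    DescribedB3 (R3 1 a b p q) (rels3B3 a b) :=
  describedB3_of_poly (braidCoeff_R3 1 a b p q) (triangular_R3 1 a b p q) (coeff_R3 1 a b p q)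
    (v := [a, b, p, q]) (s := [[(1, [])], [(1, [1])], [(1, [0, 1])], [(1, [0, 0, 1])], [(1, [0, 0, 0, 1])]])
    (A := 0) (AP := []) (B := 0) (BP := []) (C := a) (CP := [(1, [1])]) (D := 0) (DP := [])
    (E := 0) (EP := []) (F := b) (FP := [(1, [0, 1])]) (G := 0) (GP := [])
    (by decide +kernel)
    (by module) (by module) (by module)

theorem describedB1_R3 [CharZero K] (a b p q : K) (h : q ≠ 0) :
    DescribedB1 (R3 (-1) a b p q) (rels3B1 b) :=
  describedB1_of_poly (braidCoeff_R3 (-1) a b p q) (triangular_R3 (-1) a b p q) (coeff_R3 (-1) a b p q)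
    (v := [a, b, p, q]) (s := [[(-1, [])], [(1, [1])], [(1, [0, 1])], [(1, [0, 0, 1])], [(1, [0, 0, 0, 1])]])
    (B := 0) (BP := []) (D := 0) (DP := []) (F := b) (FP := [(1, [0, 1])]) (H := 0) (HP := []) []
    [(1, [0, 1])] [(1, [0, 0, 1])] [(-1, [0, 0, 0, 1])] [] [(1, [0, 1])] [] 1 1 (by decide)
    (fun h0 => h (by
      simp only [eval, evalMon] at h0
      push_cast at h0
      linear_combination -h0))
    (by decide +kernel) (by decide +kernel) (by decide +kernel)
    (by module) (by module) (by module) (by module) (by module)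

theorem describedB0_R3 (a b p : K) :
    DescribedB0 (R3 (-1) a b p 0) (rels3B0 b p) :=
  describedB0_of_poly (braidCoeff_R3 (-1) a b p 0) (triangular_R3 (-1) a b p 0) (coeff_R3 (-1) a b p 0)
    (v := [a, b, p]) (s := [[(-1, [])], [(1, [1])], [(1, [0, 1])], [(1, [0, 0, 1])], []])
    (B := 0) (BP := []) (D := 0) (DP := []) (F := b) (FP := [(1, [0, 1])]) (H := 0) (HP := [])
    (I := 0) (IP := []) (J := b) (JP := [(1, [0, 1])]) (L := p) (LP := [(1, [0, 0, 1])])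
    (by decide +kernel)
    (by module) (by module) (by module) (by module) (by module) (by module)

theorem describedB3_R4 [CharZero K] (a b p : K) :
    DescribedB3 (R4 1 a b p) (rels4B3 a b) :=
  describedB3_of_poly (braidCoeff_R4 1 a b p) (triangular_R4 1 a b p) (coeff_R4 1 a b p)
    (v := [a, b, p]) (s := [[(1, [])], [(1, [1])], [(1, [0, 1])], [(1, [0, 0, 1])]])
    (A := 0) (AP := []) (B := 0) (BP := []) (C := a) (CP := [(1, [1])]) (D := 0) (DP := [])
    (E := 0) (EP := []) (F := 2 * b - a) (FP := [(2, [0, 1]), (-1, [1])]) (G := 0) (GP := [])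
    (by decide +kernel)
    (by module) (by module) (by module)

theorem describedB1_R4 [CharZero K] (a b p : K) (h : p ≠ 0) :
    DescribedB1 (R4 (-1) a b p) (rels4B1 a b) :=
  describedB1_of_poly (braidCoeff_R4 (-1) a b p) (triangular_R4 (-1) a b p) (coeff_R4 (-1) a b p)
    (v := [a, b, p]) (s := [[(-1, [])], [(1, [1])], [(1, [0, 1])], [(1, [0, 0, 1])]])
    (B := 0) (BP := []) (D := 0) (DP := []) (F := 2 * b - a) (FP := [(2, [0, 1]), (-1, [1])])
    (H := 0) (HP := []) [] [(1, [0, 1])] [] [(-1, [0, 0, 1])] [] [(2, [0, 1]), (-1, [1])] [] 0 1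
    (by decide)
    (fun h0 => h (by
      simp only [eval, evalMon] at h0
      push_cast at h0
      linear_combination -h0))
    (by decide +kernel) (by decide +kernel) (by decide +kernel)
    (by module) (by module) (by module) (by module) (by module)

theorem describedB0_R4 (a b : K) :
    DescribedB0 (R4 (-1) a b 0) (rels4B0 a b) :=
  describedB0_of_poly (braidCoeff_R4 (-1) a b 0) (triangular_R4 (-1) a b 0) (coeff_R4 (-1) a b 0)
    (v := [a, b]) (s := [[(-1, [])], [(1, [1])], [(1, [0, 1])], []])
    (B := 0) (BP := []) (D := 0) (DP := []) (F := 2 * b - a) (FP := [(2, [0, 1]), (-1, [1])])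
    (H := 0) (HP := []) (I := 0) (IP := []) (J := b) (JP := [(1, [0, 1])]) (L := 0) (LP := [])
    (by decide +kernel)
    (by module) (by module) (by module) (by module) (by module) (by module)

theorem describedB3_R5 [CharZero K] (a b q k ℓ : K) :
    DescribedB3 (R5 1 a b (2 * q) q k ℓ) (rels5B3 q k ℓ) :=
  describedB3_of_poly (braidCoeff_R5 1 a b (2 * q) q k ℓ) (triangular_R5 1 a b (2 * q) q k ℓ) (coeff_R5 1 a b (2 * q) q k ℓ)
    (v := [a, b, q, k, ℓ]) (s := [[(1, [])], [(1, [1])], [(1, [0, 1])], [(2, [0, 0, 1])], [(1, [0, 0, 1])], [(1, [0, 0, 0, 1])], [(1, [0, 0, 0, 0, 1])]])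
    (A := ℓ) (AP := [(1, [0, 0, 0, 0, 1])]) (B := 0) (BP := []) (C := -q) (CP := [(-1, [0, 0, 1])])
    (D := -ℓ) (DP := [(-1, [0, 0, 0, 0, 1])]) (E := 0) (EP := []) (F := -q)
    (FP := [(-1, [0, 0, 1])]) (G := q * ℓ - k) (GP := [(1, [0, 0, 1, 0, 1]), (-1, [0, 0, 0, 1])])
    (by decide +kernel)
    (by module) (by module) (by module)

theorem describedB1_R5 [CharZero K] (a b q k ℓ : K) (h : a ≠ b * ℓ) :
    DescribedB1 (R5 (-1) a b 0 q k ℓ) (rels5B1 q ℓ) :=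
  describedB1_of_poly (braidCoeff_R5 (-1) a b 0 q k ℓ) (triangular_R5 (-1) a b 0 q k ℓ) (coeff_R5 (-1) a b 0 q k ℓ)
    (v := [a, b, q, k, ℓ]) (s := [[(-1, [])], [(1, [1])], [(1, [0, 1])], [], [(1, [0, 0, 1])], [(1, [0, 0, 0, 1])], [(1, [0, 0, 0, 0, 1])]])
    (B := 0) (BP := []) (D := ℓ) (DP := [(1, [0, 0, 0, 0, 1])]) (F := -q) (FP := [(-1, [0, 0, 1])])
    (H := ℓ) (HP := [(1, [0, 0, 0, 0, 1])]) [] [] [(-1, [0, 1])] [(1, [0, 1, 0, 0, 1]), (-1, [1])]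
    [(1, [0, 0, 0, 0, 1])] [] [] 0 0 (by decide)
    (fun h0 => h (by
      simp only [eval, evalMon] at h0
      push_cast at h0
      linear_combination -h0))
    (by decide +kernel) (by decide +kernel) (by decide +kernel)
    (by module) (by module) (by module) (by module) (by module)

theorem describedB0_R5 (b q k ℓ : K) :
    DescribedB0 (R5 (-1) (b * ℓ) b 0 q k ℓ) (rels5B0 b q ℓ) :=
  describedB0_of_poly (braidCoeff_R5 (-1) (b * ℓ) b 0 q k ℓ) (triangular_R5 (-1) (b * ℓ) b 0 q k ℓ) (coeff_R5 (-1) (b * ℓ) b 0 q k ℓ)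
    (v := [b, q, k, ℓ]) (s := [[(-1, [])], [(1, [1, 0, 0, 1])], [(1, [1])], [], [(1, [0, 1])], [(1, [0, 0, 1])], [(1, [0, 0, 0, 1])]])
    (B := 0) (BP := []) (D := ℓ) (DP := [(1, [0, 0, 0, 1])]) (F := -q) (FP := [(-1, [0, 1])])
    (H := ℓ) (HP := [(1, [0, 0, 0, 1])]) (I := 0) (IP := []) (J := 0) (JP := []) (L := -b)
    (LP := [(-1, [1])])
    (by decide +kernel)
    (by module) (by module) (by module) (by module) (by module) (by module)

theorem describedB0_R6 (a b p q k : K) :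
    DescribedB0 (R6 (-1) a b p q k) (rels6B0 a b p q) :=
  describedB0_of_poly (braidCoeff_R6 (-1) a b p q k) (triangular_R6 (-1) a b p q k) (coeff_R6 (-1) a b p q k)
    (v := [a, b, p, q, k]) (s := [[(-1, [])], [(1, [1])], [(1, [0, 1])], [(1, [0, 0, 1])], [(1, [0, 0, 0, 1])], [(1, [0, 0, 0, 0, 1])]])
    (B := 0) (BP := []) (D := a) (DP := [(1, [1])]) (F := p) (FP := [(1, [0, 0, 1])]) (H := b)
    (HP := [(1, [0, 1])]) (I := 0) (IP := []) (J := q) (JP := [(1, [0, 0, 0, 1])]) (L := 0)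
    (LP := [])
    (by decide +kernel)
    (by module) (by module) (by module) (by module) (by module) (by module)

theorem describedB3_R6 [CharZero K] (a b p q k : K) :
    DescribedB3 (R6 1 a b p q k) (rels6B3 a p k) :=
  describedB3_of_poly (braidCoeff_R6 1 a b p q k) (triangular_R6 1 a b p q k) (coeff_R6 1 a b p q k)
    (v := [a, b, p, q, k]) (s := [[(1, [])], [(1, [1])], [(1, [0, 1])], [(1, [0, 0, 1])], [(1, [0, 0, 0, 1])], [(1, [0, 0, 0, 0, 1])]])
    (A := a) (AP := [(1, [1])]) (B := 0) (BP := []) (C := p) (CP := [(1, [0, 0, 1])]) (D := -a)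
    (DP := [(-1, [1])]) (E := 0) (EP := []) (F := p) (FP := [(1, [0, 0, 1])]) (G := -k - a * p)
    (GP := [(-1, [0, 0, 0, 0, 1]), (-1, [1, 0, 1])])
    (by decide +kernel)
    (by module) (by module) (by module)

theorem describedB3_R7 [CharZero K] (b p q k ℓ d : K) :
    DescribedB3 (R7 1 (p - 2 * q) b p q k ℓ d) (rels7B3 q k d) :=
  describedB3_of_poly (braidCoeff_R7 1 (p - 2 * q) b p q k ℓ d) (triangular_R7 1 (p - 2 * q) b p q k ℓ d) (coeff_R7 1 (p - 2 * q) b p q k ℓ d)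
    (v := [b, p, q, k, ℓ, d]) (s := [[(1, [])], [(1, [0, 1]), (-2, [0, 0, 1])], [(1, [1])], [(1, [0, 1])], [(1, [0, 0, 1])], [(1, [0, 0, 0, 1])], [(1, [0, 0, 0, 0, 1])], [(1, [0, 0, 0, 0, 0, 1])]])
    (A := k) (AP := [(1, [0, 0, 0, 1])]) (B := 0) (BP := []) (C := q) (CP := [(1, [0, 0, 1])])
    (D := -k) (DP := [(-1, [0, 0, 0, 1])]) (E := 0) (EP := []) (F := q) (FP := [(1, [0, 0, 1])])
    (G := d + k * q) (GP := [(1, [0, 0, 0, 0, 0, 1]), (1, [0, 0, 1, 1])])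
    (by decide +kernel)
    (by module) (by module) (by module)

theorem describedB1_R7 [CharZero K] (b p q k ℓ d : K) (h : b ≠ -p ^ 2) :
    DescribedB1 (R7 (-1) (-p) b p q k ℓ d) (rels7B1 q k ℓ) :=
  describedB1_of_poly (braidCoeff_R7 (-1) (-p) b p q k ℓ d) (triangular_R7 (-1) (-p) b p q k ℓ d) (coeff_R7 (-1) (-p) b p q k ℓ d)
    (v := [b, p, q, k, ℓ, d]) (s := [[(-1, [])], [(-1, [0, 1])], [(1, [1])], [(1, [0, 1])], [(1, [0, 0, 1])], [(1, [0, 0, 0, 1])], [(1, [0, 0, 0, 0, 1])], [(1, [0, 0, 0, 0, 0, 1])]])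
    (B := 0) (BP := []) (D := k) (DP := [(1, [0, 0, 0, 1])]) (F := q) (FP := [(1, [0, 0, 1])])
    (H := ℓ) (HP := [(1, [0, 0, 0, 0, 1])]) [] [(1, [0, 1])] [] [(-1, [1]), (-1, [0, 2])]
    [(1, [0, 0, 0, 1])] [(1, [0, 1])] [] 0 0 (by decide)
    (fun h0 => h (by
      simp only [eval, evalMon] at h0
      push_cast at h0
      linear_combination -h0))
    (by decide +kernel) (by decide +kernel) (by decide +kernel)
    (by module) (by module) (by module) (by module) (by module)

theorem describedB0_R7 (p q k ℓ d : K) :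
    DescribedB0 (R7 (-1) (-p) (-p ^ 2) p q k ℓ d) (rels7B0 p q k ℓ) :=
  describedB0_of_poly (braidCoeff_R7 (-1) (-p) (-p ^ 2) p q k ℓ d) (triangular_R7 (-1) (-p) (-p ^ 2) p q k ℓ d) (coeff_R7 (-1) (-p) (-p ^ 2) p q k ℓ d)
    (v := [p, q, k, ℓ, d]) (s := [[(-1, [])], [(-1, [1])], [(-1, [2])], [(1, [1])], [(1, [0, 1])], [(1, [0, 0, 1])], [(1, [0, 0, 0, 1])], [(1, [0, 0, 0, 0, 1])]])
    (B := 0) (BP := []) (D := k) (DP := [(1, [0, 0, 1])]) (F := q) (FP := [(1, [0, 1])]) (H := ℓ)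
    (HP := [(1, [0, 0, 0, 1])]) (I := 0) (IP := []) (J := p) (JP := [(1, [1])]) (L := 0) (LP := [])
    (by decide +kernel)
    (by module) (by module) (by module) (by module) (by module) (by module)

theorem describedB0_R8 (a b p q : K) :
    DescribedB0 (R8 (-1) a b p q) (rels8B0 a p q) :=
  describedB0_of_poly (braidCoeff_R8 (-1) a b p q) (triangular_R8 (-1) a b p q) (coeff_R8 (-1) a b p q)
    (v := [a, b, p, q]) (s := [[(-1, [])], [(1, [1])], [(1, [0, 1])], [(1, [0, 0, 1])], [(1, [0, 0, 0, 1])]])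
    (B := 0) (BP := []) (D := a) (DP := [(1, [1])]) (F := -q) (FP := [(-1, [0, 0, 0, 1])]) (H := a)
    (HP := [(1, [1])]) (I := 0) (IP := []) (J := 0) (JP := []) (L := -p) (LP := [(-1, [0, 0, 1])])
    (by decide +kernel)
    (by module) (by module) (by module) (by module) (by module) (by module)

theorem describedB3_R8 [CharZero K] (a b p q : K) :
    DescribedB3 (R8 1 a b p q) (rels8B3 a b q) :=
  describedB3_of_poly (braidCoeff_R8 1 a b p q) (triangular_R8 1 a b p q) (coeff_R8 1 a b p q)
    (v := [a, b, p, q]) (s := [[(1, [])], [(1, [1])], [(1, [0, 1])], [(1, [0, 0, 1])], [(1, [0, 0, 0, 1])]])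
    (A := a) (AP := [(1, [1])]) (B := 0) (BP := []) (C := q) (CP := [(1, [0, 0, 0, 1])]) (D := -a)
    (DP := [(-1, [1])]) (E := 0) (EP := []) (F := q) (FP := [(1, [0, 0, 0, 1])]) (G := -b)
    (GP := [(-1, [0, 1])])
    (by decide +kernel)
    (by module) (by module) (by module)

theorem describedB3_R9 [CharZero K] (a p q : K) :
    DescribedB3 (R9 1 a 1 p q) (rels9B3 a) :=
  describedB3_of_poly (braidCoeff_R9 1 a 1 p q) (triangular_R9 1 a 1 p q) (coeff_R9 1 a 1 p q)
    (v := [a, p, q]) (s := [[(1, [])], [(1, [1])], [(1, [])], [(1, [0, 1])], [(1, [0, 0, 1])]])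
    (A := 1) (AP := [(1, [])]) (B := 1) (BP := [(1, [])]) (C := 0) (CP := []) (D := -1)
    (DP := [(-1, [])]) (E := 1) (EP := [(1, [])]) (F := -1) (FP := [(-1, [])]) (G := a)
    (GP := [(1, [1])])
    (by decide +kernel)
    (by module) (by module) (by module)

theorem describedB1_R9 [CharZero K] (a p q : K) (h : p ≠ -a - q) :
    DescribedB1 (R9 (-1) a 1 p q) rels9B1 :=
  describedB1_of_poly (braidCoeff_R9 (-1) a 1 p q) (triangular_R9 (-1) a 1 p q) (coeff_R9 (-1) a 1 p q)
    (v := [a, p, q]) (s := [[(-1, [])], [(1, [1])], [(1, [])], [(1, [0, 1])], [(1, [0, 0, 1])]])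
    (B := -1) (BP := [(-1, [])]) (D := 1) (DP := [(1, [])]) (F := 0) (FP := []) (H := 1)
    (HP := [(1, [])]) [(1, [])] [(-1, [])] [(1, [0, 0, 1])]
    [(-1, [0, 1]), (-1, [1]), (-1, [0, 0, 1])] [(1, [])] [(-1, [])] [(1, [])] 0 0 (by decide)
    (fun h0 => h (by
      simp only [eval, evalMon] at h0
      push_cast at h0
      linear_combination -h0))
    (by decide +kernel) (by decide +kernel) (by decide +kernel)
    (by module) (by module) (by module) (by module) (by module)

theorem describedB0_R9 (a q : K) :
    DescribedB0 (R9 (-1) a 1 (-a - q) q) (rels9B0 q) :=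
  describedB0_of_poly (braidCoeff_R9 (-1) a 1 (-a - q) q) (triangular_R9 (-1) a 1 (-a - q) q) (coeff_R9 (-1) a 1 (-a - q) q)
    (v := [a, q]) (s := [[(-1, [])], [(1, [1])], [(1, [])], [(-1, [1]), (-1, [0, 1])], [(1, [0, 1])]])
    (B := -1) (BP := [(-1, [])]) (D := 1) (DP := [(1, [])]) (F := 0) (FP := []) (H := 1)
    (HP := [(1, [])]) (I := 1) (IP := [(1, [])]) (J := -1) (JP := [(-1, [])]) (L := q)
    (LP := [(1, [0, 1])])
    (by decide +kernel)
    (by module) (by module) (by module) (by module) (by module) (by module)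

theorem describedB3_R10 [CharZero K] (a : K) :
    DescribedB3 (R10 1 a) (rels10B3 a) :=
  describedB3_of_poly (braidCoeff_R10 1 a) (triangular_R10 1 a) (coeff_R10 1 a)
    (v := [a]) (s := [[(1, [])], [(1, [1])]])
    (A := 2) (AP := [(2, [])]) (B := 2) (BP := [(2, [])]) (C := 0) (CP := []) (D := 2 - 4 * a)
    (DP := [(2, []), (-4, [1])]) (E := 2 * a) (EP := [(2, [1])]) (F := 4 - 8 * a)
    (FP := [(4, []), (-8, [1])]) (G := 4 * a ^ 2 + 4 * a) (GP := [(4, [2]), (4, [1])])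
    (by decide +kernel)
    (by module) (by module) (by module)

theorem describedB0_R10 (a : K) :
    DescribedB0 (R10 (-1) a) (rels10B0 a) :=
  describedB0_of_poly (braidCoeff_R10 (-1) a) (triangular_R10 (-1) a) (coeff_R10 (-1) a)
    (v := [a]) (s := [[(-1, [])], [(1, [1])]])
    (B := -2) (BP := [(-2, [])]) (D := 4 * a - 2) (DP := [(-2, []), (4, [1])]) (F := 4 * a - 4)
    (FP := [(-4, []), (4, [1])]) (H := 2 * a) (HP := [(2, [1])]) (I := 4 * a - 2)
    (IP := [(4, [1]), (-2, [])]) (J := 4 * a - 8 * a ^ 2) (JP := [(-8, [2]), (4, [1])])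
    (L := 2 * a ^ 3 + 8 * a - 2 * a ^ 2) (LP := [(2, [3]), (-2, [2]), (8, [1])])
    (by decide +kernel)
    (by module) (by module) (by module) (by module) (by module) (by module)

end FamiliesB

/-! ### Towers `z_{n+1} = x₃ z_n - (n+1) b x₁ z_n ∓ z_n x₃ + c_n v_{n+1} x₂` -/

section Towers

variable {K : Type*} [Field K] {A : Type*} [Ring A] [Algebra K A]

/-- The elements `v n` of degree `n` obtained from `x₁` by bracketing with `x₃`, for the sign `t`
of the (super)commutation. -/
structure SkewData (t : K) (X : Fin 3 → A) (v : ℕ → A) (ξ η : ℕ → K) : Prop where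
  sq : t * t = 1
  v_zero : v 0 = 1
  v_one : v 1 = X 0
  x₁_mul : ∀ n, X 0 * v n = ξ n • v (n + 1)
  x₃_mul : ∀ n, X 2 * v n = t ^ n • (v n * X 2) + η n • v (n + 1)
  comm : ∀ m n, v m * v n = t ^ (m * n) • (v n * v m)
  mul_x₂ : ∀ n, v n * X 1 = t ^ n • (X 1 * v n)

/-- A sequence starting with `x₂` which is defined by bracketing with `x₃`. -/
structure IsTower (t b : K) (X : Fin 3 → A) (v : ℕ → A) (c : ℕ → K) (Z : ℕ → A) : Prop where
  zero : Z 0 = X 1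
  succ : ∀ n, Z (n + 1) = X 2 * Z n - (((n + 1 : ℕ) : K) * b) • (X 0 * Z n) -
    t ^ (n + 1) • (Z n * X 2) + c n • (v (n + 1) * X 1)

variable {t b : K} {X : Fin 3 → A} {v : ℕ → A} {ξ η c : ℕ → K} {Z W : ℕ → A}

namespace SkewData

theorem sq_pow (h : SkewData t X v ξ η) (n : ℕ) : t ^ n * t ^ n = 1 := by
  rw [← mul_pow, h.sq, one_pow]

theorem mul_x₃ (h : SkewData t X v ξ η) (n : ℕ) :
    v n * X 2 = t ^ n • (X 2 * v n) - (t ^ n * η n) • v (n + 1) := by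
  rw [h.x₃_mul, smul_add, smul_smul, smul_smul, h.sq_pow, one_smul, add_sub_cancel_right]

theorem mul_x₁ (h : SkewData t X v ξ η) (n : ℕ) : v n * X 0 = t ^ n • (X 0 * v n) := by
  rw [← h.v_one, h.comm, mul_one]

end SkewData

namespace IsTower

theorem v_mul (h : SkewData t X v ξ η) (hZ : IsTower t b X v c Z) (n m : ℕ) :
    v m * Z n = t ^ (m * (n + 1)) • (Z n * v m) := by
  induction n generalizing m with
  | zero => rw [hZ.zero, h.mul_x₂, zero_add, mul_one]
  | succ n ih =>
    have h1 := h.mul_x₃ m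
    have h2 := h.mul_x₁ m
    have h3 := h.comm m (n + 1)
    have h4 := h.mul_x₂ m
    have h5 := ih m
    have h6 := ih (m + 1)
    have e1 : t ^ ((m + 1) * (n + 1)) = t ^ (m * (n + 1)) * t ^ (n + 1) := by ring
    have e2 : t ^ (m * (n + 1 + 1)) = t ^ (m * (n + 1)) * t ^ m := by ring
    have ha := h.sq_pow m
    rw [hZ.succ, e2]
    rw [e1] at h6
    generalize t ^ (m * (n + 1)) = d at *
    generalize t ^ (n + 1) = s at *
    generalize t ^ m = a at *
    linear_combination (norm := (simp only [mul_add, add_mul, mul_sub, sub_mul, smul_mul_assoc,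
      mul_smul_comm, mul_assoc]; module)) h1 * Z n + a • (X 2 * h5) - (a * η m) • h6 -
      (((n + 1 : ℕ) : K) * b) • (h2 * Z n) - (((n + 1 : ℕ) : K) * b * a) • (X 0 * h5) -
      s • (h5 * X 2) - (s * d) • (Z n * h1) + c n • (h3 * X 1) + (c n * d) • (v (n + 1) * h4)

/-- The elements of two towers skew commute in degrees `i`, `j`. -/
def Comm (t : K) (Z : ℕ → A) (i j : ℕ) : Prop := Z i * Z j = t ^ ((i + 1) * (j + 1)) • (Z j * Z i)

theorem comm_step (h : SkewData t X v ξ η) (hZ : IsTower t b X v c Z) {i j : ℕ}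
    (hij : Comm t Z i j) (hi : Comm t Z 0 i) (hj : Comm t Z 0 j) :
    Z (i + 1) * Z j - t ^ ((i + 2) * (j + 1)) • (Z j * Z (i + 1)) +
      t ^ (i + 1) • (Z i * Z (j + 1) - t ^ ((i + 1) * (j + 2)) • (Z (j + 1) * Z i)) = 0 := by
  have vi := v_mul h hZ j (i + 1)
  have vj := v_mul h hZ i (j + 1)
  have xi := v_mul h hZ i 1
  have xj := v_mul h hZ j 1
  rw [h.v_one, one_mul] at xi xj
  rw [Comm, zero_add, one_mul, hZ.zero] at hi hj
  rw [Comm] at hij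
  have e1 : t ^ ((i + 2) * (j + 1)) = t ^ ((i + 1) * (j + 1)) * t ^ (j + 1) := by ring
  have e2 : t ^ ((i + 1) * (j + 2)) = t ^ ((i + 1) * (j + 1)) * t ^ (i + 1) := by ring
  have hs := h.sq_pow (i + 1)
  have hu := h.sq_pow (j + 1)
  have hd := h.sq_pow ((i + 1) * (j + 1))
  rw [mul_comm (j + 1) (i + 1)] at vj
  rw [e1, e2, hZ.succ i, hZ.succ j]
  generalize t ^ ((i + 1) * (j + 1)) = d at *
  generalize t ^ (i + 1) = s at *
  generalize t ^ (j + 1) = u at *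
  linear_combination (norm := (simp only [mul_add, add_mul, mul_sub, sub_mul, smul_mul_assoc,
      mul_smul_comm, mul_assoc]; module))
    X 2 * hij - (d • hs) • (X 2 * (Z j * Z i)) - (((i + 1 : ℕ) : K) * b) • (X 0 * hij) -
      (d * (((i + 1 : ℕ) : K) * b)) • (xj * Z i) + (((j + 1 : ℕ) : K) * b) • (xi * Z j) -
      (((j + 1 : ℕ) : K) * b) • (X 0 * hij) +
      (d * (((j + 1 : ℕ) : K) * b) * hs) • (X 0 * (Z j * Z i)) - (s * u) • (hij * X 2) +
      (d * u * hs) • (Z j * (X 2 * Z i)) + c i • (v (i + 1) * hj) + (c i * u) • (vi * X 1) -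
      (d * s * s * c j) • (v (j + 1) * hi) - (d * s * s * s * c j) • (vj * X 1) -
      (s * c j * s * s * hd) • (Z i * (v (j + 1) * X 1)) -
      (s * c j * hs) • (Z i * (v (j + 1) * X 1))

/-- In a tower, skew commutation in one pair of degrees with a given sum implies skew commutation
in all of them. -/
theorem comm_of_exists (h : SkewData t X v ξ η) (hZ : IsTower t b X v c Z)
    (H : ∀ k, (∀ i j, i + j < k → Comm t Z i j) → ∃ i j, i + j = k ∧ Comm t Z i j)
    (i j : ℕ) : Comm t Z i j := by
  suffices ∀ k i j, i + j = k → Comm t Z i j from this _ i j rfl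
  intro k
  induction k using Nat.strong_induction_on with
  | _ k ih =>
    have step : ∀ i j, i + j + 1 = k → (Comm t Z (i + 1) j ↔ Comm t Z i (j + 1)) := by
      intro i j hk
      have := comm_step h hZ (ih (i + j) (by omega) i j rfl) (ih i (by omega) 0 i (by omega))
        (ih j (by omega) 0 j (by omega))
      rw [Comm, Comm, ← sub_eq_zero, ← sub_eq_zero (a := Z i * Z (j + 1))]
      constructor
      · intro h0
        rw [h0, zero_add] at this
        have h1 := congrArg (fun x => t ^ (i + 1) • x) this
        simp only [smul_smul, h.sq_pow, one_smul, smul_zero] at h1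
        exact h1
      · intro h0
        rw [h0, smul_zero, add_zero] at this
        exact this
    have all : ∀ i j, i + j = k → (Comm t Z i j ↔ Comm t Z 0 k) := by
      intro i
      induction i with
      | zero => intro j hj; rw [← hj, zero_add]
      | succ i ihi => intro j hj; rw [step i j (by omega), ihi (j + 1) (by omega)]
    obtain ⟨i, j, hk, hc⟩ := H k fun i j hk => ih (i + j) (by omega) i j rfl
    intro i' j' hk'
    rw [all i' j' hk', ← all i j hk]
    exact hc

/-- Bracketing with `x₃` on products of the `v i` with a tower. -/
theorem bracket_v_mul (h : SkewData t X v ξ η) (hW : IsTower t b X v 0 W) {i j n : ℕ}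
    (hn : i + j = n) :
    X 2 * (v i * W j) - (((n + 1 : ℕ) : K) * b) • (X 0 * (v i * W j)) -
      t ^ (n + 1) • (v i * W j * X 2) =
      t ^ i • (v i * W (j + 1)) + (η i - i * b * ξ i) • (v (i + 1) * W j) := by
  have h1 := h.x₃_mul i
  have h2 := h.mul_x₁ i
  have h3 := h.x₁_mul i
  have h4 := hW.succ j
  rw [Pi.zero_apply, zero_smul, add_zero] at h4
  subst hn
  have e : t ^ (i + j + 1) = t ^ i * t ^ (j + 1) := by ring
  have hs := h.sq_pow i
  rw [e]
  push_cast at h4 ⊢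
  generalize t ^ i = a at *
  generalize t ^ (j + 1) = u at *
  linear_combination (norm := (simp only [mul_add, add_mul, mul_sub, smul_mul_assoc,
      mul_smul_comm, mul_assoc]; module))
    h1 * W j - a • (v i * h4) + (a * (j + 1) * b) • (h2 * W j) +
      ((j + 1) * b * hs) • (X 0 * (v i * W j)) - (i * b) • (h3 * W j)

/-- The products `v i * W j` of degree `n + 1`, with `k ≤ i`. -/
def layer (K : Type*) [Field K] {A : Type*} [Ring A] [Algebra K A] (v W : ℕ → A) (k n : ℕ) :
    Submodule K A :=
  Submodule.span K {x | ∃ i j, k ≤ i ∧ i + j = n ∧ x = v i * W j}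

theorem bracket_mem_layer (h : SkewData t X v ξ η) (hW : IsTower t b X v 0 W) {k n : ℕ} {x : A}
    (hx : x ∈ layer K v W k n) :
    X 2 * x - (((n + 1 : ℕ) : K) * b) • (X 0 * x) - t ^ (n + 1) • (x * X 2) ∈
      layer K v W k (n + 1) := by
  induction hx using Submodule.span_induction with
  | mem x hx =>
    obtain ⟨i, j, hk, hn, rfl⟩ := hx
    rw [bracket_v_mul h hW hn]
    exact add_mem (Submodule.smul_mem _ _ (Submodule.subset_span ⟨i, j + 1, hk, by omega, rfl⟩))
      (Submodule.smul_mem _ _ (Submodule.subset_span ⟨i + 1, j, by omega, by omega, rfl⟩))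
  | zero => simp
  | add x y _ _ hx hy =>
    convert add_mem hx hy using 1
    simp only [mul_add, add_mul]
    module
  | smul a x _ hx =>
    convert Submodule.smul_mem _ a hx using 1
    simp only [mul_smul_comm, smul_mul_assoc]
    module

theorem sub_mem_layer (h : SkewData t X v ξ η) (hW : IsTower t b X v 0 W)
    (hZ : IsTower t b X v c Z) (n : ℕ) : Z n - W n ∈ layer K v W 1 n := by
  induction n with
  | zero => rw [hZ.zero, hW.zero, sub_self]; exact zero_mem _
  | succ n ih =>
    have h1 := bracket_mem_layer h hW ih
    have h2 : c n • (v (n + 1) * X 1) ∈ layer K v W 1 (n + 1) :=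
      Submodule.smul_mem _ _ (Submodule.subset_span ⟨n + 1, 0, by omega, by omega, by rw [hW.zero]⟩)
    convert add_mem h1 h2 using 1
    rw [hZ.succ, hW.succ, Pi.zero_apply]
    simp only [mul_sub, sub_mul]
    module

theorem mem_layer (h : SkewData t X v ξ η) (hW : IsTower t b X v 0 W)
    (hZ : IsTower t b X v c Z) (n : ℕ) : Z n ∈ layer K v W 0 n := by
  have h1 : W n ∈ layer K v W 0 n :=
    Submodule.subset_span ⟨0, n, le_rfl, by omega, by rw [h.v_zero, one_mul]⟩
  have h2 : layer K v W 1 n ≤ layer K v W 0 n := Submodule.span_mono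
    fun x ⟨i, j, _, hn, hx⟩ => ⟨i, j, by omega, hn, hx⟩
  simpa using add_mem h1 (h2 (sub_mem_layer h hW hZ n))

/-- If a tower without corrections skew commutes, then so do all towers. -/
theorem comm_of_comm (h : SkewData t X v ξ η) (hW : IsTower t b X v 0 W)
    (hZ : IsTower t b X v c Z) (hc : ∀ i j, Comm t W i j) (m n : ℕ) : Comm t Z m n := by
  have key : ∀ x ∈ layer K v W 0 m, ∀ y ∈ layer K v W 0 n,
      x * y = t ^ ((m + 1) * (n + 1)) • (y * x) := by
    intro x hx y hy
    induction hx using Submodule.span_induction with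
    | zero => simp
    | add x x' _ _ hx hx' => rw [add_mul, mul_add y, smul_add, hx, hx']
    | smul a x _ hx => rw [smul_mul_assoc, hx, mul_smul_comm, smul_comm]
    | mem x hx =>
      induction hy using Submodule.span_induction with
      | zero => simp
      | add y y' _ _ hy hy' => rw [mul_add, add_mul y, smul_add, hy, hy']
      | smul a y _ hy => rw [smul_mul_assoc, mul_smul_comm, hy, smul_comm]
      | mem y hy =>
        obtain ⟨i, j, -, hm, rfl⟩ := hx
        obtain ⟨i', j', -, hn, rfl⟩ := hy
        have h1 := v_mul h hW j i'
        have h2 := v_mul h hW j' i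
        have h3 := h.comm i i'
        have h4 := hc j j'
        rw [Comm] at h4
        subst hm hn
        have e : t ^ ((i + j + 1) * (i' + j' + 1)) =
          t ^ (i * i') * t ^ (i * (j' + 1)) * t ^ (i' * (j + 1)) * t ^ ((j + 1) * (j' + 1)) := by
          ring
        have hs := h.sq_pow (i * (j' + 1))
        have hu := h.sq_pow (i' * (j + 1))
        rw [e]
        generalize t ^ (i * i') = p at *
        generalize t ^ (i * (j' + 1)) = q at *
        generalize t ^ (i' * (j + 1)) = r at *
        generalize t ^ ((j + 1) * (j' + 1)) = u at *
        linear_combination (norm := (simp only [smul_mul_assoc, mul_smul_comm, mul_assoc]; module))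
          -(r • (v i * (h1 * W j'))) - (hu) • (v i * (W j * (v i' * W j'))) +
          r • (h3 * (W j * W j')) + (r * p) • (v i' * (v i * h4)) +
          (r * p * u) • (v i' * (h2 * W j))
  exact key _ (mem_layer h hW hZ m) _ (mem_layer h hW hZ n)

end IsTower

end Towers

/-! ### Spanning by monomials ending in powers of `x₃` -/

section SpanWithLast

variable {K : Type*} [Field K] {A : Type*} [Ring A] [Algebra K A]

theorem exists_mul_eq_of_mem_adjoin {s : Set A} {x : A}
    (hx : ∀ g ∈ s, ∃ f ∈ Algebra.adjoin K s, ∃ f' ∈ Algebra.adjoin K s, x * g = f * x + f')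
    {g : A} (hg : g ∈ Algebra.adjoin K s) :
    ∃ f ∈ Algebra.adjoin K s, ∃ f' ∈ Algebra.adjoin K s, x * g = f * x + f' := by
  induction hg using Algebra.adjoin_induction with
  | mem g hg => exact hx g hg
  | algebraMap r =>
    exact ⟨algebraMap K A r, Subalgebra.algebraMap_mem _ r, 0, zero_mem _, by
      rw [Algebra.commutes, add_zero]⟩
  | add g h _ _ hg hh =>
    obtain ⟨f, hf, f', hf', e⟩ := hg
    obtain ⟨k, hk, k', hk', e'⟩ := hh
    exact ⟨f + k, add_mem hf hk, f' + k', add_mem hf' hk', by rw [mul_add, e, e', add_mul]; abel⟩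
  | mul g h _ hh' hg hh =>
    obtain ⟨f, hf, f', hf', e⟩ := hg
    obtain ⟨k, hk, k', hk', e'⟩ := hh
    refine ⟨f * k, mul_mem hf hk, f * k' + f' * h, add_mem (mul_mem hf hk') (mul_mem hf' hh'), ?_⟩
    rw [← mul_assoc, e, add_mul, mul_assoc, e', mul_add, mul_assoc]
    abel

/-- If `x₁, x₂` lie in the subalgebra generated by skew commuting elements `g i`, and this
subalgebra is stable under bracketing with `x₃`, then the ordered monomials in the `g i` and `x₃`
span everything. -/
theorem span_withLast_eq_top {π : T K →ₐ[K] A} (hπ : Function.Surjective π) {ι : Type*}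
    [LinearOrder ι] {g : ι → A} {h : ι → ℕ∞}
    (hc : ∀ i j, ∃ c : K, g i * g j = c • (g j * g i))
    (hsq : ∀ i, h i = ⊤ ∨ (h i = 2 ∧ g i * g i = 0))
    (h1 : π x₁ ∈ Set.range g) (h2 : π x₂ ∈ Set.range g)
    (h3 : ∀ i, ∃ f ∈ Algebra.adjoin K (Set.range g), ∃ f' ∈ Algebra.adjoin K (Set.range g),
      π x₃ * g i = f * π x₃ + f') :
    Submodule.span K (Set.range fun n : {n : WithTop ι →₀ ℕ // ∀ i, (n i : ℕ∞) < withLast ⊤ h i} =>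
      orderedMonomial (withLast (π x₃) g) n.1) = ⊤ := by
  set S := Algebra.adjoin K (Set.range g)
  set U := Submodule.span K (Set.range
    fun n : {n : WithTop ι →₀ ℕ // ∀ i, (n i : ℕ∞) < withLast ⊤ h i} =>
      orderedMonomial (withLast (π x₃) g) n.1) with hU
  have hSU : ∀ f ∈ S, ∀ m : ℕ, f * π x₃ ^ m ∈ U := by
    intro f hf m
    have hf' := adjoin_le_span_of_skew hc hsq hf
    clear hf
    induction hf' using Submodule.span_induction with
    | zero => rw [zero_mul]; exact zero_mem _
    | add x y _ _ hx hy => rw [add_mul]; exact add_mem (hx) (hy)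
    | smul a x _ hx => rw [smul_mul_assoc]; exact Submodule.smul_mem _ _ hx
    | mem x hx =>
      obtain ⟨n, rfl⟩ := hx
      refine Submodule.subset_span ⟨⟨n.1.mapDomain WithTop.some + Finsupp.single ⊤ m, ?_⟩, ?_⟩
      · intro i
        induction i using WithTop.recTopCoe with
        | top => exact ENat.natCast_lt_top _
        | coe i =>
          rw [Finsupp.add_apply, Finsupp.mapDomain_apply WithTop.coe_injective,
            Finsupp.single_eq_of_ne (WithTop.coe_ne_top), add_zero]
          exact n.2 i
      · change orderedMonomial (withLast (π x₃) g) (n.1.mapDomain WithTop.some +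
          Finsupp.single ⊤ m) = orderedMonomial g n.1 * π x₃ ^ m
        rw [orderedMonomial_withLast]
        congr 2
        · ext i
          rw [Finsupp.comapDomain_apply, Finsupp.add_apply,
            Finsupp.mapDomain_apply WithTop.coe_injective,
            Finsupp.single_eq_of_ne (WithTop.coe_ne_top), add_zero]
        · rw [Finsupp.add_apply, Finsupp.single_eq_same, Finsupp.mapDomain_of_notMem_range, zero_add]
          simp
  have hU' : U = Submodule.span K {y | ∃ f ∈ S, ∃ m : ℕ, y = f * π x₃ ^ m} := by
    refine le_antisymm (Submodule.span_le.mpr ?_) (Submodule.span_le.mpr ?_)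
    · rintro _ ⟨n, rfl⟩
      refine Submodule.subset_span ⟨_, ?_, _, orderedMonomial_withLast _ _ _⟩
      refine list_prod_mem (S := S) fun x hx => ?_
      obtain ⟨i, -, rfl⟩ := List.mem_map.mp hx
      exact pow_mem (Algebra.subset_adjoin (Set.mem_range_self i)) _
    · rintro _ ⟨f, hf, m, rfl⟩
      exact hSU f hf m
  have hmul : ∀ i, ∀ y ∈ U, π (FreeAlgebra.ι K i) * y ∈ U := by
    intro i y hy
    rw [hU'] at hy
    induction hy using Submodule.span_induction with
    | zero => rw [mul_zero]; exact zero_mem _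
    | add x y _ _ hx hy => rw [mul_add]; exact add_mem (hx) (hy)
    | smul a x _ hx => rw [mul_smul_comm]; exact Submodule.smul_mem _ _ hx
    | mem x hx =>
      obtain ⟨f, hf, m, rfl⟩ := hx
      rw [← mul_assoc]
      have hin : ∀ y, y ∈ Set.range g → y * f * π x₃ ^ m ∈ U := fun y hy =>
        hSU _ (mul_mem (Algebra.subset_adjoin hy) hf) m
      fin_cases i
      · exact hin _ h1
      · exact hin _ h2
      · obtain ⟨k, hk, k', hk', e⟩ := exists_mul_eq_of_mem_adjoin
          (s := Set.range g) (x := π x₃) (fun y hy => by obtain ⟨i, rfl⟩ := hy; exact h3 i) hf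
        change π x₃ * f * π x₃ ^ m ∈ U
        rw [e, add_mul, mul_assoc, ← pow_succ']
        exact add_mem (hSU _ hk _) (hSU _ hk' _)
  rw [eq_top_iff]
  intro y _
  obtain ⟨x, rfl⟩ := hπ y
  induction x using left_induction with
  | one => simpa using hSU 1 (one_mem _) 0
  | smul c x hx => rw [map_smul]; exact Submodule.smul_mem _ _ (hx trivial)
  | add x y hx hy => rw [map_add]; exact add_mem (hx trivial) (hy trivial)
  | mul i x hx => rw [map_mul]; exact hmul i _ (hx trivial)

end SpanWithLast

/-! ### The sequences `v n` -/

section SkewDataInstances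

variable {K : Type*} [Field K] {A : Type*} [Ring A] [Algebra K A] {X : Fin 3 → A}

theorem skewData_one {e : K} (h21 : X 1 * X 0 = X 0 * X 1)
    (h31 : X 2 * X 0 = X 0 * X 2 + e • (X 0 * X 0)) :
    SkewData 1 X (fun n => X 0 ^ n) (fun _ => 1) (fun n => n * e) where
  sq := one_mul 1
  v_zero := pow_zero _
  v_one := pow_one _
  x₁_mul n := by rw [one_smul, pow_succ']
  x₃_mul n := by
    rw [one_pow, one_smul]
    induction n with
    | zero => simp
    | succ n ih =>
      rw [pow_succ, ← mul_assoc, ih, add_mul, mul_assoc, h31, mul_add, smul_mul_assoc,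
        mul_smul_comm]
      simp only [pow_succ, mul_assoc]
      push_cast
      module
  comm m n := by rw [one_pow, one_smul, ← pow_add, ← pow_add, add_comm]
  mul_x₂ n := by
    rw [one_pow, one_smul]
    exact (Commute.pow_left (show Commute (X 0) (X 1) from h21.symm) n)

/-- The sequence `1, x₁, y, x₁ y, y², …`. -/
def superPow (x y : A) (n : ℕ) : A := x ^ (n % 2) * y ^ (n / 2)

theorem superPow_even (x y : A) (m : ℕ) : superPow x y (2 * m) = y ^ m := by
  simp [superPow]

theorem superPow_odd (x y : A) (m : ℕ) : superPow x y (2 * m + 1) = x * y ^ m := by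
  rw [superPow, Nat.mul_add_mod, show (2 * m + 1) / 2 = m by omega]
  simp

theorem skewData_neg_one {e : K} {Y : A} (h21 : X 1 * X 0 = -(X 0 * X 1)) (h11 : X 0 * X 0 = 0)
    (hY : X 2 * X 0 + X 0 * X 2 = Y) (hY2 : Y * X 1 = X 1 * Y)
    (hY3 : X 2 * Y = Y * X 2 + (2 * e) • (X 0 * Y)) :
    SkewData (-1) X (superPow (X 0) Y) (fun n => if Even n then 1 else 0)
      (fun n => if Even n then n * e else 1) := by
  have hY1 : X 0 * Y = Y * X 0 := by
    rw [← hY, mul_add, add_mul, ← mul_assoc (X 0) (X 0), h11, mul_assoc (X 2), h11, mul_assoc]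
    simp
  have c1 : ∀ m : ℕ, X 0 * Y ^ m = Y ^ m * X 0 := fun m =>
    (show Commute (X 0) Y from hY1).pow_right m
  have c2 : ∀ m : ℕ, Y ^ m * X 1 = X 1 * Y ^ m := fun m =>
    (show Commute Y (X 1) from hY2).pow_left m
  have c3 : ∀ m : ℕ, X 2 * Y ^ m = Y ^ m * X 2 + (2 * m * e) • (X 0 * Y ^ m) := by
    intro m
    induction m with
    | zero => simp
    | succ m ih =>
      rw [pow_succ, ← mul_assoc, ih, add_mul, mul_assoc, hY3, mul_add, smul_mul_assoc,
        mul_smul_comm, ← mul_assoc (Y ^ m) (X 0), ← c1]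
      simp only [mul_assoc]
      push_cast
      module
  refine ⟨by ring, by simp [superPow], by simp [superPow], fun n => ?_, fun n => ?_, fun m n => ?_,
    fun n => ?_⟩
  · rcases Nat.even_or_odd' n with ⟨m, rfl | rfl⟩
    · simp [superPow_even, superPow_odd]
    · rw [if_neg (by simp), superPow_odd, ← mul_assoc, h11]
      simp
  · rcases Nat.even_or_odd' n with ⟨m, rfl | rfl⟩
    · rw [if_pos (by simp), superPow_odd, superPow_even, c3, pow_mul]
      simp
    · rw [if_neg (by simp), show 2 * m + 1 + 1 = 2 * (m + 1) by ring, superPow_odd, superPow_even,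
        pow_succ, pow_mul, ← mul_assoc, eq_sub_of_add_eq hY, sub_mul, mul_assoc (X 0), c3, mul_add,
        mul_smul_comm, ← mul_assoc (X 0) (X 0), h11]
      simp only [pow_succ']
      simp [mul_assoc]
      abel
  · rcases Nat.even_or_odd' m with ⟨i, rfl | rfl⟩ <;> rcases Nat.even_or_odd' n with ⟨j, rfl | rfl⟩
    · rw [superPow_even, superPow_even, mul_assoc, pow_mul]
      simp [← pow_add, add_comm]
    · rw [superPow_even, superPow_odd, mul_assoc, pow_mul, ← mul_assoc, ← c1, mul_assoc]
      simp [← pow_add, mul_assoc, add_comm]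
    · rw [superPow_even, superPow_odd, mul_left_comm, pow_mul, ← mul_assoc (Y ^ j), ← c1, mul_assoc]
      simp [← pow_add, mul_assoc, add_comm]
    · rw [superPow_odd, superPow_odd, mul_assoc, mul_assoc, ← mul_assoc (Y ^ i) (X 0), ← c1,
        ← mul_assoc (Y ^ j) (X 0), ← c1, ← mul_assoc, ← mul_assoc, ← mul_assoc (X 0) (X 0 * _),
        ← mul_assoc (X 0) (X 0), h11]
      simp
  · rcases Nat.even_or_odd' n with ⟨m, rfl | rfl⟩
    · rw [superPow_even, c2, pow_mul]; simp
    · rw [superPow_odd, mul_assoc, c2, ← mul_assoc, ← neg_eq_iff_eq_neg.mpr h21, pow_succ, pow_mul]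
      simp [mul_assoc]

end SkewDataInstances

/-! ### Comparison of two towers -/

section TowerIdentities

variable {K : Type*} [Field K] {A : Type*} [Ring A] [Algebra K A] {X : Fin 3 → A}
  {b e s y : K} {c : ℕ → K} {Z W : ℕ → A}

theorem tower_identity_one (he : e = b - s) (h31 : X 2 * X 0 = X 0 * X 2 + e • (X 0 * X 0))
    (hZ : IsTower 1 b X (fun n => X 0 ^ n) c Z) (hW : IsTower 1 b X (fun n => X 0 ^ n) 0 W)
    (hc0 : c 0 = -y) (hc : ∀ n, c (n + 1) = -((n + 1) * s * c n)) (n : ℕ) :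
    Z (n + 1) + (((n : K) + 1) * s) • (X 0 * Z n) =
      W (n + 1) + (((n : K) + 1) * s - y) • (X 0 * W n) := by
  subst he
  induction n with
  | zero =>
    rw [hZ.succ, hW.succ, hZ.zero, hW.zero, hc0]
    simp
    module
  | succ n P =>
    have z1 := hZ.succ n
    have z2 := hZ.succ (n + 1)
    have w1 := hW.succ n
    have w2 := hW.succ (n + 1)
    rw [hc n] at z2
    have hv : X 0 ^ (n + 1 + 1) = X 0 * X 0 ^ (n + 1) := pow_succ' _ _
    simp only [one_pow, one_smul, Pi.zero_apply, zero_smul, add_zero, hv] at z1 z2 w1 w2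
    push_cast at z1 z2 w1 w2 ⊢
    linear_combination (norm := (simp only [mul_add, add_mul, mul_sub, sub_mul, smul_mul_assoc,
      mul_smul_comm, mul_assoc]; module))
      X 2 * P - (((n : K) + 2) * b) • (X 0 * P) - P * X 2 + s • (X 0 * P) + z2 -
      (((n : K) + 1) * s) • (h31 * Z n) + (((n : K) + 1) * s) • (X 0 * z1) - w2 +
      (((n : K) + 1) * s - y) • (h31 * W n) - (((n : K) + 1) * s - y) • (X 0 * w1)

/-- The bracket with `x₃` in the recursion of a tower. -/
def towerBracket (t b : K) (X : Fin 3 → A) (n : ℕ) : A →ₗ[K] A :=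
  LinearMap.mulLeft K (X 2) - (((n + 1 : ℕ) : K) * b) • LinearMap.mulLeft K (X 0) -
    t ^ (n + 1) • LinearMap.mulRight K (X 2)

theorem towerBracket_apply (t b : K) (X : Fin 3 → A) (n : ℕ) (f : A) :
    towerBracket t b X n f =
      X 2 * f - (((n + 1 : ℕ) : K) * b) • (X 0 * f) - t ^ (n + 1) • (f * X 2) := by
  simp [towerBracket]

theorem IsTower.bracket {t : K} {v : ℕ → A} (hZ : IsTower t b X v c Z) (n : ℕ) :
    towerBracket t b X n (Z n) = Z (n + 1) - c n • (v (n + 1) * X 1) := by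
  rw [towerBracket_apply, hZ.succ, add_sub_cancel_right]

theorem tower_identity_neg_one {Y : A} (he : e = b - s) (h11 : X 0 * X 0 = 0)
    (hY : X 2 * X 0 + X 0 * X 2 = Y) (hY3 : X 2 * Y = Y * X 2 + (2 * e) • (X 0 * Y))
    (hZ : IsTower (-1) b X (superPow (X 0) Y) c Z) (hW : IsTower (-1) b X (superPow (X 0) Y) 0 W)
    (hc0 : c 0 = y) (hc1 : c 1 = -y) (hce : ∀ m, c (2 * m + 2) = (2 * m + 2) * s * c (2 * m + 1))
    (hco : ∀ m, c (2 * m + 3) = -((2 * m + 2) * s * c (2 * m + 1))) (m : ℕ) :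
    Z (2 * m + 2) + ((2 * (m : K) + 2) * s) • (X 0 * Z (2 * m + 1)) =
      W (2 * m + 2) + ((2 * (m : K) + 2) * s - y) • (X 0 * W (2 * m + 1)) := by
  subst he
  have hY1 : Y * X 0 = X 0 * Y := by
    rw [← hY, mul_add, add_mul, ← mul_assoc (X 0) (X 0), h11, mul_assoc (X 2), h11, mul_assoc]
    simp
  have bX : ∀ n f, towerBracket (-1) b X (n + 1) (X 0 * f) =
      Y * f - X 0 * towerBracket (-1) b X n f := by
    intro n f
    simp only [towerBracket_apply]
    rw [pow_succ]
    generalize (-1 : K) ^ (n + 1) = u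
    linear_combination (norm := (simp only [mul_add, add_mul, mul_sub, sub_mul, smul_mul_assoc,
      mul_smul_comm, mul_assoc, zero_mul]; module))
      hY * f - (((n + 1 + 1 : ℕ) : K) * b) • (h11 * f) - (((n + 1 : ℕ) : K) * b) • (h11 * f)
  have bY : ∀ n f, towerBracket (-1) b X (n + 2) (Y * f) =
      Y * towerBracket (-1) b X n f - (2 * s) • (X 0 * (Y * f)) := by
    intro n f
    simp only [towerBracket_apply]
    rw [show n + 2 + 1 = n + 1 + 1 + 1 by ring, pow_succ, pow_succ]
    generalize (-1 : K) ^ (n + 1) = u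
    push_cast
    linear_combination (norm := (simp only [mul_add, add_mul, mul_sub, sub_mul, smul_mul_assoc,
      mul_smul_comm, mul_assoc]; module))
      hY3 * f + (((n : K) + 1) * b) • (hY1 * f)
  have vX : ∀ m : ℕ, X 0 * superPow (X 0) Y (2 * m) = superPow (X 0) Y (2 * m + 1) := fun m => by
    rw [superPow_even, superPow_odd]
  have vY : ∀ m : ℕ, Y * superPow (X 0) Y (2 * m) = superPow (X 0) Y (2 * m + 2) := fun m => by
    rw [superPow_even, show 2 * m + 2 = 2 * (m + 1) by ring, superPow_even, pow_succ']
  have first : Z 1 = W 1 + y • (X 0 * X 1) := by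
    have h1 := hZ.bracket 0
    have h2 := hW.bracket 0
    rw [hZ.zero, hc0] at h1
    rw [hW.zero, Pi.zero_apply, zero_smul, sub_zero] at h2
    have : superPow (X 0) Y (0 + 1) = X 0 := by simpa using superPow_odd (X 0) Y 0
    rw [this, h2] at h1
    rw [h1]; abel
  induction m with
  | zero =>
    have h1 := congrArg (towerBracket (-1) b X 1) first
    rw [hZ.bracket, map_add, hW.bracket, map_smul, bX, ← hW.zero, hW.bracket, hc1] at h1
    have h2 := congrArg (X 0 * ·) first
    have h3 := vY 0
    simp only [Nat.mul_zero, superPow, Nat.zero_mod, Nat.zero_div, pow_zero, mul_one] at h3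
    simp only [superPow] at h1
    simp at h1 h2 ⊢
    rw [mul_add, mul_smul_comm, ← mul_assoc, h11, zero_mul, smul_zero, add_zero] at h2
    rw [hW.zero] at h1
    linear_combination (norm := module) h1 + (2 * s) • h2
  | succ m E =>
    have O : Z (2 * m + 3) = W (2 * m + 3) + y • (X 0 * W (2 * m + 2)) -
        ((2 * (m : K) + 2) * s) • (Y * Z (2 * m + 1)) +
        ((2 * (m : K) + 2) * s - y) • (Y * W (2 * m + 1)) := by
      have h1 := congrArg (towerBracket (-1) b X (2 * m + 2)) E
      have h2 := congrArg (X 0 * ·) E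
      have h3 := vX (m + 1)
      rw [show 2 * (m + 1) = 2 * m + 2 by ring] at h3
      simp only [map_add, map_smul, bX, hZ.bracket, hW.bracket, Pi.zero_apply, zero_smul, sub_zero,
        hce] at h1
      simp only [mul_add, mul_smul_comm, ← mul_assoc (X 0) (X 0), h11, zero_mul, smul_zero,
        add_zero] at h2
      linear_combination (norm := (simp only [mul_add, add_mul, mul_sub, sub_mul, smul_mul_assoc,
        mul_smul_comm, mul_assoc]; module)) h1 + ((2 * (m : K) + 2) * s) • h2 -
        ((2 * (m : K) + 2) * s * c (2 * m + 1)) • (h3 * X 1)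
    have h1 := congrArg (towerBracket (-1) b X (2 * m + 3)) O
    have h3 := vY (m + 1)
    rw [show 2 * (m + 1) = 2 * m + 2 by ring] at h3
    have h2 := congrArg (X 0 * ·) O
    simp only [map_add, map_sub, map_smul, bX (2 * m + 2), bY (2 * m + 1), hZ.bracket, hW.bracket,
      Pi.zero_apply, zero_smul, sub_zero, hco] at h1
    simp only [mul_add, mul_sub, mul_smul_comm, ← mul_assoc (X 0) (X 0), h11, zero_mul, smul_zero,
      add_zero] at h2
    rw [show 2 * (m + 1) + 2 = 2 * m + 4 by ring, show 2 * (m + 1) + 1 = 2 * m + 3 by ring]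
    push_cast
    linear_combination (norm := (simp only [mul_add, add_mul, mul_sub, sub_mul, smul_mul_assoc,
        mul_smul_comm, mul_assoc]; module)) h1 - ((2 * (m : K) + 2) * s) • (Y * E) +
        ((2 * (m : K) + 2) * s * ((2 * (m : K) + 2) * s)) • (hY1 * Z (2 * m + 1)) -
        ((2 * (m : K) + 2) * s * ((2 * (m : K) + 2) * s - y)) • (hY1 * W (2 * m + 1)) +
        ((2 * (m : K) + 4) * s) • h2 + ((2 * (m : K) + 2) * s * c (2 * m + 1)) • (h3 * X 1)

end TowerIdentities

/-! ### Spanning sets for the second family -/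

section SpanSecondFamily

variable {K : Type u} [Field K] {A : Type u} [Ring A] [Algebra K A] {π : T K →ₐ[K] A} {b p q : K}

theorem SkewData.skew {t : K} {X : Fin 3 → A} {v : ℕ → A} {ξ η c : ℕ → K} {Z : ℕ → A}
    (h : SkewData t X v ξ η) (hZ : IsTower t b X v c Z) (hc : ∀ i j, IsTower.Comm t Z i j) {x y : A}
    (hx : (∃ m, x = v m) ∨ ∃ n, x = Z n) (hy : (∃ m, y = v m) ∨ ∃ n, y = Z n) :
    ∃ c : K, x * y = c • (y * x) := by
  rcases hx with ⟨m, rfl⟩ | ⟨m, rfl⟩ <;> rcases hy with ⟨n, rfl⟩ | ⟨n, rfl⟩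
  · exact ⟨_, h.comm m n⟩
  · exact ⟨_, hZ.v_mul h n m⟩
  · refine ⟨t ^ (n * (m + 1)), ?_⟩
    rw [hZ.v_mul h m n, smul_smul, h.sq_pow, one_smul]
  · exact ⟨_, hc m n⟩

/-- The images of the generators `x₁, x₂, x₃`. -/
abbrev images (π : T K →ₐ[K] A) (i : Fin 3) : A := π (FreeAlgebra.ι K i)

theorem skewData_one_of_relsPlus (hrel : ∀ r ∈ relsPlus b p q, π r = 0) :
    SkewData 1 (images π) (fun n => images π 0 ^ n) (fun _ => 1)
      (fun n => (n : K) * ((b - p) / 2)) := by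
  have h1 := hrel _ (Or.inl (Or.inl rfl))
  have h2 := hrel _ (Or.inl (Or.inr rfl))
  refine skewData_one ?_ ?_
  · rwa [map_sub, map_mul, map_mul, sub_eq_zero] at h1
  · simp only [map_add, map_sub, map_mul, map_smul, pow_two] at h2
    linear_combination (norm := module) h2

theorem isTower_z (π : T K →ₐ[K] A) (b p q : K) :
    IsTower 1 b (images π) (fun n => images π 0 ^ n)
      (fun n => (n.factorial : K) * (q - p) * ((-b - p) / 2) ^ n) (fun n => π (z b p q n)) where
  zero := rfl
  succ n := by
    simp only [z, map_add, map_sub, map_mul, map_smul, map_pow, sub_mul, smul_mul_assoc, one_pow,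
      one_smul]

theorem comm_z_of_relsPlus (hrel : ∀ r ∈ relsPlus b p q, π r = 0) (i j : ℕ) :
    IsTower.Comm (1 : K) (fun n => π (z b p q n)) i j := by
  refine (isTower_z π b p q).comm_of_exists (skewData_one_of_relsPlus hrel) (fun k _ => ?_) i j
  rcases Nat.even_or_odd' k with ⟨m, rfl | rfl⟩
  · exact ⟨m, m, by ring, by rw [IsTower.Comm, one_pow, one_smul]⟩
  · refine ⟨m + 1, m, by ring, ?_⟩
    have := hrel _ (Or.inr ⟨m, rfl⟩)
    rw [IsTower.Comm, one_pow, one_smul]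
    rwa [map_sub, map_mul, map_mul, sub_eq_zero] at this

theorem span_eq_top_of_relsPlus (hπ : Function.Surjective π)
    (hrel : ∀ r ∈ relsPlus b p q, π r = 0) {ι : Type} [LinearOrder ι] {f : ι → ℕ}
    (h0 : 0 ∈ Set.range f) (h1 : 1 ∈ Set.range f)
    (hclosed : ∀ n, n + 1 ∈ Set.range f → π (z b p q (n + 1)) ∈
      Algebra.adjoin K (Set.range fun i => π (genPlus b p q (f i)))) :
    Submodule.span K (Set.range fun n : {n : WithTop ι →₀ ℕ //
        ∀ i, (n i : ℕ∞) < withLast ⊤ (fun _ => ⊤) i} =>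
      orderedMonomial (fun i => π (withLast x₃ (fun i => genPlus b p q (f i)) i)) n.1) = ⊤ := by
  have hS := skewData_one_of_relsPlus hrel
  have hZ := isTower_z π b p q
  have hg : ∀ n, (∃ m, π (genPlus b p q n) = images π 0 ^ m) ∨
      ∃ m, π (genPlus b p q n) = π (z b p q m) := by
    intro n
    cases n with
    | zero => exact Or.inl ⟨1, by rw [pow_one]; rfl⟩
    | succ n => exact Or.inr ⟨n, rfl⟩
  have e1 : (fun i => π (withLast x₃ (fun i => genPlus b p q (f i)) i)) =
      withLast (π x₃) (fun i => π (genPlus b p q (f i))) := by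
    funext i
    induction i using WithTop.recTopCoe <;> rfl
  have hx1 : π x₁ ∈ Set.range fun i => π (genPlus b p q (f i)) := by
    obtain ⟨i, hi⟩ := h0
    exact ⟨i, by simp only [hi]; rfl⟩
  have hx2 : π x₂ ∈ Set.range fun i => π (genPlus b p q (f i)) := by
    obtain ⟨i, hi⟩ := h1
    exact ⟨i, by simp only [hi]; rfl⟩
  have key := span_withLast_eq_top hπ (g := fun i => π (genPlus b p q (f i))) (h := fun _ => ⊤)
    (fun i j => hS.skew hZ (comm_z_of_relsPlus hrel) (hg _) (hg _)) (fun _ => Or.inl rfl)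
    hx1 hx2 (fun i => by
      have m1 := Algebra.subset_adjoin (R := K) hx1
      have m2 := Algebra.subset_adjoin (R := K) hx2
      have mi : π (genPlus b p q (f i)) ∈
        Algebra.adjoin K (Set.range fun i => π (genPlus b p q (f i))) :=
        Algebra.subset_adjoin ⟨i, rfl⟩
      have hc := hclosed (f i - 1)
      revert mi hc
      rcases hfi : f i with _ | n
      · intro mi _
        refine ⟨_, mi, ((b - p) / 2) • (π x₁ * π x₁), Subalgebra.smul_mem _ (mul_mem m1 m1) _, ?_⟩
        have := hS.x₃_mul 1
        rw [← pow_two]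
        simp only [pow_one, one_smul, Nat.cast_one, one_mul] at this
        exact this
      · intro mi hc
        have hc := hc ⟨i, by omega⟩
        have := hZ.succ n
        refine ⟨_, mi, π (z b p q (n + 1)) + (((n + 1 : ℕ) : K) * b) • (π x₁ * π (z b p q n)) -
          ((n.factorial : K) * (q - p) * ((-b - p) / 2) ^ n) • (π x₁ ^ (n + 1) * π x₂),
          sub_mem (add_mem hc (Subalgebra.smul_mem _ (mul_mem m1 mi) _))
            (Subalgebra.smul_mem _ (mul_mem (pow_mem m1 _) m2) _), ?_⟩
        rw [this, one_pow, one_smul]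
        simp only [genPlus]
        abel)
  rw [← e1] at key
  exact key

theorem skewData_neg_one_of_relsMinus [CharZero K] (hrel : ∀ r ∈ relsMinus b p q, π r = 0) :
    SkewData (-1) (images π) (superPow (images π 0) (π x₃₁)) (fun n => if Even n then 1 else 0)
      (fun n => if Even n then (n : K) * ((b - p) / 2) else 1) := by
  have h1 := hrel _ (Or.inl (Or.inl rfl))
  have h2 := hrel _ (Or.inl (Or.inr (Or.inl rfl)))
  have h3 := hrel _ (Or.inl (Or.inr (Or.inr (Or.inr (Or.inl rfl)))))
  have h4 := hrel _ (Or.inl (Or.inr (Or.inr (Or.inr (Or.inr rfl)))))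
  refine skewData_neg_one ?_ ?_ ?_ ?_ ?_
  · rwa [map_add, map_mul, map_mul, add_eq_zero_iff_eq_neg] at h1
  · rwa [map_pow, pow_two] at h2
  · rw [x₃₁, map_add, map_mul, map_mul]
  · rwa [map_sub, map_mul, map_mul, sub_eq_zero] at h3
  · simp only [map_add, map_sub, map_mul, map_smul] at h4
    rw [mul_div_cancel₀ _ (two_ne_zero)]
    linear_combination (norm := module) h4

/-- The coefficients of the corrections in the recursion for `z_n`, `t = -1`. -/
def correction' (b p q : K) (n : ℕ) : K :=
  if Even n then ((n / 2).factorial : K) * (p - q) * (-p - b) ^ (n / 2)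
  else -((((n - 1) / 2).factorial : K) * (p - q) * (-p - b) ^ ((n - 1) / 2))

theorem isTower_z' (hc : π x₃₁ * π x₂ = π x₂ * π x₃₁) :
    IsTower (-1) b (images π) (superPow (images π 0) (π x₃₁)) (correction' b p q)
      (fun n => π (z' b p q n)) where
  zero := rfl
  succ n := by
    have c2 : ∀ m : ℕ, π x₃₁ ^ m * π x₂ = π x₂ * π x₃₁ ^ m := fun m =>
      (show Commute (π x₃₁) (π x₂) from hc).pow_left m
    rcases Nat.even_or_odd' n with ⟨m, rfl | rfl⟩
    · rw [superPow_odd, mul_assoc, c2, correction', if_pos (even_two_mul m), z',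
        if_pos (even_two_mul m)]
      simp only [map_add, map_sub, map_mul, map_smul, map_pow, sub_mul, smul_mul_assoc, pow_succ,
        pow_mul, mul_assoc]
      simp
      abel
    · have ho : ¬ Even (2 * m + 1) := by simp
      rw [show 2 * m + 1 + 1 = 2 * (m + 1) by ring, superPow_even, c2, correction', if_neg ho,
        show 2 * (m + 1) = 2 * m + 1 + 1 by ring, z', if_neg ho,
        show (2 * m + 1 + 1) / 2 = m + 1 by omega, show (2 * m + 1 - 1) / 2 = m by omega]
      simp only [map_add, map_sub, map_neg, map_mul, map_smul, map_pow, sub_mul, smul_mul_assoc]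
      rw [show 2 * m + 1 + 1 = 2 * (m + 1) by ring, pow_mul (-1 : K)]
      simp
      abel

theorem comm_z'_of_relsMinus [CharZero K] (hrel : ∀ r ∈ relsMinus b p q, π r = 0) (i j : ℕ) :
    IsTower.Comm (-1 : K) (fun n => π (z' b p q n)) i j := by
  have hS := skewData_neg_one_of_relsMinus hrel
  have hZ := isTower_z' (b := b) (p := p) (q := q) (π := π) (by
    have := hrel _ (Or.inl (Or.inr (Or.inr (Or.inr (Or.inl rfl)))))
    rwa [map_sub, map_mul, map_mul, sub_eq_zero] at this)
  have hsq : ∀ n, π (z' b p q (2 * n)) * π (z' b p q (2 * n)) = 0 := by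
    intro n
    cases n with
    | zero =>
      have := hrel _ (Or.inl (Or.inr (Or.inr (Or.inl rfl))))
      rwa [map_pow, pow_two] at this
    | succ n =>
      have := hrel _ (Or.inr ⟨n + 1, by omega, Or.inr rfl⟩)
      rwa [map_pow, pow_two] at this
  refine hZ.comm_of_exists hS (fun k ih => ?_) i j
  rcases Nat.even_or_odd' k with ⟨m, rfl | rfl⟩
  · refine ⟨m, m, by ring, ?_⟩
    rcases Nat.even_or_odd' m with ⟨n, rfl | rfl⟩
    · rw [IsTower.Comm, hsq, smul_zero]
    · rw [IsTower.Comm, show (2 * n + 1 + 1) * (2 * n + 1 + 1) = 2 * (2 * (n + 1) * (n + 1)) by ring,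
        pow_mul]
      simp
  · refine ⟨m + 1, m, by ring, ?_⟩
    rcases Nat.even_or_odd' m with ⟨n, rfl | rfl⟩
    · have h0 := ih (2 * n) (2 * n) (by omega)
      have h1 := hZ.comm_step hS h0 (ih 0 (2 * n) (by omega)) (ih 0 (2 * n) (by omega))
      have e1 : ((-1 : K)) ^ ((2 * n + 2) * (2 * n + 1)) = 1 :=
        Even.neg_one_pow (Even.mul_right (by simp [parity_simps]) _)
      have e2 : ((-1 : K)) ^ (2 * n + 1) = -1 := Odd.neg_one_pow (by simp)
      rw [mul_comm (2 * n + 1), e1, e2, one_smul, one_smul] at h1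
      rw [IsTower.Comm, e1, one_smul, ← sub_eq_zero]
      have h2 : (2 : K) • (π (z' b p q (2 * n + 1)) * π (z' b p q (2 * n)) -
          π (z' b p q (2 * n)) * π (z' b p q (2 * n + 1))) = 0 := by
        linear_combination (norm := module) h1
      exact (smul_eq_zero.mp h2).resolve_left two_ne_zero
    · have := hrel _ (Or.inr ⟨n + 1, by omega, Or.inl rfl⟩)
      rw [map_sub, map_mul, map_mul, sub_eq_zero, show 2 * (n + 1) - 1 = 2 * n + 1 by omega] at this
      rw [IsTower.Comm, show (2 * n + 1 + 1 + 1) * (2 * n + 1 + 1) = 2 * ((2 * n + 3) * (n + 1)) by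
        ring, pow_mul]
      rw [show 2 * (n + 1) = 2 * n + 1 + 1 by ring] at this
      simpa using this

theorem span_eq_top_of_relsMinus [CharZero K] (hπ : Function.Surjective π)
    (hrel : ∀ r ∈ relsMinus b p q, π r = 0) {ι : Type} [LinearOrder ι] {f : ι → ℕ}
    (h0 : 0 ∈ Set.range f) (h1 : 1 ∈ Set.range f) (h2 : 2 ∈ Set.range f)
    (hclosed : ∀ n, n = 0 ∨ n + 2 ∈ Set.range f → π (z' b p q (n + 1)) ∈
      Algebra.adjoin K (Set.range fun i => π (genMinus b p q (f i)))) :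
    Submodule.span K (Set.range fun n : {n : WithTop ι →₀ ℕ //
        ∀ i, (n i : ℕ∞) < withLast ⊤ (fun i => heightMinus (f i)) i} =>
      orderedMonomial (fun i => π (withLast x₃ (fun i => genMinus b p q (f i)) i)) n.1) = ⊤ := by
  have hS := skewData_neg_one_of_relsMinus hrel
  have hZ := isTower_z' (b := b) (p := p) (q := q) (π := π) (by
    have := hrel _ (Or.inl (Or.inr (Or.inr (Or.inr (Or.inl rfl)))))
    rwa [map_sub, map_mul, map_mul, sub_eq_zero] at this)
  have v2 : superPow (images π 0) (π x₃₁) 2 = π x₃₁ := by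
    simpa using superPow_even (images π 0) (π x₃₁) 1
  have hg : ∀ n, (∃ m, π (genMinus b p q n) = superPow (images π 0) (π x₃₁) m) ∨
      ∃ m, π (genMinus b p q n) = π (z' b p q m) := by
    intro n
    match n with
    | 0 => exact Or.inl ⟨1, hS.v_one.symm⟩
    | 1 => exact Or.inr ⟨0, rfl⟩
    | 2 => exact Or.inl ⟨2, v2.symm⟩
    | n + 3 => exact Or.inr ⟨n + 1, rfl⟩
  have hsq : ∀ n, heightMinus n = ⊤ ∨
      (heightMinus n = 2 ∧ π (genMinus b p q n) * π (genMinus b p q n) = 0) := by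
    intro n
    match n with
    | 0 =>
      have := hrel _ (Or.inl (Or.inr (Or.inl rfl)))
      rw [map_pow, pow_two] at this
      exact Or.inr ⟨rfl, this⟩
    | 1 =>
      have := hrel _ (Or.inl (Or.inr (Or.inr (Or.inl rfl))))
      rw [map_pow, pow_two] at this
      exact Or.inr ⟨rfl, this⟩
    | 2 => exact Or.inl rfl
    | n + 3 =>
      by_cases hn : Even (n + 1)
      · obtain ⟨m, hm⟩ := even_iff_exists_two_mul.mp hn
        have := hrel _ (Or.inr ⟨m, by omega, Or.inr rfl⟩)
        rw [map_pow, pow_two, ← hm] at this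
        exact Or.inr ⟨if_pos hn, this⟩
      · exact Or.inl (if_neg hn)
  have e1 : (fun i => π (withLast x₃ (fun i => genMinus b p q (f i)) i)) =
      withLast (π x₃) (fun i => π (genMinus b p q (f i))) := by
    funext i
    induction i using WithTop.recTopCoe <;> rfl
  have hx : ∀ n, n ∈ Set.range f → π (genMinus b p q n) ∈
      Set.range fun i => π (genMinus b p q (f i)) := by
    rintro _ ⟨i, rfl⟩
    exact ⟨i, rfl⟩
  have m1 := Algebra.subset_adjoin (R := K) (hx 0 h0)
  have m2 := Algebra.subset_adjoin (R := K) (hx 1 h1)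
  have m3 := Algebra.subset_adjoin (R := K) (hx 2 h2)
  have mv : ∀ n, superPow (images π 0) (π x₃₁) n ∈
      Algebra.adjoin K (Set.range fun i => π (genMinus b p q (f i))) := fun n =>
    mul_mem (pow_mem m1 _) (pow_mem m3 _)
  have mz : ∀ n, π (z' b p q n) ∈ Algebra.adjoin K (Set.range fun i => π (genMinus b p q (f i))) →
      π (z' b p q (n + 1)) ∈ Algebra.adjoin K (Set.range fun i => π (genMinus b p q (f i))) →
      ∃ g ∈ Algebra.adjoin K (Set.range fun i => π (genMinus b p q (f i))),
      ∃ g' ∈ Algebra.adjoin K (Set.range fun i => π (genMinus b p q (f i))),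
        π x₃ * π (z' b p q n) = g * π x₃ + g' := by
    intro n hn hn'
    refine ⟨(-1 : K) ^ (n + 1) • π (z' b p q n), Subalgebra.smul_mem _ hn _,
      π (z' b p q (n + 1)) + (((n + 1 : ℕ) : K) * b) • (π x₁ * π (z' b p q n)) -
      correction' b p q n • (superPow (images π 0) (π x₃₁) (n + 1) * π x₂),
      sub_mem (add_mem hn' (Subalgebra.smul_mem _ (mul_mem m1 hn) _))
        (Subalgebra.smul_mem _ (mul_mem (mv _) m2) _), ?_⟩
    rw [hZ.succ n, smul_mul_assoc]
    abel
  have key := span_withLast_eq_top hπ (g := fun i => π (genMinus b p q (f i)))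
    (h := fun i => heightMinus (f i))
    (fun i j => hS.skew hZ (comm_z'_of_relsMinus hrel) (hg _) (hg _)) (fun i => hsq (f i))
    (hx 0 h0) (hx 1 h1) (fun i => by
      have mi := Algebra.subset_adjoin (R := K) (hx (f i) ⟨i, rfl⟩)
      have hc := hclosed (f i - 2)
      have hfi : f i ∈ Set.range f := ⟨i, rfl⟩
      revert mi hc hfi
      generalize f i = n
      match n with
      | 0 =>
        intro _ _ _
        refine ⟨_, Subalgebra.neg_mem _ m1, _, m3, ?_⟩
        have := hS.x₃_mul 1
        rw [hS.v_one, v2, pow_one] at this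
        rw [neg_mul]
        simp only [neg_smul, one_smul, if_neg (by decide : ¬ Even 1)] at this
        exact this
      | 1 => exact fun mi hc _ => mz 0 mi (hc (Or.inl rfl))
      | 2 =>
        intro _ _ _
        refine ⟨_, m3, _, Subalgebra.smul_mem _ (mv 3) (2 * ((b - p) / 2)), ?_⟩
        have := hS.x₃_mul 2
        rw [v2] at this
        simp only [even_two, if_true, neg_one_sq, one_smul, Nat.cast_ofNat] at this
        exact this
      | n + 3 => exact fun mi hc h => mz (n + 1) mi (hc (Or.inr (by simpa using h))))
  rw [← e1] at key
  exact key

end SpanSecondFamily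

/-! ### The skew derivations for the second family -/

section SecondFamilyDerivations

variable {K : Type u} [Field K] {t a b p q k : K}

theorem fact_braidCoeff_R2 (t a b p q k : K) : Fact (BraidCoeff (R2 t a b p q k)) :=
  ⟨braidCoeff_R2 t a b p q k⟩

attribute [local instance] fact_braidCoeff_R2

set_option maxHeartbeats 1600000 in
theorem npast_gen_R2 (i j l : Fin 3) :
    npast (R2 t a b p q k) i l (gen _ j) =
      match i, j, l with
      | 0, 0, 0 | 1, 0, 1 | 2, 0, 2 => t • gen _ 0
      | 2, 0, 0 => (t * b) • gen _ 0
      | 0, 1, 0 | 1, 1, 1 | 2, 1, 2 => t • gen _ 1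
      | 2, 1, 1 => (t * (p - q)) • gen _ 0
      | 2, 1, 0 => (t * b) • gen _ 1
      | 0, 2, 0 | 2, 2, 2 => t • (gen _ 2 + p • gen _ 0)
      | 1, 2, 1 => t • (gen _ 2 + q • gen _ 0)
      | 2, 2, 0 => t • (a • gen _ 0 - k • gen _ 1 + b • gen _ 2)
      | 2, 2, 1 => (t * k) • gen _ 0
      | _, _, _ => 0 := by
  rw [npast_gen]
  simp only [coeff_R2, Fin.sum_univ_three]
  fin_cases i <;> fin_cases j <;> fin_cases l <;>
    simp [Poly.entry, poly2, Poly.eval, Poly.evalMon] <;> module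

local notation "ℜ" => R2 t a b p q k

theorem npast_0_0_gen_0 : npast ℜ 0 0 (gen ℜ 0) = t • gen ℜ 0 :=
  npast_gen_R2 0 0 0

theorem npast_1_1_gen_0 : npast ℜ 1 1 (gen ℜ 0) = t • gen ℜ 0 :=
  npast_gen_R2 1 0 1

theorem npast_2_2_gen_0 : npast ℜ 2 2 (gen ℜ 0) = t • gen ℜ 0 :=
  npast_gen_R2 2 0 2

theorem npast_2_0_gen_0 : npast ℜ 2 0 (gen ℜ 0) = (t * b) • gen ℜ 0 :=
  npast_gen_R2 2 0 0

theorem npast_2_1_gen_0 : npast ℜ 2 1 (gen ℜ 0) = 0 :=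
  npast_gen_R2 2 0 1

theorem npast_0_0_gen_1 : npast ℜ 0 0 (gen ℜ 1) = t • gen ℜ 1 :=
  npast_gen_R2 0 1 0

theorem npast_1_1_gen_1 : npast ℜ 1 1 (gen ℜ 1) = t • gen ℜ 1 :=
  npast_gen_R2 1 1 1

theorem npast_2_2_gen_1 : npast ℜ 2 2 (gen ℜ 1) = t • gen ℜ 1 :=
  npast_gen_R2 2 1 2

theorem npast_2_1_gen_1 : npast ℜ 2 1 (gen ℜ 1) = (t * (p - q)) • gen ℜ 0 :=
  npast_gen_R2 2 1 1

theorem npast_2_0_gen_1 : npast ℜ 2 0 (gen ℜ 1) = (t * b) • gen ℜ 1 :=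
  npast_gen_R2 2 1 0

theorem npast_0_0_gen_2 : npast ℜ 0 0 (gen ℜ 2) = t • (gen ℜ 2 + p • gen ℜ 0) :=
  npast_gen_R2 0 2 0

theorem npast_2_2_gen_2 : npast ℜ 2 2 (gen ℜ 2) = t • (gen ℜ 2 + p • gen ℜ 0) :=
  npast_gen_R2 2 2 2

theorem npast_1_1_gen_2 : npast ℜ 1 1 (gen ℜ 2) = t • (gen ℜ 2 + q • gen ℜ 0) :=
  npast_gen_R2 1 2 1

theorem npast_2_0_gen_2 : npast ℜ 2 0 (gen ℜ 2) = t • (a • gen ℜ 0 - k • gen ℜ 1 + b • gen ℜ 2) :=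
  npast_gen_R2 2 2 0

theorem npast_2_1_gen_2 : npast ℜ 2 1 (gen ℜ 2) = (t * k) • gen ℜ 0 :=
  npast_gen_R2 2 2 1

theorem npast_gen_eq_zero {v : Fin 3} (hv : v ≠ 2) (j l : Fin 3) (hl : l ≠ v) :
    npast ℜ v l (gen ℜ j) = 0 := by
  rw [npast_gen_R2]
  fin_cases v <;> fin_cases l <;> fin_cases j <;> first | rfl | exact absurd rfl hv | exact absurd rfl hl

theorem npast_eq_zero_R2 {v l : Fin 3} (hv : v ≠ 2) (hl : l ≠ v) (x : NicholsAlgebra ℜ) :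
    npast ℜ v l x = 0 :=
  npast_eq_zero (fun j l hl => npast_gen_eq_zero hv j l hl) hl x

theorem npast_0_0_mul (x y : NicholsAlgebra ℜ) :
    npast ℜ 0 0 (x * y) = npast ℜ 0 0 x * npast ℜ 0 0 y :=
  npast_self_mul (fun j l hl => npast_gen_eq_zero (by decide) j l hl) x y

theorem npast_1_1_mul (x y : NicholsAlgebra ℜ) :
    npast ℜ 1 1 (x * y) = npast ℜ 1 1 x * npast ℜ 1 1 y :=
  npast_self_mul (fun j l hl => npast_gen_eq_zero (by decide) j l hl) x y

theorem npast_2_2_mul (x y : NicholsAlgebra ℜ) :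
    npast ℜ 2 2 (x * y) = npast ℜ 2 2 x * npast ℜ 2 2 y := by
  rw [npast_mul, Fin.sum_univ_three, npast_eq_zero_R2 (v := 0) (l := 2) (by decide) (by decide),
    npast_eq_zero_R2 (v := 1) (l := 2) (by decide) (by decide), mul_zero, mul_zero, zero_add,
    zero_add]

theorem npast_2_0_mul (x y : NicholsAlgebra ℜ) :
    npast ℜ 2 0 (x * y) = npast ℜ 2 2 x * npast ℜ 2 0 y + npast ℜ 2 0 x * npast ℜ 0 0 y := by
  rw [npast_mul, Fin.sum_univ_three, npast_eq_zero_R2 (v := 1) (l := 0) (by decide) (by decide),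
    mul_zero, add_zero, add_comm]

theorem npast_2_1_mul (x y : NicholsAlgebra ℜ) :
    npast ℜ 2 1 (x * y) = npast ℜ 2 2 x * npast ℜ 2 1 y + npast ℜ 2 1 x * npast ℜ 1 1 y := by
  rw [npast_mul, Fin.sum_univ_three, npast_eq_zero_R2 (v := 0) (l := 1) (by decide) (by decide),
    mul_zero, zero_add, add_comm]

theorem nder_0_mul (x y : NicholsAlgebra ℜ) :
    nder ℜ 0 (x * y) = x * nder ℜ 0 y + nder ℜ 0 x * npast ℜ 0 0 y +
      nder ℜ 2 x * npast ℜ 2 0 y := by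
  rw [nder_mul, Fin.sum_univ_three, npast_eq_zero_R2 (v := 1) (l := 0) (by decide) (by decide),
    mul_zero, add_zero, add_assoc]

theorem nder_1_mul (x y : NicholsAlgebra ℜ) :
    nder ℜ 1 (x * y) = x * nder ℜ 1 y + nder ℜ 1 x * npast ℜ 1 1 y +
      nder ℜ 2 x * npast ℜ 2 1 y := by
  rw [nder_mul, Fin.sum_univ_three, npast_eq_zero_R2 (v := 0) (l := 1) (by decide) (by decide),
    mul_zero, zero_add, add_assoc]

theorem nder_2_mul (x y : NicholsAlgebra ℜ) :
    nder ℜ 2 (x * y) = x * nder ℜ 2 y + nder ℜ 2 x * npast ℜ 2 2 y := by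
  rw [nder_mul, Fin.sum_univ_three, npast_eq_zero_R2 (v := 0) (l := 2) (by decide) (by decide),
    npast_eq_zero_R2 (v := 1) (l := 2) (by decide) (by decide), mul_zero, mul_zero, zero_add,
    zero_add]

theorem nder_gen_self (i : Fin 3) : nder ℜ i (gen ℜ i) = 1 := by rw [nder_gen, if_pos rfl]

theorem nder_gen_of_ne {l i : Fin 3} (h : i ≠ l) : nder ℜ l (gen ℜ i) = 0 := by
  rw [nder_gen, if_neg h]

theorem gen_1_mul_gen_0 (ht : t * t = 1) : gen ℜ 1 * gen ℜ 0 = t • (gen ℜ 0 * gen ℜ 1) := by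
  refine eq_of_nder (by simp [ncounit_mul]) fun l => ?_
  fin_cases l
  · simp [nder_0_mul, nder_gen, npast_0_0_gen_1, smul_smul, ht]
  · simp [nder_1_mul, nder_gen, npast_1_1_gen_0]
  · simp [nder_2_mul, nder_gen]

theorem gen_2_mul_gen_0 [CharZero K] (ht : t = 1) : gen ℜ 2 * gen ℜ 0 = gen ℜ 0 * gen ℜ 2 +
    ((b - p) / 2) • (gen ℜ 0 * gen ℜ 0) := by
  refine eq_of_nder (by simp [ncounit_mul]) fun l => ?_
  fin_cases l
  · simp [nder_0_mul, nder_gen, npast_0_0_gen_0, npast_0_0_gen_2, npast_2_0_gen_0, ht]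
    module
  · simp [nder_1_mul, nder_gen, npast_2_1_gen_0]
  · simp [nder_2_mul, nder_gen, npast_2_2_gen_0, ht]

theorem gen_0_mul_gen_0 (ht : t = -1) : gen ℜ 0 * gen ℜ 0 = 0 := by
  refine eq_zero_of_nder (by simp [ncounit_mul]) fun l => ?_
  fin_cases l
  · simp [nder_0_mul, nder_gen, npast_0_0_gen_0, ht]
  · simp [nder_1_mul, nder_gen]
  · simp [nder_2_mul, nder_gen]

theorem gen_1_mul_gen_1 (ht : t = -1) : gen ℜ 1 * gen ℜ 1 = 0 := by
  refine eq_zero_of_nder (by simp [ncounit_mul]) fun l => ?_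
  fin_cases l
  · simp [nder_0_mul, nder_gen]
  · simp [nder_1_mul, nder_gen, npast_1_1_gen_1, ht]
  · simp [nder_2_mul, nder_gen]

end SecondFamilyDerivations

/-! ### The sequence `v n` in the Nichols algebra -/

section VDerivations

variable {K : Type u} [Field K] {t a b p q k : K}

attribute [local instance] fact_braidCoeff_R2

local notation "ℜ" => R2 t a b p q k

/-- The braiding and the skew derivations on the elements `v n`. -/
structure VData (R : Matrix (Fin 9) (Fin 9) K) [Fact (BraidCoeff R)] (t : K)
    (v : ℕ → NicholsAlgebra R) (ρ : ℕ → K) : Prop where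
  npast_0 : ∀ n, npast R 0 0 (v n) = t ^ n • v n
  npast_1 : ∀ n, npast R 1 1 (v n) = t ^ n • v n
  nder_0 : ∀ n, nder R 0 (v (n + 1)) = ρ n • v n
  nder_1 : ∀ n, nder R 1 (v n) = 0
  nder_2 : ∀ n, nder R 2 (v n) = 0

theorem skewData_R2_one [CharZero K] (a b p q k : K) :
    SkewData 1 (gen (R2 1 a b p q k)) (fun n => gen _ 0 ^ n) (fun _ => 1)
      (fun n => (n : K) * ((b - p) / 2)) :=
  skewData_one (by rw [gen_1_mul_gen_0 (one_mul 1), one_smul]) (gen_2_mul_gen_0 rfl)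

theorem vData_one (a b p q k : K) :
    VData (R2 1 a b p q k) 1 (fun n => gen _ 0 ^ n) (fun n => (n : K) + 1) where
  npast_0 n := by
    rw [one_pow, one_smul]
    induction n with
    | zero => simp [npast_one]
    | succ n ih => rw [pow_succ, npast_0_0_mul, ih, npast_0_0_gen_0, one_smul]
  npast_1 n := by
    rw [one_pow, one_smul]
    induction n with
    | zero => simp [npast_one]
    | succ n ih => rw [pow_succ, npast_1_1_mul, ih, npast_1_1_gen_0, one_smul]
  nder_0 n := by
    induction n with
    | zero => simp [nder_gen_self]
    | succ n ih =>
      rw [pow_succ, nder_0_mul, ih, npast_0_0_gen_0, nder_gen_self]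
      have : nder (R2 1 a b p q k) 2 (gen _ 0 ^ (n + 1)) = 0 := by
        induction n + 1 with
        | zero => simp
        | succ n ih => rw [pow_succ, nder_2_mul, ih, nder_gen_of_ne (by decide)]; simp
      rw [this, zero_mul, smul_mul_assoc, one_smul, mul_one, ← pow_succ]
      push_cast
      module
  nder_1 n := by
    have : ∀ n, nder (R2 1 a b p q k) 2 (gen _ 0 ^ n) = 0 := by
      intro n
      induction n with
      | zero => simp
      | succ n ih => rw [pow_succ, nder_2_mul, ih, nder_gen_of_ne (by decide)]; simp
    induction n with
    | zero => simp
    | succ n ih => rw [pow_succ, nder_1_mul, ih, this, nder_gen_of_ne (by decide)]; simp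
  nder_2 n := by
    induction n with
    | zero => simp
    | succ n ih => rw [pow_succ, nder_2_mul, ih, nder_gen_of_ne (by decide)]; simp

theorem proj_x₃₁ (R : Matrix (Fin 9) (Fin 9) K) :
    proj R x₃₁ = gen R 2 * gen R 0 + gen R 0 * gen R 2 := by
  rw [x₃₁, map_add, map_mul, map_mul]; rfl

theorem nder_x₃₁ (ht : t = -1) (l : Fin 3) :
    nder ℜ l (proj ℜ x₃₁) = if l = 0 then -(b + p) • gen ℜ 0 else 0 := by
  subst ht
  rw [proj_x₃₁]
  fin_cases l
  · simp [nder_0_mul, nder_gen, npast_0_0_gen_0, npast_0_0_gen_2, npast_2_0_gen_0]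
    module
  · simp [nder_1_mul, nder_gen, npast_2_1_gen_0]
  · simp [nder_2_mul, nder_gen, npast_2_2_gen_0]

theorem npast_0_0_x₃₁ (ht : t = -1) : npast ℜ 0 0 (proj ℜ x₃₁) = proj ℜ x₃₁ := by
  have h := gen_0_mul_gen_0 (a := a) (b := b) (p := p) (q := q) (k := k) ht
  subst ht
  simp only [proj_x₃₁, map_add, npast_0_0_mul, npast_0_0_gen_0, npast_0_0_gen_2]
  simp only [add_mul, mul_add, smul_mul_assoc, mul_smul_comm, h]
  module

theorem npast_1_1_x₃₁ (ht : t = -1) : npast ℜ 1 1 (proj ℜ x₃₁) = proj ℜ x₃₁ := by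
  have h := gen_0_mul_gen_0 (a := a) (b := b) (p := p) (q := q) (k := k) ht
  subst ht
  simp only [proj_x₃₁, map_add, npast_1_1_mul, npast_1_1_gen_0, npast_1_1_gen_2]
  simp only [add_mul, mul_add, smul_mul_assoc, mul_smul_comm, h]
  module

theorem npast_2_2_x₃₁ (ht : t = -1) : npast ℜ 2 2 (proj ℜ x₃₁) = proj ℜ x₃₁ := by
  have h := gen_0_mul_gen_0 (a := a) (b := b) (p := p) (q := q) (k := k) ht
  subst ht
  simp only [proj_x₃₁, map_add, npast_2_2_mul, npast_2_2_gen_0, npast_2_2_gen_2]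
  simp only [add_mul, mul_add, smul_mul_assoc, mul_smul_comm, h]
  module

theorem npast_2_0_x₃₁ (ht : t = -1) : npast ℜ 2 0 (proj ℜ x₃₁) = (2 * b) • proj ℜ x₃₁ := by
  have h := gen_0_mul_gen_0 (a := a) (b := b) (p := p) (q := q) (k := k) ht
  have h' := gen_1_mul_gen_0 (t := t) (a := a) (b := b) (p := p) (q := q) (k := k) (by rw [ht]; ring)
  subst ht
  simp only [proj_x₃₁, map_add, npast_2_0_mul, npast_2_2_gen_0, npast_2_2_gen_2, npast_2_0_gen_0,
    npast_2_0_gen_2, npast_0_0_gen_0, npast_0_0_gen_2]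
  simp only [add_mul, mul_add, sub_mul, mul_sub, smul_mul_assoc, mul_smul_comm, h, h']
  module

theorem npast_2_1_x₃₁ (ht : t = -1) : npast ℜ 2 1 (proj ℜ x₃₁) = 0 := by
  have h := gen_0_mul_gen_0 (a := a) (b := b) (p := p) (q := q) (k := k) ht
  subst ht
  simp only [proj_x₃₁, map_add, npast_2_1_mul, npast_2_2_gen_0, npast_2_2_gen_2, npast_2_1_gen_0,
    npast_2_1_gen_2, npast_1_1_gen_0, npast_1_1_gen_2]
  simp only [add_mul, mul_add, smul_mul_assoc, mul_smul_comm, h, mul_zero, zero_mul]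
  module

theorem x₃₁_mul_gen_1 (ht : t = -1) : proj ℜ x₃₁ * gen ℜ 1 = gen ℜ 1 * proj ℜ x₃₁ := by
  have h' := gen_1_mul_gen_0 (t := t) (a := a) (b := b) (p := p) (q := q) (k := k) (by rw [ht]; ring)
  have h1 := nder_x₃₁ (a := a) (b := b) (p := p) (q := q) (k := k) ht
  have h2 := npast_1_1_x₃₁ (a := a) (b := b) (p := p) (q := q) (k := k) ht
  refine eq_of_nder (by simp [ncounit_mul]) fun l => ?_
  fin_cases l
  · simp [nder_0_mul, nder_gen, npast_0_0_gen_1, h1, h', smul_smul, ht]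
  · simp [nder_1_mul, nder_gen, h1, h2]
  · simp [nder_2_mul, nder_gen, h1]

theorem gen_2_mul_x₃₁ (ht : t = -1) :
    gen ℜ 2 * proj ℜ x₃₁ = proj ℜ x₃₁ * gen ℜ 2 + (b - p) • (gen ℜ 0 * proj ℜ x₃₁) := by
  have h := gen_0_mul_gen_0 (a := a) (b := b) (p := p) (q := q) (k := k) ht
  have h1 := nder_x₃₁ (a := a) (b := b) (p := p) (q := q) (k := k) ht
  refine eq_of_nder (by simp [ncounit_mul]) fun l => ?_
  fin_cases l
  · simp [nder_0_mul, nder_gen, npast_0_0_gen_2, h1, npast_2_0_x₃₁ ht, npast_0_0_x₃₁ ht, h, mul_add]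
    rw [proj_x₃₁, ht]
    module
  · simp [nder_1_mul, nder_gen, h1, npast_2_1_x₃₁ ht]
  · simp [nder_2_mul, nder_gen, h1, npast_2_2_x₃₁ ht]

theorem skewData_R2_neg_one [CharZero K] (a b p q k : K) :
    SkewData (-1) (gen (R2 (-1) a b p q k)) (superPow (gen _ 0) (proj _ x₃₁))
      (fun n => if Even n then 1 else 0)
      (fun n => if Even n then (n : K) * ((b - p) / 2) else 1) :=
  skewData_neg_one (by rw [gen_1_mul_gen_0 (by ring), neg_smul, one_smul]) (gen_0_mul_gen_0 rfl)
    (proj_x₃₁ _).symm (x₃₁_mul_gen_1 rfl)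
    (by rw [mul_div_cancel₀ _ two_ne_zero]; exact gen_2_mul_x₃₁ rfl)

theorem vData_neg_one [CharZero K] (a b p q k : K) :
    VData (R2 (-1) a b p q k) (-1) (superPow (gen _ 0) (proj _ x₃₁))
      (fun n => if Even n then 1 else -(((n : K) + 1) / 2 * (b + p))) := by
  set R := R2 (-1) a b p q k
  set Y := proj R x₃₁ with hYdef
  have h11 : gen R 0 * gen R 0 = 0 := gen_0_mul_gen_0 rfl
  have hY1 : gen R 0 * Y = Y * gen R 0 := by
    rw [hYdef, proj_x₃₁, mul_add, add_mul, ← mul_assoc (gen R 0) (gen R 0), h11,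
      mul_assoc (gen R 2), h11, mul_assoc]
    simp
  have hD := nder_x₃₁ (t := -1) (a := a) (b := b) (p := p) (q := q) (k := k) rfl
  have p0 : ∀ m, npast R 0 0 (Y ^ m) = Y ^ m := by
    intro m
    induction m with
    | zero => simp [npast_one]
    | succ m ih => rw [pow_succ, npast_0_0_mul, ih, npast_0_0_x₃₁ rfl]
  have p1 : ∀ m, npast R 1 1 (Y ^ m) = Y ^ m := by
    intro m
    induction m with
    | zero => simp [npast_one]
    | succ m ih => rw [pow_succ, npast_1_1_mul, ih, npast_1_1_x₃₁ rfl]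
  have d2 : ∀ m, nder R 2 (Y ^ m) = 0 := by
    intro m
    induction m with
    | zero => simp
    | succ m ih => rw [pow_succ, nder_2_mul, ih, hD]; simp
  have d1 : ∀ m, nder R 1 (Y ^ m) = 0 := by
    intro m
    induction m with
    | zero => simp
    | succ m ih => rw [pow_succ, nder_1_mul, ih, hD, d2]; simp
  have d0 : ∀ m : ℕ, nder R 0 (Y ^ (m + 1)) = -(((m : K) + 1) * (b + p)) • (gen R 0 * Y ^ m) := by
    intro m
    induction m with
    | zero => simp [hYdef, hD, R]
    | succ m ih =>
      rw [pow_succ', nder_0_mul, ih, p0, hD, hD, if_pos rfl, if_neg (by decide), mul_smul_comm,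
        ← mul_assoc, ← hY1, mul_assoc, ← pow_succ', smul_mul_assoc, zero_mul]
      push_cast
      module
  refine ⟨fun n => ?_, fun n => ?_, fun n => ?_, fun n => ?_, fun n => ?_⟩ <;>
    rcases Nat.even_or_odd' n with ⟨m, rfl | rfl⟩
  · rw [superPow_even, p0, pow_mul]; simp
  · rw [superPow_odd, npast_0_0_mul, p0, npast_0_0_gen_0, pow_succ, pow_mul]; simp
  · rw [superPow_even, p1, pow_mul]; simp
  · rw [superPow_odd, npast_1_1_mul, p1, npast_1_1_gen_0, pow_succ, pow_mul]; simp
  · rw [superPow_even, superPow_odd, nder_0_mul, p0, if_pos (by simp), nder_gen_self,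
      nder_gen_of_ne (by decide)]
    cases m with
    | zero => simp
    | succ m => rw [d0, mul_smul_comm, ← mul_assoc, h11]; simp
  · rw [show 2 * m + 1 + 1 = 2 * (m + 1) by ring, superPow_even, superPow_odd, d0,
      if_neg (by simp)]
    congr 1
    push_cast
    field_simp
    ring
  · rw [superPow_even, d1]
  · rw [superPow_odd, nder_1_mul, d1, nder_gen_of_ne (by decide), nder_gen_of_ne (by decide)]; simp
  · rw [superPow_even, d2]
  · rw [superPow_odd, nder_2_mul, d2, nder_gen_of_ne (by decide)]; simp

end VDerivations

/-! ### The tower `w n` in the Nichols algebra -/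

section WDerivations

variable {K : Type u} [Field K] {t a b p q k : K}

attribute [local instance] fact_braidCoeff_R2

local notation "ℜ" => R2 t a b p q k

/-- The tower without corrections. -/
def tower {A : Type*} [Ring A] [Algebra K A] (t b : K) (X : Fin 3 → A) : ℕ → A
  | 0 => X 1
  | n + 1 => X 2 * tower t b X n - (((n + 1 : ℕ) : K) * b) • (X 0 * tower t b X n) -
      t ^ (n + 1) • (tower t b X n * X 2)

theorem isTower_tower {A : Type*} [Ring A] [Algebra K A] (t b : K) (X : Fin 3 → A) (v : ℕ → A) :
    IsTower t b X v 0 (tower t b X) where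
  zero := rfl
  succ n := by rw [Pi.zero_apply, zero_smul, add_zero]; rfl

/-- The coefficients of the braiding of `x₃` with `w n`. -/
def thetaCoeff (b y : K) (ξ η : ℕ → K) : ℕ → K
  | 0 => y
  | n + 1 => thetaCoeff b y ξ η n * (η (n + 1) + (y - (n + 1) * b) * ξ (n + 1))

/-- The coefficients of the skew derivation `∂₂ w_n = γ_n v_n`. -/
def gammaCoeff (t b q y : K) (ξ η : ℕ → K) : ℕ → K
  | 0 => 1
  | n + 1 => gammaCoeff t b q y ξ η n * (η n - ((n + 1) * b + q) * ξ n) +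
      t ^ (n + 1) * thetaCoeff b y ξ η n

variable {v : ℕ → NicholsAlgebra (R2 t a b p q k)} {ξ η ρ : ℕ → K}

local notation "w" => tower t b (gen (R2 t a b p q k))

theorem gen_0_mul_w (h : SkewData t (gen ℜ) v ξ η) (n : ℕ) :
    gen ℜ 0 * w n = t ^ (n + 1) • (w n * gen ℜ 0) := by
  have := (isTower_tower t b (gen ℜ) v).v_mul h n 1
  rwa [h.v_one, one_mul] at this

theorem npast_0_w (h : SkewData t (gen ℜ) v ξ η) (n : ℕ) : npast ℜ 0 0 (w n) = t ^ (n + 1) • w n := by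
  induction n with
  | zero => simp [tower, npast_0_0_gen_1]
  | succ n ih =>
    have h1 := gen_0_mul_w h n
    rw [tower, map_sub, map_sub, map_smul, map_smul, npast_0_0_mul, npast_0_0_mul, npast_0_0_mul, ih,
      npast_0_0_gen_0, npast_0_0_gen_2, pow_succ t (n + 1)]
    generalize t ^ (n + 1) = u at *
    linear_combination (norm := (simp only [mul_add, add_mul, mul_sub, sub_mul, smul_mul_assoc,
      mul_smul_comm, mul_assoc]; module)) (t * u * p) • h1

theorem npast_1_w (h : SkewData t (gen ℜ) v ξ η) (n : ℕ) : npast ℜ 1 1 (w n) = t ^ (n + 1) • w n := by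
  induction n with
  | zero => simp [tower, npast_1_1_gen_1]
  | succ n ih =>
    have h1 := gen_0_mul_w h n
    rw [tower, map_sub, map_sub, map_smul, map_smul, npast_1_1_mul, npast_1_1_mul, npast_1_1_mul, ih,
      npast_1_1_gen_0, npast_1_1_gen_2, pow_succ t (n + 1)]
    generalize t ^ (n + 1) = u at *
    linear_combination (norm := (simp only [mul_add, add_mul, mul_sub, sub_mul, smul_mul_assoc,
      mul_smul_comm, mul_assoc]; module)) (t * u * q) • h1

theorem npast_2_w (h : SkewData t (gen ℜ) v ξ η) (n : ℕ) : npast ℜ 2 2 (w n) = t ^ (n + 1) • w n := by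
  induction n with
  | zero => simp [tower, npast_2_2_gen_1]
  | succ n ih =>
    have h1 := gen_0_mul_w h n
    rw [tower, map_sub, map_sub, map_smul, map_smul, npast_2_2_mul, npast_2_2_mul, npast_2_2_mul, ih,
      npast_2_2_gen_0, npast_2_2_gen_2, pow_succ t (n + 1)]
    generalize t ^ (n + 1) = u at *
    linear_combination (norm := (simp only [mul_add, add_mul, mul_sub, sub_mul, smul_mul_assoc,
      mul_smul_comm, mul_assoc]; module)) (t * u * p) • h1

theorem ncounit_w (n : ℕ) : ncounit ℜ (w n) = 0 := by
  cases n <;> simp [tower, ncounit_mul]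

/-- Elements on which only `∂₂` is nonzero skew commute. -/
theorem w_comm (h : SkewData t (gen ℜ) v ξ η) {γ : ℕ → K} {m n : ℕ}
    (hm : ∀ l, nder ℜ l (w m) = if l = 1 then γ m • v m else 0)
    (hn : ∀ l, nder ℜ l (w n) = if l = 1 then γ n • v n else 0) :
    w m * w n = t ^ ((m + 1) * (n + 1)) • (w n * w m) := by
  refine eq_of_nder (by simp [ncounit_mul, ncounit_w]) fun l => ?_
  fin_cases l
  · simp [nder_0_mul, hm, hn]
  · have h1 := (isTower_tower t b (gen ℜ) v).v_mul h n m
    have h2 := (isTower_tower t b (gen ℜ) v).v_mul h m n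
    have e1 : t ^ ((m + 1) * (n + 1)) = t ^ (m * (n + 1)) * t ^ (n + 1) := by ring
    have e2 : t ^ (m * (n + 1)) * t ^ (n + 1) = t ^ (n * (m + 1)) * t ^ (m + 1) := by ring
    have hs := h.sq_pow (n * (m + 1))
    have hu := h.sq_pow (m + 1)
    simp [nder_1_mul, hm, hn, npast_1_w h]
    rw [e1]
    generalize t ^ (m * (n + 1)) = d at *
    generalize t ^ (n * (m + 1)) = d' at *
    generalize t ^ (n + 1) = s at *
    generalize t ^ (m + 1) = u at *
    linear_combination (norm := module) (γ m * s) • h1 - (γ n * d') • h2 -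
      (γ n * hs) • (w m * v n) - (γ n * u * e2) • (v n * w m) - (γ n * d' * hu) • (v n * w m)
  · simp [nder_2_mul, hm, hn]

theorem w_structure (h : SkewData t (gen ℜ) v ξ η) (n : ℕ) :
    npast ℜ 2 0 (w n) = (t ^ (n + 1) * ((n + 1) * b)) • w n ∧
    npast ℜ 2 1 (w n) = (t ^ (n + 1) * thetaCoeff b (p - q) ξ η n) • v (n + 1) ∧
    ∀ l, nder ℜ l (w n) = if l = 1 then gammaCoeff t b q (p - q) ξ η n • v n else 0 := by
  induction n with
  | zero =>
    refine ⟨by simp [tower, npast_2_0_gen_1], ?_, fun l => ?_⟩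
    · simp [tower, npast_2_1_gen_1, thetaCoeff, h.v_one]
    · rw [tower, nder_gen, gammaCoeff, h.v_zero, one_smul]
      simp only [eq_comm]
  | succ n ih =>
    obtain ⟨i1, i2, i3⟩ := ih
    have h1 := gen_0_mul_w h n
    have hx2 : gen ℜ 1 * w n = t ^ (n + 1) • (w n * gen ℜ 1) := by
      have := w_comm h (γ := gammaCoeff t b q (p - q) ξ η) (m := 0) (n := n) (fun l => by
        rw [tower, nder_gen, gammaCoeff, h.v_zero, one_smul]
        simp only [eq_comm]) i3
      simpa [tower] using this
    have hs := h.sq_pow (n + 1)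
    refine ⟨?_, ?_, fun l => ?_⟩
    · rw [tower, map_sub, map_sub, map_smul, map_smul, npast_2_0_mul, npast_2_0_mul, npast_2_0_mul,
        i1, npast_2_w h, npast_0_w h, npast_2_0_gen_0, npast_2_0_gen_2, npast_2_2_gen_0,
        npast_2_2_gen_2, npast_0_0_gen_2, pow_succ t (n + 1)]
      push_cast
      generalize t ^ (n + 1) = u at *
      linear_combination (norm := (simp only [mul_add, add_mul, mul_sub, sub_mul, smul_mul_assoc,
        mul_smul_comm, mul_assoc]; module)) (t * u * ((n + 1) * b * p + a)) • h1 -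
        (t * u * k) • hx2
    · have h3 := h.x₃_mul (n + 1)
      have h4 := h.x₁_mul (n + 1)
      have h5 := h.mul_x₁ (n + 1)
      rw [tower, map_sub, map_sub, map_smul, map_smul, npast_2_1_mul, npast_2_1_mul, npast_2_1_mul,
        i2, npast_2_w h, npast_1_w h, npast_2_1_gen_0, npast_2_1_gen_2, npast_2_2_gen_0,
        npast_2_2_gen_2, npast_1_1_gen_2, pow_succ t (n + 1), thetaCoeff]
      push_cast
      generalize t ^ (n + 1) = u at *
      generalize thetaCoeff b (p - q) ξ η n = θ at *
      linear_combination (norm := (simp only [mul_add, add_mul, mul_sub, sub_mul, smul_mul_assoc,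
        mul_smul_comm, mul_assoc, mul_zero, zero_mul]; module)) (t * u * k) • h1 + (t * u * θ) • h3 +
        (t * u * θ * (p - q - (n + 1) * b)) • h4 - (t * u * u * θ * q) • h5 -
        (t * u * θ * q * hs) • (gen ℜ 0 * v (n + 1))
    · fin_cases l
      · simp [tower, nder_0_mul, nder_gen, i3, i1, npast_0_w h]
        module
      · have h3 := h.x₃_mul n
        have h4 := h.x₁_mul n
        have h5 := h.mul_x₁ n
        have hn := h.sq_pow n
        have ht := h.sq
        simp [tower, nder_1_mul, nder_gen, i3, i2, npast_1_1_gen_2, gammaCoeff]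
        rw [pow_succ] at hs ⊢
        generalize t ^ n = u at *
        generalize thetaCoeff b (p - q) ξ η n = θ at *
        generalize gammaCoeff t b q (p - q) ξ η n = γ at *
        linear_combination (norm := (simp only [mul_add, add_mul, mul_sub, sub_mul, smul_mul_assoc,
          mul_smul_comm, mul_assoc]; module)) γ • h3 - (γ * ((n + 1) * b + q)) • h4 -
          (γ * u * ht) • (v n * gen ℜ 2) - (γ * u * q * t * t) • h5 -
          (γ * q * hs) • (gen ℜ 0 * v n)
      · simp [tower, nder_2_mul, nder_gen, i3, npast_2_w h]

end WDerivations

/-! ### Monomials in strictly increasing sequences -/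

section MonomialLemmas

variable {A : Type*} [Ring A] {ι : Type*} [LinearOrder ι]

theorem orderedMonomial_single_add_of_lt (g : ι → A) {i : ι} {n : ι →₀ ℕ} (m : ℕ)
    (h : ∀ j, n j ≠ 0 → i < j) :
    orderedMonomial g (Finsupp.single i m + n) = g i ^ m * orderedMonomial g n := by
  induction m with
  | zero => simp
  | succ m ih =>
    rw [add_comm m, Finsupp.single_add, add_assoc, orderedMonomial_single_add, ih, ← mul_assoc,
      ← pow_succ', add_comm]
    intro j hj
    by_contra hlt
    have hn : n j = 0 := by
      by_contra hn
      exact hlt (h j hn).le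
    have hne : j ≠ i := fun e => hlt e.ge
    rw [Finsupp.add_apply, hn, Finsupp.single_eq_of_ne hne] at hj
    exact hj rfl

theorem orderedMonomial_mem {K : Type*} [Field K] [Algebra K A] (g : ι → A) (n : ι →₀ ℕ) :
    orderedMonomial g n ∈ Algebra.adjoin K (Set.range g) := by
  refine list_prod_mem (S := Algebra.adjoin K (Set.range g)) fun x hx => ?_
  obtain ⟨i, -, rfl⟩ := List.mem_map.mp hx
  exact pow_mem (Algebra.subset_adjoin (Set.mem_range_self i)) _

end MonomialLemmas

/-! ### Independence of the monomials `v_n w^a` -/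

section WMonomials

variable {K : Type u} [Field K] {t a b p q k : K}

attribute [local instance] fact_braidCoeff_R2

local notation "ℜ" => R2 t a b p q k

local notation "w" => tower t b (gen (R2 t a b p q k))

local notation "𝒲" => Algebra.adjoin K (Set.range (tower t b (gen (R2 t a b p q k))))

local notation "γ" => gammaCoeff t b q (p - q)

variable {v : ℕ → NicholsAlgebra (R2 t a b p q k)} {ξ η ρ : ℕ → K}

theorem nder_2_adjoin_w (h : SkewData t (gen ℜ) v ξ η) {f : NicholsAlgebra ℜ} (hf : f ∈ 𝒲) :
    nder ℜ 2 f = 0 := by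
  induction hf using Algebra.adjoin_induction with
  | mem x hx =>
    obtain ⟨n, rfl⟩ := hx
    rw [(w_structure h n).2.2, if_neg (by decide)]
  | algebraMap r => rw [Algebra.algebraMap_eq_smul_one, map_smul, nder_one, smul_zero]
  | add x y _ _ hx hy => rw [map_add, hx, hy, add_zero]
  | mul x y _ _ hx hy => rw [nder_2_mul, hx, hy]; simp

theorem nder_0_adjoin_w (h : SkewData t (gen ℜ) v ξ η) {f : NicholsAlgebra ℜ} (hf : f ∈ 𝒲) :
    nder ℜ 0 f = 0 := by
  induction hf using Algebra.adjoin_induction with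
  | mem x hx =>
    obtain ⟨n, rfl⟩ := hx
    rw [(w_structure h n).2.2, if_neg (by decide)]
  | algebraMap r => rw [Algebra.algebraMap_eq_smul_one, map_smul, nder_one, smul_zero]
  | add x y _ _ hx hy => rw [map_add, hx, hy, add_zero]
  | mul x y hx' _ hx hy => rw [nder_0_mul, hx, hy, nder_2_adjoin_w h hx']; simp

theorem npast_0_adjoin_w (h : SkewData t (gen ℜ) v ξ η) {f : NicholsAlgebra ℜ} (hf : f ∈ 𝒲) :
    npast ℜ 0 0 f ∈ 𝒲 ∧ npast ℜ 0 0 (npast ℜ 0 0 f) = f := by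
  induction hf using Algebra.adjoin_induction with
  | mem x hx =>
    obtain ⟨n, rfl⟩ := hx
    rw [npast_0_w h, map_smul, npast_0_w h, smul_smul, h.sq_pow, one_smul]
    exact ⟨Subalgebra.smul_mem _ (Algebra.subset_adjoin (Set.mem_range_self n)) _, rfl⟩
  | algebraMap r =>
    rw [Algebra.algebraMap_eq_smul_one, map_smul, npast_one, if_pos rfl, map_smul, npast_one,
      if_pos rfl]
    exact ⟨Subalgebra.smul_mem _ (one_mem _) _, rfl⟩
  | add x y _ _ hx hy =>
    rw [map_add, map_add, hx.2, hy.2]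
    exact ⟨add_mem hx.1 hy.1, rfl⟩
  | mul x y _ _ hx hy =>
    rw [npast_0_0_mul, npast_0_0_mul, hx.2, hy.2]
    exact ⟨mul_mem hx.1 hy.1, rfl⟩

/-- The sum of the subspaces `v n * 𝒲` is direct. -/
theorem eq_zero_of_sum_v_mul (h : SkewData t (gen ℜ) v ξ η) (hv : VData ℜ t v ρ)
    (hρ : ∀ n, ρ n ≠ 0) (M : ℕ) (f : ℕ → NicholsAlgebra ℜ) (hf : ∀ n, f n ∈ 𝒲)
    (h0 : ∑ n ∈ Finset.range M, v n * f n = 0) : ∀ n < M, f n = 0 := by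
  induction M generalizing f with
  | zero => intro n hn; omega
  | succ M ih =>
    have h1 := congrArg (nder ℜ 0) h0
    rw [Finset.sum_range_succ', map_add, map_sum, map_zero, h.v_zero, one_mul,
      nder_0_adjoin_w h (hf 0), add_zero] at h1
    have h2 : ∀ n ∈ Finset.range M, nder ℜ 0 (v (n + 1) * f (n + 1)) =
        v n * (ρ n • npast ℜ 0 0 (f (n + 1))) := by
      intro n _
      rw [nder_0_mul, nder_0_adjoin_w h (hf _), hv.nder_0, hv.nder_2]
      simp
    rw [Finset.sum_congr rfl h2] at h1
    have h3 := ih (fun n => ρ n • npast ℜ 0 0 (f (n + 1)))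
      (fun n => Subalgebra.smul_mem _ (npast_0_adjoin_w h (hf _)).1 _) h1
    have h4 : ∀ n < M, f (n + 1) = 0 := by
      intro n hn
      rw [← (npast_0_adjoin_w h (hf (n + 1))).2, (smul_eq_zero.mp (h3 n hn)).resolve_left (hρ n),
        map_zero]
    intro n hn
    cases n with
    | zero =>
      rw [Finset.sum_range_succ', Finset.sum_eq_zero, zero_add, h.v_zero, one_mul] at h0
      · exact h0
      · intro n hn
        rw [h4 n (Finset.mem_range.mp hn), mul_zero]
    | succ n => exact h4 n (by omega)

theorem w_pow_mul_v (h : SkewData t (gen ℜ) v ξ η) (i m k' : ℕ) :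
    ∃ u : K, u ≠ 0 ∧ w i ^ m * v k' = u • (v k' * w i ^ m) := by
  induction m with
  | zero => exact ⟨1, one_ne_zero, by simp⟩
  | succ m ih =>
    obtain ⟨u, hu, e⟩ := ih
    have h1 := (isTower_tower t b (gen ℜ) v).v_mul h i k'
    have hs := h.sq_pow (k' * (i + 1))
    have h2 : w i * v k' = t ^ (k' * (i + 1)) • (v k' * w i) := by
      rw [h1, smul_smul, hs, one_smul]
    refine ⟨t ^ (k' * (i + 1)) * u, mul_ne_zero (left_ne_zero_of_mul_eq_one hs) hu, ?_⟩
    rw [pow_succ, mul_assoc, h2, mul_smul_comm, ← mul_assoc, e, smul_mul_assoc, mul_assoc, smul_smul]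

theorem npast_1_orderedMonomial_w (h : SkewData t (gen ℜ) v ξ η) (n : ℕ →₀ ℕ) :
    ∃ u : K, u ≠ 0 ∧ npast ℜ 1 1 (orderedMonomial w n) = u • orderedMonomial w n := by
  have ht : t ≠ 0 := left_ne_zero_of_mul_eq_one h.sq
  rw [orderedMonomial]
  induction n.support.sort (· ≤ ·) with
  | nil => exact ⟨1, one_ne_zero, by simp [npast_one]⟩
  | cons i l ih =>
    obtain ⟨u, hu, e⟩ := ih
    have hp : ∀ m, npast ℜ 1 1 (w i ^ m) = (t ^ (i + 1)) ^ m • w i ^ m := by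
      intro m
      induction m with
      | zero => simp [npast_one]
      | succ m ih =>
        rw [pow_succ, npast_1_1_mul, ih, npast_1_w h, smul_mul_smul_comm, ← pow_succ]
    refine ⟨(t ^ (i + 1)) ^ n i * u, mul_ne_zero (pow_ne_zero _ (pow_ne_zero _ ht)) hu, ?_⟩
    rw [List.map_cons, List.prod_cons, npast_1_1_mul, e, hp, smul_mul_smul_comm]

/-- An exponent is admissible if the odd generators occur at most once. -/
def Admissible (t : K) (n : ℕ →₀ ℕ) : Prop := ∀ i, n i ≤ 1 ∨ t ^ (i + 1) = 1

theorem nder_1_w_pow (h : SkewData t (gen ℜ) v ξ η) {i m : ℕ} (hm : m + 1 ≤ 1 ∨ t ^ (i + 1) = 1) :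
    nder ℜ 1 (w i ^ (m + 1)) = ((m + 1) * γ ξ η i) • (v i * w i ^ m) := by
  induction m with
  | zero => simp [(w_structure h i).2.2]
  | succ m ih =>
    have ht : t ^ (i + 1) = 1 := hm.resolve_left (by omega)
    have h1 := (isTower_tower t b (gen ℜ) v).v_mul h i i
    rw [mul_comm, pow_mul, ht, one_pow, one_smul] at h1
    rw [pow_succ', nder_1_mul, ih (Or.inr ht), (w_structure h i).2.2, (w_structure h i).2.2,
      if_pos rfl, if_neg (by decide), zero_mul, add_zero, mul_smul_comm, ← mul_assoc, ← h1,
      mul_assoc, ← pow_succ']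
    have hp : npast ℜ 1 1 (w i ^ (m + 1)) = w i ^ (m + 1) := by
      generalize m + 1 = m
      induction m with
      | zero => simp [npast_one]
      | succ m ih => rw [pow_succ, npast_1_1_mul, ih, npast_1_w h, ht, one_smul]
    rw [hp, smul_mul_assoc]
    push_cast
    module

theorem nder_1_orderedMonomial_w [CharZero K] (h : SkewData t (gen ℜ) v ξ η) {n : ℕ →₀ ℕ}
    (hn : Admissible t n) :
    ∃ σ : ℕ → K, (∀ i, n i ≠ 0 → σ i ≠ 0) ∧ nder ℜ 1 (orderedMonomial w n) =
      ∑ i ∈ n.support, (σ i * γ ξ η i) • (v i * orderedMonomial w (n - Finsupp.single i 1)) := by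
  induction n using Finsupp.induction_on_min with
  | zero => exact ⟨0, by simp, by simp [orderedMonomial_zero]⟩
  | single_add i m n hlt hm ih =>
    have hlt' : ∀ j, n j ≠ 0 → i < j := fun j hj => hlt j (Finsupp.mem_support_iff.mpr hj)
    have hi : n i = 0 := by
      by_contra hne
      exact lt_irrefl _ (hlt' i hne)
    have hn' : Admissible t n := by
      intro j
      rcases hn j with h1 | h1
      · left
        rw [Finsupp.add_apply] at h1
        omega
      · exact Or.inr h1
    obtain ⟨σ, hσ, e⟩ := ih hn'
    obtain ⟨u, hu, eu⟩ := npast_1_orderedMonomial_w h n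
    obtain ⟨m, rfl⟩ := Nat.exists_eq_add_one_of_ne_zero hm
    choose τ hτ eτ using w_pow_mul_v h i (m + 1)
    have hmi : m + 1 ≤ 1 ∨ t ^ (i + 1) = 1 := by
      rcases hn i with h1 | h1
      · left
        rw [Finsupp.add_apply, Finsupp.single_eq_same] at h1
        omega
      · exact Or.inr h1
    refine ⟨fun j => if j = i then (m + 1) * u else τ j * σ j, ?_, ?_⟩
    · intro j hj
      simp only
      split_ifs with hji
      · exact mul_ne_zero (Nat.cast_add_one_ne_zero m) hu
      · refine mul_ne_zero (hτ j) (hσ j ?_)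
        rwa [Finsupp.add_apply, Finsupp.single_eq_of_ne hji, zero_add] at hj
    · have hsupp : (Finsupp.single i (m + 1) + n).support = insert i n.support := by
        ext j
        by_cases hji : j = i
        · simp [hji]
        · simp [hji, Finsupp.single_eq_of_ne hji]
      rw [hsupp, Finset.sum_insert (by simpa using hi), orderedMonomial_single_add_of_lt _ _ hlt',
        nder_1_mul, e, eu, nder_1_w_pow h hmi,
        nder_2_adjoin_w h (pow_mem (Algebra.subset_adjoin (Set.mem_range_self i)) _), zero_mul,
        add_zero, add_comm, Finset.mul_sum]
      congr 1
      · have : Finsupp.single i (m + 1) + n - Finsupp.single i 1 = Finsupp.single i m + n := by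
          ext j
          by_cases hji : j = i
          · subst hji; simp [hi]
          · simp [Finsupp.single_eq_of_ne hji]
        beta_reduce
        rw [if_pos rfl, this, orderedMonomial_single_add_of_lt _ _ hlt', smul_mul_smul_comm,
          mul_assoc (v i)]
        congr 1
        ring
      · refine Finset.sum_congr rfl fun j hj => ?_
        have hji : j ≠ i := by
          rintro rfl
          exact Finsupp.mem_support_iff.mp hj hi
        have : Finsupp.single i (m + 1) + n - Finsupp.single j 1 =
            Finsupp.single i (m + 1) + (n - Finsupp.single j 1) := by
          ext l
          by_cases hli : l = i
          · subst hli; simp [Finsupp.single_eq_of_ne hji.symm]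
          · simp [Finsupp.single_eq_of_ne hli]
        beta_reduce
        rw [if_neg hji, this, orderedMonomial_single_add_of_lt, mul_smul_comm, ← mul_assoc, eτ,
          smul_mul_assoc, smul_smul, mul_assoc (v j)]
        · congr 1
          ring
        · intro l hl
          refine hlt' l fun h0 => hl ?_
          rw [Finsupp.tsub_apply, h0, zero_tsub]

theorem one_ne_zero_nichols {R : Matrix (Fin 9) (Fin 9) K} [Fact (BraidCoeff R)] :
    (1 : NicholsAlgebra R) ≠ 0 := fun h => by
  simpa using congrArg (ncounit R) h

/-- The ordered monomials in those `w i` with `γ i ≠ 0` are linearly independent. -/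
theorem eq_zero_of_sum_orderedMonomial_w [CharZero K] (h : SkewData t (gen ℜ) v ξ η)
    (hv : VData ℜ t v ρ) (hρ : ∀ n, ρ n ≠ 0) (D : ℕ) (s : Finset (ℕ →₀ ℕ)) (c : (ℕ →₀ ℕ) → K)
    (hs : ∀ n ∈ s, Admissible t n ∧ ∀ i, n i ≠ 0 → γ ξ η i ≠ 0) (hD : ∀ n ∈ s, n.degree < D)
    (h0 : ∑ n ∈ s, c n • orderedMonomial w n = 0) : ∀ n ∈ s, c n = 0 := by
  induction D generalizing s c with
  | zero => exact fun n hn => absurd (hD n hn) (Nat.not_lt_zero _)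
  | succ D ih =>
    choose σ hσ hσ' using fun n : s => nder_1_orderedMonomial_w h (hs n.1 n.2).1
    let σ' : (ℕ →₀ ℕ) → ℕ → K := fun n => if hn : n ∈ s then σ ⟨n, hn⟩ else 0
    have e1 : ∀ n ∈ s, nder ℜ 1 (c n • orderedMonomial w n) = ∑ i ∈ n.support,
        v i * ((c n * (σ' n i * γ ξ η i)) • orderedMonomial w (n - Finsupp.single i 1)) := by
      intro n hn
      rw [map_smul, hσ' ⟨n, hn⟩, Finset.smul_sum]
      refine Finset.sum_congr rfl fun i _ => ?_
      simp only [σ', dif_pos hn, mul_smul_comm, smul_smul]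
    obtain ⟨M, hM⟩ := (s.biUnion Finsupp.support).exists_nat_subset_range
    have e2 := congrArg (nder ℜ 1) h0
    rw [map_sum, Finset.sum_congr rfl e1, map_zero, Finset.sum_comm' (t' := Finset.range M)
      (s' := fun i => s.filter fun n => n i ≠ 0)] at e2
    · simp only [← Finset.mul_sum] at e2
      have e3 := eq_zero_of_sum_v_mul h hv hρ M _ (fun i => sum_mem fun n _ =>
        Subalgebra.smul_mem _ (orderedMonomial_mem w _) _) e2
      have e4 : ∀ n ∈ s, ∀ i, n i ≠ 0 → c n = 0 := by
        intro n hn i hi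
        have hiM : i < M := Finset.mem_range.mp
          (hM (Finset.mem_biUnion.mpr ⟨n, hn, Finsupp.mem_support_iff.mpr hi⟩))
        have hsub : ∀ n : ℕ →₀ ℕ, n i ≠ 0 → n - Finsupp.single i 1 + Finsupp.single i 1 = n :=
          fun n hn => tsub_add_cancel_of_le (Finsupp.single_le_iff.mpr (Nat.one_le_iff_ne_zero.mpr hn))
        have e5 := ih ((s.filter fun n => n i ≠ 0).image fun n => n - Finsupp.single i 1)
          (fun n => c (n + Finsupp.single i 1) *
            (σ' (n + Finsupp.single i 1) i * γ ξ η i)) ?_ ?_ ?_ (n - Finsupp.single i 1)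
          (Finset.mem_image_of_mem _ (Finset.mem_filter.mpr ⟨hn, hi⟩))
        · simp only [hsub n hi] at e5
          refine (mul_eq_zero.mp e5).resolve_right (mul_ne_zero ?_ ((hs n hn).2 i hi))
          simp only [σ', dif_pos hn]
          exact hσ _ i hi
        · simp only [Finset.mem_image, Finset.mem_filter]
          rintro _ ⟨n, ⟨hn, -⟩, rfl⟩
          refine ⟨fun j => ?_, fun j hj => (hs n hn).2 j fun h0 => hj ?_⟩
          · exact ((hs n hn).1 j).imp_left (le_trans (Nat.sub_le _ _))
          · rw [Finsupp.tsub_apply, h0, zero_tsub]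
        · simp only [Finset.mem_image, Finset.mem_filter]
          rintro _ ⟨n, ⟨hn, hi⟩, rfl⟩
          have e6 := congrArg Finsupp.degree (hsub n hi)
          rw [map_add, Finsupp.degree_single] at e6
          have := hD n hn
          omega
        · rw [Finset.sum_image, ← e3 i hiM]
          · refine Finset.sum_congr rfl fun n hn => ?_
            rw [hsub n (Finset.mem_filter.mp hn).2]
          · intro n hn n' hn' e
            rw [← hsub n (Finset.mem_filter.mp hn).2, ← hsub n' (Finset.mem_filter.mp hn').2]
            exact congrArg (· + Finsupp.single i 1) e
      intro n hn
      by_cases hn0 : n = 0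
      · subst hn0
        rw [Finset.sum_eq_single_of_mem _ hn, orderedMonomial_zero] at h0
        · exact (smul_eq_zero.mp h0).resolve_right one_ne_zero_nichols
        · intro n hn hne
          obtain ⟨i, hi⟩ := Finsupp.ne_iff.mp hne
          rw [e4 n hn i hi, zero_smul]
      · obtain ⟨i, hi⟩ := Finsupp.ne_iff.mp hn0
        exact e4 n hn i hi
    · intro n i
      simp only [Finset.mem_filter, Finset.mem_range, Finsupp.mem_support_iff]
      exact ⟨fun ⟨h1, h2⟩ => ⟨⟨h1, h2⟩, Finset.mem_range.mp
        (hM (Finset.mem_biUnion.mpr ⟨n, h1, Finsupp.mem_support_iff.mpr h2⟩))⟩, fun ⟨⟨h1, h2⟩, _⟩ =>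
        ⟨h1, h2⟩⟩

end WMonomials

/-! ### Stable subspaces and homogeneous spanning sets -/

section Graded

variable {K : Type u} [Field K] {R : Matrix (Fin 9) (Fin 9) K} [hR : Fact (BraidCoeff R)]

/-- A nonzero subspace which is stable under the skew derivations contains the unit. -/
theorem one_mem_of_nder_mem {N : Submodule K (NicholsAlgebra R)}
    (hN : ∀ l, ∀ x ∈ N, nder R l x ∈ N) {x : NicholsAlgebra R} (hx : x ∈ N) (h0 : x ≠ 0) :
    (1 : NicholsAlgebra R) ∈ N := by
  obtain ⟨x, rfl⟩ := proj_surjective x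
  obtain ⟨n, hn⟩ : ∃ n, ∀ m, n ≤ m → component m x = 0 :=
    ⟨(gradeHom K x).natDegree + 1, fun m hm =>
      Polynomial.coeff_eq_zero_of_natDegree_lt (Nat.lt_of_succ_le hm)⟩
  induction n generalizing x with
  | zero =>
    refine absurd ?_ h0
    rw [← sum_component x, Finset.sum_eq_zero fun m _ => hn m (Nat.zero_le _), map_zero]
  | succ n ih =>
    by_cases hd : ∀ l, nder R l (proj R x) = 0
    · have e : proj R x = ncounit R (proj R x) • 1 := by
        refine eq_of_nder ?_ fun l => ?_
        · rw [map_smul, ncounit_one, smul_eq_mul, mul_one]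
        · rw [hd, map_smul, nder_one, smul_zero]
      have hc : ncounit R (proj R x) ≠ 0 := fun hc => h0 (by rw [e, hc, zero_smul])
      rw [e] at hx
      exact (Submodule.smul_mem_iff N hc).mp hx
    · push Not at hd
      obtain ⟨l, hl⟩ := hd
      have hx' := hN l _ hx
      rw [nder_proj] at hx' hl
      refine ih _ hx' hl fun m hm => ?_
      rw [← der_component_succ, hn (m + 1) (by omega), map_zero]

/-- A homogeneous spanning family is a basis if there is an independent family of the same
degrees. -/
theorem linearIndependent_of_homogeneous {σ : Type*} {x y : σ → T K} {d : σ → ℕ}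
    (hx : ∀ n, x n ∈ degreePart K (d n)) (hy : ∀ n, y n ∈ degreePart K (d n))
    (hind : LinearIndependent K fun n => proj R (x n))
    (hspan : Submodule.span K (Set.range fun n => proj R (y n)) = ⊤) :
    LinearIndependent K fun n => proj R (y n) := by
  classical
  have key : ∀ k, LinearIndependent K fun n : {n // d n = k} => proj R (y n) := by
    intro k
    have hfin : (degreePart K k).FG := by
      rw [degreePart]
      exact Submodule.FG.pow (Submodule.fg_span (Set.finite_range _)) _
    have : FiniteDimensional K ((degreePart K k).map (proj R).toLinearMap) :=
      Module.Finite.iff_fg.mpr (hfin.map _)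
    have hmem : ∀ n : {n // d n = k}, proj R (x n) ∈ (degreePart K k).map (proj R).toLinearMap := by
      rintro ⟨n, rfl⟩
      exact ⟨x n, hx n, rfl⟩
    have hindk : LinearIndependent K fun n : {n // d n = k} => proj R (x n) :=
      hind.comp _ Subtype.val_injective
    have hfinσ : Finite {n // d n = k} := LinearIndependent.finite
      (LinearIndependent.of_comp (v := fun n => ⟨_, hmem n⟩) (Submodule.subtype _) hindk)
    have := Fintype.ofFinite {n // d n = k}
    rw [linearIndependent_iff_card_le_finrank_span] at hindk ⊢
    have : FiniteDimensional K (Submodule.span K (Set.range fun n : {n // d n = k} =>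
        proj R (y n))) := FiniteDimensional.span_of_finite K (Set.finite_range _)
    refine hindk.trans (Submodule.finrank_mono (Submodule.span_le.mpr ?_))
    rintro _ ⟨⟨m, rfl⟩, rfl⟩
    have h1 : proj R (x m) ∈ Submodule.span K (Set.range fun n => proj R (y n)) := by
      rw [hspan]; trivial
    obtain ⟨c, hc⟩ := Finsupp.mem_span_range_iff_exists_finsupp.mp h1
    have h2 : x m - c.sum (fun n c => c • y n) ∈ nicholsIdeal R := by
      rw [← proj_eq_zero, map_sub, sub_eq_zero, ← hc]
      simp [Finsupp.sum]
    have h3 := component_mem_nicholsIdeal hR.out h2 (d m)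
    rw [map_sub, component_of_mem (hx m), if_pos rfl, ← proj_eq_zero, map_sub, sub_eq_zero] at h3
    simp only [SetLike.mem_coe]
    rw [h3, Finsupp.sum, map_sum, map_sum]
    refine sum_mem fun n _ => ?_
    rw [map_smul, map_smul, component_of_mem (hy n)]
    split_ifs with h
    · exact Submodule.smul_mem _ _ (Submodule.subset_span ⟨⟨n, h.symm⟩, rfl⟩)
    · rw [map_zero, smul_zero]; exact zero_mem _
  rw [linearIndependent_iff']
  intro s c hs n hn
  have h1 := sum_filter_degree_eq_zero s c y d hy hs (d n)
  refine linearIndependent_iff'.mp (key (d n)) (s.subtype fun m => d m = d n) (fun m => c m) ?_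
    ⟨n, rfl⟩ (Finset.mem_subtype.mpr hn)
  rw [← h1]
  exact Finset.sum_subtype_eq_sum_filter (fun m => c m • proj R (y m))

end Graded

/-! ### Left submodules spanned by small powers -/

section Below

variable {K : Type*} [Field K] {A : Type*} [Ring A] [Algebra K A] {S : Subalgebra K A} {x : A}

/-- The span of the elements `f x ^ i` with `f ∈ S` and `i < m`. -/
def below (S : Subalgebra K A) (x : A) (m : ℕ) : Submodule K A :=
  Submodule.span K {y | ∃ f ∈ S, ∃ i < m, y = f * x ^ i}

theorem mul_pow_mem_below {f : A} (hf : f ∈ S) {i m : ℕ} (hi : i < m) : f * x ^ i ∈ below S x m :=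
  Submodule.subset_span ⟨f, hf, i, hi, rfl⟩

theorem below_mono {m n : ℕ} (h : m ≤ n) : below S x m ≤ below S x n :=
  Submodule.span_mono fun _ ⟨f, hf, i, hi, e⟩ => ⟨f, hf, i, hi.trans_le h, e⟩

theorem below_zero : below S x 0 = ⊥ := by
  rw [below, Submodule.span_eq_bot]
  rintro _ ⟨_, _, i, hi, _⟩
  omega

theorem map_below_le {m n : ℕ} {φ : A →ₗ[K] A}
    (h : ∀ f ∈ S, ∀ i < m, φ (f * x ^ i) ∈ below S x n) {y : A} (hy : y ∈ below S x m) :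
    φ y ∈ below S x n := by
  have : below S x m ≤ (below S x n).comap φ := by
    refine Submodule.span_le.mpr ?_
    rintro _ ⟨f, hf, i, hi, rfl⟩
    exact h f hf i hi
  exact this hy

theorem mul_mem_below {f y : A} (hf : f ∈ S) {m : ℕ} (hy : y ∈ below S x m) :
    f * y ∈ below S x m :=
  map_below_le (φ := LinearMap.mulLeft K f) (fun g hg i hi => by
    rw [LinearMap.mulLeft_apply, ← mul_assoc]
    exact mul_pow_mem_below (mul_mem hf hg) hi) hy

theorem x_mul_mem_below (hx : ∀ f ∈ S, ∃ f₁ ∈ S, ∃ f₂ ∈ S, x * f = f₁ * x + f₂) {y : A} {m : ℕ}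
    (hy : y ∈ below S x m) : x * y ∈ below S x (m + 1) :=
  map_below_le (φ := LinearMap.mulLeft K x) (fun g hg i hi => by
    obtain ⟨f₁, h₁, f₂, h₂, e⟩ := hx g hg
    rw [LinearMap.mulLeft_apply, ← mul_assoc, e, add_mul, mul_assoc, ← pow_succ']
    exact add_mem (mul_pow_mem_below h₁ (by omega)) (mul_pow_mem_below h₂ (by omega))) hy

theorem exists_of_mem_below_succ {y : A} {m : ℕ} (hy : y ∈ below S x (m + 1)) :
    ∃ g ∈ S, ∃ u ∈ below S x m, y = g * x ^ m + u := by
  induction hy using Submodule.span_induction with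
  | mem y hy =>
    obtain ⟨f, hf, i, hi, rfl⟩ := hy
    rcases Nat.lt_succ_iff_lt_or_eq.mp hi with hi | rfl
    · exact ⟨0, zero_mem _, _, mul_pow_mem_below hf hi, by simp⟩
    · exact ⟨f, hf, 0, zero_mem _, by simp⟩
  | zero => exact ⟨0, zero_mem _, 0, zero_mem _, by simp⟩
  | add y y' _ _ h h' =>
    obtain ⟨g, hg, u, hu, rfl⟩ := h
    obtain ⟨g', hg', u', hu', rfl⟩ := h'
    exact ⟨_, add_mem hg hg', _, add_mem hu hu', by rw [add_mul]; abel⟩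
  | smul c y _ h =>
    obtain ⟨g, hg, u, hu, rfl⟩ := h
    exact ⟨_, Subalgebra.smul_mem _ hg c, _, Submodule.smul_mem _ c hu, by
      rw [smul_add, smul_mul_assoc]⟩

/-- If `P` agrees with `x` up to `S`, its powers agree with those of `x` up to lower terms. -/
theorem pow_sub_pow_mem_below (hx : ∀ f ∈ S, ∃ f₁ ∈ S, ∃ f₂ ∈ S, x * f = f₁ * x + f₂) {f : A}
    (hf : f ∈ S) (m : ℕ) : (x + f) ^ m - x ^ m ∈ below S x m := by
  induction m with
  | zero => simp
  | succ m ih =>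
    have e : (x + f) ^ (m + 1) - x ^ (m + 1) = x * ((x + f) ^ m - x ^ m) +
        f * ((x + f) ^ m - x ^ m) + f * x ^ m := by
      rw [pow_succ', pow_succ']
      noncomm_ring
    rw [e]
    exact add_mem (add_mem (x_mul_mem_below hx ih) (below_mono m.le_succ (mul_mem_below hf ih)))
      (mul_pow_mem_below hf m.lt_succ_self)

end Below

/-! ### Powers of `x₃` -/

section PowersOfLast

variable {K : Type u} [Field K] {t a b p q k : K}

attribute [local instance] fact_braidCoeff_R2

local notation "ℜ" => R2 t a b p q k

local notation "w" => tower t b (gen (R2 t a b p q k))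

local notation "𝒲" => Algebra.adjoin K (Set.range (tower t b (gen (R2 t a b p q k))))

local notation "γ" => gammaCoeff t b q (p - q)

variable {v : ℕ → NicholsAlgebra (R2 t a b p q k)} {ξ η ρ : ℕ → K}

/-- The subalgebra generated by the elements `v n` and `w n`. -/
def vwAlgebra (t a b p q k : K) (v : ℕ → NicholsAlgebra (R2 t a b p q k)) :
    Subalgebra K (NicholsAlgebra (R2 t a b p q k)) :=
  Algebra.adjoin K (Set.range v ∪ Set.range (tower t b (gen (R2 t a b p q k))))

local notation "𝒮" => vwAlgebra t a b p q k v

theorem v_mem_vwAlgebra (n : ℕ) : v n ∈ 𝒮 := Algebra.subset_adjoin (Or.inl (Set.mem_range_self n))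

theorem w_mem_vwAlgebra (n : ℕ) : w n ∈ 𝒮 := Algebra.subset_adjoin (Or.inr (Set.mem_range_self n))

theorem gen_0_mem_vwAlgebra (h : SkewData t (gen ℜ) v ξ η) : gen ℜ 0 ∈ 𝒮 :=
  h.v_one ▸ v_mem_vwAlgebra 1

theorem exists_gen_2_mul (h : SkewData t (gen ℜ) v ξ η) :
    ∀ f ∈ 𝒮, ∃ f₁ ∈ 𝒮, ∃ f₂ ∈ 𝒮, gen ℜ 2 * f = f₁ * gen ℜ 2 + f₂ := by
  intro f hf
  induction hf using Algebra.adjoin_induction with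
  | mem f hf =>
    rcases hf with ⟨n, rfl⟩ | ⟨n, rfl⟩
    · exact ⟨_, Subalgebra.smul_mem _ (v_mem_vwAlgebra n) (t ^ n), _,
        Subalgebra.smul_mem _ (v_mem_vwAlgebra (n + 1)) (η n), by rw [h.x₃_mul, smul_mul_assoc]⟩
    · refine ⟨_, Subalgebra.smul_mem _ (w_mem_vwAlgebra n) (t ^ (n + 1)), _,
        add_mem (w_mem_vwAlgebra (n + 1)) (Subalgebra.smul_mem _
          (mul_mem (gen_0_mem_vwAlgebra h) (w_mem_vwAlgebra n)) (((n + 1 : ℕ) : K) * b)), ?_⟩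
      rw [tower, smul_mul_assoc]
      abel
  | algebraMap r =>
    refine ⟨_, Subalgebra.algebraMap_mem _ r, 0, zero_mem _, ?_⟩
    rw [Algebra.commutes, add_zero]
  | add f g _ _ hf hg =>
    obtain ⟨f₁, h₁, f₂, h₂, e⟩ := hf
    obtain ⟨g₁, i₁, g₂, i₂, e'⟩ := hg
    exact ⟨_, add_mem h₁ i₁, _, add_mem h₂ i₂, by rw [mul_add, e, e', add_mul]; abel⟩
  | mul f g hf' hg' hf hg =>
    obtain ⟨f₁, h₁, f₂, h₂, e⟩ := hf
    obtain ⟨g₁, i₁, g₂, i₂, e'⟩ := hg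
    refine ⟨_, mul_mem h₁ i₁, _, add_mem (mul_mem h₁ i₂) (mul_mem h₂ hg'), ?_⟩
    rw [← mul_assoc, e, add_mul, mul_assoc f₁, e', mul_add]
    simp only [mul_assoc, add_assoc]

theorem nder_2_vwAlgebra (h : SkewData t (gen ℜ) v ξ η) (hv : VData ℜ t v ρ)
    {f : NicholsAlgebra ℜ} (hf : f ∈ 𝒮) : nder ℜ 2 f = 0 := by
  induction hf using Algebra.adjoin_induction with
  | mem x hx =>
    rcases hx with ⟨n, rfl⟩ | ⟨n, rfl⟩
    · exact hv.nder_2 n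
    · rw [(w_structure h n).2.2, if_neg (by decide)]
  | algebraMap r => rw [Algebra.algebraMap_eq_smul_one, map_smul, nder_one, smul_zero]
  | add x y _ _ hx hy => rw [map_add, hx, hy, add_zero]
  | mul x y _ _ hx hy => rw [nder_2_mul, hx, hy]; simp

theorem npast_vwAlgebra (h : SkewData t (gen ℜ) v ξ η) (hv : VData ℜ t v ρ)
    {f : NicholsAlgebra ℜ} (hf : f ∈ 𝒮) : npast ℜ 0 0 f ∈ 𝒮 ∧ npast ℜ 1 1 f ∈ 𝒮 := by
  induction hf using Algebra.adjoin_induction with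
  | mem x hx =>
    rcases hx with ⟨n, rfl⟩ | ⟨n, rfl⟩
    · rw [hv.npast_0, hv.npast_1]
      exact ⟨Subalgebra.smul_mem _ (v_mem_vwAlgebra n) _, Subalgebra.smul_mem _ (v_mem_vwAlgebra n) _⟩
    · rw [npast_0_w h, npast_1_w h]
      exact ⟨Subalgebra.smul_mem _ (w_mem_vwAlgebra n) _, Subalgebra.smul_mem _ (w_mem_vwAlgebra n) _⟩
  | algebraMap r =>
    rw [Algebra.algebraMap_eq_smul_one, map_smul, map_smul, npast_one, npast_one, if_pos rfl,
      if_pos rfl]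
    exact ⟨Subalgebra.smul_mem _ (one_mem _) _, Subalgebra.smul_mem _ (one_mem _) _⟩
  | add x y _ _ hx hy => rw [map_add, map_add]; exact ⟨add_mem hx.1 hy.1, add_mem hx.2 hy.2⟩
  | mul x y _ _ hx hy =>
    rw [npast_0_0_mul, npast_1_1_mul]
    exact ⟨mul_mem hx.1 hy.1, mul_mem hx.2 hy.2⟩

theorem nder_mem_vwAlgebra (h : SkewData t (gen ℜ) v ξ η) (hv : VData ℜ t v ρ)
    {f : NicholsAlgebra ℜ} (hf : f ∈ 𝒮) (l : Fin 3) : nder ℜ l f ∈ 𝒮 := by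
  induction hf using Algebra.adjoin_induction generalizing l with
  | mem x hx =>
    rcases hx with ⟨n, rfl⟩ | ⟨n, rfl⟩
    · fin_cases l
      · cases n with
        | zero => simp [h.v_zero]
        | succ n =>
          simp only [Fin.zero_eta, hv.nder_0]
          exact Subalgebra.smul_mem _ (v_mem_vwAlgebra n) _
      · simp [hv.nder_1]
      · simp [hv.nder_2]
    · rw [(w_structure h n).2.2]
      split_ifs
      · exact Subalgebra.smul_mem _ (v_mem_vwAlgebra n) _
      · exact zero_mem _
  | algebraMap r =>
    rw [Algebra.algebraMap_eq_smul_one, map_smul, nder_one, smul_zero]; exact zero_mem _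
  | add x y _ _ hx hy => rw [map_add]; exact add_mem (hx l) (hy l)
  | mul x y hx' hy' hx hy =>
    have h2 := nder_2_vwAlgebra h hv hx'
    have hp := npast_vwAlgebra h hv hy'
    fin_cases l
    · simp only [Fin.zero_eta, nder_0_mul, h2, zero_mul, add_zero]
      exact add_mem (mul_mem hx' (hy 0)) (mul_mem (hx 0) hp.1)
    · simp only [Fin.mk_one, nder_1_mul, h2, zero_mul, add_zero]
      exact add_mem (mul_mem hx' (hy 1)) (mul_mem (hx 1) hp.2)
    · simp only [Fin.reduceFinMk, nder_2_mul, h2, zero_mul, add_zero]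
      exact mul_mem hx' (hy 2)

local notation "𝓑" => below (vwAlgebra t a b p q k v) (gen (R2 t a b p q k) 2)

theorem npast_pow_sub_mem_below (h : SkewData t (gen ℜ) v ξ η) (m : ℕ) :
    npast ℜ 0 0 (gen ℜ 2 ^ m) - t ^ m • gen ℜ 2 ^ m ∈ 𝓑 m ∧
    npast ℜ 1 1 (gen ℜ 2 ^ m) - t ^ m • gen ℜ 2 ^ m ∈ 𝓑 m ∧
    npast ℜ 2 2 (gen ℜ 2 ^ m) - t ^ m • gen ℜ 2 ^ m ∈ 𝓑 m ∧
    npast ℜ 2 0 (gen ℜ 2 ^ m) - (m * b * t ^ m) • gen ℜ 2 ^ m ∈ 𝓑 m ∧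
    npast ℜ 2 1 (gen ℜ 2 ^ m) ∈ 𝓑 m := by
  have hx := exists_gen_2_mul h
  have h1 := gen_0_mem_vwAlgebra h
  have hs : ∀ c : K, c • gen ℜ 0 ∈ 𝒮 := fun c => Subalgebra.smul_mem _ h1 c
  have e0 : ∀ m, npast ℜ 0 0 (gen ℜ 2 ^ m) = t ^ m • (gen ℜ 2 + p • gen ℜ 0) ^ m := by
    intro m
    induction m with
    | zero => simp [npast_one]
    | succ m ih => rw [pow_succ, npast_0_0_mul, ih, npast_0_0_gen_2, smul_mul_smul_comm, pow_succ,
        pow_succ]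
  have e1 : ∀ m, npast ℜ 1 1 (gen ℜ 2 ^ m) = t ^ m • (gen ℜ 2 + q • gen ℜ 0) ^ m := by
    intro m
    induction m with
    | zero => simp [npast_one]
    | succ m ih => rw [pow_succ, npast_1_1_mul, ih, npast_1_1_gen_2, smul_mul_smul_comm, pow_succ,
        pow_succ]
  have e2 : ∀ m, npast ℜ 2 2 (gen ℜ 2 ^ m) = t ^ m • (gen ℜ 2 + p • gen ℜ 0) ^ m := by
    intro m
    induction m with
    | zero => simp [npast_one]
    | succ m ih => rw [pow_succ, npast_2_2_mul, ih, npast_2_2_gen_2, smul_mul_smul_comm, pow_succ,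
        pow_succ]
  have key : ∀ (c d : K) (m : ℕ), c • (gen ℜ 2 + d • gen ℜ 0) ^ m - c • gen ℜ 2 ^ m ∈ 𝓑 m := by
    intro c d m
    rw [← smul_sub]
    exact Submodule.smul_mem _ _ (pow_sub_pow_mem_below hx (hs d) m)
  refine ⟨e0 m ▸ key _ _ m, e1 m ▸ key _ _ m, e2 m ▸ key _ _ m, ?_⟩
  have hlow : ∀ (m : ℕ) (c : K), (gen ℜ 2 + c • gen ℜ 0) ^ m ∈ 𝓑 (m + 1) := by
    intro m c
    rw [← sub_add_cancel ((gen ℜ 2 + c • gen ℜ 0) ^ m) (gen ℜ 2 ^ m)]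
    refine add_mem (below_mono m.le_succ (pow_sub_pow_mem_below hx (hs c) m)) ?_
    rw [← one_mul (gen ℜ 2 ^ m)]
    exact mul_pow_mem_below (one_mem _) m.lt_succ_self
  have h2 : gen ℜ 1 ∈ 𝒮 := w_mem_vwAlgebra 0
  induction m with
  | zero => simp [npast_one]
  | succ m ih =>
    obtain ⟨i1, i2⟩ := ih
    refine ⟨?_, ?_⟩
    · rw [pow_succ', npast_2_0_mul, npast_2_2_gen_2, npast_2_0_gen_2, e0]
      have e : t • (gen ℜ 2 + p • gen ℜ 0) * npast ℜ 2 0 (gen ℜ 2 ^ m) +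
          t • (a • gen ℜ 0 - k • gen ℜ 1 + b • gen ℜ 2) * t ^ m • (gen ℜ 2 + p • gen ℜ 0) ^ m -
          ((m + 1 : ℕ) * b * t ^ (m + 1)) • (gen ℜ 2 * gen ℜ 2 ^ m) =
          t • (gen ℜ 2 * (npast ℜ 2 0 (gen ℜ 2 ^ m) - (m * b * t ^ m) • gen ℜ 2 ^ m)) +
          (t * p) • (gen ℜ 0 * (npast ℜ 2 0 (gen ℜ 2 ^ m) - (m * b * t ^ m) • gen ℜ 2 ^ m)) +
          (t * p * (m * b * t ^ m)) • (gen ℜ 0 * gen ℜ 2 ^ m) +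
          (t * t ^ m) • ((a • gen ℜ 0 - k • gen ℜ 1) * (gen ℜ 2 + p • gen ℜ 0) ^ m) +
          (t * t ^ m * b) • (gen ℜ 2 * ((gen ℜ 2 + p • gen ℜ 0) ^ m - gen ℜ 2 ^ m)) := by
        generalize (gen ℜ 2 + p • gen ℜ 0) ^ m = Q
        generalize npast ℜ 2 0 (gen ℜ 2 ^ m) = Q'
        generalize gen ℜ 2 ^ m = Q''
        push_cast
        simp only [mul_add, add_mul, mul_sub, sub_mul, smul_mul_assoc, mul_smul_comm]
        module
      rw [e]
      refine add_mem (add_mem (add_mem (add_mem ?_ ?_) ?_) ?_) ?_ <;> refine Submodule.smul_mem _ _ ?_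
      · exact x_mul_mem_below hx i1
      · exact below_mono m.le_succ (mul_mem_below h1 i1)
      · exact mul_pow_mem_below h1 m.lt_succ_self
      · exact mul_mem_below (sub_mem (hs a) (Subalgebra.smul_mem _ h2 k)) (hlow m p)
      · exact x_mul_mem_below hx (pow_sub_pow_mem_below hx (hs p) m)
    · rw [pow_succ', npast_2_1_mul, npast_2_2_gen_2, npast_2_1_gen_2, e1, smul_mul_assoc, add_mul,
        smul_mul_assoc, smul_mul_smul_comm]
      refine add_mem (Submodule.smul_mem _ _ (add_mem (x_mul_mem_below hx i2) ?_)) ?_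
      · exact Submodule.smul_mem _ _ (below_mono m.le_succ (mul_mem_below h1 i2))
      · exact Submodule.smul_mem _ _ (mul_mem_below h1 (hlow m q))

theorem nder_pow_mem_below (h : SkewData t (gen ℜ) v ξ η) (m : ℕ) :
    nder ℜ 2 (gen ℜ 2 ^ (m + 1)) - (∑ j ∈ Finset.range (m + 1), t ^ j) • gen ℜ 2 ^ m ∈ 𝓑 m ∧
    nder ℜ 0 (gen ℜ 2 ^ (m + 1)) - (∑ j ∈ Finset.range (m + 1), j * b * t ^ j) • gen ℜ 2 ^ m ∈ 𝓑 m ∧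
    nder ℜ 1 (gen ℜ 2 ^ (m + 1)) ∈ 𝓑 (m + 1) := by
  have hx := exists_gen_2_mul h
  induction m with
  | zero => simp [nder_gen]
  | succ m ih =>
    obtain ⟨-, -, j2, j0, j1⟩ := npast_pow_sub_mem_below h (m + 1)
    obtain ⟨i2, i0, i1⟩ := ih
    rw [pow_succ' _ (m + 1), nder_gen_mul, nder_gen_mul, nder_gen_mul]
    refine ⟨?_, ?_, add_mem (x_mul_mem_below hx i1) (below_mono (Nat.le_succ _) j1)⟩
    · convert add_mem (x_mul_mem_below hx i2) j2 using 1
      rw [Finset.sum_range_succ _ (m + 1), mul_sub, mul_smul_comm, ← pow_succ']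
      module
    · convert add_mem (x_mul_mem_below hx i0) j0 using 1
      rw [Finset.sum_range_succ _ (m + 1), mul_sub, mul_smul_comm, ← pow_succ']
      module

theorem gen_2_pow_mem_below (m : ℕ) : gen ℜ 2 ^ m ∈ 𝓑 (m + 1) := by
  rw [← one_mul (gen ℜ 2 ^ m)]
  exact mul_pow_mem_below (one_mem _) m.lt_succ_self

theorem nder_pow_mem_below' (h : SkewData t (gen ℜ) v ξ η) (m : ℕ) (l : Fin 3) :
    nder ℜ l (gen ℜ 2 ^ m) ∈ 𝓑 m := by
  cases m with
  | zero => simp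
  | succ m =>
    obtain ⟨h2, h0, h1⟩ := nder_pow_mem_below h m
    have key : ∀ {x : NicholsAlgebra ℜ} {c : K}, x - c • gen ℜ 2 ^ m ∈ 𝓑 m → x ∈ 𝓑 (m + 1) := by
      intro x c hx
      rw [← sub_add_cancel x (c • gen ℜ 2 ^ m)]
      exact add_mem (below_mono m.le_succ hx) (Submodule.smul_mem _ _ (gen_2_pow_mem_below m))
    fin_cases l
    · exact key h0
    · exact h1
    · exact key h2

theorem nder_mul_pow (h : SkewData t (gen ℜ) v ξ η) (hv : VData ℜ t v ρ) {f : NicholsAlgebra ℜ}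
    (hf : f ∈ 𝒮) (m : ℕ) (l : Fin 3) :
    nder ℜ l (f * gen ℜ 2 ^ m) - f * nder ℜ l (gen ℜ 2 ^ m) -
      t ^ m • (nder ℜ l f * gen ℜ 2 ^ m) ∈ 𝓑 m := by
  obtain ⟨j0, j1, -⟩ := npast_pow_sub_mem_below h m
  have h2 := nder_2_vwAlgebra h hv hf
  have hd := nder_mem_vwAlgebra h hv hf
  fin_cases l
  · convert mul_mem_below (hd 0) j0 using 1
    simp only [Fin.zero_eta, nder_0_mul, h2, zero_mul, mul_sub, mul_smul_comm]
    module
  · convert mul_mem_below (hd 1) j1 using 1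
    simp only [Fin.mk_one, nder_1_mul, h2, zero_mul, mul_sub, mul_smul_comm]
    module
  · simp [nder_2_mul, h2]

theorem nder_mem_below (h : SkewData t (gen ℜ) v ξ η) (hv : VData ℜ t v ρ) (l : Fin 3) {m : ℕ}
    {y : NicholsAlgebra ℜ} (hy : y ∈ 𝓑 m) : nder ℜ l y ∈ 𝓑 m := by
  refine map_below_le (fun f hf i hi => ?_) hy
  have h1 := add_mem (add_mem (below_mono hi.le (nder_mul_pow h hv hf i l))
    (Submodule.smul_mem _ (t ^ i) (mul_pow_mem_below (nder_mem_vwAlgebra h hv hf l) hi)))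
    (below_mono hi.le (mul_mem_below hf (nder_pow_mem_below' h i l)))
  convert h1 using 1
  abel

theorem nder_2_mem_below (h : SkewData t (gen ℜ) v ξ η) (hv : VData ℜ t v ρ) {m : ℕ}
    {y : NicholsAlgebra ℜ} (hy : y ∈ 𝓑 (m + 1)) : nder ℜ 2 y ∈ 𝓑 m := by
  refine map_below_le (fun f hf i hi => ?_) hy
  rw [nder_2_mul, nder_2_vwAlgebra h hv hf, zero_mul, add_zero]
  exact below_mono (Nat.le_of_lt_succ hi) (mul_mem_below hf (nder_pow_mem_below' h i 2))

theorem eq_zero_of_mul_pow_mem_below (h : SkewData t (gen ℜ) v ξ η) (hv : VData ℜ t v ρ) {m : ℕ}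
    (hm : gen ℜ 2 ^ m ∉ 𝓑 m) {f : NicholsAlgebra ℜ} (hf : f ∈ 𝒮) (hfm : f * gen ℜ 2 ^ m ∈ 𝓑 m) :
    f = 0 := by
  by_contra hne
  have ht : t ^ m ≠ 0 := left_ne_zero_of_mul_eq_one (h.sq_pow m)
  have key := one_mem_of_nder_mem (N := Subalgebra.toSubmodule 𝒮 ⊓
    (𝓑 m).comap (LinearMap.mulRight K (gen ℜ 2 ^ m))) ?_ (x := f) ⟨hf, hfm⟩ hne
  · refine hm ?_
    simpa using key.2
  · rintro l x ⟨hx, hxm⟩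
    refine ⟨nder_mem_vwAlgebra h hv hx l, ?_⟩
    rw [SetLike.mem_coe, Submodule.mem_comap, LinearMap.mulRight_apply] at hxm ⊢
    rw [← Submodule.smul_mem_iff _ ht]
    convert sub_mem (sub_mem (nder_mem_below h hv l hxm)
      (mul_mem_below hx (nder_pow_mem_below' h m l))) (nder_mul_pow h hv hx m l) using 1
    abel

theorem gen_2_pow_notMem_succ (h : SkewData t (gen ℜ) v ξ η) (hv : VData ℜ t v ρ) {m : ℕ}
    (hm : gen ℜ 2 ^ m ∉ 𝓑 m) (ht : ∑ j ∈ Finset.range (m + 1), t ^ j ≠ 0) :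
    gen ℜ 2 ^ (m + 1) ∉ 𝓑 (m + 1) := by
  intro hmem
  refine hm ?_
  rw [← Submodule.smul_mem_iff _ ht]
  convert sub_mem (nder_2_mem_below h hv hmem) (nder_pow_mem_below h m).1 using 1
  abel

theorem gen_2_pow_zero_notMem : gen ℜ 2 ^ 0 ∉ 𝓑 0 := by
  rw [pow_zero, below_zero, Submodule.mem_bot]
  exact one_ne_zero_nichols

end PowersOfLast

section PowersOfLastOne

variable {K : Type u} [Field K] [CharZero K] {a b p q k : K}

attribute [local instance] fact_braidCoeff_R2

theorem gen_2_pow_notMem_one {v : ℕ → NicholsAlgebra (R2 1 a b p q k)} {ξ η ρ : ℕ → K}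
    (h : SkewData 1 (gen _) v ξ η) (hv : VData _ 1 v ρ) (m : ℕ) :
    gen (R2 1 a b p q k) 2 ^ m ∉ below (vwAlgebra 1 a b p q k v) (gen _ 2) m := by
  induction m with
  | zero => exact gen_2_pow_zero_notMem
  | succ m ih =>
    refine gen_2_pow_notMem_succ h hv ih ?_
    simpa using Nat.cast_add_one_ne_zero (R := K) m

local notation "ℜ" => R2 (-1) a b p q k

variable {v : ℕ → NicholsAlgebra (R2 (-1) a b p q k)} {ξ η ρ : ℕ → K}

local notation "𝓑" => below (vwAlgebra (-1) a b p q k v) (gen (R2 (-1) a b p q k) 2)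

theorem gen_2_pow_notMem_neg_one (hbp : b ≠ -p) (h : SkewData (-1) (gen ℜ) v ξ η)
    (hv : VData ℜ (-1) v ρ) (m : ℕ) : gen ℜ 2 ^ m ∉ 𝓑 m := by
  have hx := exists_gen_2_mul h
  have h1 := gen_0_mem_vwAlgebra h
  have hsign : ∀ r : ℕ, ∑ j ∈ Finset.range (2 * r + 1), (-1 : K) ^ j = 1 := by
    intro r
    rw [neg_one_geom_sum, if_neg (by simp)]
  have hd2 : ∀ r : ℕ, nder ℜ 2 (gen ℜ 2 ^ (2 * r + 2)) +
      (p * (r + 1)) • (gen ℜ 0 * gen ℜ 2 ^ (2 * r)) ∈ 𝓑 (2 * r) := by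
    intro r
    induction r with
    | zero =>
      rw [pow_two, nder_gen_mul, nder_gen, npast_2_2_gen_2]
      simp
    | succ r ih =>
      have hN := (npast_pow_sub_mem_below h (2 * r + 2)).2.2.1
      have e1 := h.x₃_mul 1
      have e2 := h.x₃_mul 2
      rw [h.v_one] at e1
      rw [show (-1 : K) ^ (2 * r + 2) = 1 by rw [show 2 * r + 2 = 2 * (r + 1) by ring, pow_mul]; simp]
        at hN
      have e3 : gen ℜ 2 * (gen ℜ 2 * (gen ℜ 0 * gen ℜ 2 ^ (2 * r))) =
          gen ℜ 0 * gen ℜ 2 ^ (2 * r + 2) + (η 1 * η 2) • (v 3 * gen ℜ 2 ^ (2 * r)) := by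
        rw [show 2 * r + 2 = 2 * r + 1 + 1 by ring, pow_succ', pow_succ']
        linear_combination (norm := (simp only [mul_add, add_mul, mul_sub, sub_mul, smul_mul_assoc,
          mul_smul_comm, mul_assoc, pow_one, neg_one_sq]; module))
          gen ℜ 2 * e1 * gen ℜ 2 ^ (2 * r) - e1 * gen ℜ 2 * gen ℜ 2 ^ (2 * r) +
          η 1 • (e2 * gen ℜ 2 ^ (2 * r))
      have e4 : nder ℜ 2 (gen ℜ 2 ^ (2 * (r + 1) + 2)) +
          (p * ((r + 1 : ℕ) + 1)) • (gen ℜ 0 * gen ℜ 2 ^ (2 * (r + 1))) =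
          gen ℜ 2 * (gen ℜ 2 * (nder ℜ 2 (gen ℜ 2 ^ (2 * r + 2)) +
            (p * (r + 1)) • (gen ℜ 0 * gen ℜ 2 ^ (2 * r)))) -
          p • (gen ℜ 0 * (npast ℜ 2 2 (gen ℜ 2 ^ (2 * r + 2)) - (1 : K) • gen ℜ 2 ^ (2 * r + 2))) -
          (p * (r + 1) * (η 1 * η 2)) • (v 3 * gen ℜ 2 ^ (2 * r)) := by
        rw [show 2 * (r + 1) + 2 = 2 * r + 2 + 1 + 1 by ring, show 2 * (r + 1) = 2 * r + 2 by ring,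
          pow_succ' _ (2 * r + 2 + 1), pow_succ' _ (2 * r + 2), nder_gen_mul, nder_gen_mul,
          npast_2_2_mul, npast_2_2_gen_2]
        simp only [mul_add, mul_smul_comm, e3]
        simp only [add_mul, mul_sub, smul_mul_assoc, mul_smul_comm]
        push_cast
        module
      rw [e4]
      refine sub_mem (sub_mem (x_mul_mem_below hx (x_mul_mem_below hx ih)) ?_) ?_
      · exact Submodule.smul_mem _ _ (mul_mem_below h1 hN)
      · exact Submodule.smul_mem _ _ (mul_pow_mem_below (v_mem_vwAlgebra 3) (by omega))
  have hd0 : ∀ r : ℕ, ∑ j ∈ Finset.range (2 * r + 1 + 1), (j : K) * b * (-1) ^ j = -(b * (r + 1)) := by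
    intro r
    induction r with
    | zero => simp [Finset.sum_range_succ]
    | succ r ih =>
      rw [show 2 * (r + 1) + 1 + 1 = 2 * r + 1 + 1 + 1 + 1 by ring, Finset.sum_range_succ,
        Finset.sum_range_succ, ih]
      have : (-1 : K) ^ (2 * r) = 1 := by rw [pow_mul]; simp
      simp only [pow_succ, this]
      push_cast
      ring
  induction m using Nat.strong_induction_on with
  | _ m ih =>
    rcases Nat.even_or_odd' m with ⟨r, rfl | rfl⟩
    · cases r with
      | zero => exact gen_2_pow_zero_notMem
      | succ r =>
        intro hmem
        obtain ⟨g, hg, u, hu, e⟩ : ∃ g ∈ vwAlgebra (-1) a b p q k v, ∃ u ∈ 𝓑 (2 * r + 1),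
            gen ℜ 2 ^ (2 * r + 2) = g * gen ℜ 2 ^ (2 * r + 1) + u := exists_of_mem_below_succ hmem
        have hodd : (-1 : K) ^ (2 * r + 1) = -1 := by rw [pow_succ, pow_mul]; simp
        have hg0 : g + (p * (r + 1)) • gen ℜ 0 = 0 := by
          refine eq_zero_of_mul_pow_mem_below h hv (ih (2 * r) (by omega))
            (add_mem hg (Subalgebra.smul_mem _ h1 _)) ?_
          have h2 := (nder_pow_mem_below h (2 * r)).1
          rw [hsign] at h2
          have h3 := hd2 r
          rw [e, map_add, nder_2_mul, nder_2_vwAlgebra h hv hg, zero_mul, add_zero] at h3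
          convert sub_mem (sub_mem h3 (mul_mem_below hg h2)) (nder_2_mem_below h hv hu) using 1
          simp only [add_mul, mul_sub, smul_mul_assoc, mul_smul_comm]
          module
        have h3 := (nder_pow_mem_below h (2 * r + 1)).2.1
        have h4 := nder_mul_pow h hv hg (2 * r + 1) 0
        have h5 := mul_mem_below hg (nder_pow_mem_below' h (2 * r + 1) 0)
        have h6 : nder ℜ 0 g = -(p * (r + 1)) • 1 := by
          rw [eq_neg_of_add_eq_zero_left hg0, map_neg, map_smul, nder_gen_self, neg_smul]
        rw [e, map_add, hd0] at h3
        rw [h6, hodd] at h4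
        have hne : -(((r : K) + 1) * (b + p)) ≠ 0 := neg_ne_zero.mpr (mul_ne_zero
          (Nat.cast_add_one_ne_zero r) fun h0 => hbp (eq_neg_of_add_eq_zero_left h0))
        refine ih (2 * r + 1) (by omega) ((Submodule.smul_mem_iff _ hne).mp ?_)
        convert sub_mem (add_mem (add_mem h4 h5) (nder_mem_below h hv 0 hu)) h3 using 1
        simp only [smul_mul_assoc, one_mul]
        module
    · exact gen_2_pow_notMem_succ h hv (ih _ (by omega)) (by rw [hsign]; exact one_ne_zero)

end PowersOfLastOne

/-! ### Independence of the monomials `v_n w^a x₃^m` -/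

theorem linearIndependent_of_direct {K A τ : Type*} [Field K] [Ring A] [Algebra K A]
    {φ : ℕ → A →ₗ[K] A} {U : Submodule K A}
    (hφ : ∀ M (f : ℕ → A), (∀ i, f i ∈ U) → ∑ i ∈ Finset.range M, φ i (f i) = 0 →
      ∀ i < M, f i = 0) {x : τ → A} (hx : ∀ j, x j ∈ U) (hind : LinearIndependent K x) :
    LinearIndependent K fun j : ℕ × τ => φ j.1 (x j.2) := by
  classical
  rw [linearIndependent_iff'']
  intro s c hc hs
  obtain ⟨M, hM⟩ := (s.image Prod.fst).exists_nat_subset_range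
  have hsub : s ⊆ Finset.range M ×ˢ s.image Prod.snd := fun j hj => Finset.mem_product.mpr
    ⟨hM (Finset.mem_image_of_mem _ hj), Finset.mem_image_of_mem _ hj⟩
  rw [Finset.sum_subset hsub (fun j _ hj => by rw [hc j hj, zero_smul]), Finset.sum_product] at hs
  simp only [← map_smul, ← map_sum] at hs
  have h1 := hφ M _ (fun i => sum_mem fun j _ => Submodule.smul_mem _ _ (hx j)) hs
  intro j
  by_cases hj : j ∈ s
  · have hj' := Finset.mem_product.mp (hsub hj)
    exact linearIndependent_iff'.mp hind _ _ (h1 j.1 (Finset.mem_range.mp hj'.1)) _ hj'.2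
  · exact hc j hj

section Independence

variable {K : Type u} [Field K] {t a b p q k : K}

attribute [local instance] fact_braidCoeff_R2

local notation "ℜ" => R2 t a b p q k

local notation "w" => tower t b (gen (R2 t a b p q k))

variable {v : ℕ → NicholsAlgebra (R2 t a b p q k)} {ξ η ρ : ℕ → K}

theorem eq_zero_of_sum_mul_pow (h : SkewData t (gen ℜ) v ξ η) (hv : VData ℜ t v ρ)
    (hm : ∀ m, gen ℜ 2 ^ m ∉ below (vwAlgebra t a b p q k v) (gen ℜ 2) m) (M : ℕ)
    (f : ℕ → NicholsAlgebra ℜ) (hf : ∀ i, f i ∈ vwAlgebra t a b p q k v)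
    (h0 : ∑ i ∈ Finset.range M, f i * gen ℜ 2 ^ i = 0) : ∀ i < M, f i = 0 := by
  induction M with
  | zero => intro i hi; omega
  | succ M ih =>
    rw [Finset.sum_range_succ] at h0
    have hM : f M = 0 := by
      refine eq_zero_of_mul_pow_mem_below h hv (hm M) (hf M) ?_
      rw [eq_neg_of_add_eq_zero_right h0]
      exact neg_mem (sum_mem fun i hi => mul_pow_mem_below (hf i) (Finset.mem_range.mp hi))
    rw [hM, zero_mul, add_zero] at h0
    intro i hi
    rcases Nat.lt_succ_iff_lt_or_eq.mp hi with hi | rfl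
    · exact ih h0 i hi
    · exact hM

theorem linearIndependent_orderedMonomial_w [CharZero K] (h : SkewData t (gen ℜ) v ξ η)
    (hv : VData ℜ t v ρ) (hρ : ∀ n, ρ n ≠ 0) :
    LinearIndependent K fun n : {n : ℕ →₀ ℕ // Admissible t n ∧
      ∀ i, n i ≠ 0 → gammaCoeff t b q (p - q) ξ η i ≠ 0} => orderedMonomial w n.1 := by
  classical
  rw [linearIndependent_iff']
  intro s c hs n hn
  obtain ⟨D, hD⟩ := (s.image fun n => n.1.degree).exists_nat_subset_range
  have key := eq_zero_of_sum_orderedMonomial_w h hv hρ D (s.map (Function.Embedding.subtype _))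
    (fun n => if hn : _ then c ⟨n, hn⟩ else 0) ?_ ?_ ?_ n.1
    (Finset.mem_map_of_mem (Function.Embedding.subtype _) hn)
  · rwa [dif_pos n.2] at key
  · intro n hn
    obtain ⟨n, -, rfl⟩ := Finset.mem_map.mp hn
    exact n.2
  · intro n hn
    obtain ⟨n, hn', rfl⟩ := Finset.mem_map.mp hn
    exact Finset.mem_range.mp (hD (Finset.mem_image_of_mem _ hn'))
  · rw [Finset.sum_map, ← hs]
    refine Finset.sum_congr rfl fun n _ => ?_
    rw [Function.Embedding.subtype_apply, dif_pos n.2]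

theorem linearIndependent_v_w_x₃ [CharZero K] (h : SkewData t (gen ℜ) v ξ η) (hv : VData ℜ t v ρ)
    (hρ : ∀ n, ρ n ≠ 0)
    (hm : ∀ m, gen ℜ 2 ^ m ∉ below (vwAlgebra t a b p q k v) (gen ℜ 2) m) {σ : Type*}
    {ν μ : σ → ℕ} {α : σ → ℕ →₀ ℕ}
    (hα : ∀ n, Admissible t (α n) ∧ ∀ i, α n i ≠ 0 → gammaCoeff t b q (p - q) ξ η i ≠ 0)
    (hinj : Function.Injective fun n => (μ n, ν n, α n)) :
    LinearIndependent K fun n => v (ν n) * orderedMonomial w (α n) * gen ℜ 2 ^ μ n := by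
  have h1 := linearIndependent_orderedMonomial_w h hv hρ
  have h2' : ∀ M (f : ℕ → NicholsAlgebra ℜ),
      (∀ i, f i ∈ Subalgebra.toSubmodule (Algebra.adjoin K (Set.range w))) →
      ∑ i ∈ Finset.range M, LinearMap.mulLeft K (v i) (f i) = 0 → ∀ i < M, f i = 0 :=
    fun M f hf h0 => eq_zero_of_sum_v_mul h hv hρ M f hf h0
  have h2 := linearIndependent_of_direct h2' (x := fun n : {n : ℕ →₀ ℕ // Admissible t n ∧
    ∀ i, n i ≠ 0 → gammaCoeff t b q (p - q) ξ η i ≠ 0} => orderedMonomial w n.1)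
    (fun n => orderedMonomial_mem w n.1) h1
  have h3' : ∀ M (f : ℕ → NicholsAlgebra ℜ),
      (∀ i, f i ∈ Subalgebra.toSubmodule (vwAlgebra t a b p q k v)) →
      ∑ i ∈ Finset.range M, LinearMap.mulRight K (gen ℜ 2 ^ i) (f i) = 0 → ∀ i < M, f i = 0 :=
    fun M f hf h0 => eq_zero_of_sum_mul_pow h hv hm M f hf h0
  have h3 := linearIndependent_of_direct h3' (x := fun j : ℕ × {n : ℕ →₀ ℕ // Admissible t n ∧
    ∀ i, n i ≠ 0 → gammaCoeff t b q (p - q) ξ η i ≠ 0} => v j.1 * orderedMonomial w j.2.1)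
    (fun n => (vwAlgebra t a b p q k v).mul_mem (v_mem_vwAlgebra n.1)
      (Algebra.adjoin_mono Set.subset_union_right (orderedMonomial_mem w n.2.1))) h2
  refine h3.comp (fun n => (μ n, ν n, ⟨α n, hα n⟩)) fun m n e => hinj ?_
  simp only [Prod.mk.injEq, Subtype.mk.injEq] at e ⊢
  exact e

end Independence

/-! ### Splitting off the first generators of a monomial -/

section Splitting

variable {A : Type*} [Ring A]

theorem orderedMonomial_embDomain {ι κ : Type*} [LinearOrder ι] [LinearOrder κ] (f : ι ↪o κ)
    (g : κ → A) (n : ι →₀ ℕ) :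
    orderedMonomial g (n.embDomain f.toEmbedding) = orderedMonomial (fun i => g (f i)) n := by
  rw [orderedMonomial_eq_prod g _ (L := (n.support.sort (· ≤ ·)).map f)]
  · rw [List.map_map, orderedMonomial]
    congr 1
    refine List.map_congr_left fun i _ => ?_
    have := Finsupp.embDomain_apply_self f.toEmbedding n i
    simp only [RelEmbedding.coe_toEmbedding] at this
    simp [this]
  · rw [List.pairwise_map]
    exact (Finset.sortedLT_sort _).pairwise.imp fun h => f.strictMono h
  · intro i hi
    rw [← Finsupp.mem_support_iff, Finsupp.support_embDomain, Finset.mem_map] at hi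
    obtain ⟨j, hj, rfl⟩ := hi
    exact List.mem_map_of_mem ((Finset.mem_sort _).mpr hj)

theorem orderedMonomial_nat (g : ℕ → A) (n : ℕ →₀ ℕ) :
    orderedMonomial g n = g 0 ^ n 0 *
      orderedMonomial (fun i => g (i + 1)) (n.comapDomain Nat.succ Nat.succ_injective.injOn) := by
  rw [orderedMonomial_eq_prod g n (L := 0 :: ((n.comapDomain Nat.succ
    Nat.succ_injective.injOn).support.sort (· ≤ ·)).map Nat.succ)]
  · rw [List.map_cons, List.prod_cons, List.map_map, orderedMonomial]
    rfl
  · rw [List.pairwise_cons, List.pairwise_map]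
    refine ⟨fun i hi => ?_, (Finset.sortedLT_sort _).pairwise.imp fun h => Nat.succ_lt_succ h⟩
    obtain ⟨j, -, rfl⟩ := List.mem_map.mp hi
    exact j.succ_pos
  · intro i hi
    cases i with
    | zero => simp
    | succ i =>
      refine List.mem_cons_of_mem _ (List.mem_map_of_mem ((Finset.mem_sort _).mpr ?_))
      simpa using hi

end Splitting

/-! ### Degrees -/

section Degrees

variable {K : Type u} [Field K]

theorem IsTower.mem_degreePart {t b : K} {v Z : ℕ → T K} {c : ℕ → K}
    (hZ : IsTower t b (FreeAlgebra.ι K) v c Z) (hv : ∀ n, v n ∈ degreePart K n) (n : ℕ) :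
    Z n ∈ degreePart K (n + 1) := by
  induction n with
  | zero => rw [hZ.zero]; exact ι_mem_degreePart 1
  | succ n ih =>
    have h := fun i => mul_mem_degreePart (ι_mem_degreePart (K := K) i) ih
    rw [add_comm 1] at h
    rw [hZ.succ]
    exact add_mem (sub_mem (sub_mem (h 2) (Submodule.smul_mem _ _ (h 0))) (Submodule.smul_mem _ _
      (mul_mem_degreePart ih (ι_mem_degreePart 2)))) (Submodule.smul_mem _ _
      (mul_mem_degreePart (hv (n + 1)) (ι_mem_degreePart 1)))

theorem pow_x₁_mem_degreePart (n : ℕ) : (x₁ : T K) ^ n ∈ degreePart K n := by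
  simpa using pow_mem_degreePart (ι_mem_degreePart (K := K) 0) n

theorem z_mem_degreePart (b p q : K) (n : ℕ) : z b p q n ∈ degreePart K (n + 1) :=
  (isTower_z (AlgHom.id K (T K)) b p q).mem_degreePart pow_x₁_mem_degreePart n

theorem tower_mem_degreePart (t b : K) (n : ℕ) :
    tower t b (FreeAlgebra.ι K) n ∈ degreePart K (n + 1) :=
  (isTower_tower t b (FreeAlgebra.ι K) _).mem_degreePart pow_x₁_mem_degreePart n

theorem x₃₁_mem_degreePart : (x₃₁ : T K) ∈ degreePart K 2 :=
  add_mem (mul_mem_degreePart (ι_mem_degreePart 2) (ι_mem_degreePart 0))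
    (mul_mem_degreePart (ι_mem_degreePart 0) (ι_mem_degreePart 2))

theorem z'_mem_degreePart (b p q : K) (n : ℕ) : z' b p q n ∈ degreePart K (n + 1) := by
  induction n with
  | zero => exact ι_mem_degreePart 1
  | succ n ih =>
    have h := fun i => mul_mem_degreePart (ι_mem_degreePart (K := K) i) ih
    have h' := mul_mem_degreePart ih (ι_mem_degreePart (K := K) 2)
    have hY := pow_mem_degreePart (x₃₁_mem_degreePart (K := K))
    rw [add_comm 1] at h
    rw [z', sub_mul, smul_mul_assoc]
    refine add_mem (sub_mem (h 2) (Submodule.smul_mem _ _ (h 0))) ?_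
    split_ifs with hn
    · refine add_mem h' (Submodule.smul_mem _ _ ?_)
      have := mul_mem_degreePart (mul_mem_degreePart (ι_mem_degreePart (K := K) 0)
        (ι_mem_degreePart 1)) (hY (n / 2))
      rw [Nat.div_mul_cancel hn.two_dvd] at this
      convert this using 2
      ring
    · refine sub_mem (neg_mem h') (Submodule.smul_mem _ _ ?_)
      have := mul_mem_degreePart (ι_mem_degreePart (K := K) 1) (hY ((n + 1) / 2))
      rw [Nat.div_mul_cancel (Nat.not_even_iff_odd.mp hn).add_one.two_dvd] at this
      convert this using 2
      ring

theorem map_tower {A : Type*} [Ring A] [Algebra K A] (π : T K →ₐ[K] A) (t b : K) (n : ℕ) :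
    π (tower t b (FreeAlgebra.ι K) n) = tower t b (fun i => π (FreeAlgebra.ι K i)) n := by
  induction n with
  | zero => rfl
  | succ n ih => simp only [tower, map_sub, map_mul, map_smul, ih]

/-- The degrees of the generators for `t = 1`. -/
def degreePlus : ℕ → ℕ
  | 0 => 1
  | n + 1 => n + 1

/-- The degrees of the generators for `t = -1`. -/
def degreeMinus : ℕ → ℕ
  | 0 => 1
  | 1 => 1
  | 2 => 2
  | n + 3 => n + 2

/-- The generators `x₁, x₂ = w_0, w_1, …`. -/
def towerPlus (b : K) : ℕ → T K
  | 0 => x₁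
  | n + 1 => tower 1 b (FreeAlgebra.ι K) n

/-- The generators `x₁, x₂, x₃₁, w_1, …`. -/
def towerMinus (b : K) : ℕ → T K
  | 0 => x₁
  | 1 => x₂
  | 2 => x₃₁
  | n + 3 => tower (-1) b (FreeAlgebra.ι K) (n + 1)

theorem genPlus_mem_degreePart (b p q : K) (n : ℕ) :
    genPlus b p q n ∈ degreePart K (degreePlus n) := by
  cases n with
  | zero => exact ι_mem_degreePart 0
  | succ n => exact z_mem_degreePart b p q n

theorem towerPlus_mem_degreePart (b : K) (n : ℕ) : towerPlus b n ∈ degreePart K (degreePlus n) := by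
  cases n with
  | zero => exact ι_mem_degreePart 0
  | succ n => exact tower_mem_degreePart 1 b n

theorem genMinus_mem_degreePart (b p q : K) (n : ℕ) :
    genMinus b p q n ∈ degreePart K (degreeMinus n) :=
  match n with
  | 0 => ι_mem_degreePart 0
  | 1 => ι_mem_degreePart 1
  | 2 => x₃₁_mem_degreePart
  | n + 3 => z'_mem_degreePart b p q (n + 1)

theorem towerMinus_mem_degreePart (b : K) (n : ℕ) :
    towerMinus b n ∈ degreePart K (degreeMinus n) :=
  match n with
  | 0 => ι_mem_degreePart 0
  | 1 => ι_mem_degreePart 1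
  | 2 => x₃₁_mem_degreePart
  | n + 3 => tower_mem_degreePart (-1) b (n + 1)

theorem withLast_mem_degreePart {ι : Type} {g : ι → T K} {d : ι → ℕ}
    (h : ∀ i, g i ∈ degreePart K (d i)) (i : WithTop ι) :
    withLast x₃ g i ∈ degreePart K (withLast 1 d i) := by
  induction i using WithTop.recTopCoe with
  | top => exact ι_mem_degreePart 2
  | coe i => exact h i

end Degrees

section Presentation

variable {K : Type u} [Field K] {R : Matrix (Fin 9) (Fin 9) K} [hR : Fact (BraidCoeff R)]

/-- A presentation and a PBW basis, from spanning in every quotient and from an independent family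
of monomials in generators of the same degrees. -/
theorem presentation_of_homogeneous {rels : Set (T K)} {ι : Type} [LinearOrder ι]
    {g g' : ι → T K} {h : ι → ℕ∞} {d : ι → ℕ} (hg : ∀ i, g i ∈ degreePart K (d i))
    (hg' : ∀ i, g' i ∈ degreePart K (d i)) (hrels : ∀ r ∈ rels, proj R r = 0)
    (hspan : ∀ (A : Type u) [Ring A] [Algebra K A] (π : T K →ₐ[K] A), Function.Surjective π →
      (∀ r ∈ rels, π r = 0) →
      Submodule.span K (Set.range fun n : {n : ι →₀ ℕ // ∀ i, (n i : ℕ∞) < h i} =>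
        orderedMonomial (fun i => π (g i)) n.1) = ⊤)
    (hind : LinearIndependent K fun n : {n : ι →₀ ℕ // ∀ i, (n i : ℕ∞) < h i} =>
      orderedMonomial (fun i => proj R (g' i)) n.1) :
    nicholsIdeal R = TwoSidedIdeal.span rels ∧ IsPBWBasis K (fun i => proj R (g i)) h := by
  refine presentation_of_span_of_linearIndependent (fun r hr => proj_eq_zero.mp (hrels r hr))
    (hspan _ _ (toPresented_surjective _) fun r hr => toPresented_of_mem hr) ?_
  have h1 := hspan _ (proj R) proj_surjective hrels
  simp only [← map_orderedMonomial (proj R)] at h1 hind ⊢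
  exact linearIndependent_of_homogeneous (fun n => orderedMonomial_mem_degreePart hg' n.1)
    (fun n => orderedMonomial_mem_degreePart hg n.1) hind h1

end Presentation

/-! ### The case `t = 1` -/

section One

variable {K : Type u} [Field K] {a b p q k : K}

attribute [local instance] fact_braidCoeff_R2

local notation "ℜ" => R2 1 a b p q k

/-- `∏_{j = 1}^n (y - j s)`. -/
def stepProd (y s : K) (n : ℕ) : K := ∏ j ∈ Finset.range n, (y - ((j : K) + 1) * s)

theorem stepProd_succ (y s : K) (n : ℕ) :
    stepProd y s (n + 1) = stepProd y s n * (y - ((n : K) + 1) * s) :=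
  Finset.prod_range_succ _ _

theorem stepProd_ne_zero {y s : K} {n : ℕ} (h : ∀ j < n, y ≠ ((j : K) + 1) * s) :
    stepProd y s n ≠ 0 :=
  Finset.prod_ne_zero_iff.mpr fun j hj => sub_ne_zero.mpr (h j (Finset.mem_range.mp hj))

theorem comm_tower {t : K} {v : ℕ → NicholsAlgebra (R2 t a b p q k)} {ξ η : ℕ → K}
    (h : SkewData t (gen (R2 t a b p q k)) v ξ η) (i j : ℕ) :
    IsTower.Comm t (tower t b (gen (R2 t a b p q k))) i j :=
  w_comm h (w_structure h i).2.2 (w_structure h j).2.2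

theorem tower_eq_zero {t : K} {v : ℕ → NicholsAlgebra (R2 t a b p q k)} {ξ η : ℕ → K}
    (h : SkewData t (gen (R2 t a b p q k)) v ξ η) {n : ℕ}
    (hγ : gammaCoeff t b q (p - q) ξ η n = 0) : tower t b (gen (R2 t a b p q k)) n = 0 :=
  eq_zero_of_nder (ncounit_w n) fun l => by
    rw [(w_structure h n).2.2, hγ, zero_smul, ite_self]

theorem tower_gen_one (n : ℕ) : proj ℜ (tower 1 b (FreeAlgebra.ι K) n) = tower 1 b (gen ℜ) n :=
  map_tower (proj ℜ) 1 b n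

variable [CharZero K]

/-- The coefficients `γ n` for `t = 1`. -/
abbrev gammaOne (b p q : K) : ℕ → K :=
  gammaCoeff 1 b q (p - q) (fun _ => 1) (fun n => (n : K) * ((b - p) / 2))

theorem thetaCoeff_one (b p q : K) (n : ℕ) :
    thetaCoeff b (p - q) (fun _ => 1) (fun n => (n : K) * ((b - p) / 2)) n =
      (p - q) * stepProd (p - q) ((b + p) / 2) n := by
  induction n with
  | zero => simp [thetaCoeff, stepProd]
  | succ n ih =>
    rw [thetaCoeff, ih, stepProd_succ]
    push_cast
    ring

theorem gammaCoeff_one (n : ℕ) : gammaOne b p q n = ((n : K) + 1) * stepProd (p - q) ((b + p) / 2) n := by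
  induction n with
  | zero => simp [gammaCoeff, stepProd]
  | succ n ih =>
    rw [gammaOne, gammaCoeff, ← gammaOne, ih, thetaCoeff_one, stepProd_succ]
    push_cast
    ring

theorem β_eq (n : ℕ) : β b p q n = n * ((p - q) - ((n : K) + 1) * ((b + p) / 2)) := by
  rw [β]
  ring

theorem β_eq_zero_iff {n : ℕ} (hn : 1 ≤ n) :
    β b p q n = 0 ↔ p - q = ((n : K) + 1) * ((b + p) / 2) := by
  rw [β_eq, mul_eq_zero, sub_eq_zero, or_iff_right (Nat.cast_ne_zero.mpr (by omega))]

theorem existsUnique_β_eq_zero (b p q : K) (h : b ≠ p - 2 * q)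
    (hb : ¬ ∀ n, 1 ≤ n → β b p q n ≠ 0) : ∃! N : ℕ, 1 ≤ N ∧ β b p q N = 0 := by
  push Not at hb
  obtain ⟨N, hN, hN0⟩ := hb
  refine ⟨N, ⟨hN, hN0⟩, fun M ⟨hM, hM0⟩ => ?_⟩
  rw [β_eq_zero_iff hN] at hN0
  rw [β_eq_zero_iff hM] at hM0
  have h1 : ((M : K) - N) * ((b + p) / 2) = 0 := by linear_combination hN0 - hM0
  rcases mul_eq_zero.mp h1 with h1 | h1
  · exact_mod_cast sub_eq_zero.mp h1
  · refine absurd ?_ h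
    rw [h1] at hN0
    linear_combination 2 * h1 - 2 * hN0

theorem linearIndependent_towerPlus {ι : Type} [LinearOrder ι] (f : ι ↪o ℕ)
    (hγ : ∀ i, i + 1 ∈ Set.range f → gammaOne b p q i ≠ 0) :
    LinearIndependent K fun n : {n : WithTop ι →₀ ℕ //
        ∀ i, (n i : ℕ∞) < withLast ⊤ (fun _ => ⊤) i} =>
      orderedMonomial (fun i => proj ℜ (withLast x₃ (fun i => towerPlus b (f i)) i)) n.1 := by
  let N : (WithTop ι →₀ ℕ) → ℕ →₀ ℕ := fun n =>
    (n.comapDomain WithTop.some WithTop.coe_injective.injOn).embDomain f.toEmbedding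
  have hN : ∀ n i, N n (f i) = n i := fun n i => Finsupp.embDomain_apply_self f.toEmbedding _ i
  have hN' : ∀ n i, N n i ≠ 0 → i ∈ Set.range f := fun n i hi => by
    by_contra hr
    exact hi (Finsupp.embDomain_of_notMem_range _ _ _ hr)
  have h1 := linearIndependent_v_w_x₃ (skewData_R2_one a b p q k) (vData_one a b p q k)
    (fun n => Nat.cast_add_one_ne_zero n)
    (gen_2_pow_notMem_one (skewData_R2_one a b p q k) (vData_one a b p q k))
    (σ := {n : WithTop ι →₀ ℕ // ∀ i, (n i : ℕ∞) < withLast ⊤ (fun _ => ⊤) i})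
    (ν := fun n => N n.1 0) (μ := fun n => n.1 ⊤)
    (α := fun n => (N n.1).comapDomain Nat.succ Nat.succ_injective.injOn)
    (fun n => ⟨fun i => Or.inr (one_pow _), fun i hi => hγ i (hN' _ _ hi)⟩) ?_
  · convert h1 using 1
    funext n
    have e : (fun i => proj ℜ (withLast x₃ (fun i => towerPlus b (f i)) i)) =
        withLast (gen ℜ 2) (fun i => proj ℜ (towerPlus b (f i))) := by
      funext i
      induction i using WithTop.recTopCoe <;> rfl
    rw [e, orderedMonomial_withLast,
      ← orderedMonomial_embDomain f (fun i => proj ℜ (towerPlus b i)), orderedMonomial_nat]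
    simp only [towerPlus, tower_gen_one]
    rfl
  · rintro ⟨m, hm⟩ ⟨n, hn⟩ e
    simp only [Prod.mk.injEq] at e
    rw [Subtype.mk.injEq]
    have e' : N m = N n := by
      ext i
      cases i with
      | zero => exact e.2.1
      | succ i => exact DFunLike.congr_fun e.2.2 i
    ext i
    induction i using WithTop.recTopCoe with
    | top => exact e.1
    | coe i => rw [← hN, ← hN, e']

theorem proj_relsPlus : ∀ r ∈ relsPlus b p q, proj ℜ r = 0 := by
  have hS := skewData_R2_one a b p q k
  rintro r ((rfl | rfl) | ⟨n, rfl⟩)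
  · have := gen_1_mul_gen_0 (a := a) (b := b) (p := p) (q := q) (k := k) (one_mul (1 : K))
    rw [one_smul] at this
    rw [map_sub, map_mul, map_mul, sub_eq_zero]
    exact this
  · have := gen_2_mul_gen_0 (a := a) (b := b) (p := p) (q := q) (k := k) rfl
    rw [map_add, map_sub, map_mul, map_mul, map_smul, map_pow]
    change gen ℜ 2 * gen ℜ 0 - gen ℜ 0 * gen ℜ 2 + ((p - b) / 2) • gen ℜ 0 ^ 2 = 0
    rw [this, pow_two]
    module
  · have := (isTower_tower 1 b (gen ℜ) _).comm_of_comm hS (isTower_z (proj ℜ) b p q)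
      (comm_tower hS) (n + 1) n
    rw [IsTower.Comm, one_pow, one_smul] at this
    rw [map_sub, map_mul, map_mul, sub_eq_zero]
    exact this

theorem presentation_R2_one {ι : Type} [LinearOrder ι] (f : ι ↪o ℕ) {rels : Set (T K)}
    (hsub : relsPlus b p q ⊆ rels) (hrels : ∀ r ∈ rels, proj ℜ r = 0)
    (h0 : 0 ∈ Set.range f) (h1 : 1 ∈ Set.range f) (hγ : ∀ i, i + 1 ∈ Set.range f → gammaOne b p q i ≠ 0)
    (hclosed : ∀ (A : Type u) [Ring A] [Algebra K A] (π : T K →ₐ[K] A), (∀ r ∈ rels, π r = 0) →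
      ∀ n, n + 1 ∈ Set.range f → π (z b p q (n + 1)) ∈
        Algebra.adjoin K (Set.range fun i => π (genPlus b p q (f i)))) :
    nicholsIdeal ℜ = TwoSidedIdeal.span rels ∧
      IsPBWBasis K (fun i => proj ℜ (withLast x₃ (fun i => genPlus b p q (f i)) i)) fun _ => ⊤ := by
  have e : (fun _ : WithTop ι => (⊤ : ℕ∞)) = withLast ⊤ fun _ => ⊤ := by
    funext i
    induction i using WithTop.recTopCoe <;> rfl
  rw [e]
  exact presentation_of_homogeneous
    (withLast_mem_degreePart fun i => genPlus_mem_degreePart b p q (f i))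
    (withLast_mem_degreePart fun i => towerPlus_mem_degreePart b (f i)) hrels
    (fun A _ _ π hπ hr => span_eq_top_of_relsPlus hπ (fun r h => hr r (hsub h)) h0 h1
      (hclosed A π hr)) (linearIndependent_towerPlus f hγ)

theorem describes_R2_one_of_ne (a b p q k : K) (h : b ≠ p - 2 * q)
    (hb : ∀ n, 1 ≤ n → β b p q n ≠ 0) :
    Describes (R2 1 a b p q k) (relsPlus b p q) (withLast x₃ (genPlus b p q)) (fun _ => ⊤) ⊤ := by
  have hγ : ∀ i, gammaOne b p q i ≠ 0 := by
    intro i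
    rw [gammaCoeff_one]
    refine mul_ne_zero (Nat.cast_add_one_ne_zero i) (stepProd_ne_zero fun j _ e => ?_)
    cases j with
    | zero => exact h (by linear_combination -2 * e)
    | succ j => exact hb (j + 1) (by omega) ((β_eq_zero_iff (by omega)).mpr e)
  obtain ⟨h1, h2⟩ := presentation_R2_one (a := a) (k := k) (OrderIso.refl ℕ).toOrderEmbedding
    subset_rfl proj_relsPlus ⟨0, rfl⟩ ⟨1, rfl⟩ (fun i _ => hγ i)
    (fun A _ _ π _ n _ => Algebra.subset_adjoin (Set.mem_range_self (n + 2)))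
  exact ⟨h1, h2, GKdim_eq_top h2 (by simpa using Set.infinite_univ) fun _ => ENat.top_pos⟩

theorem describes_R2_one_of_eq (a b p q k : K) (h : b ≠ p - 2 * q)
    (N : ℕ) (hN : 1 ≤ N) (hb : β b p q N = 0) :
    Describes (R2 1 a b p q k)
      (relsPlus b p q ∪
        {z b p q (N + 1) + (((N : K) + 1) * ((b + p) / 2)) • (x₁ * z b p q N)})
      (withLast x₃ (fun i : Fin (N + 2) => genPlus b p q i)) (fun _ => ⊤)
      ((N + 3 : ℕ) : EReal) := by
  rw [β_eq_zero_iff hN] at hb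
  have hs : (b + p) / 2 ≠ 0 := by
    intro hs
    rw [hs] at hb
    exact h (by linear_combination 2 * hs - 2 * hb)
  have hγ : ∀ i ≤ N, gammaOne b p q i ≠ 0 := by
    intro i hi
    rw [gammaCoeff_one]
    refine mul_ne_zero (Nat.cast_add_one_ne_zero i) (stepProd_ne_zero fun j hj e => ?_)
    have := mul_right_cancel₀ hs (hb.symm.trans e)
    have : N + 1 = j + 1 := by exact_mod_cast this
    omega
  have hS := skewData_R2_one a b p q k
  have hw : tower 1 b (gen (R2 1 a b p q k)) (N + 1) = 0 := tower_eq_zero hS (by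
    rw [← gammaOne, gammaCoeff_one, stepProd_succ, ← hb, sub_self, mul_zero, mul_zero])
  have hrel : proj (R2 1 a b p q k)
      (z b p q (N + 1) + (((N : K) + 1) * ((b + p) / 2)) • (x₁ * z b p q N)) = 0 := by
    have := tower_identity_one (b := b) (s := (b + p) / 2) (y := p - q) (e := (b - p) / 2) (by ring)
      (gen_2_mul_gen_0 rfl) (isTower_z (proj (R2 1 a b p q k)) b p q)
      (isTower_tower 1 b (gen (R2 1 a b p q k)) _) (by simp) (fun n => by
        rw [Nat.factorial_succ, pow_succ]
        push_cast
        ring) N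
    rw [hw, sub_eq_zero.mpr hb.symm, zero_smul, add_zero] at this
    rw [map_add, map_smul, map_mul]
    exact this
  obtain ⟨h1, h2⟩ := presentation_R2_one (a := a) (k := k) (Fin.valOrderEmb (N + 2))
    (rels := relsPlus b p q ∪
      {z b p q (N + 1) + (((N : K) + 1) * ((b + p) / 2)) • (x₁ * z b p q N)})
    Set.subset_union_left (by
      rintro r (hr | rfl)
      · exact proj_relsPlus r hr
      · exact hrel) ⟨0, rfl⟩ ⟨1, rfl⟩ (fun i ⟨j, hj⟩ => hγ i (by
        have := j.2
        simp only [Fin.valOrderEmb_apply] at hj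
        omega)) (by
      rintro A _ _ π hr n ⟨j, hj⟩
      have hg : ∀ m (hm : m < N + 2), π (genPlus b p q m) ∈
          Algebra.adjoin K (Set.range fun i => π (genPlus b p q (Fin.valOrderEmb (N + 2) i))) :=
        fun m hm => Algebra.subset_adjoin ⟨⟨m, hm⟩, rfl⟩
      simp only [Fin.valOrderEmb_apply] at hj
      by_cases hn : n + 2 < N + 2
      · exact hg (n + 2) hn
      · obtain rfl : n = N := by omega
        have := hr _ (Or.inr rfl)
        rw [map_add, map_smul, map_mul] at this
        rw [eq_neg_of_add_eq_zero_left this]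
        exact neg_mem (Subalgebra.smul_mem _ (mul_mem (hg 0 (by omega)) (hg (n + 1) (by omega))) _))
  refine ⟨h1, h2, ?_⟩
  rw [GKdim_eq_card (braidCoeff_R2 1 a b p q k)
    (withLast_mem_degreePart fun i => genPlus_mem_degreePart b p q _) ?_ (fun _ => Or.inr rfl) h2]
  · rw [Finset.filter_true_of_mem fun _ _ => rfl, Finset.card_univ]
    exact congrArg _ (congrArg Nat.cast ((Fintype.card_option (α := Fin (N + 2))).trans (by simp)))
  · intro i
    induction i using WithTop.recTopCoe with
    | top => exact le_rfl
    | coe i =>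
      change 1 ≤ degreePlus i
      rcases i with ⟨_ | i, hi⟩
      · exact le_rfl
      · exact Nat.le_add_left _ _

end One

/-! ### The case `t = -1` -/

section NegOne

variable {K : Type u} [Field K] [CharZero K] {a b p q k : K}

attribute [local instance] fact_braidCoeff_R2

local notation "ℜ" => R2 (-1) a b p q k

/-- The coefficients `γ n` for `t = -1`. -/
abbrev gammaNegOne (b p q : K) : ℕ → K :=
  gammaCoeff (-1) b q (p - q) (fun n => if Even n then 1 else 0)
    (fun n => if Even n then (n : K) * ((b - p) / 2) else 1)

theorem thetaCoeff_neg_one (b p q : K) (m : ℕ) :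
    thetaCoeff b (p - q) (fun n => if Even n then 1 else 0)
      (fun n => if Even n then (n : K) * ((b - p) / 2) else 1) (2 * m) =
      (p - q) * stepProd (p - q) (b + p) m := by
  induction m with
  | zero => simp [thetaCoeff, stepProd]
  | succ m ih =>
    rw [show 2 * (m + 1) = 2 * m + 1 + 1 by ring, thetaCoeff, thetaCoeff, ih, stepProd_succ]
    simp only [Nat.even_add_one, even_two_mul, not_true_eq_false, not_false_eq_true, if_true,
      if_false]
    push_cast
    ring

theorem gammaCoeff_neg_one (m : ℕ) :
    gammaNegOne b p q (2 * m) = stepProd (p - q) (b + p) m ∧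
    gammaNegOne b p q (2 * m + 1) = -(((m : K) + 1) * (b + p)) * stepProd (p - q) (b + p) m := by
  have h1 : ∀ m, gammaNegOne b p q (2 * m) = stepProd (p - q) (b + p) m →
      gammaNegOne b p q (2 * m + 1) =
        -(((m : K) + 1) * (b + p)) * stepProd (p - q) (b + p) m := by
    intro m h
    rw [gammaNegOne, gammaCoeff, ← gammaNegOne, h, thetaCoeff_neg_one, pow_succ, pow_mul]
    simp only [even_two_mul, if_true]
    push_cast
    rw [neg_one_sq, one_pow]
    ring
  suffices h : gammaNegOne b p q (2 * m) = stepProd (p - q) (b + p) m from ⟨h, h1 m h⟩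
  induction m with
  | zero => simp [gammaCoeff, stepProd]
  | succ m ih =>
    rw [show 2 * (m + 1) = 2 * m + 1 + 1 by ring, gammaNegOne, gammaCoeff, ← gammaNegOne, h1 m ih,
      thetaCoeff, thetaCoeff_neg_one, stepProd_succ, pow_succ, pow_succ, pow_mul]
    simp only [Nat.even_add_one, even_two_mul, not_true_eq_false, if_false]
    rw [neg_one_sq, one_pow]
    ring

theorem gammaNegOne_ne_zero (h : b ≠ -p) {i : ℕ}
    (hi : ∀ j, 2 * j + 2 ≤ i → p - q ≠ ((j : K) + 1) * (b + p)) : gammaNegOne b p q i ≠ 0 := by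
  have hs : b + p ≠ 0 := fun h0 => h (eq_neg_of_add_eq_zero_left h0)
  rcases Nat.even_or_odd' i with ⟨m, rfl | rfl⟩
  · rw [(gammaCoeff_neg_one m).1]
    exact stepProd_ne_zero fun j hj => hi j (by omega)
  · rw [(gammaCoeff_neg_one m).2]
    exact mul_ne_zero (neg_ne_zero.mpr (mul_ne_zero (Nat.cast_add_one_ne_zero m) hs))
      (stepProd_ne_zero fun j hj => hi j (by omega))

theorem β'_odd_eq_zero_iff {m : ℕ} :
    β' b p q (2 * m + 1) = 0 ↔ p - q = ((m : K) + 1) * (b + p) := by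
  rw [β', if_neg (by simp), ← sub_eq_zero (a := p - q)]
  refine Eq.congr_left ?_
  push_cast
  ring

theorem odd_of_β'_eq_zero (b p q : K) (h : b ≠ -p) {N : ℕ} (hN : 1 ≤ N) (hb : β' b p q N = 0) :
    Odd N := by
  rw [← Nat.not_even_iff_odd]
  intro he
  rw [β', if_pos he, neg_eq_zero, mul_eq_zero] at hb
  rcases hb with hb | hb
  · exact div_ne_zero (Nat.cast_ne_zero.mpr (by omega)) two_ne_zero hb
  · exact h (eq_neg_of_add_eq_zero_left hb)

theorem existsUnique_β'_eq_zero (b p q : K) (h : b ≠ -p)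
    (hb : ¬ ∀ n, 1 ≤ n → β' b p q n ≠ 0) : ∃! N : ℕ, 1 ≤ N ∧ β' b p q N = 0 := by
  push Not at hb
  obtain ⟨N, hN, hN0⟩ := hb
  refine ⟨N, ⟨hN, hN0⟩, fun M ⟨hM, hM0⟩ => ?_⟩
  obtain ⟨m, rfl⟩ := odd_of_β'_eq_zero b p q h hN hN0
  obtain ⟨n, rfl⟩ := odd_of_β'_eq_zero b p q h hM hM0
  rw [β'_odd_eq_zero_iff] at hN0 hM0
  have h1 := mul_right_cancel₀ (fun h0 => h (eq_neg_of_add_eq_zero_left h0)) (hN0.symm.trans hM0)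
  have h2 : m + 1 = n + 1 := by exact_mod_cast h1
  omega

/-- The position in the list of generators of the elements `w n`. -/
def minusIndex : ℕ → ℕ
  | 0 => 1
  | n + 1 => n + 3

theorem minusIndex_injective : Function.Injective minusIndex := by
  intro m n h
  cases m <;> cases n <;> simp_all [minusIndex]

theorem heightMinus_minusIndex (n : ℕ) : heightMinus (minusIndex n) = if Even n then 2 else ⊤ := by
  cases n <;> simp [minusIndex, heightMinus]

theorem tower_gen_neg_one (n : ℕ) :
    proj ℜ (tower (-1) b (FreeAlgebra.ι K) n) = tower (-1) b (gen ℜ) n :=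
  map_tower (proj ℜ) (-1) b n

theorem orderedMonomial_towerMinus {N : ℕ →₀ ℕ} (h0 : N 0 < 2) :
    orderedMonomial (fun i => proj ℜ (towerMinus b i)) N =
      superPow (gen ℜ 0) (proj ℜ x₃₁) (N 0 + 2 * N 2) *
        orderedMonomial (tower (-1) b (gen ℜ)) (N.comapDomain minusIndex
          minusIndex_injective.injOn) := by
  have hc := (show Commute (proj ℜ x₃₁) (gen ℜ 1) from x₃₁_mul_gen_1 rfl).pow_pow (N 2) (N 1)
  rw [orderedMonomial_nat, orderedMonomial_nat, orderedMonomial_nat, orderedMonomial_nat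
    (tower (-1) b (gen ℜ)), superPow, Nat.add_mul_mod_self_left, Nat.mod_eq_of_lt h0,
    Nat.add_mul_div_left _ _ two_pos, Nat.div_eq_of_lt h0, zero_add]
  simp only [towerMinus, tower_gen_neg_one, Finsupp.comapDomain_apply, minusIndex, Nat.succ_eq_add_one,
    zero_add, Nat.reduceAdd]
  have e : ((N.comapDomain Nat.succ Nat.succ_injective.injOn).comapDomain Nat.succ
      Nat.succ_injective.injOn).comapDomain Nat.succ Nat.succ_injective.injOn =
      (N.comapDomain minusIndex minusIndex_injective.injOn).comapDomain Nat.succ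
        Nat.succ_injective.injOn := by
    ext
    rfl
  rw [e]
  generalize orderedMonomial (fun i => tower (-1) b (gen ℜ) (i + 1)) _ = y
  change gen ℜ 0 ^ N 0 * (gen ℜ 1 ^ N 1 * (proj ℜ x₃₁ ^ N 2 * y)) =
    gen ℜ 0 ^ N 0 * proj ℜ x₃₁ ^ N 2 * (gen ℜ 1 ^ N 1 * y)
  rw [← mul_assoc (gen ℜ 1 ^ N 1), ← hc.eq, mul_assoc, mul_assoc]

theorem linearIndependent_towerMinus (hbp : b ≠ -p) {ι : Type} [LinearOrder ι] (f : ι ↪o ℕ)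
    (hγ : ∀ i, minusIndex i ∈ Set.range f → gammaNegOne b p q i ≠ 0) :
    LinearIndependent K fun n : {n : WithTop ι →₀ ℕ //
        ∀ i, (n i : ℕ∞) < withLast ⊤ (fun i => heightMinus (f i)) i} =>
      orderedMonomial (fun i => proj ℜ (withLast x₃ (fun i => towerMinus b (f i)) i)) n.1 := by
  let N : (WithTop ι →₀ ℕ) → ℕ →₀ ℕ := fun n =>
    (n.comapDomain WithTop.some WithTop.coe_injective.injOn).embDomain f.toEmbedding
  have hN : ∀ n i, N n (f i) = n i := fun n i => Finsupp.embDomain_apply_self f.toEmbedding _ i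
  have hN' : ∀ n i, N n i ≠ 0 → i ∈ Set.range f := fun n i hi => by
    by_contra hr
    exact hi (Finsupp.embDomain_of_notMem_range _ _ _ hr)
  have hlt : ∀ n : {n : WithTop ι →₀ ℕ //
      ∀ i, (n i : ℕ∞) < withLast ⊤ (fun i => heightMinus (f i)) i}, ∀ i, heightMinus i = 2 →
      N n.1 i < 2 := by
    intro n i hi
    by_cases hn : N n.1 i = 0
    · omega
    · obtain ⟨j, rfl⟩ := hN' n.1 i hn
      rw [hN]
      have := n.2 j
      change _ < heightMinus (f j) at this
      rw [hi] at this
      exact_mod_cast this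
  have hs : b + p ≠ 0 := fun h0 => hbp (eq_neg_of_add_eq_zero_left h0)
  have h1 := linearIndependent_v_w_x₃ (skewData_R2_neg_one a b p q k) (vData_neg_one a b p q k)
    (fun n => by
      split_ifs
      · exact one_ne_zero
      · exact neg_ne_zero.mpr (mul_ne_zero (div_ne_zero (Nat.cast_add_one_ne_zero n) two_ne_zero) hs))
    (gen_2_pow_notMem_neg_one hbp (skewData_R2_neg_one a b p q k) (vData_neg_one a b p q k))
    (σ := {n : WithTop ι →₀ ℕ // ∀ i, (n i : ℕ∞) < withLast ⊤ (fun i => heightMinus (f i)) i})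
    (ν := fun n => N n.1 0 + 2 * N n.1 2) (μ := fun n => n.1 ⊤)
    (α := fun n => (N n.1).comapDomain minusIndex minusIndex_injective.injOn)
    (fun n => ⟨fun i => ?_, fun i hi => hγ i (hN' _ _ hi)⟩) ?_
  · convert h1 using 1
    funext n
    have e : (fun i => proj ℜ (withLast x₃ (fun i => towerMinus b (f i)) i)) =
        withLast (gen ℜ 2) (fun i => proj ℜ (towerMinus b (f i))) := by
      funext i
      induction i using WithTop.recTopCoe <;> rfl
    rw [e, orderedMonomial_withLast,
      ← orderedMonomial_embDomain f (fun i => proj ℜ (towerMinus b i)),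
      orderedMonomial_towerMinus (hlt n 0 rfl)]
  · by_cases hi : Even i
    · left
      have := hlt n (minusIndex i) (by rw [heightMinus_minusIndex, if_pos hi])
      exact Nat.le_of_lt_succ this
    · exact Or.inr (Nat.not_even_iff_odd.mp hi).add_one.neg_one_pow
  · intro m n e
    simp only [Prod.mk.injEq] at e
    have hm := hlt m 0 rfl
    have hn := hlt n 0 rfl
    have e' : N m.1 = N n.1 := by
      ext i
      match i with
      | 0 => omega
      | 1 => exact DFunLike.congr_fun e.2.2 0
      | 2 => omega
      | i + 3 => exact DFunLike.congr_fun e.2.2 (i + 1)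
    refine Subtype.ext (Finsupp.ext fun i => ?_)
    induction i using WithTop.recTopCoe with
    | top => exact e.1
    | coe i => rw [← hN, ← hN, e']

theorem proj_x₃₁_mul_x₂ : proj ℜ x₃₁ * proj ℜ x₂ = proj ℜ x₂ * proj ℜ x₃₁ := x₃₁_mul_gen_1 rfl

theorem proj_relsMinus : ∀ r ∈ relsMinus b p q, proj ℜ r = 0 := by
  have hS := skewData_R2_neg_one a b p q k
  have hc := (isTower_tower (-1) b (gen ℜ) _).comm_of_comm hS
    (isTower_z' (b := b) (p := p) (q := q) (proj_x₃₁_mul_x₂ (a := a) (k := k))) (comm_tower hS)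
  rintro r ((rfl | rfl | rfl | rfl | rfl) | ⟨n, hn, rfl | rfl⟩)
  · have := gen_1_mul_gen_0 (t := -1) (a := a) (b := b) (p := p) (q := q) (k := k) (by ring)
    rw [neg_smul, one_smul, eq_neg_iff_add_eq_zero] at this
    rw [map_add, map_mul, map_mul]
    exact this
  · rw [map_pow, pow_two]
    exact gen_0_mul_gen_0 rfl
  · rw [map_pow, pow_two]
    exact gen_1_mul_gen_1 rfl
  · rw [map_sub, map_mul, map_mul, sub_eq_zero]
    exact proj_x₃₁_mul_x₂
  · have := gen_2_mul_x₃₁ (t := -1) (a := a) (b := b) (p := p) (q := q) (k := k) rfl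
    rw [map_add, map_sub, map_mul, map_mul, map_smul, map_mul]
    change gen ℜ 2 * proj ℜ x₃₁ - proj ℜ x₃₁ * gen ℜ 2 + (p - b) • (gen ℜ 0 * proj ℜ x₃₁) = 0
    rw [this]
    module
  · have := hc (2 * n) (2 * n - 1)
    rw [IsTower.Comm, Even.neg_one_pow (by
      rw [Nat.sub_add_cancel (by omega)]
      exact (even_two_mul n).mul_left _), one_smul] at this
    rw [map_sub, map_mul, map_mul, sub_eq_zero]
    exact this
  · have := hc (2 * n) (2 * n)
    rw [IsTower.Comm, Odd.neg_one_pow ((even_two_mul n).add_one.mul (even_two_mul n).add_one),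
      neg_smul, one_smul] at this
    rw [map_pow, pow_two]
    have h2 : (2 : K) • (proj ℜ (z' b p q (2 * n)) * proj ℜ (z' b p q (2 * n))) = 0 := by
      linear_combination (norm := module) this
    exact (smul_eq_zero.mp h2).resolve_left two_ne_zero

theorem presentation_R2_neg_one (hbp : b ≠ -p) {ι : Type} [LinearOrder ι] (f : ι ↪o ℕ)
    {rels : Set (T K)} (hsub : relsMinus b p q ⊆ rels) (hrels : ∀ r ∈ rels, proj ℜ r = 0)
    (h0 : 0 ∈ Set.range f) (h1 : 1 ∈ Set.range f) (h2 : 2 ∈ Set.range f)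
    (hγ : ∀ i, minusIndex i ∈ Set.range f → gammaNegOne b p q i ≠ 0)
    (hclosed : ∀ (A : Type u) [Ring A] [Algebra K A] (π : T K →ₐ[K] A), (∀ r ∈ rels, π r = 0) →
      ∀ n, n = 0 ∨ n + 2 ∈ Set.range f → π (z' b p q (n + 1)) ∈
        Algebra.adjoin K (Set.range fun i => π (genMinus b p q (f i)))) :
    nicholsIdeal ℜ = TwoSidedIdeal.span rels ∧
      IsPBWBasis K (fun i => proj ℜ (withLast x₃ (fun i => genMinus b p q (f i)) i))
        (withLast ⊤ fun i => heightMinus (f i)) :=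
  presentation_of_homogeneous
    (withLast_mem_degreePart fun i => genMinus_mem_degreePart b p q (f i))
    (withLast_mem_degreePart fun i => towerMinus_mem_degreePart b (f i)) hrels
    (fun A _ _ π hπ hr => span_eq_top_of_relsMinus hπ (fun r h => hr r (hsub h)) h0 h1 h2
      (hclosed A π hr)) (linearIndependent_towerMinus hbp f hγ)

theorem heightMinus_eq (n : ℕ) : heightMinus n = 2 ∨ heightMinus n = ⊤ := by
  match n with
  | 0 => exact Or.inl rfl
  | 1 => exact Or.inl rfl
  | 2 => exact Or.inr rfl
  | n + 3 =>
    rw [heightMinus]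
    split_ifs
    · exact Or.inl rfl
    · exact Or.inr rfl

theorem withLast_heightMinus_eq {ι : Type} (f : ι → ℕ) (i : WithTop ι) :
    withLast ⊤ (fun i => heightMinus (f i)) i = 2 ∨
      withLast ⊤ (fun i => heightMinus (f i)) i = ⊤ := by
  induction i using WithTop.recTopCoe with
  | top => exact Or.inr rfl
  | coe i => exact heightMinus_eq (f i)

theorem describes_R2_neg_one_of_ne (a b p q k : K) (h : b ≠ -p)
    (hb : ∀ n, 1 ≤ n → β' b p q n ≠ 0) :
    Describes (R2 (-1) a b p q k) (relsMinus b p q) (withLast x₃ (genMinus b p q))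
      (withLast ⊤ heightMinus) ⊤ := by
  have hγ : ∀ i, gammaNegOne b p q i ≠ 0 := fun i => gammaNegOne_ne_zero h fun j _ e =>
    hb (2 * j + 1) (by omega) (β'_odd_eq_zero_iff.mpr e)
  obtain ⟨h1, h2⟩ := presentation_R2_neg_one (a := a) (k := k) h (OrderIso.refl ℕ).toOrderEmbedding
    subset_rfl proj_relsMinus ⟨0, rfl⟩ ⟨1, rfl⟩ ⟨2, rfl⟩ (fun i _ => hγ i)
    (fun A _ _ π _ n _ => Algebra.subset_adjoin (Set.mem_range_self (n + 3)))
  refine ⟨h1, h2, GKdim_eq_top h2 ?_ fun i => ?_⟩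
  · refine Set.infinite_of_injective_forall_mem (f := fun m : ℕ => WithTop.some (2 * m + 3))
      (fun m n e => ?_) fun m => ?_
    · have := WithTop.coe_injective e
      omega
    · exact if_neg (by simp)
  · rcases withLast_heightMinus_eq (OrderIso.refl ℕ).toOrderEmbedding i with e | e <;> rw [e] <;>
      simp

theorem card_heightMinus_eq_top (r : ℕ) :
    (Finset.univ.filter fun i : WithTop (Fin (2 * r + 1 + 3)) =>
      withLast ⊤ (fun i : Fin (2 * r + 1 + 3) => heightMinus i) i = ⊤).card = r + 3 := by
  have key : ∑ i ∈ Finset.range (2 * r + 1 + 3), (if heightMinus i = ⊤ then 1 else 0) = r + 2 := by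
    induction r with
    | zero => simp [Finset.sum_range_succ, heightMinus]
    | succ r ih =>
      rw [show 2 * (r + 1) + 1 + 3 = 2 * r + 1 + 3 + 1 + 1 by ring, Finset.sum_range_succ,
        Finset.sum_range_succ, ih, show 2 * r + 1 + 3 = (2 * r + 1) + 3 by ring, heightMinus,
        show 2 * r + 1 + 3 + 1 = (2 * r + 2) + 3 by ring, heightMinus]
      simp [Nat.even_add_one]
  rw [Finset.card_filter]
  refine (Fintype.sum_option (α := Fin (2 * r + 1 + 3)) _).trans ?_
  rw [← Fin.sum_univ_eq_sum_range (fun i => if heightMinus i = ⊤ then 1 else 0)] at key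
  exact (congrArg₂ (· + ·) (if_pos rfl) key).trans (by ring)

theorem correction'_eq (m : ℕ) :
    correction' b p q (2 * m + 2) = ((m : K) + 1) * m.factorial * (p - q) * (-p - b) ^ (m + 1) ∧
    correction' b p q (2 * m + 1) = -(m.factorial * (p - q) * (-p - b) ^ m) := by
  rw [correction', correction', if_pos (by simp [Nat.even_add]), if_neg (by simp)]
  rw [show (2 * m + 2) / 2 = m + 1 by omega, show (2 * m + 1 - 1) / 2 = m by omega,
    Nat.factorial_succ]
  push_cast
  exact ⟨rfl, rfl⟩

theorem describes_R2_neg_one_of_eq (a b p q k : K) (h : b ≠ -p)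
    (N : ℕ) (hN : 1 ≤ N) (hb : β' b p q N = 0) :
    Describes (R2 (-1) a b p q k)
      (relsMinus b p q ∪
        {z' b p q (N + 1) + (((N : K) + 1) * ((b + p) / 2)) • (x₁ * z' b p q N)})
      (withLast x₃ (fun i : Fin (N + 3) => genMinus b p q i))
      (withLast ⊤ (fun i : Fin (N + 3) => heightMinus i))
      ((((N : ℝ) + 5) / 2 : ℝ) : EReal) := by
  obtain ⟨r, rfl⟩ := odd_of_β'_eq_zero b p q h hN hb
  rw [β'_odd_eq_zero_iff] at hb
  have hs : b + p ≠ 0 := fun h0 => h (eq_neg_of_add_eq_zero_left h0)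
  have hγ : ∀ i ≤ 2 * r + 1, gammaNegOne b p q i ≠ 0 := by
    intro i hi
    refine gammaNegOne_ne_zero h fun j hj e => ?_
    have := mul_right_cancel₀ hs (hb.symm.trans e)
    have : r + 1 = j + 1 := by exact_mod_cast this
    omega
  have hS := skewData_R2_neg_one a b p q k
  have hw : tower (-1) b (gen (R2 (-1) a b p q k)) (2 * r + 2) = 0 := tower_eq_zero hS (by
    have := (gammaCoeff_neg_one (b := b) (p := p) (q := q) (r + 1)).1
    rwa [stepProd_succ, ← hb, sub_self, mul_zero] at this)
  have hrel : proj (R2 (-1) a b p q k) (z' b p q (2 * r + 1 + 1) +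
      ((((2 * r + 1 : ℕ) : K) + 1) * ((b + p) / 2)) • (x₁ * z' b p q (2 * r + 1))) = 0 := by
    have := tower_identity_neg_one (b := b) (s := (b + p) / 2) (y := p - q) (e := (b - p) / 2)
      (by ring) (gen_0_mul_gen_0 rfl) (proj_x₃₁ _).symm
      (by rw [mul_div_cancel₀ _ two_ne_zero]; exact gen_2_mul_x₃₁ rfl)
      (isTower_z' (b := b) (p := p) (q := q) (proj_x₃₁_mul_x₂ (a := a) (k := k)))
      (isTower_tower (-1) b (gen (R2 (-1) a b p q k)) _) (by simp [correction'])
      (by simp [correction'])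
      (fun m => by
        rw [(correction'_eq m).1, (correction'_eq m).2]
        ring)
      (fun m => by
        rw [(correction'_eq m).2, show 2 * m + 3 = 2 * (m + 1) + 1 by ring,
          (correction'_eq (m + 1)).2, Nat.factorial_succ, pow_succ]
        push_cast
        ring) r
    rw [hw, zero_add] at this
    rw [map_add, map_smul, map_mul]
    refine Eq.trans ?_ (this.trans ?_)
    · congr 2
      push_cast
      ring
    · rw [show (2 * (r : K) + 2) * ((b + p) / 2) - (p - q) = 0 by rw [hb]; ring, zero_smul]
  obtain ⟨h1, h2⟩ := presentation_R2_neg_one (a := a) (k := k) h (Fin.valOrderEmb (2 * r + 1 + 3))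
    (rels := relsMinus b p q ∪ {z' b p q (2 * r + 1 + 1) +
      ((((2 * r + 1 : ℕ) : K) + 1) * ((b + p) / 2)) • (x₁ * z' b p q (2 * r + 1))})
    Set.subset_union_left (by
      rintro r (hr | rfl)
      · exact proj_relsMinus r hr
      · exact hrel) ⟨0, rfl⟩ ⟨1, rfl⟩ ⟨2, rfl⟩ (fun i ⟨j, hj⟩ => hγ i (by
        have := j.2
        simp only [Fin.valOrderEmb_apply] at hj
        cases i with
        | zero => omega
        | succ i =>
          rw [minusIndex] at hj
          omega)) (by
      rintro A _ _ π hr n hn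
      have hg : ∀ m (hm : m < 2 * r + 1 + 3), π (genMinus b p q m) ∈ Algebra.adjoin K
          (Set.range fun i => π (genMinus b p q (Fin.valOrderEmb (2 * r + 1 + 3) i))) :=
        fun m hm => Algebra.subset_adjoin ⟨⟨m, hm⟩, rfl⟩
      have hn' : n + 2 < 2 * r + 1 + 3 := by
        rcases hn with rfl | ⟨j, hj⟩
        · omega
        · have := j.2
          simp only [Fin.valOrderEmb_apply] at hj
          omega
      by_cases hn : n + 3 < 2 * r + 1 + 3
      · exact hg (n + 3) hn
      · obtain rfl : n = 2 * r + 1 := by omega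
        have := hr _ (Or.inr rfl)
        rw [map_add, map_smul, map_mul] at this
        rw [eq_neg_of_add_eq_zero_left this]
        exact neg_mem (Subalgebra.smul_mem _ (mul_mem (hg 0 (by omega))
          (hg (2 * r + 3) (by omega))) _))
  refine ⟨h1, h2, ?_⟩
  rw [GKdim_eq_card (braidCoeff_R2 (-1) a b p q k)
    (withLast_mem_degreePart fun i => genMinus_mem_degreePart b p q _) ?_
    (withLast_heightMinus_eq _) h2]
  · trans ((((r + 3 : ℕ) : ℝ)) : EReal)
    · rw [← card_heightMinus_eq_top r]
      rfl
    · congr 1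
      push_cast
      ring
  · intro i
    induction i using WithTop.recTopCoe with
    | top => exact le_rfl
    | coe i =>
      change 1 ≤ degreeMinus i
      rcases i with ⟨_ | _ | _ | i, hi⟩ <;> simp [degreeMinus]

end NegOne

end Hietarinta

end

open Hietarinta

theorem theorem1p1 {K : Type*} [Field K] [IsAlgClosed K] [CharZero K]
    (t : K) (ht : t ≠ 0) (a b p q k ℓ d : K) :
    -- quadratic relations
    (∀ R, IsFamilyMember t R → IsRigidBraided R ∧ (HasQuadraticRelation R ↔ t ^ 2 = 1)) ∧
    -- first family
    (t = -1 → DescribedB0 (R1 t a b p) (rels1B0 b p)) ∧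
    (t = 1 → DescribedB3 (R1 t a b p) (rels1B3 a b)) ∧
    -- second family, `t = 1`, `b ≠ p - 2q`
    (t = 1 → b ≠ p - 2 * q →
      ((∀ n, 1 ≤ n → β b p q n ≠ 0) →
        Describes (R2 t a b p q k) (relsPlus b p q)
          (withLast x₃ (genPlus b p q)) (fun _ => ⊤) ⊤) ∧
      ((¬ ∀ n, 1 ≤ n → β b p q n ≠ 0) →
        ∃! N : ℕ, 1 ≤ N ∧ β b p q N = 0) ∧
      (∀ N : ℕ, 1 ≤ N → β b p q N = 0 →
        Describes (R2 t a b p q k)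
          (relsPlus b p q ∪
            {z b p q (N + 1) + (((N : K) + 1) * ((b + p) / 2)) • (x₁ * z b p q N)})
          (withLast x₃ (fun i : Fin (N + 2) => genPlus b p q i)) (fun _ => ⊤)
          ((N + 3 : ℕ) : EReal))) ∧
    -- second family, `t = -1`, `b ≠ -p`
    (t = -1 → b ≠ -p →
      ((∀ n, 1 ≤ n → β' b p q n ≠ 0) →
        Describes (R2 t a b p q k) (relsMinus b p q)
          (withLast x₃ (genMinus b p q)) (withLast ⊤ heightMinus) ⊤) ∧
      ((¬ ∀ n, 1 ≤ n → β' b p q n ≠ 0) →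
        ∃! N : ℕ, 1 ≤ N ∧ β' b p q N = 0) ∧
      (∀ N : ℕ, 1 ≤ N → β' b p q N = 0 → Odd N ∧
        Describes (R2 t a b p q k)
          (relsMinus b p q ∪
            {z' b p q (N + 1) + (((N : K) + 1) * ((b + p) / 2)) • (x₁ * z' b p q N)})
          (withLast x₃ (fun i : Fin (N + 3) => genMinus b p q i))
          (withLast ⊤ (fun i : Fin (N + 3) => heightMinus i))
          ((((N : ℝ) + 5) / 2 : ℝ) : EReal))) ∧
    -- second family, remaining cases
    (t = 1 → b = p - 2 * q → DescribedB3 (R2 t a b p q k) (rels2B3 p q)) ∧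
    (t = -1 → b = -p → a ≠ -p ^ 2 → DescribedB1 (R2 t a b p q k) (rels2B1 p)) ∧
    (t = -1 → b = -p → a = -p ^ 2 → DescribedB0 (R2 t a b p q k) (rels2B0 p k)) ∧
    -- third family
    (t = 1 → DescribedB3 (R3 t a b p q) (rels3B3 a b)) ∧
    (t = -1 → q ≠ 0 → DescribedB1 (R3 t a b p q) (rels3B1 b)) ∧
    (t = -1 → q = 0 → DescribedB0 (R3 t a b p q) (rels3B0 b p)) ∧
    -- fourth family
    (t = 1 → DescribedB3 (R4 t a b p) (rels4B3 a b)) ∧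
    (t = -1 → p ≠ 0 → DescribedB1 (R4 t a b p) (rels4B1 a b)) ∧
    (t = -1 → p = 0 → DescribedB0 (R4 t a b p) (rels4B0 a b)) ∧
    -- fifth family
    (t = 1 → p = 2 * q → DescribedB3 (R5 t a b p q k ℓ) (rels5B3 q k ℓ)) ∧
    (t = -1 → p = 0 → a ≠ b * ℓ → DescribedB1 (R5 t a b p q k ℓ) (rels5B1 q ℓ)) ∧
    (t = -1 → p = 0 → a = b * ℓ → DescribedB0 (R5 t a b p q k ℓ) (rels5B0 b q ℓ)) ∧
    -- sixth family
    (t = -1 → DescribedB0 (R6 t a b p q k) (rels6B0 a b p q)) ∧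
    (t = 1 → DescribedB3 (R6 t a b p q k) (rels6B3 a p k)) ∧
    -- seventh family
    (t = 1 → a = p - 2 * q → DescribedB3 (R7 t a b p q k ℓ d) (rels7B3 q k d)) ∧
    (t = -1 → a = -p → b ≠ -p ^ 2 → DescribedB1 (R7 t a b p q k ℓ d) (rels7B1 q k ℓ)) ∧
    (t = -1 → a = -p → b = -p ^ 2 → DescribedB0 (R7 t a b p q k ℓ d) (rels7B0 p q k ℓ)) ∧
    -- eighth family
    (t = -1 → DescribedB0 (R8 t a b p q) (rels8B0 a p q)) ∧
    (t = 1 → DescribedB3 (R8 t a b p q) (rels8B3 a b q)) ∧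
    -- ninth family
    (t = 1 → b = 1 → DescribedB3 (R9 t a b p q) (rels9B3 a)) ∧
    (t = -1 → b = 1 → p ≠ -a - q → DescribedB1 (R9 t a b p q) rels9B1) ∧
    (t = -1 → b = 1 → p = -a - q → DescribedB0 (R9 t a b p q) (rels9B0 q)) ∧
    -- tenth family
    (t = 1 → DescribedB3 (R10 t a) (rels10B3 a)) ∧
    (t = -1 → DescribedB0 (R10 t a) (rels10B0 a)) := by
  refine ⟨fun R h => ⟨isRigidBraided ht h.triangular h.braidCoeff,
    hasQuadraticRelation_iff h.triangular h.braidCoeff⟩, ?_, ?_, ?_, ?_, ?_, ?_, ?_, ?_, ?_, ?_,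
    ?_, ?_, ?_, ?_, ?_, ?_, ?_, ?_, ?_, ?_, ?_, ?_, ?_, ?_, ?_, ?_, ?_, ?_⟩
  · rintro rfl; exact describedB0_R1 a b p
  · rintro rfl; exact describedB3_R1 a b p
  · rintro rfl hb
    exact ⟨describes_R2_one_of_ne a b p q k hb, existsUnique_β_eq_zero b p q hb,
      describes_R2_one_of_eq a b p q k hb⟩
  · rintro rfl hb
    exact ⟨describes_R2_neg_one_of_ne a b p q k hb, existsUnique_β'_eq_zero b p q hb,
      fun N hN h => ⟨odd_of_β'_eq_zero b p q hb hN h,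
        describes_R2_neg_one_of_eq a b p q k hb N hN h⟩⟩
  · rintro rfl rfl; exact describedB3_R2 a p q k
  · rintro rfl rfl; exact describedB1_R2 a p q k
  · rintro rfl rfl rfl; exact describedB0_R2 p q k
  · rintro rfl; exact describedB3_R3 a b p q
  · rintro rfl; exact describedB1_R3 a b p q
  · rintro rfl rfl; exact describedB0_R3 a b p
  · rintro rfl; exact describedB3_R4 a b p
  · rintro rfl; exact describedB1_R4 a b p
  · rintro rfl rfl; exact describedB0_R4 a b
  · rintro rfl rfl; exact describedB3_R5 a b q k ℓ
  · rintro rfl rfl; exact describedB1_R5 a b q k ℓ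
  · rintro rfl rfl rfl; exact describedB0_R5 b q k ℓ
  · rintro rfl; exact describedB0_R6 a b p q k
  · rintro rfl; exact describedB3_R6 a b p q k
  · rintro rfl rfl; exact describedB3_R7 b p q k ℓ d
  · rintro rfl rfl; exact describedB1_R7 b p q k ℓ d
  · rintro rfl rfl rfl; exact describedB0_R7 p q k ℓ d
  · rintro rfl; exact describedB0_R8 a b p q
  · rintro rfl; exact describedB3_R8 a b p q
  · rintro rfl rfl; exact describedB3_R9 a p q
  · rintro rfl rfl; exact describedB1_R9 a p q
  · rintro rfl rfl rfl; exact describedB0_R9 a q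
  · rintro rfl; exact describedB3_R10 a
  · rintro rfl; exact describedB0_R10 a
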